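/- **Setting.** Let $\kappa>0$ and let $c\in C^1(\mathbb R)$ satisfy $\kappa^{-1}\le c\le\kappa$. Let $\mathcal D$ be the set of tuples $(u,R,S,\mu,\nu)$ with $u,R,S\in L^2(\mathbb R)$, $u$ continuous with $u_x=\frac{R-S}{2c(u)}$, and $\mu,\nu$ finite positive Borel measures on $\mathbb R$ whose absolutely continuous parts (with respect to Lebesgue measure) are $\frac14R^2\,dx$ and $\frac14S^2\,dx$. For a nondecreasing $f$ put $f^{-1}(y)=\sup\{s: f(s)<y\}$. Let $\mathcal C$ be the set of curves $(\mathcal X,\mathcal Y)\colon\mathbb R\to\mathbb R^2$ with $\mathcal X-\mathrm{id},\mathcal Y-\mathrm{id}\in W^{1,\infty}(\mathbb R)$, $\dot{\mathcal X},\dot{\mathcal Y}\ge0$ and $\mathcal X(s)+\mathcal Y(s)=2s$. For $Z=(t,x,U,J,K)\colon\mathbb R^2\to\mathbb R^5$ let $Z\bullet(\mathcal X,\mathcal Y)$ be the curve together with the data $\mathcal Z(s)=Z(\mathcal X(s),\mathcal Y(s))$, $\mathcal V(X)=Z_X(X,\mathcal Y(\mathcal X^{-1}(X)))$, $\mathcal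 W(Y)=Z_Y(\mathcal X(\mathcal Y^{-1}(Y)),Y)$, the latter two being identified almost everywhere. Let $\mathcal H$ be the set of $Z$ with the following properties. On every bounded rectangle, $Z$ is Lipschitz, $Z_X(X,\cdot)$ is defined, bounded and Lipschitz uniformly for a.e. $X$, and $Z_Y(\cdot,Y)$ is defined, bounded and Lipschitz uniformly for a.e. $Y$. Almost everywhere, both $(Z_X)_Y$ and $(Z_Y)_X$ equal the right-hand side $(t_{XY},x_{XY},U_{XY},J_{XY},K_{XY})$ of $$t_{XY}=-\tfrac{c'}{2c}(U_Xt_Y+U_Yt_X),\quad x_{XY}=\tfrac{c'}{2c}(U_Yx_X+U_Xx_Y),\quad U_{XY}=\tfrac{c'}{2c^3}(x_YJ_X+J_Yx_X)-\tfrac{c'}{2c}U_YU_X,$$ $$J_{XY}=\tfrac{c'}{2c}(J_XU_Y+J_YU_X),\quad K_{XY}=-\tfrac{c'}{2c}(K_XU_Y+K_YU_X),$$ where $c=c(U)$, $c'=c'(U)$. For a.e. $X$ and all $Y$, $x_X=c(U)t_X$, $J_X=c(U)K_X$, $2J_Xx_X=(c(U)U_X)^2$, $x_X,J_X\ge0$,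 $x_X+J_X>0$; for a.e. $Y$ and all $X$, $x_Y=-c(U)t_Y$, $J_Y=-c(U)K_Y$, $2J_Yx_Y=(c(U)U_Y)^2$, $x_Y,J_Y\ge0$, $x_Y+J_Y>0$. Finally, for at least one curve in $\mathcal C$ the data $Z\bullet(\mathcal X,\mathcal Y)$ satisfy: $U$, $\mathcal V_2-\frac12$, $\mathcal W_2-\frac12$, $\mathcal V_i$, $\mathcal W_i$ ($i=3,4,5$) are in $L^2(\mathbb R)$; $\mathcal Z_2-\mathrm{id}$, $\mathcal Z_i$ ($i\ne2$), $\mathcal V$, $\mathcal W$, $1/(\mathcal V_2+\mathcal V_4)$, $1/(\mathcal W_2+\mathcal W_4)$ are in $L^\infty(\mathbb R)$; $\mathcal Z$ is Lipschitz with $\dot{\mathcal Z}=\mathcal V(\mathcal X)\dot{\mathcal X}+\mathcal W(\mathcal Y)\dot{\mathcal Y}$ a.e.; $\mathcal V_2,\mathcal V_4,\mathcal W_2,\mathcal W_4\ge0$; the algebraic relations above hold along the curve; and $\lim_{s\to-\infty}\mathcal Z_4(s)=0$. **Initial data.** Given $\zeta_0=(u_0,R_0,S_0,\mu_0,\nu_0)\in\mathcal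 D$, set $x_1(X)=\sup\{x: x'+\mu_0((-\infty,x'))<X\ \forall x'<x\}$, $J_1(X)=X-x_1(X)$, $U_1=u_0\circ x_1$, $V_1=\frac{R_0(x_1)}{2c(U_1)}x_1'$, $K_1(X)=\int_{-\infty}^X\frac{J_1'}{c(U_1)}$, and likewise, with $\nu_0$ in place of $\mu_0$, $x_2(Y)$, $J_2(Y)$, $U_2(Y)$, $V_2=-\frac{S_0(x_2)}{2c(U_2)}x_2'$, $K_2(Y)=-\int_{-\infty}^Y\frac{J_2'}{c(U_2)}$. Let $\mathcal X(s)=\sup\{X: x_1(X')<x_2(2s-X')\ \forall X'<X\}$, $\mathcal Y(s)=2s-\mathcal X(s)$, and on this curve put $\mathcal Z=(0,\,x_1(\mathcal X),\,U_1(\mathcal X),\,J_1(\mathcal X)+J_2(\mathcal Y),\,K_1(\mathcal X)+K_2(\mathcal Y))$, $\mathcal V=(\frac{x_1'}{2c(U_1)},\frac{x_1'}2,V_1,J_1',K_1')$, $\mathcal W=(-\frac{x_2'}{2c(U_2)},\frac{x_2'}2,V_2,J_2',K_2')$. Call the resulting curve with data $\Theta_0$. **Conservative solutions.** A family $(u,R,S,\mu,\nu)(\tau)$,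 $\tau\in\mathbb R$, is a *conservative solution* with initial data $\zeta_0$, written $\bar S_\tau\zeta_0$, if there is $Z\in\mathcal H$ with $Z\bullet(\mathcal X,\mathcal Y)=\Theta_0$ such that for every $\tau$ the following holds. Let $\mathcal X_\tau(s)=\sup\{X: t(X',2s-X')<\tau\ \forall X'<X\}$, $\mathcal Y_\tau(s)=2s-\mathcal X_\tau(s)$ and let $\mathcal Z,\mathcal V,\mathcal W$ be the data of $Z\bullet(\mathcal X_\tau,\mathcal Y_\tau)$. Define $x_1,x_2,U_1,U_2,J_1,J_2$ by $x_1(\mathcal X_\tau(s))=x_2(\mathcal Y_\tau(s))=\mathcal Z_2(s)$, $U_1(\mathcal X_\tau(s))=U_2(\mathcal Y_\tau(s))=\mathcal Z_3(s)$, $J_1(\mathcal X_\tau(s))=\int_{-\infty}^s\mathcal V_4(\mathcal X_\tau)\dot{\mathcal X}_\tau\,d\sigma$, $J_2(\mathcal Y_\tau(s))=\int_{-\infty}^s\mathcal W_4(\mathcal Y_\tau)\dot{\mathcal Y}_\tau\,d\sigma$. Then $u(\tau)\circ x_1=U_1$, $u(\tau)\circ x_2=U_2$, $\mu(\tau)=(x_1)_\#(J_1'\,dX)$,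 $\nu(\tau)=(x_2)_\#(J_2'\,dY)$, and $R(\tau),S(\tau)$ are measurable with $R(\tau,x_1)x_1'=2c(U_1)\mathcal V_3$ and $S(\tau,x_2)x_2'=-2c(U_2)\mathcal W_3$ a.e. **Theorem.** For every $\zeta_0=(u_0,R_0,S_0,\mu_0,\nu_0)\in\mathcal D$ a conservative solution with initial data $\zeta_0$ exists, and every conservative solution $(u,R,S,\mu,\nu)(t)=\bar S_t\zeta_0$ satisfies: (i) for all $t\in\mathbb R$, $\ \mu(t)(\mathbb R)+\nu(t)(\mathbb R)=\mu_0(\mathbb R)+\nu_0(\mathbb R)$; (ii) for almost every $t\in\mathbb R$, the singular parts of $\mu(t)$ and $\nu(t)$ are concentrated on the set where $c'(u)=0$, that is, $\mu(t)_{\rm sing}(\{x: c'(u(t,x))\neq0\})=\nu(t)_{\rm sing}(\{x: c'(u(t,x))\ne0\})=0$. -/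

import Mathlib

open MeasureTheory Set Filter Topology
open scoped NNReal ENNReal

noncomputable section

namespace NVW

/-! ### Data in the original variables -/

/-- A tuple `(u, R, S, μ, ν)`. -/
structure EulerData where
  u : ℝ → ℝ
  R : ℝ → ℝ
  S : ℝ → ℝ
  μ : Measure ℝ
  ν : Measure ℝ

/-- The set `𝒟`. The function `u` is the continuous representative of its class, so that
`u_x = (R - S) / (2 c(u))` is the statement that `u` is an indefinite integral of the right-hand
side. The absolutely continuous and singular parts are those of the Lebesgue decomposition with
respect to Lebesgue measure. -/
structure MemD (c : ℝ → ℝ) (ζ : EulerData) : Prop where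
  memLp_u : MemLp ζ.u 2 volume
  memLp_R : MemLp ζ.R 2 volume
  memLp_S : MemLp ζ.S 2 volume
  u_x : ∀ a b : ℝ, ζ.u b - ζ.u a = ∫ x in a..b, (ζ.R x - ζ.S x) / (2 * c (ζ.u x))
  finite_μ : IsFiniteMeasure ζ.μ
  finite_ν : IsFiniteMeasure ζ.ν
  μ_ac : volume.withDensity (ζ.μ.rnDeriv volume) =
    volume.withDensity (fun x => ENNReal.ofReal (ζ.R x ^ 2 / 4))
  ν_ac : volume.withDensity (ζ.ν.rnDeriv volume) =
    volume.withDensity (fun x => ENNReal.ofReal (ζ.S x ^ 2 / 4))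

/-! ### Data in the characteristic variables -/

/-- One half `(x, U, V, J, K)` of a parametrization `ψ = (ψ₁, ψ₂)` of data at a fixed time. -/
structure Side where
  x : ℝ → ℝ
  U : ℝ → ℝ
  V : ℝ → ℝ
  J : ℝ → ℝ
  K : ℝ → ℝ

/-- A pair `ψ = (ψ₁, ψ₂)`, with `ψ₁` a function of `X` and `ψ₂` a function of `Y`. -/
structure LagData where
  fst : Side
  snd : Side

/-- A curve `(𝒳(s), 𝒴(s))` with data `𝒵(s)`, `𝒱(X)`, `𝒲(Y)`. The five components, with indices
`0, 1, 2, 3, 4`, are those of `(t, x, U, J, K)`. -/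
structure CurveData where
  𝒳 : ℝ → ℝ
  𝒴 : ℝ → ℝ
  𝒵 : ℝ → Fin 5 → ℝ
  𝒱 : ℝ → Fin 5 → ℝ
  𝒲 : ℝ → Fin 5 → ℝ

/-- Membership in `W^{1,∞}(ℝ)`: bounded and Lipschitz continuous. -/
def IsW1Infty (f : ℝ → ℝ) : Prop :=
  (∃ B : ℝ, ∀ s, |f s| ≤ B) ∧ ∃ L : ℝ≥0, LipschitzWith L f

/-- The set `𝒞` of curves. -/
structure IsCurve (𝒳 𝒴 : ℝ → ℝ) : Prop where
  reg_X : IsW1Infty (fun s => 𝒳 s - s)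
  reg_Y : IsW1Infty (fun s => 𝒴 s - s)
  mono_X : Monotone 𝒳
  mono_Y : Monotone 𝒴
  normalized : ∀ s, (𝒳 s + 𝒴 s) / 2 = s

/-- The generalized inverse of a nondecreasing function. -/
def genInv (f : ℝ → ℝ) (y : ℝ) : ℝ := sSup {s | f s < y}

/-- The set `𝒢`. The first components of `𝒱` and `𝒲` are `± (second component) / c(U)`, which tend
to the nonzero values `± 1 / (2 c(0))`; the square integrability is required of the other four
components only. -/
structure MemG (c : ℝ → ℝ) (Θ : CurveData) : Prop where
  curve : IsCurve Θ.𝒳 Θ.𝒴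
  memLp_U : MemLp (fun s => Θ.𝒵 s 2) 2 volume
  memLp_V1 : MemLp (fun X => Θ.𝒱 X 1 - 1 / 2) 2 volume
  memLp_W1 : MemLp (fun Y => Θ.𝒲 Y 1 - 1 / 2) 2 volume
  memLp_V : ∀ i : Fin 5, 2 ≤ i → MemLp (fun X => Θ.𝒱 X i) 2 volume
  memLp_W : ∀ i : Fin 5, 2 ≤ i → MemLp (fun Y => Θ.𝒲 Y i) 2 volume
  bdd_x : ∃ B : ℝ, ∀ s, |Θ.𝒵 s 1 - s| ≤ B
  bdd_Z : ∃ B : ℝ, ∀ s, ∀ i : Fin 5, i ≠ 1 → |Θ.𝒵 s i| ≤ B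
  bdd_V : MemLp Θ.𝒱 ∞ volume
  bdd_W : MemLp Θ.𝒲 ∞ volume
  inv_bdd_V : ∃ δ : ℝ, 0 < δ ∧ ∀ᵐ X, δ ≤ Θ.𝒱 X 1 + Θ.𝒱 X 3
  inv_bdd_W : ∃ δ : ℝ, 0 < δ ∧ ∀ᵐ Y, δ ≤ Θ.𝒲 Y 1 + Θ.𝒲 Y 3
  nonneg_V : ∀ᵐ X, 0 ≤ Θ.𝒱 X 1 ∧ 0 ≤ Θ.𝒱 X 3
  nonneg_W : ∀ᵐ Y, 0 ≤ Θ.𝒲 Y 1 ∧ 0 ≤ Θ.𝒲 Y 3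
  lipschitz_Z : ∃ L : ℝ≥0, LipschitzWith L Θ.𝒵
  deriv_Z : ∀ᵐ s, HasDerivAt Θ.𝒵
    (deriv Θ.𝒳 s • Θ.𝒱 (Θ.𝒳 s) + deriv Θ.𝒴 s • Θ.𝒲 (Θ.𝒴 s)) s
  rel_V : ∀ᵐ X,
    2 * Θ.𝒱 X 3 * Θ.𝒱 X 1 = (c (Θ.𝒵 (genInv Θ.𝒳 X) 2) * Θ.𝒱 X 2) ^ 2 ∧
    Θ.𝒱 X 1 = c (Θ.𝒵 (genInv Θ.𝒳 X) 2) * Θ.𝒱 X 0 ∧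
    Θ.𝒱 X 3 = c (Θ.𝒵 (genInv Θ.𝒳 X) 2) * Θ.𝒱 X 4
  rel_W : ∀ᵐ Y,
    2 * Θ.𝒲 Y 3 * Θ.𝒲 Y 1 = (c (Θ.𝒵 (genInv Θ.𝒴 Y) 2) * Θ.𝒲 Y 2) ^ 2 ∧
    Θ.𝒲 Y 1 = -(c (Θ.𝒵 (genInv Θ.𝒴 Y) 2) * Θ.𝒲 Y 0) ∧
    Θ.𝒲 Y 3 = -(c (Θ.𝒵 (genInv Θ.𝒴 Y) 2) * Θ.𝒲 Y 4)
  normalized_J : Tendsto (fun s => Θ.𝒵 s 3) atBot (𝓝 0)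

/-! ### The equivalent system -/

/-- The bilinear map `F(Z)(P, Q)`; with `P = Z_X` and `Q = Z_Y`, the system is `Z_XY = F(Z)(P, Q)`
for `Z = (t, x, U, J, K)`. -/
def F (c : ℝ → ℝ) (Z P Q : Fin 5 → ℝ) : Fin 5 → ℝ :=
  let U := Z 2
  let a := deriv c U / (2 * c U)
  ![-a * (P 2 * Q 0 + Q 2 * P 0),
    a * (Q 2 * P 1 + P 2 * Q 1),
    deriv c U / (2 * c U ^ 3) * (Q 1 * P 3 + Q 3 * P 1) - a * (Q 2 * P 2),
    a * (P 3 * Q 2 + Q 3 * P 2),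
    -a * (P 4 * Q 2 + Q 4 * P 2)]

/-- The partial derivative `Z_X(X, Y)`. -/
def dX (Z : ℝ → ℝ → Fin 5 → ℝ) (X Y : ℝ) : Fin 5 → ℝ := deriv (fun ξ => Z ξ Y) X

/-- The partial derivative `Z_Y(X, Y)`. -/
def dY (Z : ℝ → ℝ → Fin 5 → ℝ) (X Y : ℝ) : Fin 5 → ℝ := deriv (fun η => Z X η) Y

/-- `Z` is a solution of the system on `[Xl, Xr] × [Yl, Yr]`: `Z ∈ W^{1,∞}`, `Z_X ∈ W_Y^{1,∞}`,
`Z_Y ∈ W_X^{1,∞}`, and the system holds almost everywhere. For almost every `X` the derivative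
`Z_X(X, Y)` exists for every `Y` and is Lipschitz in `Y`, and symmetrically for `Z_Y`; in
particular `Z_X` and `Z_Y` have values along curves. -/
structure IsSolutionOn (c : ℝ → ℝ) (Z : ℝ → ℝ → Fin 5 → ℝ) (Xl Xr Yl Yr : ℝ) : Prop where
  lipschitz : ∃ L : ℝ≥0, LipschitzOnWith L (fun p : ℝ × ℝ => Z p.1 p.2) (Icc Xl Xr ×ˢ Icc Yl Yr)
  reg_X : ∃ L : ℝ≥0, ∀ᵐ X ∂volume.restrict (Icc Xl Xr),
    (∀ Y ∈ Icc Yl Yr, DifferentiableAt ℝ (fun ξ => Z ξ Y) X ∧ ‖dX Z X Y‖ ≤ L) ∧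
    LipschitzOnWith L (fun Y => dX Z X Y) (Icc Yl Yr)
  reg_Y : ∃ L : ℝ≥0, ∀ᵐ Y ∂volume.restrict (Icc Yl Yr),
    (∀ X ∈ Icc Xl Xr, DifferentiableAt ℝ (fun η => Z X η) Y ∧ ‖dY Z X Y‖ ≤ L) ∧
    LipschitzOnWith L (fun X => dY Z X Y) (Icc Xl Xr)
  eq_X : ∀ᵐ X ∂volume.restrict (Icc Xl Xr), ∀ᵐ Y ∂volume.restrict (Icc Yl Yr),
    HasDerivAt (fun η => dX Z X η) (F c (Z X Y) (dX Z X Y) (dY Z X Y)) Y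
  eq_Y : ∀ᵐ Y ∂volume.restrict (Icc Yl Yr), ∀ᵐ X ∂volume.restrict (Icc Xl Xr),
    HasDerivAt (fun ξ => dY Z ξ Y) (F c (Z X Y) (dX Z X Y) (dY Z X Y)) X

/-- The set `ℋ(Ω)` for `Ω = [Xl, Xr] × [Yl, Yr]`. -/
structure MemHOn (c : ℝ → ℝ) (Z : ℝ → ℝ → Fin 5 → ℝ) (Xl Xr Yl Yr : ℝ) : Prop where
  solution : IsSolutionOn c Z Xl Xr Yl Yr
  rel_X : ∀ᵐ X ∂volume.restrict (Icc Xl Xr), ∀ Y ∈ Icc Yl Yr,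
    dX Z X Y 1 = c (Z X Y 2) * dX Z X Y 0 ∧
    dX Z X Y 3 = c (Z X Y 2) * dX Z X Y 4 ∧
    2 * dX Z X Y 3 * dX Z X Y 1 = (c (Z X Y 2) * dX Z X Y 2) ^ 2 ∧
    0 ≤ dX Z X Y 1 ∧ 0 ≤ dX Z X Y 3 ∧ 0 < dX Z X Y 1 + dX Z X Y 3
  rel_Y : ∀ᵐ Y ∂volume.restrict (Icc Yl Yr), ∀ X ∈ Icc Xl Xr,
    dY Z X Y 1 = -(c (Z X Y 2) * dY Z X Y 0) ∧
    dY Z X Y 3 = -(c (Z X Y 2) * dY Z X Y 4) ∧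
    2 * dY Z X Y 3 * dY Z X Y 1 = (c (Z X Y 2) * dY Z X Y 2) ^ 2 ∧
    0 ≤ dY Z X Y 1 ∧ 0 ≤ dY Z X Y 3 ∧ 0 < dY Z X Y 1 + dY Z X Y 3

/-- Extraction `Z • (𝒳, 𝒴)` of the data of `Z` on a curve. -/
def extract (Z : ℝ → ℝ → Fin 5 → ℝ) (𝒳 𝒴 : ℝ → ℝ) : CurveData where
  𝒳 := 𝒳
  𝒴 := 𝒴
  𝒵 := fun s => Z (𝒳 s) (𝒴 s)
  𝒱 := fun X => dX Z X (𝒴 (genInv 𝒳 X))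
  𝒲 := fun Y => dY Z (𝒳 (genInv 𝒴 Y)) Y

/-- The set `ℋ` of global solutions. -/
structure MemH (c : ℝ → ℝ) (Z : ℝ → ℝ → Fin 5 → ℝ) : Prop where
  memHOn : ∀ Xl Xr Yl Yr : ℝ, Xl < Xr → Yl < Yr → MemHOn c Z Xl Xr Yl Yr
  decay : ∃ 𝒳 𝒴 : ℝ → ℝ, IsCurve 𝒳 𝒴 ∧ MemG c (extract Z 𝒳 𝒴)

/-- `Z = 𝐒(Θ)`: `Z` is a global solution with `Z • (𝒳, 𝒴) = Θ`. -/
structure IsSolutionThrough (c : ℝ → ℝ) (Θ : CurveData) (Z : ℝ → ℝ → Fin 5 → ℝ) : Prop where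
  memH : MemH c Z
  eq_Z : (extract Z Θ.𝒳 Θ.𝒴).𝒵 = Θ.𝒵
  eq_V : (extract Z Θ.𝒳 Θ.𝒴).𝒱 =ᵐ[volume] Θ.𝒱
  eq_W : (extract Z Θ.𝒳 Θ.𝒴).𝒲 =ᵐ[volume] Θ.𝒲

/-! ### The changes of variables -/

/-- The function `X ↦ sup {x | x' + μ((-∞, x')) < X for all x' < x}`. -/
def initPos (μ : Measure ℝ) (X : ℝ) : ℝ :=
  sSup {x | ∀ x' < x, x' + μ.real (Iio x') < X}

/-- The map `𝐋` from `𝒟` to pairs `ψ = (ψ₁, ψ₂)`. -/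
def mapL (c : ℝ → ℝ) (ζ : EulerData) : LagData :=
  let x₁ := initPos ζ.μ
  let x₂ := initPos ζ.ν
  let J₁ : ℝ → ℝ := fun X => X - x₁ X
  let J₂ : ℝ → ℝ := fun Y => Y - x₂ Y
  let U₁ : ℝ → ℝ := fun X => ζ.u (x₁ X)
  let U₂ : ℝ → ℝ := fun Y => ζ.u (x₂ Y)
  { fst :=
      { x := x₁
        U := U₁
        V := fun X => ζ.R (x₁ X) / (2 * c (U₁ X)) * deriv x₁ X
        J := J₁
        K := fun X => ∫ ξ in Iic X, deriv J₁ ξ / c (U₁ ξ) }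
    snd :=
      { x := x₂
        U := U₂
        V := fun Y => -(ζ.S (x₂ Y) / (2 * c (U₂ Y))) * deriv x₂ Y
        J := J₂
        K := fun Y => -∫ η in Iic Y, deriv J₂ η / c (U₂ η) } }

/-- The map `𝐂`, which selects a curve in `{(X, Y) | x₁(X) = x₂(Y)}` and the data on it. -/
def mapC (c : ℝ → ℝ) (ψ : LagData) : CurveData :=
  let 𝒳 : ℝ → ℝ := fun s => sSup {X | ∀ X' < X, ψ.fst.x X' < ψ.snd.x (2 * s - X')}
  let 𝒴 : ℝ → ℝ := fun s => 2 * s - 𝒳 s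
  { 𝒳 := 𝒳
    𝒴 := 𝒴
    𝒵 := fun s => ![0, ψ.fst.x (𝒳 s), ψ.fst.U (𝒳 s), ψ.fst.J (𝒳 s) + ψ.snd.J (𝒴 s),
      ψ.fst.K (𝒳 s) + ψ.snd.K (𝒴 s)]
    𝒱 := fun X => ![deriv ψ.fst.x X / (2 * c (ψ.fst.U X)), deriv ψ.fst.x X / 2, ψ.fst.V X,
      deriv ψ.fst.J X, deriv ψ.fst.K X]
    𝒲 := fun Y => ![-(deriv ψ.snd.x Y / (2 * c (ψ.snd.U Y))), deriv ψ.snd.x Y / 2, ψ.snd.V Y,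
      deriv ψ.snd.J Y, deriv ψ.snd.K Y] }

/-- The map `𝐭_T`, which shifts time by `T`. -/
def shift (T : ℝ) (Z : ℝ → ℝ → Fin 5 → ℝ) : ℝ → ℝ → Fin 5 → ℝ :=
  fun X Y => ![Z X Y 0 - T, Z X Y 1, Z X Y 2, Z X Y 3, Z X Y 4]

/-- The map `𝐄`, which extracts the data of a global solution at time zero. -/
def mapE (Z : ℝ → ℝ → Fin 5 → ℝ) : CurveData :=
  let 𝒳 : ℝ → ℝ := fun s => sSup {X | ∀ X' < X, Z X' (2 * s - X') 0 < 0}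
  extract Z 𝒳 (fun s => 2 * s - 𝒳 s)

/-- The map `𝐃`: the functions with `x₁(𝒳(s)) = x₂(𝒴(s)) = x(s)`, `U₁(𝒳(s)) = U₂(𝒴(s)) = U(s)`,
`J₁(𝒳(s)) = ∫_{-∞}^s 𝒱₄(𝒳) 𝒳'` and so on. Every `X` is `𝒳(s)` for `s = genInv 𝒳 X`, every `Y` is
`𝒴(s)` for `s = genInv 𝒴 Y`. -/
def mapD (Θ : CurveData) : LagData where
  fst :=
    { x := fun X => Θ.𝒵 (genInv Θ.𝒳 X) 1
      U := fun X => Θ.𝒵 (genInv Θ.𝒳 X) 2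
      V := fun X => Θ.𝒱 X 2
      J := fun X => ∫ s in Iic (genInv Θ.𝒳 X), Θ.𝒱 (Θ.𝒳 s) 3 * deriv Θ.𝒳 s
      K := fun X => ∫ s in Iic (genInv Θ.𝒳 X), Θ.𝒱 (Θ.𝒳 s) 4 * deriv Θ.𝒳 s }
  snd :=
    { x := fun Y => Θ.𝒵 (genInv Θ.𝒴 Y) 1
      U := fun Y => Θ.𝒵 (genInv Θ.𝒴 Y) 2
      V := fun Y => Θ.𝒲 Y 2
      J := fun Y => ∫ s in Iic (genInv Θ.𝒴 Y), Θ.𝒲 (Θ.𝒴 s) 3 * deriv Θ.𝒴 s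
      K := fun Y => ∫ s in Iic (genInv Θ.𝒴 Y), Θ.𝒲 (Θ.𝒴 s) 4 * deriv Θ.𝒴 s }

/-- `ζ = 𝐌(ψ)`; the functions `R` and `S` are determined up to null sets. -/
structure IsMapM (c : ℝ → ℝ) (ψ : LagData) (ζ : EulerData) : Prop where
  u_fst : ∀ X, ζ.u (ψ.fst.x X) = ψ.fst.U X
  u_snd : ∀ Y, ζ.u (ψ.snd.x Y) = ψ.snd.U Y
  μ_eq : ζ.μ = (volume.withDensity (fun X => ENNReal.ofReal (deriv ψ.fst.J X))).map ψ.fst.x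
  ν_eq : ζ.ν = (volume.withDensity (fun Y => ENNReal.ofReal (deriv ψ.snd.J Y))).map ψ.snd.x
  measurable_R : AEStronglyMeasurable ζ.R volume
  measurable_S : AEStronglyMeasurable ζ.S volume
  R_eq : ∀ᵐ X, ζ.R (ψ.fst.x X) * deriv ψ.fst.x X = 2 * c (ψ.fst.U X) * ψ.fst.V X
  S_eq : ∀ᵐ Y, ζ.S (ψ.snd.x Y) * deriv ψ.snd.x Y = -(2 * c (ψ.snd.U Y) * ψ.snd.V Y)

/-- `ζ(t) = S̄_t ζ₀` for all `t`, where `S̄_t = 𝐌 ∘ 𝐃 ∘ 𝐄 ∘ 𝐭_t ∘ 𝐒 ∘ 𝐂 ∘ 𝐋`. -/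
def IsConservativeSolution (c : ℝ → ℝ) (ζ₀ : EulerData) (ζ : ℝ → EulerData) : Prop :=
  ∃ Z : ℝ → ℝ → Fin 5 → ℝ, IsSolutionThrough c (mapC c (mapL c ζ₀)) Z ∧
    ∀ t : ℝ, IsMapM c (mapD (mapE (shift t Z))) (ζ t)

end NVW

end

/-!
The equivalent system is semilinear with a quadratic nonlinearity, its coefficient is merely
continuous because `c` is only `C¹`, and the algebraic relations `2 J_X x_X = (c U_X)²` have to be
preserved. All three points are settled by passing to square roots. Write `x_X = α²`, `J_X = β²`,
`c U_X = √2 α β` and likewise `x_Y = γ²`, `J_Y = δ²`, `c U_Y = √2 γ δ`, and put `w = A(U)` with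
`A' = c`. With `s = γ β + δ α` and `k = c' / (2 √2 c²)` the system becomes
`(α, β)_Y = k s (γ, δ)`, `(γ, δ)_X = k s (α, β)`, `w_XY = √2 k s²`, the spinor system (`spin`),
and the algebraic relations hold by construction.

*Existence for the spinor system* (`exists_spinSol`). The potential `x + J` has the nonnegative
densities `α² + β²` and `γ² + δ²`, so that its increments along the two legs of a characteristic
triangle are bounded by the data (`flux_le`). The densities themselves then stay bounded by
Grönwall's inequality (`density_le`), and the bound for `w` needs no bound for `k` (`abs_w_le`).
For smooth, truncated coefficients there is a solution by Picard iteration (`exists_picard`). For a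
continuous coefficient the components `w` of approximate solutions have a limit by the theorem of
Arzelà and Ascoli, and given the convergence of `w` the other components converge by stability
(`exists_stability`). The solutions on the two sides of the initial curve are glued
(`exists_spinorSol`), and the surface `Z` is the potential of the fields that the spinor determines
(`exists_surface`, `memHOn`). It takes the initial data since both have the same increments along
the curve (`exists_solution`), and the initial data belong to `𝒢` because the new coordinates are
Lipschitz parametrizations of the graph of `x + μ₀((-∞, x))` (`exists_isSolutionThrough`).

*Return to the original variables.* As `x` advances at a speed between `κ⁻¹` and `κ` along
characteristics, the sets `{t < τ}` are bounded by curves of `𝒞` (`Anchored.isRegion`). On such a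
curve `t_X 𝒳' + t_Y 𝒴' = 0`, hence `x_X 𝒳' = x_Y 𝒴'`: the two families contribute equally to the
displacement. So `U` is constant where `x` is (`U_eq_of_x_eq`), and `R`, `S` are quotients that are
defined wherever `x_X ≠ 0` (`exists_velocity`). Every statement for the second family follows from
the one for the first by the symmetry `(X, Y, t, K) ↦ (Y, X, -t, -K)` of the system
(`MemHLoc.swap`).

*Conservation.* The energy `J` is monotone and, along the initial curve, increases from `0` to
`μ₀(ℝ) + ν₀(ℝ)`; by comparison in the characteristic coordinates it does so along every curve
(`tendsto_J`). Its increments carried by the two families are the masses of `μ(τ)` and `ν(τ)`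
(`integrable_sideD`, `IsSideM.measure_univ`).

*Concentration.* The singular part of `μ(τ)` lives where `x_X = 0` (`IsSideM.singularPart_eq_zero`).
There `U_X = 0` and `J_X > 0`, while `U_XY = c' x_Y J_X / (2 c³)`. Where `c' ≠ 0`, either `x_Y ≠ 0`
and the zero of `U_X` on the characteristic is isolated, or `t_Y = 0` and the point is critical for
`t`. In both cases the times in question form a null set, by Sard's lemma on the line
(`volume_image_time`), and Fubini's theorem turns this into a statement for almost every time
(`ae_time`).
-/



namespace NVW

/-! ### Lipschitz and monotone functions of one real variable -/

theorem integral_eq_sub_of_lipschitzOn {f f' : ℝ → ℝ} {K : ℝ≥0} {a b : ℝ}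
    (hf : LipschitzOnWith K f (uIcc a b))
    (h : ∀ᵐ x, x ∈ uIcc a b → HasDerivAt f (f' x) x) : ∫ x in a..b, f' x = f b - f a := by
  rw [← hf.absolutelyContinuousOnInterval.integral_deriv_eq_sub]
  apply intervalIntegral.integral_congr_ae
  filter_upwards [h] with x hx hx'
  exact (hx (uIoc_subset_uIcc hx')).deriv.symm

theorem volume_image_eq_zero_of_lipschitzOn {f : ℝ → ℝ} {K : ℝ≥0} {s : Set ℝ}
    (hf : LipschitzOnWith K f s) (hs : volume s = 0) : volume (f '' s) = 0 := by
  have h := hf.hausdorffMeasure_image_le (d := 1) zero_le_one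
  rw [hausdorffMeasure_real, hs, mul_zero] at h
  exact le_antisymm h bot_le

/-- The integral form of the product rule for indefinite integrals. -/
theorem mul_sub_mul_eq_integral {f g F G : ℝ → ℝ} {a b : ℝ} (hab : a ≤ b)
    (hF : IntervalIntegrable F volume a b) (hG : IntervalIntegrable G volume a b)
    (hf : ∀ x ∈ Icc a b, f x = f a + ∫ t in a..x, F t)
    (hg : ∀ x ∈ Icc a b, g x = g a + ∫ t in a..x, G t) :
    f b * g b - f a * g a = ∫ t in a..b, (F t * g t + f t * G t) := by
  set f1 : ℝ → ℝ := fun x => f a + ∫ t in a..x, F t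
  set g1 : ℝ → ℝ := fun x => g a + ∫ t in a..x, G t
  have cst : ∀ c : ℝ, AbsolutelyContinuousOnInterval (fun _ : ℝ => c) a b := fun c =>
    ((LipschitzWith.const c).lipschitzOnWith (s := uIcc a b)).absolutelyContinuousOnInterval
  have acf : AbsolutelyContinuousOnInterval f1 a b :=
    (cst _).add (hF.absolutelyContinuousOnInterval_intervalIntegral left_mem_uIcc)
  have acg : AbsolutelyContinuousOnInterval g1 a b :=
    (cst _).add (hG.absolutelyContinuousOnInterval_intervalIntegral left_mem_uIcc)
  have := acf.integral_deriv_mul_eq_sub acg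
  have ea : f1 a = f a := by simp [f1]
  have eb : g1 a = g a := by simp [g1]
  rw [ea, eb] at this
  rw [hf b (right_mem_Icc.2 hab), hg b (right_mem_Icc.2 hab), ← this]
  apply intervalIntegral.integral_congr_ae
  filter_upwards [hF.ae_hasDerivAt_integral, hG.ae_hasDerivAt_integral] with x h1 h2 hx
  have hx' := uIoc_subset_uIcc hx
  have e1 : deriv f1 x = F x := ((h1 hx' a left_mem_uIcc).const_add (f a)).deriv
  have e2 : deriv g1 x = G x := ((h2 hx' a left_mem_uIcc).const_add (g a)).deriv
  rw [uIcc_of_le hab] at hx'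
  rw [e1, e2, hf x hx', hg x hx']

/-- Grönwall's inequality for an indefinite integral with a bounded measurable coefficient. -/
theorem le_mul_exp_of_integral {f F k : ℝ → ℝ} {a b : ℝ} (hab : a ≤ b)
    (hF : IntervalIntegrable F volume a b) (hk : IntervalIntegrable k volume a b)
    {B : ℝ} (hkB : ∀ x, |k x| ≤ B)
    (hf : ∀ x ∈ Icc a b, f x = f a + ∫ t in a..x, F t)
    (h : ∀ x ∈ Icc a b, F x ≤ k x * f x) :
    f b ≤ f a * Real.exp (∫ t in a..b, k t) := by
  set K : ℝ → ℝ := fun x => ∫ t in a..x, k t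
  set g : ℝ → ℝ := fun x => Real.exp (-K x)
  have hBn : 0 ≤ B := (abs_nonneg _).trans (hkB a)
  have hkab : ∀ x ∈ Icc a b, ∀ y ∈ Icc a b, IntervalIntegrable k volume x y := fun x hx y hy =>
    hk.mono_set (by rw [uIcc_of_le hab]; exact uIcc_subset_Icc hx hy)
  have hKL : LipschitzOnWith (Real.toNNReal B) K (uIcc a b) := by
    rw [uIcc_of_le hab]
    apply LipschitzOnWith.of_dist_le_mul
    intro x hx y hy
    rw [Real.dist_eq, Real.dist_eq, Real.coe_toNNReal _ hBn,
      intervalIntegral.integral_interval_sub_left (hkab _ (left_mem_Icc.2 hab) _ hx)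
        (hkab _ (left_mem_Icc.2 hab) _ hy)]
    exact intervalIntegral.norm_integral_le_of_norm_le_const (C := B) (f := k) (fun t _ => hkB t)
  have hgac : AbsolutelyContinuousOnInterval g a b := by
    have hc : ContDiff ℝ 1 (fun x : ℝ => Real.exp (-x)) := by fun_prop
    obtain ⟨L, hL⟩ := hc.contDiffOn.exists_lipschitzOnWith (s := Icc (-(B * (b - a))) (B * (b - a)))
      (by decide) (convex_Icc _ _) isCompact_Icc
    have hm : MapsTo K (uIcc a b) (Icc (-(B * (b - a))) (B * (b - a))) := by
      intro x hx
      rw [uIcc_of_le hab] at hx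
      have := intervalIntegral.norm_integral_le_of_norm_le_const (a := a) (b := x)
        (C := B) (f := k) (fun t _ => hkB t)
      rw [abs_of_nonneg (by linarith [hx.1])] at this
      exact abs_le.1 (this.trans (by gcongr; exact hx.2))
    exact (hL.comp hKL hm).absolutelyContinuousOnInterval
  have cst : AbsolutelyContinuousOnInterval (fun _ : ℝ => f a) a b :=
    ((LipschitzWith.const (f a)).lipschitzOnWith (s := uIcc a b)).absolutelyContinuousOnInterval
  have acf : AbsolutelyContinuousOnInterval (fun x => f a + ∫ t in a..x, F t) a b :=
    cst.add (hF.absolutelyContinuousOnInterval_intervalIntegral left_mem_uIcc)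
  have key := acf.integral_deriv_mul_eq_sub hgac
  have hle : ∫ x in a..b, (deriv (fun x => f a + ∫ t in a..x, F t) x * g x +
      (f a + ∫ t in a..x, F t) * deriv g x) ≤ 0 := by
    rw [intervalIntegral.integral_of_le hab]
    apply integral_nonpos_of_ae
    rw [EventuallyLE, ae_restrict_iff' measurableSet_Ioc]
    filter_upwards [hF.ae_hasDerivAt_integral, hk.ae_hasDerivAt_integral] with x h1 h2 hx
    have hx1 : x ∈ Icc a b := Ioc_subset_Icc_self hx
    have hx' : x ∈ uIcc a b := by rwa [uIcc_of_le hab]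
    have e1 := ((h1 hx' a left_mem_uIcc).const_add (f a)).deriv
    have e2 : deriv g x = Real.exp (-K x) * (-k x) :=
      (HasDerivAt.exp (h2 hx' a left_mem_uIcc).neg).deriv
    rw [e1, e2, ← hf x hx1]
    have := mul_le_mul_of_nonneg_left (h x hx1) (Real.exp_pos (-K x)).le
    simp only [Pi.zero_apply, g]
    linarith
  rw [key] at hle
  have eK : K a = 0 := by simp [K]
  simp only [g, eK, intervalIntegral.integral_same, add_zero, neg_zero, Real.exp_zero, mul_one,
    ← hf b (right_mem_Icc.2 hab)] at hle
  rw [Real.exp_neg] at hle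
  have hp := Real.exp_pos (K b)
  have : f b * (Real.exp (K b))⁻¹ ≤ f a := by linarith
  rwa [← div_eq_mul_inv, div_le_iff₀ hp] at this

section changeOfVariables

variable {f : ℝ → ℝ} {K : ℝ≥0}

theorem ae_eq_image_differentiableAt (hL : LipschitzWith K f) (s : Set ℝ) :
    (f '' (s ∩ {x | DifferentiableAt ℝ f x}) : Set ℝ) =ᵐ[volume] (f '' s : Set ℝ) := by
  have h0 : volume (f '' (s ∩ {x | DifferentiableAt ℝ f x}ᶜ)) = 0 :=
    volume_image_eq_zero_of_lipschitzOn hL.lipschitzOnWith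
      (measure_mono_null inter_subset_right (ae_iff.1 hL.ae_differentiableAt_real))
  have e : f '' s = f '' (s ∩ {x | DifferentiableAt ℝ f x}) ∪
      f '' (s ∩ {x | DifferentiableAt ℝ f x}ᶜ) := by
    rw [← image_union, inter_union_compl]
  rw [e]
  exact (union_ae_eq_left_of_ae_eq_empty (ae_eq_empty.2 h0)).symm

/-- Change of variables for a monotone Lipschitz function, which need not be injective. -/
theorem lintegral_image_of_monotone (hf : Monotone f) (hL : LipschitzWith K f) {s : Set ℝ}
    (hs : MeasurableSet s) (u : ℝ → ℝ≥0∞) :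
    ∫⁻ x in f '' s, u x = ∫⁻ x in s, ENNReal.ofReal (deriv f x) * u (f x) := by
  have hD : MeasurableSet {x | DifferentiableAt ℝ f x} := measurableSet_of_differentiableAt ℝ f
  rw [← setLIntegral_congr (ae_eq_image_differentiableAt hL s),
    lintegral_image_eq_lintegral_deriv_mul_of_monotoneOn (hs.inter hD) (f' := deriv f)
    (fun x hx => hx.2.hasDerivAt.hasDerivWithinAt) (hf.monotoneOn _)]
  apply setLIntegral_congr
  have : ∀ᵐ x, x ∈ {x | DifferentiableAt ℝ f x} := hL.ae_differentiableAt_real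
  filter_upwards [this] with x hx
  exact propext (and_iff_left hx)

theorem integral_image_of_monotone (hf : Monotone f) (hL : LipschitzWith K f) {s : Set ℝ}
    (hs : MeasurableSet s) (u : ℝ → ℝ) :
    ∫ x in f '' s, u x = ∫ x in s, deriv f x * u (f x) := by
  have hD : MeasurableSet {x | DifferentiableAt ℝ f x} := measurableSet_of_differentiableAt ℝ f
  rw [← setIntegral_congr_set (ae_eq_image_differentiableAt hL s),
    integral_image_eq_integral_deriv_smul_of_monotoneOn (hs.inter hD) (f' := deriv f)
    (fun x hx => hx.2.hasDerivAt.hasDerivWithinAt) (hf.monotoneOn _)]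
  apply setIntegral_congr_set
  have : ∀ᵐ x, x ∈ {x | DifferentiableAt ℝ f x} := hL.ae_differentiableAt_real
  filter_upwards [this] with x hx
  exact propext (and_iff_left hx)

theorem lintegral_eq_lintegral_deriv_mul_comp (hf : Monotone f) (hL : LipschitzWith K f)
    (hs : Function.Surjective f) (u : ℝ → ℝ≥0∞) :
    ∫⁻ x, u x = ∫⁻ x, ENNReal.ofReal (deriv f x) * u (f x) := by
  have := lintegral_image_of_monotone hf hL MeasurableSet.univ u
  rwa [image_univ, hs.range_eq, setLIntegral_univ, setLIntegral_univ] at this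

/-- On the preimage of a null set a monotone function has zero derivative. -/
theorem ae_deriv_eq_zero_of_preimage_null (hf : Monotone f) {N : Set ℝ} (hN : volume N = 0) :
    ∀ᵐ x, f x ∈ N → deriv f x = 0 := by
  obtain ⟨M, hNM, hM, hM0⟩ := exists_measurable_superset_of_null hN
  have hP : MeasurableSet (f ⁻¹' M ∩ {x | DifferentiableAt ℝ f x}) :=
    (hf.measurable hM).inter (measurableSet_of_differentiableAt ℝ f)
  have h := lintegral_image_eq_lintegral_deriv_mul_of_monotoneOn hP (f' := deriv f)
    (fun x hx => hx.2.hasDerivAt.hasDerivWithinAt) (hf.monotoneOn _) 1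
  have h0 : volume (f '' (f ⁻¹' M ∩ {x | DifferentiableAt ℝ f x})) = 0 :=
    measure_mono_null (by rintro _ ⟨x, hx, rfl⟩; exact hx.1) hM0
  simp only [Pi.one_apply, lintegral_one, Measure.restrict_apply_univ, h0, mul_one] at h
  rw [eq_comm, lintegral_eq_zero_iff (measurable_deriv f).ennreal_ofReal, EventuallyEq,
    ae_restrict_iff' hP] at h
  filter_upwards [h] with x hx hxN
  by_cases hd : DifferentiableAt ℝ f x
  · exact le_antisymm (ENNReal.ofReal_eq_zero.1 (hx ⟨hNM hxN, hd⟩)) hf.deriv_nonneg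
  · exact deriv_zero_of_not_differentiableAt hd

theorem image_Icc_of_monotone (hf : Monotone f) (hc : Continuous f) {a b : ℝ} (hab : a ≤ b) :
    f '' Icc a b = Icc (f a) (f b) :=
  Subset.antisymm (by rintro _ ⟨x, hx, rfl⟩; exact ⟨hf hx.1, hf hx.2⟩)
    (intermediate_value_Icc hab hc.continuousOn)

theorem intervalIntegral_comp_of_monotone (hf : Monotone f) (hL : LipschitzWith K f) (a b : ℝ)
    (u : ℝ → ℝ) : ∫ x in f a..f b, u x = ∫ s in a..b, deriv f s * u (f s) := by
  have key : ∀ a b, a ≤ b → ∫ x in f a..f b, u x = ∫ s in a..b, deriv f s * u (f s) := by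
    intro a b hab
    rw [intervalIntegral.integral_of_le hab, intervalIntegral.integral_of_le (hf hab),
      ← integral_Icc_eq_integral_Ioc, ← integral_Icc_eq_integral_Ioc,
      ← image_Icc_of_monotone hf hL.continuous hab, integral_image_of_monotone hf hL
      measurableSet_Icc]
  rcases le_total a b with hab | hab
  · exact key a b hab
  · rw [intervalIntegral.integral_symm, key b a hab, ← intervalIntegral.integral_symm]

end changeOfVariables

/-! ### Generalized inverses and curves -/

section genInv

variable {f : ℝ → ℝ}

theorem genInv_spec (hf : Monotone f) (hc : Continuous f) (hs : Function.Surjective f) (y : ℝ) :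
    f (genInv f y) = y := by
  obtain ⟨s1, h1⟩ := hs (y - 1)
  obtain ⟨s2, h2⟩ := hs y
  have hne : {s | f s < y}.Nonempty := ⟨s1, by simp [h1]⟩
  have hub : s2 ∈ upperBounds {s | f s < y} := fun s hs' =>
    (hf.reflect_lt (lt_of_lt_of_eq hs' h2.symm)).le
  have hbd : BddAbove {s | f s < y} := ⟨s2, hub⟩
  apply le_antisymm
  · exact (hf (csSup_le hne hub)).trans h2.le
  · by_contra! hlt
    have h1 : ∀ᶠ z in 𝓝[>] (genInv f y), f z < y :=
      mem_nhdsWithin_of_mem_nhds ((isOpen_Iio.preimage hc).mem_nhds hlt)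
    obtain ⟨z, hz, hz'⟩ := (h1.and self_mem_nhdsWithin).exists
    exact absurd (le_csSup hbd (show z ∈ {s | f s < y} from hz)) (not_le.2 hz')

theorem genInv_le (hf : Monotone f) (hs : Function.Surjective f) {s y : ℝ} (h : y ≤ f s) :
    genInv f y ≤ s := by
  obtain ⟨s1, h1⟩ := hs (y - 1)
  exact csSup_le ⟨s1, by simp [h1]⟩ fun s' hs' => (hf.reflect_lt (lt_of_lt_of_le hs' h)).le

theorem genInv_mono (hf : Monotone f) (hc : Continuous f) (hs : Function.Surjective f) :
    Monotone (genInv f) := fun x y hxy =>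
  genInv_le hf hs (by rwa [genInv_spec hf hc hs])

/-- A point of a monotone curve is recovered by the generalized inverse wherever the curve has
nonzero speed. -/
theorem deriv_eq_zero_or_genInv (hf : Monotone f) (hc : Continuous f)
    (hs : Function.Surjective f) (s : ℝ) : deriv f s = 0 ∨ genInv f (f s) = s := by
  by_cases hd : DifferentiableAt ℝ f s
  · rcases (genInv_le hf hs (le_refl (f s))).lt_or_eq with hlt | heq
    · left
      have hcst : ∀ x ∈ Icc (genInv f (f s)) s, f x = f s := fun x hx =>
        le_antisymm (hf hx.2) ((genInv_spec hf hc hs (f s)).symm.le.trans (hf hx.1))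
      have h1 : HasDerivWithinAt f (deriv f s) (Icc (genInv f (f s)) s) s :=
        hd.hasDerivAt.hasDerivWithinAt
      have h2 : HasDerivWithinAt f 0 (Icc (genInv f (f s)) s) s :=
        (hasDerivWithinAt_const s _ (f s)).congr_of_mem hcst (right_mem_Icc.2 hlt.le)
      exact ((uniqueDiffOn_Icc hlt).uniqueDiffWithinAt (right_mem_Icc.2 hlt.le)).eq_deriv _ h1 h2
    · exact Or.inr heq
  · exact Or.inl (deriv_zero_of_not_differentiableAt hd)

theorem ae_subsingleton_preimage (hf : Monotone f) :
    ∀ᵐ x, ∀ s s', f s = x → f s' = x → s = s' := by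
  have h := (hf.monotoneOn univ).countable_setOfPred_two_preimages
  have := h.ae_notMem volume
  filter_upwards [this] with x hx s s' hs hs'
  by_contra hne
  rcases lt_or_gt_of_ne hne with hlt | hlt
  · exact hx ⟨s, s', mem_univ _, mem_univ _, hlt, hs, hs'⟩
  · exact hx ⟨s', s, mem_univ _, mem_univ _, hlt, hs', hs⟩

theorem surjective_of_sub_id_bdd (hc : Continuous f) {B : ℝ} (h : ∀ s, |f s - s| ≤ B) :
    Function.Surjective f := by
  refine hc.surjective ?_ ?_
  · exact tendsto_atTop_mono (fun s => by linarith [(abs_le.1 (h s)).1] : ∀ s, s - B ≤ f s)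
      (tendsto_atTop_add_const_right _ _ tendsto_id)
  · exact tendsto_atBot_mono (fun s => by linarith [(abs_le.1 (h s)).2] : ∀ s, f s ≤ s + B)
      (tendsto_atBot_add_const_right _ _ tendsto_id)

end genInv

namespace IsCurve

variable {𝒳 𝒴 : ℝ → ℝ}

theorem add_eq (h : IsCurve 𝒳 𝒴) (s : ℝ) : 𝒳 s + 𝒴 s = 2 * s := by linarith [h.normalized s]

theorem lipschitz_fst (h : IsCurve 𝒳 𝒴) : LipschitzWith 2 𝒳 := by
  apply LipschitzWith.of_le_add_mul
  intro a b
  rcases le_total a b with hab | hab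
  · have := h.mono_X hab
    have := dist_nonneg (x := a) (y := b)
    push_cast; linarith
  · have := h.mono_Y hab
    have h1 := h.add_eq a
    have h2 := h.add_eq b
    rw [Real.dist_eq, abs_of_nonneg (by linarith)]
    push_cast; linarith

theorem symm (h : IsCurve 𝒳 𝒴) : IsCurve 𝒴 𝒳 :=
  ⟨h.reg_Y, h.reg_X, h.mono_Y, h.mono_X, fun s => by rw [add_comm]; exact h.normalized s⟩

theorem lipschitz_snd (h : IsCurve 𝒳 𝒴) : LipschitzWith 2 𝒴 := h.symm.lipschitz_fst

theorem surjective_fst (h : IsCurve 𝒳 𝒴) : Function.Surjective 𝒳 := by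
  obtain ⟨B, hB⟩ := h.reg_X.1
  exact surjective_of_sub_id_bdd h.lipschitz_fst.continuous hB

theorem surjective_snd (h : IsCurve 𝒳 𝒴) : Function.Surjective 𝒴 := h.symm.surjective_fst

theorem fst_genInv (h : IsCurve 𝒳 𝒴) (X : ℝ) : 𝒳 (genInv 𝒳 X) = X :=
  genInv_spec h.mono_X h.lipschitz_fst.continuous h.surjective_fst X

theorem snd_genInv (h : IsCurve 𝒳 𝒴) (Y : ℝ) : 𝒴 (genInv 𝒴 Y) = Y := h.symm.fst_genInv Y

theorem genInv_fst_mono (h : IsCurve 𝒳 𝒴) : Monotone (genInv 𝒳) :=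
  genInv_mono h.mono_X h.lipschitz_fst.continuous h.surjective_fst

theorem deriv_fst (h : IsCurve 𝒳 𝒴) (s : ℝ) : deriv 𝒳 s = 0 ∨ genInv 𝒳 (𝒳 s) = s :=
  deriv_eq_zero_or_genInv h.mono_X h.lipschitz_fst.continuous h.surjective_fst s

theorem deriv_snd (h : IsCurve 𝒳 𝒴) (s : ℝ) : deriv 𝒴 s = 0 ∨ genInv 𝒴 (𝒴 s) = s :=
  h.symm.deriv_fst s

end IsCurve

/-- A measurable set of the plane that is invariant under decreasing `X` and increasing `Y` and
whose boundary stays at bounded distance from the diagonal. The sets `{t < τ}` are of this kind. -/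
structure IsRegion (E : Set (ℝ × ℝ)) (C : ℝ) : Prop where
  meas : MeasurableSet E
  nw : ∀ {X Y X' Y' : ℝ}, (X, Y) ∈ E → X' ≤ X → Y ≤ Y' → (X', Y') ∈ E
  le : ∀ {X Y : ℝ}, (X, Y) ∈ E → X - Y ≤ C
  ge : ∀ {X Y : ℝ}, (X, Y) ∉ E → Y - X ≤ C

/-- The first coordinate of the boundary point of `E` on the line `X + Y = 2 s`. -/
noncomputable def edge (E : Set (ℝ × ℝ)) (s : ℝ) : ℝ :=
  sSup {X | ∀ X' < X, (X', 2 * s - X') ∈ E}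

namespace IsRegion

variable {E : Set (ℝ × ℝ)} {C : ℝ}

theorem bddAbove (h : IsRegion E C) (s : ℝ) : BddAbove {X | ∀ X' < X, (X', 2 * s - X') ∈ E} := by
  refine ⟨s + C / 2 + 1, fun X hX => ?_⟩
  by_contra! hlt
  have := h.le (hX _ hlt)
  linarith

theorem nonempty (h : IsRegion E C) (s : ℝ) :
    {X | ∀ X' < X, (X', 2 * s - X') ∈ E}.Nonempty := by
  refine ⟨s - C / 2, fun X' hX' => ?_⟩
  by_contra hn
  have := h.ge hn
  linarith

theorem mem_of_lt_edge (h : IsRegion E C) {s X : ℝ} (hX : X < edge E s) : (X, 2 * s - X) ∈ E := by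
  obtain ⟨X1, h1, h2⟩ := exists_lt_of_lt_csSup (h.nonempty s) hX
  exact h1 X h2

theorem notMem_of_edge_lt (h : IsRegion E C) {s X : ℝ} (hX : edge E s < X) :
    (X, 2 * s - X) ∉ E := by
  intro hE
  refine absurd (le_csSup (h.bddAbove s) (a := X) fun X' hX' => ?_) (not_le.2 hX)
  exact h.nw hE hX'.le (by linarith)

theorem edge_notMem (h : IsRegion E C) (ho : IsOpen E) (s : ℝ) :
    (edge E s, 2 * s - edge E s) ∉ E := by
  intro hE
  have hc : Continuous fun X : ℝ => (X, 2 * s - X) := by fun_prop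
  have h1 : ∀ᶠ z in 𝓝[>] (edge E s), (z, 2 * s - z) ∈ E :=
    mem_nhdsWithin_of_mem_nhds ((ho.preimage hc).mem_nhds hE)
  obtain ⟨z, hz, hz'⟩ := (h1.and self_mem_nhdsWithin).exists
  exact h.notMem_of_edge_lt hz' hz

theorem abs_edge_sub_le (h : IsRegion E C) (s : ℝ) : |edge E s - s| ≤ C / 2 := by
  rw [abs_le]
  constructor
  · by_contra! hlt
    obtain ⟨X, h1, h2⟩ := exists_between (show edge E s < s - C / 2 by linarith)
    have := h.ge (h.notMem_of_edge_lt h1)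
    linarith
  · by_contra! hlt
    obtain ⟨X, h1, h2⟩ := exists_between (show s + C / 2 < edge E s by linarith)
    have := h.le (h.mem_of_lt_edge h2)
    linarith

theorem edge_mono (h : IsRegion E C) : Monotone (edge E) := by
  intro s s' hs
  by_contra! hlt
  obtain ⟨X, h1, h2⟩ := exists_between hlt
  exact h.notMem_of_edge_lt h1 (h.nw (h.mem_of_lt_edge h2) le_rfl (by linarith))

/-- The second coordinate `2 s - edge E s` of the boundary point is nondecreasing in `s`. -/
theorem edge_le_add (h : IsRegion E C) {s s' : ℝ} (hs : s ≤ s') :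
    edge E s' ≤ edge E s + 2 * (s' - s) := by
  by_contra! hlt
  obtain ⟨X, h1, h2⟩ := exists_between hlt
  refine h.notMem_of_edge_lt (X := X - 2 * (s' - s)) (s := s) (by linarith)
    (h.nw (h.mem_of_lt_edge h2) (by linarith) (by linarith))

theorem isCurve (h : IsRegion E C) : IsCurve (edge E) (fun s => 2 * s - edge E s) := by
  have hL : ∀ s s', |(edge E s - s) - (edge E s' - s')| ≤ 1 * |s - s'| := by
    intro s s'
    wlog hs : s ≤ s' generalizing s s'
    · rw [abs_sub_comm, abs_sub_comm s]; exact this s' s (le_of_not_ge hs)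
    have h1 := h.edge_mono hs
    have h2 := h.edge_le_add hs
    rw [abs_sub_comm s, abs_of_nonneg (show 0 ≤ s' - s by linarith), abs_le]
    constructor <;> linarith
  refine ⟨⟨⟨_, h.abs_edge_sub_le⟩, 1, LipschitzWith.of_dist_le_mul fun s s' => ?_⟩,
    ⟨⟨C / 2, fun s => ?_⟩, 1, LipschitzWith.of_dist_le_mul fun s s' => ?_⟩,
    h.edge_mono, fun s s' hs => ?_, fun s => by ring⟩
  · exact hL s s'
  · show |2 * s - edge E s - s| ≤ _
    rw [show 2 * s - edge E s - s = -(edge E s - s) by ring, abs_neg]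
    exact h.abs_edge_sub_le s
  · rw [Real.dist_eq, show 2 * s - edge E s - s - (2 * s' - edge E s' - s') =
      -((edge E s - s) - (edge E s' - s')) by ring, abs_neg]
    exact hL s s'
  · have := h.edge_le_add hs
    show 2 * s - edge E s ≤ 2 * s' - edge E s'
    linarith

end IsRegion

/-! ### Volterra operators on a region -/

/-- Integration in `Y` from the boundary of the region `E` to the point `p`. -/
noncomputable def IY (E : Set (ℝ × ℝ)) (f : ℝ × ℝ → ℝ) (p : ℝ × ℝ) : ℝ :=
  ∫ η in Iio p.2, E.indicator f (p.1, η)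

/-- Integration in `X` from the point `p` to the boundary of the region `E`. -/
noncomputable def IX (E : Set (ℝ × ℝ)) (f : ℝ × ℝ → ℝ) (p : ℝ × ℝ) : ℝ :=
  ∫ ξ in Ioi p.1, E.indicator f (ξ, p.2)

/-- Boundedness of `f` on the intersections of `E` with the half planes `Y - X ≤ m`. -/
def StripBdd (E : Set (ℝ × ℝ)) (f : ℝ × ℝ → ℝ) : Prop :=
  ∀ m, ∃ B, ∀ p ∈ E, p.2 - p.1 ≤ m → |f p| ≤ B

/-- The reflection in the antidiagonal, which exchanges the roles of `IX` and `IY`. -/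
def antidiag (p : ℝ × ℝ) : ℝ × ℝ := (-p.2, -p.1)

@[simp] theorem antidiag_antidiag (p : ℝ × ℝ) : antidiag (antidiag p) = p := by simp [antidiag]

theorem measurable_antidiag : Measurable antidiag := by unfold antidiag; fun_prop

theorem antidiag_sub (p : ℝ × ℝ) : (antidiag p).2 - (antidiag p).1 = p.2 - p.1 := by
  simp [antidiag]; ring

section volterra

variable {E : Set (ℝ × ℝ)} {C : ℝ} {f g : ℝ × ℝ → ℝ}

theorem IsRegion.flip (h : IsRegion E C) : IsRegion (antidiag ⁻¹' E) C where
  meas := measurable_antidiag h.meas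
  nw := fun {X Y X' Y'} hm hX hY => h.nw (X := -Y) (Y := -X) hm (by linarith) (by linarith)
  le := fun {X Y} hm => by have := h.le (X := -Y) (Y := -X) hm; linarith
  ge := fun {X Y} hm => by have := h.ge (X := -Y) (Y := -X) hm; linarith

theorem StripBdd.flip (h : StripBdd E f) : StripBdd (antidiag ⁻¹' E) (f ∘ antidiag) := fun m => by
  obtain ⟨B, hB⟩ := h m
  exact ⟨B, fun p hp hm => hB _ hp (by rwa [antidiag_sub])⟩

theorem IX_eq_IY_flip (p : ℝ × ℝ) : IX E f p = IY (antidiag ⁻¹' E) (f ∘ antidiag) (antidiag p) := by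
  have := integral_comp_neg_Iic (-p.1) (fun ξ => E.indicator f (ξ, p.2))
  rw [neg_neg] at this
  rw [IX, IY, ← this, integral_Iic_eq_integral_Iio]
  apply setIntegral_congr_fun measurableSet_Iio
  intro η _
  by_cases hE : (-η, p.2) ∈ E <;> simp [indicator, antidiag, hE]

theorem StripBdd.add (hf : StripBdd E f) (hg : StripBdd E g) :
    StripBdd E (fun p => f p + g p) := fun m => by
  obtain ⟨B, hB⟩ := hf m
  obtain ⟨D, hD⟩ := hg m
  exact ⟨B + D, fun p hp hm => (abs_add_le _ _).trans (add_le_add (hB p hp hm) (hD p hp hm))⟩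

theorem StripBdd.mul (hf : StripBdd E f) (hg : StripBdd E g) :
    StripBdd E (fun p => f p * g p) := fun m => by
  obtain ⟨B, hB⟩ := hf m
  obtain ⟨D, hD⟩ := hg m
  refine ⟨B * D, fun p hp hm => ?_⟩
  rw [abs_mul]
  exact mul_le_mul (hB p hp hm) (hD p hp hm) (abs_nonneg _) ((abs_nonneg _).trans (hB p hp hm))

theorem StripBdd.const (c : ℝ) : StripBdd E (fun _ => c) := fun _ => ⟨|c|, fun _ _ _ => le_rfl⟩

theorem StripBdd.of_bdd {B : ℝ} (h : ∀ p, |f p| ≤ B) : StripBdd E f :=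
  fun _ => ⟨B, fun p _ _ => h p⟩

/-- The integrand of `IY` is supported on a bounded interval. -/
theorem IsRegion.abs_indicator_le (h : IsRegion E C) {B m : ℝ} (hB0 : 0 ≤ B)
    (hB : ∀ p ∈ E, p.2 - p.1 ≤ m → |f p| ≤ B) {X Y : ℝ} (hm : Y - X ≤ m) {η : ℝ} (hη : η < Y) :
    ‖E.indicator f (X, η)‖ ≤ (Icc (X - C) Y).indicator (fun _ => B) η := by
  by_cases hE : (X, η) ∈ E
  · have := h.le hE
    rw [indicator_of_mem hE, indicator_of_mem (show η ∈ Icc (X - C) Y from ⟨by linarith, hη.le⟩)]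
    exact hB _ hE (by simp; linarith)
  · rw [indicator_of_notMem hE, norm_zero]
    exact indicator_nonneg (fun _ _ => hB0) _

theorem measurable_slice (h : IsRegion E C) (hf : Measurable f) (X : ℝ) :
    Measurable fun η => E.indicator f (X, η) :=
  (hf.indicator h.meas).comp measurable_prodMk_left

theorem StripBdd.nonneg (hb : StripBdd E f) (m : ℝ) :
    ∃ B, 0 ≤ B ∧ ∀ p ∈ E, p.2 - p.1 ≤ m → |f p| ≤ B := by
  obtain ⟨B, hB⟩ := hb m
  exact ⟨max B 0, le_max_right _ _, fun p hp hm => (hB p hp hm).trans (le_max_left _ _)⟩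

theorem IsRegion.integrableOn (h : IsRegion E C) (hf : Measurable f) (hb : StripBdd E f)
    (X Y : ℝ) : IntegrableOn (fun η => E.indicator f (X, η)) (Iio Y) := by
  obtain ⟨B, hB0, hB⟩ := hb.nonneg (Y - X)
  refine Integrable.mono' (g := (Icc (X - C) Y).indicator (fun _ => B)) ?_
    (measurable_slice h hf X).aestronglyMeasurable ?_
  · exact (((integrable_indicator_iff measurableSet_Icc).2
      (integrableOn_const (by simp) (by simp))).integrableOn)
  · rw [ae_restrict_iff' measurableSet_Iio]
    exact ae_of_all _ fun η hη => h.abs_indicator_le hB0 hB le_rfl hη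

theorem IsRegion.abs_IY_le (h : IsRegion E C) {B m : ℝ} (hB0 : 0 ≤ B)
    (hB : ∀ p ∈ E, p.2 - p.1 ≤ m → |f p| ≤ B) {p : ℝ × ℝ} (hm : p.2 - p.1 ≤ m) :
    |IY E f p| ≤ B * max (p.2 - p.1 + C) 0 := by
  have hi : Integrable ((Icc (p.1 - C) p.2).indicator (fun _ => B)) :=
    (integrable_indicator_iff measurableSet_Icc).2 (integrableOn_const (by simp) (by simp))
  have h1 : ‖IY E f p‖ ≤ ∫ η in Iio p.2, (Icc (p.1 - C) p.2).indicator (fun _ => B) η := by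
    apply norm_integral_le_of_norm_le hi.integrableOn
    rw [ae_restrict_iff' measurableSet_Iio]
    exact ae_of_all _ fun η hη => h.abs_indicator_le hB0 hB hm hη
  refine h1.trans ?_
  refine (setIntegral_le_integral hi (ae_of_all _ fun η =>
    indicator_nonneg (fun _ _ => hB0) _)).trans ?_
  rw [integral_indicator measurableSet_Icc]
  simp only [integral_const, MeasurableSet.univ, measureReal_restrict_apply, univ_inter,
    Real.volume_real_Icc, smul_eq_mul]
  rw [mul_comm, show p.2 - (p.1 - C) = p.2 - p.1 + C by ring]

/-- In the norm with weight `exp (-l (Y - X))` the operator `IY` is of size `1 / l`. -/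
theorem abs_IY_le_exp {B l : ℝ} (hl : 0 < l) (hB0 : 0 ≤ B) (p : ℝ × ℝ)
    (hB : ∀ η < p.2, (p.1, η) ∈ E → |f (p.1, η)| ≤ B * Real.exp (l * (η - p.1))) :
    |IY E f p| ≤ B / l * Real.exp (l * (p.2 - p.1)) := by
  have e : ∀ η, B * Real.exp (l * (η - p.1)) = B * Real.exp (-(l * p.1)) * Real.exp (l * η) := by
    intro η
    rw [mul_assoc, ← Real.exp_add]; congr 2; ring
  have hi : IntegrableOn (fun η => B * Real.exp (l * (η - p.1))) (Iio p.2) := by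
    simp_rw [e]
    exact ((integrableOn_exp_mul_Iic hl p.2).mono_set Iio_subset_Iic_self).const_mul _
  have h1 : ‖IY E f p‖ ≤ ∫ η in Iio p.2, B * Real.exp (l * (η - p.1)) := by
    apply norm_integral_le_of_norm_le hi
    rw [ae_restrict_iff' measurableSet_Iio]
    refine ae_of_all _ fun η hη => ?_
    by_cases hE : (p.1, η) ∈ E
    · rw [indicator_of_mem hE]; exact hB η hη hE
    · rw [indicator_of_notMem hE, norm_zero]; positivity
  refine h1.trans (le_of_eq ?_)
  simp_rw [e]
  rw [integral_const_mul, ← integral_Iic_eq_integral_Iio, integral_exp_mul_Iic hl,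
    mul_sub l, sub_eq_add_neg, Real.exp_add]
  ring

theorem IsRegion.IY_eq_zero (h : IsRegion E C) {p : ℝ × ℝ} (hp : p ∉ E) : IY E f p = 0 := by
  apply setIntegral_eq_zero_of_forall_eq_zero
  intro η hη
  apply indicator_of_notMem
  exact fun hE => hp (h.nw hE le_rfl (le_of_lt hη))

theorem IsRegion.IX_eq_zero (h : IsRegion E C) {p : ℝ × ℝ} (hp : p ∉ E) : IX E f p = 0 := by
  rw [IX_eq_IY_flip]
  exact h.flip.IY_eq_zero (by simpa using hp)

theorem IsRegion.measurable_IY (h : IsRegion E C) (hf : Measurable f) : Measurable (IY E f) := by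
  have e : IY E f = fun p => ∫ η, (if η < p.2 then E.indicator f (p.1, η) else 0) := by
    funext p
    rw [IY, ← integral_indicator measurableSet_Iio]
    rfl
  rw [e]
  have hm : Measurable (fun q : (ℝ × ℝ) × ℝ =>
      (if q.2 < q.1.2 then E.indicator f (q.1.1, q.2) else 0)) := by
    refine Measurable.ite (measurableSet_lt (by fun_prop) (by fun_prop)) ?_ measurable_const
    exact (hf.indicator h.meas).comp (by fun_prop)
  exact (hm.stronglyMeasurable.integral_prod_right (ν := volume)).measurable

theorem IsRegion.measurable_IX (h : IsRegion E C) (hf : Measurable f) : Measurable (IX E f) := by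
  rw [show IX E f = _ from funext IX_eq_IY_flip]
  exact (h.flip.measurable_IY (hf.comp measurable_antidiag)).comp measurable_antidiag

theorem IsRegion.stripBdd_IY (h : IsRegion E C) (hb : StripBdd E f) : StripBdd E (IY E f) := by
  intro m
  obtain ⟨B, hB0, hB⟩ := hb.nonneg m
  refine ⟨B * max (m + C) 0, fun p _ hm => (h.abs_IY_le hB0 hB hm).trans ?_⟩
  gcongr

theorem IsRegion.stripBdd_IX (h : IsRegion E C) (hb : StripBdd E f) : StripBdd E (IX E f) := by
  have := (h.flip.stripBdd_IY hb.flip).flip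
  rw [← preimage_comp] at this
  have e : antidiag ∘ antidiag = id := funext antidiag_antidiag
  rw [e, preimage_id] at this
  convert this using 1
  exact funext IX_eq_IY_flip

theorem IsRegion.abs_IX_le (h : IsRegion E C) {B m : ℝ} (hB0 : 0 ≤ B)
    (hB : ∀ p ∈ E, p.2 - p.1 ≤ m → |f p| ≤ B) {p : ℝ × ℝ} (hm : p.2 - p.1 ≤ m) :
    |IX E f p| ≤ B * max (p.2 - p.1 + C) 0 := by
  rw [IX_eq_IY_flip, ← antidiag_sub p]
  exact h.flip.abs_IY_le (m := m) hB0 (fun q hq hm => hB _ hq (by rwa [antidiag_sub]))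
    (by rwa [antidiag_sub])

theorem abs_IX_le_exp {B l : ℝ} (hl : 0 < l) (hB0 : 0 ≤ B) (p : ℝ × ℝ)
    (hB : ∀ ξ > p.1, (ξ, p.2) ∈ E → |f (ξ, p.2)| ≤ B * Real.exp (l * (p.2 - ξ))) :
    |IX E f p| ≤ B / l * Real.exp (l * (p.2 - p.1)) := by
  rw [IX_eq_IY_flip, ← antidiag_sub p]
  refine abs_IY_le_exp hl hB0 _ fun η hη hE => ?_
  have := hB (-η) (by simp [antidiag] at hη; linarith) (by simpa [antidiag] using hE)
  simpa [antidiag, add_comm, sub_eq_add_neg] using this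

theorem IsRegion.IY_sub (h : IsRegion E C) (hf : Measurable f) (hg : Measurable g)
    (hfb : StripBdd E f) (hgb : StripBdd E g) (p : ℝ × ℝ) :
    IY E (fun q => f q - g q) p = IY E f p - IY E g p := by
  rw [IY, IY, IY, ← integral_sub (h.integrableOn hf hfb _ _) (h.integrableOn hg hgb _ _)]
  congr 1; funext η
  by_cases hE : (p.1, η) ∈ E <;> simp [hE]

theorem IsRegion.IX_sub (h : IsRegion E C) (hf : Measurable f) (hg : Measurable g)
    (hfb : StripBdd E f) (hgb : StripBdd E g) (p : ℝ × ℝ) :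
    IX E (fun q => f q - g q) p = IX E f p - IX E g p := by
  simp_rw [IX_eq_IY_flip]
  exact h.flip.IY_sub (hf.comp measurable_antidiag) (hg.comp measurable_antidiag) hfb.flip
    hgb.flip _

theorem IsRegion.IY_add (h : IsRegion E C) (hf : Measurable f) (hg : Measurable g)
    (hfb : StripBdd E f) (hgb : StripBdd E g) (p : ℝ × ℝ) :
    IY E (fun q => f q + g q) p = IY E f p + IY E g p := by
  rw [IY, IY, IY, ← integral_add (h.integrableOn hf hfb _ _) (h.integrableOn hg hgb _ _)]
  congr 1; funext η
  by_cases hE : (p.1, η) ∈ E <;> simp [hE]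

theorem IsRegion.IX_add (h : IsRegion E C) (hf : Measurable f) (hg : Measurable g)
    (hfb : StripBdd E f) (hgb : StripBdd E g) (p : ℝ × ℝ) :
    IX E (fun q => f q + g q) p = IX E f p + IX E g p := by
  simp_rw [IX_eq_IY_flip]
  exact h.flip.IY_add (hf.comp measurable_antidiag) (hg.comp measurable_antidiag) hfb.flip
    hgb.flip _

theorem IY_const_mul (c : ℝ) (p : ℝ × ℝ) : IY E (fun q => c * f q) p = c * IY E f p := by
  rw [IY, IY, ← integral_const_mul]
  congr 1; funext η
  by_cases hE : (p.1, η) ∈ E <;> simp [hE]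

theorem IX_const_mul (c : ℝ) (p : ℝ × ℝ) : IX E (fun q => c * f q) p = c * IX E f p := by
  simp_rw [IX_eq_IY_flip]
  exact IY_const_mul c _

theorem IY_nonneg (hf : ∀ p ∈ E, 0 ≤ f p) (p : ℝ × ℝ) : 0 ≤ IY E f p :=
  integral_nonneg fun _ => indicator_nonneg (fun q hq => hf q hq) _

theorem IX_nonneg (hf : ∀ p ∈ E, 0 ≤ f p) (p : ℝ × ℝ) : 0 ≤ IX E f p :=
  integral_nonneg fun _ => indicator_nonneg (fun q hq => hf q hq) _

/-- Both sides are the double integral over the characteristic triangle with vertex `p`. -/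
theorem IsRegion.IY_IX (h : IsRegion E C) (hf : Measurable f) (hb : StripBdd E f) (p : ℝ × ℝ) :
    IY E (IX E f) p = IX E (IY E f) p := by
  obtain ⟨X, Y⟩ := p
  have e1 : IY E (IX E f) (X, Y) = ∫ η in Iio Y, ∫ ξ in Ioi X, E.indicator f (ξ, η) := by
    apply setIntegral_congr_fun measurableSet_Iio
    intro η _
    by_cases hE : (X, η) ∈ E
    · simp only [indicator_of_mem hE]; rfl
    · simp only [indicator_of_notMem hE]; exact (h.IX_eq_zero hE).symm
  have e2 : IX E (IY E f) (X, Y) = ∫ ξ in Ioi X, ∫ η in Iio Y, E.indicator f (ξ, η) := by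
    apply setIntegral_congr_fun measurableSet_Ioi
    intro ξ _
    by_cases hE : (ξ, Y) ∈ E
    · simp only [indicator_of_mem hE]; rfl
    · simp only [indicator_of_notMem hE]; exact (h.IY_eq_zero hE).symm
  rw [e1, e2]
  apply integral_integral_swap
  obtain ⟨B, hB0, hB⟩ := hb.nonneg (Y - X)
  rw [Measure.prod_restrict]
  refine Integrable.mono' (g := (Icc (X - C) Y ×ˢ Icc X (Y + C)).indicator (fun _ => B)) ?_ ?_ ?_
  · refine ((integrable_indicator_iff (measurableSet_Icc.prod measurableSet_Icc)).2
      (integrableOn_const ?_ (by simp))).integrableOn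
    exact (isCompact_Icc.prod isCompact_Icc).measure_lt_top.ne
  · exact ((hf.indicator h.meas).comp measurable_swap).aestronglyMeasurable
  · rw [ae_restrict_iff' (measurableSet_Iio.prod measurableSet_Ioi)]
    refine ae_of_all _ ?_
    rintro ⟨η, ξ⟩ ⟨h1, h2⟩
    simp only [mem_Iio, mem_Ioi] at h1 h2
    by_cases hE : (ξ, η) ∈ E
    · have := h.le hE
      rw [indicator_of_mem (show (η, ξ) ∈ Icc (X - C) Y ×ˢ Icc X (Y + C) from
        ⟨⟨by simp; linarith, h1.le⟩, ⟨h2.le, by simp; linarith⟩⟩)]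
      simp only [Function.uncurry_apply_pair, indicator_of_mem hE]
      exact hB _ hE (by simp; linarith)
    · simp only [Function.uncurry_apply_pair, indicator_of_notMem hE, norm_zero]
      exact indicator_nonneg (fun _ _ => hB0) _

/-- On a vertical line the operator `IY` is an indefinite integral. -/
theorem IsRegion.IY_eq_intervalIntegral (h : IsRegion E C) (X Y : ℝ) {a : ℝ}
    (haC : a ≤ X - C) (ha : a ≤ Y) :
    IY E f (X, Y) = ∫ η in a..Y, E.indicator f (X, η) := by
  rw [intervalIntegral.integral_of_le ha, integral_Ioc_eq_integral_Ioo, IY, ← Ioi_inter_Iio]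
  have hz : ∀ η ∈ Iio Y \ (Ioi a ∩ Iio Y), E.indicator f (X, η) = 0 ∨ η = a := by
    rintro η ⟨h1, h2⟩
    by_cases hE : (X, η) ∈ E
    · have h3 : ¬ a < η := fun h' => h2 ⟨h', h1⟩
      have := h.le hE
      right; linarith
    · left; exact indicator_of_notMem hE _
  apply setIntegral_eq_of_subset_of_ae_sdiff_eq_zero measurableSet_Iio.nullMeasurableSet
    inter_subset_right
  have : ∀ᵐ η : ℝ, η ≠ a := by simp [ae_iff]
  filter_upwards [this] with η h1 h2
  exact (hz η h2).resolve_right h1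

/-- The product rule for functions given by the operator `IY`. -/
theorem IsRegion.IY_mul (h : IsRegion E C) {F G : ℝ × ℝ → ℝ} (hF : Measurable F)
    (hG : Measurable G) (hFb : StripBdd E F) (hGb : StripBdd E G) {f0 g0 : ℝ → ℝ}
    (hf : ∀ p, f p = f0 p.1 + IY E F p) (hg : ∀ p, g p = g0 p.1 + IY E G p)
    (p : ℝ × ℝ) : f p * g p = f0 p.1 * g0 p.1 + IY E (fun q => F q * g q + f q * G q) p := by
  obtain ⟨X, Y⟩ := p
  set a := min (X - C) Y with ha
  have haC : a ≤ X - C := min_le_left _ _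
  have haY : a ≤ Y := min_le_right _ _
  have hii : ∀ {F : ℝ × ℝ → ℝ}, Measurable F → StripBdd E F →
      IntervalIntegrable (fun η => E.indicator F (X, η)) volume a Y := by
    intro F hF hFb
    rw [intervalIntegrable_iff_integrableOn_Ioo_of_le haY]
    exact (h.integrableOn hF hFb X Y).mono_set Ioo_subset_Iio_self
  have z : ∀ F : ℝ × ℝ → ℝ, IY E F (X, a) = 0 := by
    intro F
    rw [h.IY_eq_intervalIntegral X a haC le_rfl, intervalIntegral.integral_same]
  have fa : f (X, a) = f0 X := by rw [hf, z, add_zero]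
  have ga : g (X, a) = g0 X := by rw [hg, z, add_zero]
  have key := mul_sub_mul_eq_integral (f := fun y => f (X, y)) (g := fun y => g (X, y)) haY
    (hii hF hFb) (hii hG hGb)
    (fun y hy => by
      show f (X, y) = f (X, a) + _
      rw [fa, hf, h.IY_eq_intervalIntegral X y haC hy.1])
    (fun y hy => by
      show g (X, y) = g (X, a) + _
      rw [ga, hg, h.IY_eq_intervalIntegral X y haC hy.1])
  have e0 := h.IY_eq_intervalIntegral (f := fun q => F q * g q + f q * G q) X Y haC haY
  rw [e0]
  rw [fa, ga] at key
  have e : (fun t => E.indicator F (X, t) * g (X, t) + f (X, t) * E.indicator G (X, t)) =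
      fun η => E.indicator (fun q => F q * g q + f q * G q) (X, η) := by
    funext t
    by_cases hE : (X, t) ∈ E <;> simp [hE]
  rw [e] at key
  simp only
  linarith

theorem IsRegion.IX_mul (h : IsRegion E C) {F G : ℝ × ℝ → ℝ} (hF : Measurable F)
    (hG : Measurable G) (hFb : StripBdd E F) (hGb : StripBdd E G) {f0 g0 : ℝ → ℝ}
    (hf : ∀ p, f p = f0 p.2 + IX E F p) (hg : ∀ p, g p = g0 p.2 + IX E G p)
    (p : ℝ × ℝ) : f p * g p = f0 p.2 * g0 p.2 + IX E (fun q => F q * g q + f q * G q) p := by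
  have := h.flip.IY_mul (hF.comp measurable_antidiag) (hG.comp measurable_antidiag) hFb.flip
    hGb.flip
    (f := f ∘ antidiag) (g := g ∘ antidiag) (f0 := fun x => f0 (-x)) (g0 := fun x => g0 (-x))
    (fun q => by rw [Function.comp_apply, hf, IX_eq_IY_flip, antidiag_antidiag]; rfl)
    (fun q => by rw [Function.comp_apply, hg, IX_eq_IY_flip, antidiag_antidiag]; rfl)
    (antidiag p)
  rw [IX_eq_IY_flip]
  simp only [Function.comp_apply, antidiag_antidiag] at this
  rw [this]
  simp [antidiag]
  rfl

/-- Grönwall's inequality for the operator `IY`. -/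
theorem IsRegion.le_mul_exp_IY (h : IsRegion E C) {F k : ℝ × ℝ → ℝ} (hF : Measurable F)
    (hFb : StripBdd E F) (hk : Measurable k) (hkb : StripBdd E k) {f0 : ℝ → ℝ}
    (hf : ∀ p, f p = f0 p.1 + IY E F p) {p : ℝ × ℝ}
    (hle : ∀ η ≤ p.2, (p.1, η) ∈ E → F (p.1, η) ≤ k (p.1, η) * f (p.1, η)) :
    f p ≤ f0 p.1 * Real.exp (IY E k p) := by
  obtain ⟨X, Y⟩ := p
  set a := min (X - C) Y with ha
  have haC : a ≤ X - C := min_le_left _ _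
  have haY : a ≤ Y := min_le_right _ _
  have hii : ∀ {F : ℝ × ℝ → ℝ}, Measurable F → StripBdd E F →
      IntervalIntegrable (fun η => E.indicator F (X, η)) volume a Y := by
    intro F hF hFb
    rw [intervalIntegrable_iff_integrableOn_Ioo_of_le haY]
    exact (h.integrableOn hF hFb X Y).mono_set Ioo_subset_Iio_self
  have fa : f (X, a) = f0 X := by
    rw [hf, h.IY_eq_intervalIntegral X a haC le_rfl, intervalIntegral.integral_same,
      add_zero]
  obtain ⟨B, hB0, hB⟩ := hkb.nonneg (Y - X)
  -- The coefficient is cut off above `Y`, where no bound is available.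
  set k1 : ℝ → ℝ := (Iic Y).indicator fun η => E.indicator k (X, η)
  have hk1 : ∀ x, |k1 x| ≤ B := by
    intro x
    by_cases hx : x ≤ Y
    · by_cases hE : (X, x) ∈ E
      · simp only [k1, indicator_of_mem (show x ∈ Iic Y from hx), indicator_of_mem hE]
        exact hB _ hE (by simpa using hx)
      · simp only [k1, indicator_of_mem (show x ∈ Iic Y from hx), indicator_of_notMem hE,
          abs_zero, hB0]
    · simp only [k1, indicator_of_notMem (show x ∉ Iic Y from hx), abs_zero, hB0]
  have hk1e : ∀ x ∈ uIcc a Y, k1 x = E.indicator k (X, x) := by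
    intro x hx
    rw [uIcc_of_le haY] at hx
    exact indicator_of_mem (show x ∈ Iic Y from hx.2) _
  have hi1 : IntervalIntegrable k1 volume a Y :=
    (hii hk hkb).congr (fun x hx => (hk1e x (uIoc_subset_uIcc hx)).symm)
  have key := le_mul_exp_of_integral (f := fun y => f (X, y)) haY (hii hF hFb)
    hi1 hk1
    (fun y hy => by
      show f (X, y) = f (X, a) + _
      rw [fa, hf, h.IY_eq_intervalIntegral X y haC hy.1])
    (fun y hy => by
      rw [hk1e y (by rwa [uIcc_of_le haY])]
      by_cases hE : (X, y) ∈ E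
      · simp only [indicator_of_mem hE]; exact hle y hy.2 hE
      · simp [hE])
  rw [intervalIntegral.integral_congr hk1e, ← h.IY_eq_intervalIntegral X Y haC haY, fa]
    at key
  exact key

theorem IsRegion.le_mul_exp_IX (h : IsRegion E C) {F k : ℝ × ℝ → ℝ} (hF : Measurable F)
    (hFb : StripBdd E F) (hk : Measurable k) (hkb : StripBdd E k) {f0 : ℝ → ℝ}
    (hf : ∀ p, f p = f0 p.2 + IX E F p) {p : ℝ × ℝ}
    (hle : ∀ ξ ≥ p.1, (ξ, p.2) ∈ E → F (ξ, p.2) ≤ k (ξ, p.2) * f (ξ, p.2)) :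
    f p ≤ f0 p.2 * Real.exp (IX E k p) := by
  have := h.flip.le_mul_exp_IY (hF.comp measurable_antidiag) hFb.flip (hk.comp measurable_antidiag)
    hkb.flip (f := f ∘ antidiag) (f0 := fun x => f0 (-x)) (p := antidiag p)
    (fun q => by rw [Function.comp_apply, hf, IX_eq_IY_flip, antidiag_antidiag]; rfl)
    (fun η hη hE => by
      have := hle (-η) (by simp [antidiag] at hη; linarith) (by simpa [antidiag] using hE)
      simpa [antidiag] using this)
  rw [IX_eq_IY_flip]
  simpa [antidiag] using this

end volterra

/-! ### Picard iteration -/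

/-- The integral operators of the five equations of the spinor system. -/
noncomputable def volterra (E : Set (ℝ × ℝ)) (i : Fin 5) (f : ℝ × ℝ → ℝ) : ℝ × ℝ → ℝ :=
  ![IY E f, IY E f, fun p => -IX E f p, fun p => -IX E f p,
    fun p => -(√2 * IX E (IY E f) p)] i

section

variable {E : Set (ℝ × ℝ)} {C : ℝ} {f g : ℝ × ℝ → ℝ}

theorem IsRegion.measurable_volterra (h : IsRegion E C) (i : Fin 5) (hf : Measurable f) :
    Measurable (volterra E i f) := by
  fin_cases i
  · exact h.measurable_IY hf
  · exact h.measurable_IY hf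
  · exact (h.measurable_IX hf).neg
  · exact (h.measurable_IX hf).neg
  · exact ((h.measurable_IX (h.measurable_IY hf)).const_mul _).neg

theorem StripBdd.neg (hf : StripBdd E f) : StripBdd E (fun p => -f p) := fun m => by
  obtain ⟨B, hB⟩ := hf m
  exact ⟨B, fun p hp hm => by rw [abs_neg]; exact hB p hp hm⟩

theorem StripBdd.const_mul (c : ℝ) (hf : StripBdd E f) : StripBdd E (fun p => c * f p) :=
  (StripBdd.const c).mul hf

theorem IsRegion.stripBdd_volterra (h : IsRegion E C) (i : Fin 5) (hb : StripBdd E f) :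
    StripBdd E (volterra E i f) := by
  fin_cases i
  · exact h.stripBdd_IY hb
  · exact h.stripBdd_IY hb
  · exact (h.stripBdd_IX hb).neg
  · exact (h.stripBdd_IX hb).neg
  · exact ((h.stripBdd_IX (h.stripBdd_IY hb)).const_mul _).neg

theorem IsRegion.volterra_sub (h : IsRegion E C) (i : Fin 5) (hf : Measurable f)
    (hg : Measurable g) (hfb : StripBdd E f) (hgb : StripBdd E g) (p : ℝ × ℝ) :
    volterra E i (fun q => f q - g q) p = volterra E i f p - volterra E i g p := by
  have h1 := h.IY_sub hf hg hfb hgb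
  have h2 := h.IX_sub hf hg hfb hgb p
  have h3 := h.IX_sub (h.measurable_IY hf) (h.measurable_IY hg) (h.stripBdd_IY hfb)
    (h.stripBdd_IY hgb) p
  fin_cases i
  · exact h1 p
  · exact h1 p
  · show -IX E _ p = -IX E _ p - -IX E _ p
    rw [h2]; ring
  · show -IX E _ p = -IX E _ p - -IX E _ p
    rw [h2]; ring
  · show -(√2 * IX E (IY E _) p) = -(√2 * IX E _ p) - -(√2 * IX E _ p)
    rw [show IY E (fun q => f q - g q) = fun q => IY E f q - IY E g q from funext h1, h3]; ring

theorem IsRegion.volterra_eq_zero (h : IsRegion E C) (i : Fin 5) {p : ℝ × ℝ} (hp : p ∉ E) :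
    volterra E i f p = 0 := by
  have h1 := h.IY_eq_zero (f := f) hp
  have h2 := h.IX_eq_zero (f := f) hp
  have h3 := h.IX_eq_zero (f := IY E f) hp
  fin_cases i
  · exact h1
  · exact h1
  · show -IX E f p = 0
    rw [h2, neg_zero]
  · show -IX E f p = 0
    rw [h2, neg_zero]
  · show -(√2 * IX E (IY E f) p) = 0
    rw [h3, mul_zero, neg_zero]

theorem abs_volterra_le_exp (i : Fin 5) {B l : ℝ} (hl : 1 ≤ l) (hB0 : 0 ≤ B) (p : ℝ × ℝ)
    (hB : ∀ q ∈ E, p.1 ≤ q.1 → q.2 ≤ p.2 → |f q| ≤ B * Real.exp (l * (q.2 - q.1))) :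
    |volterra E i f p| ≤ 2 * B / l * Real.exp (l * (p.2 - p.1)) := by
  have hl0 : 0 < l := by linarith
  have h1 : |IY E f p| ≤ B / l * Real.exp (l * (p.2 - p.1)) :=
    abs_IY_le_exp hl0 hB0 p fun η hη hE => hB _ hE le_rfl hη.le
  have h2 : |IX E f p| ≤ B / l * Real.exp (l * (p.2 - p.1)) :=
    abs_IX_le_exp hl0 hB0 p fun ξ hξ hE => hB _ hE hξ.le le_rfl
  have h3 : |IX E (IY E f) p| ≤ B / l / l * Real.exp (l * (p.2 - p.1)) :=
    abs_IX_le_exp hl0 (by positivity) p fun ξ hξ hE =>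
      abs_IY_le_exp hl0 hB0 (ξ, p.2) fun η hη hE => hB _ hE hξ.le hη.le
  have e : 0 ≤ B / l * Real.exp (l * (p.2 - p.1)) := by positivity
  have h4 : 2 * B / l * Real.exp (l * (p.2 - p.1)) = 2 * (B / l * Real.exp (l * (p.2 - p.1))) := by
    ring
  have h5 : B / l / l * Real.exp (l * (p.2 - p.1)) ≤ B / l * Real.exp (l * (p.2 - p.1)) := by
    gcongr
    exact div_le_self (by positivity) hl
  have hs : √2 ≤ 2 := by
    rw [Real.sqrt_le_left (by norm_num)]; norm_num
  rw [h4]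
  fin_cases i
  · show |IY E f p| ≤ _
    linarith
  · show |IY E f p| ≤ _
    linarith
  · show |-IX E f p| ≤ _
    rw [abs_neg]; linarith
  · show |-IX E f p| ≤ _
    rw [abs_neg]; linarith
  · show |-(√2 * IX E (IY E f) p)| ≤ _
    rw [abs_neg, abs_mul, abs_of_nonneg (Real.sqrt_nonneg _)]
    exact mul_le_mul hs (h3.trans h5) (abs_nonneg _) (by norm_num)

/-- Global solvability of the integral equations with a bounded, globally Lipschitz right-hand
side, by Picard iteration in a norm with exponential weight. -/
theorem exists_picard (h : IsRegion E C) {G : (Fin 5 → ℝ) → Fin 5 → ℝ} {L : ℝ≥0}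
    (hG : LipschitzWith L G) {K : ℝ} (hK : ∀ v i, |G v i| ≤ K) {v0 : ℝ × ℝ → Fin 5 → ℝ}
    (hv0 : ∀ i, Measurable fun p => v0 p i) :
    ∃ v : ℝ × ℝ → Fin 5 → ℝ, (∀ i, Measurable fun p => v p i) ∧
      ∀ p i, v p i = v0 p i + volterra E i (fun q => G (v q) i) p := by
  set l : ℝ := 4 * L + 1 with hldef
  have hL0 : (0 : ℝ) ≤ L := L.2
  have hl : 1 ≤ l := by linarith
  have hl0 : 0 < l := by linarith
  have hK0 : 0 ≤ K := (abs_nonneg _).trans (hK 0 0)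
  set ω : ℝ × ℝ → ℝ := fun p => Real.exp (l * (p.2 - p.1))
  have hωpos : ∀ p, 0 < ω p := fun p => Real.exp_pos _
  have hω : ∀ p ∈ E, 1 ≤ Real.exp (l * C) * ω p := by
    rintro ⟨X, Y⟩ hp
    rw [← Real.exp_add]
    apply Real.one_le_exp
    have := h.le hp
    have : 0 ≤ l * (C + (Y - X)) := by apply mul_nonneg hl0.le; linarith
    simp only; linarith
  let v : ℕ → ℝ × ℝ → Fin 5 → ℝ := fun n => Nat.rec v0
    (fun _ u p i => v0 p i + volterra E i (fun q => G (u q) i) p) n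
  have hvs : ∀ n p i, v (n + 1) p i = v0 p i + volterra E i (fun q => G (v n q) i) p :=
    fun n p i => rfl
  have hGm : ∀ {u : ℝ × ℝ → Fin 5 → ℝ}, (∀ i, Measurable fun p => u p i) → ∀ i,
      Measurable fun p => G (u p) i := by
    intro u hu i
    exact (measurable_pi_apply i).comp (hG.continuous.measurable.comp (measurable_pi_iff.2 hu))
  have hGb : ∀ (u : ℝ × ℝ → Fin 5 → ℝ) i, StripBdd E fun p => G (u p) i := fun u i =>
    StripBdd.of_bdd fun p => hK _ _
  have hvm : ∀ n i, Measurable fun p => v n p i := by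
    intro n
    induction n with
    | zero => exact hv0
    | succ n ih => exact fun i => (hv0 i).add (h.measurable_volterra i (hGm ih i))
  have hGL : ∀ (u u' : ℝ × ℝ → Fin 5 → ℝ) q i, |G (u q) i - G (u' q) i| ≤ L * ‖u q - u' q‖ := by
    intro u u' q i
    have h1 := hG.dist_le_mul (u q) (u' q)
    rw [dist_eq_norm, dist_eq_norm] at h1
    exact (norm_le_pi_norm (G (u q) - G (u' q)) i).trans h1
  set D : ℝ := 2 * (K * Real.exp (l * C)) / l
  have hD0 : 0 ≤ D := by positivity
  have step : ∀ n p, ‖v n p - v (n + 1) p‖ ≤ D * ω p * (1 / 2) ^ n := by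
    intro n
    induction n with
    | zero =>
      intro p
      rw [pow_zero, mul_one, pi_norm_le_iff_of_nonneg (by positivity)]
      intro i
      have : v 0 p i - v (0 + 1) p i = -volterra E i (fun q => G (v 0 q) i) p := by
        rw [hvs]; show v0 p i - _ = _; ring
      rw [Pi.sub_apply, this, norm_neg]
      refine abs_volterra_le_exp i hl (by positivity) p fun q hq _ _ => (hK _ _).trans ?_
      have := mul_le_mul_of_nonneg_left (hω q hq) hK0
      simp only [ω] at this; linarith
    | succ n ih =>
      intro p
      rw [pi_norm_le_iff_of_nonneg (by positivity)]
      intro i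
      have e : v (n + 1) p i - v (n + 1 + 1) p i =
          volterra E i (fun q => G (v n q) i - G (v (n + 1) q) i) p := by
        rw [hvs n, hvs (n + 1), h.volterra_sub i (hGm (hvm n) i) (hGm (hvm (n + 1)) i) (hGb _ _) (hGb _ _)]
        ring
      rw [Pi.sub_apply, e]
      have := abs_volterra_le_exp (E := E) (f := fun q => G (v n q) i - G (v (n + 1) q) i)
        (B := L * (D * (1 / 2) ^ n)) i hl (by positivity) p fun q _ _ _ =>
        (hGL (v n) (v (n + 1)) q i).trans (by
          have := mul_le_mul_of_nonneg_left (ih q) hL0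
          simp only [ω] at this; linarith)
      refine this.trans ?_
      have e2 : 2 * (L * (D * (1 / 2) ^ n)) / l * Real.exp (l * (p.2 - p.1)) =
        (4 * L / l) * (D * ω p * (1 / 2) ^ (n + 1)) := by rw [pow_succ]; simp only [ω]; ring
      rw [e2]
      have : 4 * L / l ≤ 1 := by rw [div_le_one hl0]; linarith
      exact mul_le_of_le_one_left (by positivity) this
  have hcs : ∀ p, ∃ x, Tendsto (fun n => v n p) atTop (𝓝 x) := fun p =>
    cauchySeq_tendsto_of_complete (cauchySeq_of_le_geometric (1 / 2) (D * ω p) (by norm_num)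
      fun n => by rw [dist_eq_norm]; exact step n p)
  choose u hu using hcs
  have hum : ∀ i, Measurable fun p => u p i := fun i =>
    measurable_of_tendsto_metrizable (fun n => hvm n i)
      (tendsto_pi_nhds.2 fun p => (tendsto_pi_nhds.1 (hu p)) i)
  have hdist : ∀ n p, ‖v n p - u p‖ ≤ D * ω p * (1 / 2) ^ n / (1 - 1 / 2) := fun n p => by
    rw [← dist_eq_norm]
    exact dist_le_of_le_geometric_of_tendsto (1 / 2) (D * ω p) (by norm_num)
      (fun n => by rw [dist_eq_norm]; exact step n p) (hu p) n
  refine ⟨u, hum, fun p i => ?_⟩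
  have l1 : Tendsto (fun n => v (n + 1) p i) atTop (𝓝 (u p i)) :=
    ((tendsto_pi_nhds.1 (hu p)) i).comp (tendsto_add_atTop_nat 1)
  refine tendsto_nhds_unique l1 ?_
  simp_rw [hvs]
  apply Tendsto.const_add
  rw [tendsto_iff_norm_sub_tendsto_zero]
  have l2 : Tendsto (fun n : ℕ => 2 * (L * (D * 2)) / l * ω p * (1 / 2) ^ n) atTop (𝓝 0) := by
    have := (tendsto_pow_atTop_nhds_zero_of_lt_one (r := (1 / 2 : ℝ)) (by norm_num)
      (by norm_num)).const_mul (2 * (L * (D * 2)) / l * ω p)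
    rwa [mul_zero] at this
  refine squeeze_zero (fun _ => norm_nonneg _) (fun n => ?_) l2
  rw [← h.volterra_sub i (hGm (hvm n) i) (hGm hum i) (hGb _ _) (hGb _ _)]
  have := abs_volterra_le_exp (E := E) (f := fun q => G (v n q) i - G (u q) i)
    (B := L * (D * (1 / 2) ^ n * 2)) i hl (by positivity) p fun q _ _ _ =>
    (hGL (v n) u q i).trans (by
      have := mul_le_mul_of_nonneg_left (hdist n q) hL0
      simp only [ω] at this
      refine this.trans (le_of_eq (by ring)))
  refine this.trans (le_of_eq ?_)
  simp only [ω]; ring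

/-! ### The spinor system -/

/-- The right-hand side of the spinor system: with `v = (α, β, γ, δ, w)` and `s = γ β + δ α` it is
`(k s γ, k s δ, k s α, k s β, k s²)`. -/
def spin (k : ℝ) (v : Fin 5 → ℝ) : Fin 5 → ℝ :=
  ![k * (v 2 * v 1 + v 3 * v 0) * v 2, k * (v 2 * v 1 + v 3 * v 0) * v 3,
    k * (v 2 * v 1 + v 3 * v 0) * v 0, k * (v 2 * v 1 + v 3 * v 0) * v 1,
    k * (v 2 * v 1 + v 3 * v 0) ^ 2]

/-- The quantity `k s (α γ + β δ)`, half of the common mixed derivative of `x + J`. -/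
def cross (k : ℝ) (v : Fin 5 → ℝ) : ℝ :=
  k * (v 2 * v 1 + v 3 * v 0) * (v 0 * v 2 + v 1 * v 3)

/-- Solutions of the spinor system with coefficient `k` in the region `E`, with data `v0` on the
boundary of `E`. -/
structure SpinSol (E : Set (ℝ × ℝ)) (k : ℝ × ℝ → ℝ) (v0 v : ℝ × ℝ → Fin 5 → ℝ) : Prop where
  meas_k : Measurable k
  bdd_k : StripBdd E k
  meas : ∀ i, Measurable fun p => v p i
  bdd : ∀ i, StripBdd E fun p => v p i
  eq : ∀ p i, v p i = v0 p i + volterra E i (fun q => spin (k q) (v q) i) p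

namespace SpinSol

variable {k : ℝ × ℝ → ℝ} {v0 v : ℝ × ℝ → Fin 5 → ℝ}

theorem meas_s (hv : SpinSol E k v0 v) :
    Measurable fun p => k p * (v p 2 * v p 1 + v p 3 * v p 0) := by
  exact hv.meas_k.mul (((hv.meas 2).mul (hv.meas 1)).add ((hv.meas 3).mul (hv.meas 0)))

theorem bdd_s (hv : SpinSol E k v0 v) :
    StripBdd E fun p => k p * (v p 2 * v p 1 + v p 3 * v p 0) :=
  hv.bdd_k.mul (((hv.bdd 2).mul (hv.bdd 1)).add ((hv.bdd 3).mul (hv.bdd 0)))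

theorem meas_spin (hv : SpinSol E k v0 v) (i : Fin 5) :
    Measurable fun p => spin (k p) (v p) i := by
  have h0 := hv.meas_s
  fin_cases i
  · exact h0.mul (hv.meas 2)
  · exact h0.mul (hv.meas 3)
  · exact h0.mul (hv.meas 0)
  · exact h0.mul (hv.meas 1)
  · exact hv.meas_k.mul ((((hv.meas 2).mul (hv.meas 1)).add
      ((hv.meas 3).mul (hv.meas 0))).pow_const 2)

theorem bdd_spin (hv : SpinSol E k v0 v) (i : Fin 5) :
    StripBdd E fun p => spin (k p) (v p) i := by
  have h0 := hv.bdd_s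
  fin_cases i
  · exact h0.mul (hv.bdd 2)
  · exact h0.mul (hv.bdd 3)
  · exact h0.mul (hv.bdd 0)
  · exact h0.mul (hv.bdd 1)
  · have := hv.bdd_k.mul ((((hv.bdd 2).mul (hv.bdd 1)).add ((hv.bdd 3).mul (hv.bdd 0))).mul
      (((hv.bdd 2).mul (hv.bdd 1)).add ((hv.bdd 3).mul (hv.bdd 0))))
    refine (show (fun p => spin (k p) (v p) 4) = _ from ?_) ▸ this
    funext p; simp only [spin, Matrix.cons_val]; ring

variable {α₀ β₀ γ₀ δ₀ : ℝ → ℝ} {w₀ : ℝ × ℝ → ℝ}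

/-- The density `α² + β²` of `x + J` in `X` is an indefinite integral in `Y`. -/
theorem density_fst (h : IsRegion E C)
    (hv : SpinSol E k (fun p => ![α₀ p.1, β₀ p.1, γ₀ p.2, δ₀ p.2, w₀ p]) v) (p : ℝ × ℝ) :
    v p 0 ^ 2 + v p 1 ^ 2 = (α₀ p.1 ^ 2 + β₀ p.1 ^ 2) +
      IY E (fun q => 2 * cross (k q) (v q)) p := by
  have h0 := h.IY_mul (hv.meas_spin 0) (hv.meas_spin 0) (hv.bdd_spin 0) (hv.bdd_spin 0)
    (f0 := α₀) (g0 := α₀) (fun p => hv.eq p 0) (fun p => hv.eq p 0) p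
  have h1 := h.IY_mul (hv.meas_spin 1) (hv.meas_spin 1) (hv.bdd_spin 1) (hv.bdd_spin 1)
    (f0 := β₀) (g0 := β₀) (fun p => hv.eq p 1) (fun p => hv.eq p 1) p
  have e : (fun q => 2 * cross (k q) (v q)) = fun q =>
      (spin (k q) (v q) 0 * v q 0 + v q 0 * spin (k q) (v q) 0) +
      (spin (k q) (v q) 1 * v q 1 + v q 1 * spin (k q) (v q) 1) := by
    funext q; simp only [spin, cross, Matrix.cons_val]; ring
  rw [e, h.IY_add]
  · rw [sq, sq, h0, h1]; ring
  · exact ((hv.meas_spin 0).mul (hv.meas 0)).add ((hv.meas 0).mul (hv.meas_spin 0))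
  · exact ((hv.meas_spin 1).mul (hv.meas 1)).add ((hv.meas 1).mul (hv.meas_spin 1))
  · exact ((hv.bdd_spin 0).mul (hv.bdd 0)).add ((hv.bdd 0).mul (hv.bdd_spin 0))
  · exact ((hv.bdd_spin 1).mul (hv.bdd 1)).add ((hv.bdd 1).mul (hv.bdd_spin 1))

theorem eq_IX (hv : SpinSol E k v0 v) (p : ℝ × ℝ) :
    v p 2 = v0 p 2 + IX E (fun q => (-1) * spin (k q) (v q) 2) p ∧
    v p 3 = v0 p 3 + IX E (fun q => (-1) * spin (k q) (v q) 3) p := by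
  rw [IX_const_mul, IX_const_mul]
  refine ⟨(hv.eq p 2).trans ?_, (hv.eq p 3).trans ?_⟩
  · show _ + -IX E _ p = _; ring
  · show _ + -IX E _ p = _; ring

/-- The density `γ² + δ²` of `x + J` in `Y` is an indefinite integral in `X`, with the opposite
integrand: this makes `x + J` a potential, and its flux out of a triangle vanishes. -/
theorem density_snd (h : IsRegion E C)
    (hv : SpinSol E k (fun p => ![α₀ p.1, β₀ p.1, γ₀ p.2, δ₀ p.2, w₀ p]) v) (p : ℝ × ℝ) :
    v p 2 ^ 2 + v p 3 ^ 2 = (γ₀ p.2 ^ 2 + δ₀ p.2 ^ 2) +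
      IX E (fun q => -2 * cross (k q) (v q)) p := by
  have m2 := (hv.meas_spin 2).const_mul (-1)
  have m3 := (hv.meas_spin 3).const_mul (-1)
  have b2 := (hv.bdd_spin 2).const_mul (-1)
  have b3 := (hv.bdd_spin 3).const_mul (-1)
  have h0 := h.IX_mul m2 m2 b2 b2 (f0 := γ₀) (g0 := γ₀) (fun p => (hv.eq_IX p).1)
    (fun p => (hv.eq_IX p).1) p
  have h1 := h.IX_mul m3 m3 b3 b3 (f0 := δ₀) (g0 := δ₀) (fun p => (hv.eq_IX p).2)
    (fun p => (hv.eq_IX p).2) p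
  have e : (fun q => -2 * cross (k q) (v q)) = fun q =>
      ((-1) * spin (k q) (v q) 2 * v q 2 + v q 2 * ((-1) * spin (k q) (v q) 2)) +
      ((-1) * spin (k q) (v q) 3 * v q 3 + v q 3 * ((-1) * spin (k q) (v q) 3)) := by
    funext q; simp only [spin, cross, Matrix.cons_val]; ring
  rw [e, h.IX_add]
  · rw [sq, sq, h0, h1]; ring
  · exact (m2.mul (hv.meas 2)).add ((hv.meas 2).mul m2)
  · exact (m3.mul (hv.meas 3)).add ((hv.meas 3).mul m3)
  · exact (b2.mul (hv.bdd 2)).add ((hv.bdd 2).mul b2)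
  · exact (b3.mul (hv.bdd 3)).add ((hv.bdd 3).mul b3)

/-- The product `γ δ` is `w_Y / √2`; its derivative in `X` is the last component of `spin`. -/
theorem prod_snd (h : IsRegion E C)
    (hv : SpinSol E k (fun p => ![α₀ p.1, β₀ p.1, γ₀ p.2, δ₀ p.2, w₀ p]) v) (p : ℝ × ℝ) :
    v p 2 * v p 3 = γ₀ p.2 * δ₀ p.2 + IX E (fun q => (-1) * spin (k q) (v q) 4) p := by
  have m2 := (hv.meas_spin 2).const_mul (-1)
  have m3 := (hv.meas_spin 3).const_mul (-1)
  have b2 := (hv.bdd_spin 2).const_mul (-1)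
  have b3 := (hv.bdd_spin 3).const_mul (-1)
  have h0 := h.IX_mul m2 m3 b2 b3 (f0 := γ₀) (g0 := δ₀) (fun p => (hv.eq_IX p).1)
    (fun p => (hv.eq_IX p).2) p
  rw [h0]
  congr 2
  funext q; simp only [spin, Matrix.cons_val]; ring

end SpinSol

end

/-! ### A priori estimates and stability -/

section

variable {E : Set (ℝ × ℝ)} {C : ℝ} {f g : ℝ × ℝ → ℝ}

theorem IsRegion.abs_IY_le_IY (h : IsRegion E C) (hg : Measurable g) (hgb : StripBdd E g)
    (hfg : ∀ p ∈ E, |f p| ≤ g p) (p : ℝ × ℝ) : |IY E f p| ≤ IY E g p := by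
  rw [← Real.norm_eq_abs, IY, IY]
  refine norm_integral_le_of_norm_le (h.integrableOn hg hgb _ _) ?_
  refine ae_of_all _ fun η => ?_
  by_cases hE : (p.1, η) ∈ E
  · simp only [indicator_of_mem hE]; exact hfg _ hE
  · simp [hE]

theorem IsRegion.IX_sub_le (h : IsRegion E C) (hg : Measurable g) (hgb : StripBdd E g) {B m : ℝ}
    (hB0 : 0 ≤ B) (hB : ∀ p ∈ E, p.2 - p.1 ≤ m → |g p| ≤ B) {X X' Y : ℝ} (hX : X ≤ X')
    (hm : Y - X ≤ m) : |IX E g (X, Y) - IX E g (X', Y)| ≤ B * (X' - X) := by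
  have hi : IntegrableOn (fun ξ => E.indicator g (ξ, Y)) (Ioi X) := by
    have := h.flip.integrableOn (hg.comp measurable_antidiag) hgb.flip (-Y) (-X)
    have := (this.comp_neg)
    simp only [neg_Iio, neg_neg] at this
    refine this.congr_fun (fun ξ _ => ?_) measurableSet_Ioi
    by_cases hE : (ξ, Y) ∈ E <;> simp [indicator, antidiag, hE]
  have e : IX E g (X, Y) - IX E g (X', Y) = ∫ ξ in Ioc X X', E.indicator g (ξ, Y) := by
    rw [IX, IX, ← Ioc_union_Ioi_eq_Ioi hX, setIntegral_union
      (by rw [Set.disjoint_left]; intro x h1 h2; exact absurd h1.2 (not_le.2 h2)) measurableSet_Ioi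
      (hi.mono_set Ioc_subset_Ioi_self) (hi.mono_set (Ioi_subset_Ioi hX))]
    ring
  rw [e]
  have := norm_setIntegral_le_of_norm_le_const (μ := volume) (s := Ioc X X') (C := B)
    (f := fun ξ => E.indicator g (ξ, Y)) (by simp) (fun ξ hξ => by
      by_cases hE : (ξ, Y) ∈ E
      · rw [indicator_of_mem hE]; exact hB _ hE (by simp only; linarith [hξ.1])
      · rw [indicator_of_notMem hE, norm_zero]; exact hB0)
  rwa [Real.volume_real_Ioc_of_le hX] at this

theorem IsRegion.IY_sub_le (h : IsRegion E C) (hg : Measurable g) (hgb : StripBdd E g) {B m : ℝ}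
    (hB0 : 0 ≤ B) (hB : ∀ p ∈ E, p.2 - p.1 ≤ m → |g p| ≤ B) {X Y Y' : ℝ} (hY : Y ≤ Y')
    (hm : Y' - X ≤ m) : |IY E g (X, Y') - IY E g (X, Y)| ≤ B * (Y' - Y) := by
  have hi := h.integrableOn hg hgb X Y'
  have e : IY E g (X, Y') - IY E g (X, Y) = ∫ η in Ico Y Y', E.indicator g (X, η) := by
    rw [IY, IY, ← Iio_union_Ico_eq_Iio hY, setIntegral_union
      (by rw [Set.disjoint_left]; intro x h1 h2; exact absurd h1 (not_lt.2 h2.1)) measurableSet_Ico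
      (hi.mono_set (Iio_subset_Iio hY)) (hi.mono_set Ico_subset_Iio_self)]
    ring
  rw [e]
  have := norm_setIntegral_le_of_norm_le_const (μ := volume) (s := Ico Y Y') (C := B)
    (f := fun ξ => E.indicator g (X, ξ)) (by simp) (fun ξ hξ => by
      by_cases hE : (X, ξ) ∈ E
      · rw [indicator_of_mem hE]; exact hB _ hE (by simp only; linarith [hξ.2])
      · rw [indicator_of_notMem hE, norm_zero]; exact hB0)
  rwa [Real.volume_real_Ico_of_le hY] at this

/-- The double integral is Lipschitz near `p₀`, with a constant that depends only on the bound for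
`f`; this is the equicontinuity needed for the component `w`. -/
theorem IsRegion.abs_IX_IY_sub_le (h : IsRegion E C) (hf : Measurable f) (hb : StripBdd E f)
    {B : ℝ} (hB0 : 0 ≤ B) {p₀ q r : ℝ × ℝ}
    (hB : ∀ p ∈ E, p.2 - p.1 ≤ p₀.2 - p₀.1 + 2 → |f p| ≤ B)
    (hq : q ∈ Metric.ball p₀ 1) (hr : r ∈ Metric.ball p₀ 1) :
    |IX E (IY E f) q - IX E (IY E f) r| ≤
      2 * (B * max (p₀.2 - p₀.1 + 2 + C) 0) * dist q r := by
  set m := p₀.2 - p₀.1 + 2 with hm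
  have hcon : ∀ a b : ℝ × ℝ, a ∈ Metric.ball p₀ 1 → b ∈ Metric.ball p₀ 1 → b.2 - a.1 ≤ m := by
    intro a b ha hb'
    rw [Metric.mem_ball, Prod.dist_eq, max_lt_iff, Real.dist_eq, Real.dist_eq] at ha hb'
    have := (abs_lt.1 ha.1).1
    have := (abs_lt.1 hb'.2).2
    linarith
  set M := B * max (m + C) 0
  have hM0 : 0 ≤ M := by positivity
  have b1 : ∀ p ∈ E, p.2 - p.1 ≤ m → |IY E f p| ≤ M := fun p _ hpm =>
    (h.abs_IY_le hB0 hB hpm).trans (by simp only [M]; gcongr)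
  have b2 : ∀ p ∈ E, p.2 - p.1 ≤ m → |IX E f p| ≤ M := fun p _ hpm =>
    (h.abs_IX_le hB0 hB hpm).trans (by simp only [M]; gcongr)
  have d1 : dist q.1 r.1 ≤ dist q r := le_max_left _ _
  have d2 : dist q.2 r.2 ≤ dist q r := le_max_right _ _
  have s1 : |IX E (IY E f) q - IX E (IY E f) (r.1, q.2)| ≤ M * dist q r := by
    refine le_trans ?_ (mul_le_mul_of_nonneg_left d1 hM0)
    rw [Real.dist_eq]
    rcases le_total q.1 r.1 with hle | hle
    · rw [abs_sub_comm q.1, abs_of_nonneg (sub_nonneg.2 hle)]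
      exact h.IX_sub_le (h.measurable_IY hf) (h.stripBdd_IY hb) hM0 b1 hle (hcon q q hq hq)
    · rw [abs_sub_comm, abs_of_nonneg (sub_nonneg.2 hle)]
      exact h.IX_sub_le (h.measurable_IY hf) (h.stripBdd_IY hb) hM0 b1 hle (hcon r q hr hq)
  have s2 : |IX E (IY E f) (r.1, q.2) - IX E (IY E f) r| ≤ M * dist q r := by
    refine le_trans ?_ (mul_le_mul_of_nonneg_left d2 hM0)
    rw [Real.dist_eq, ← h.IY_IX hf hb, ← h.IY_IX hf hb]
    rcases le_total q.2 r.2 with hle | hle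
    · rw [abs_sub_comm, abs_sub_comm q.2, abs_of_nonneg (sub_nonneg.2 hle)]
      exact h.IY_sub_le (h.measurable_IX hf) (h.stripBdd_IX hb) hM0 b2 hle (hcon r r hr hr)
    · rw [abs_of_nonneg (sub_nonneg.2 hle)]
      exact h.IY_sub_le (h.measurable_IX hf) (h.stripBdd_IX hb) hM0 b2 hle (hcon r q hr hq)
  have := abs_sub_le (IX E (IY E f) q) (IX E (IY E f) (r.1, q.2)) (IX E (IY E f) r)
  linarith

namespace SpinSol

variable {k : ℝ × ℝ → ℝ} {v0 v : ℝ × ℝ → Fin 5 → ℝ}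
variable {α₀ β₀ γ₀ δ₀ : ℝ → ℝ} {w₀ : ℝ × ℝ → ℝ} {D : ℝ}

theorem meas_density (hv : SpinSol E k v0 v) (i j : Fin 5) :
    Measurable fun p => v p i ^ 2 + v p j ^ 2 :=
  ((hv.meas i).pow_const 2).add ((hv.meas j).pow_const 2)

theorem bdd_density (hv : SpinSol E k v0 v) (i j : Fin 5) :
    StripBdd E fun p => v p i ^ 2 + v p j ^ 2 := by
  simp only [sq]
  exact ((hv.bdd i).mul (hv.bdd i)).add ((hv.bdd j).mul (hv.bdd j))

theorem meas_cross (hv : SpinSol E k v0 v) : Measurable fun p => cross (k p) (v p) :=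
  hv.meas_s.mul (((hv.meas 0).mul (hv.meas 2)).add ((hv.meas 1).mul (hv.meas 3)))

theorem bdd_cross (hv : SpinSol E k v0 v) : StripBdd E fun p => cross (k p) (v p) :=
  hv.bdd_s.mul (((hv.bdd 0).mul (hv.bdd 2)).add ((hv.bdd 1).mul (hv.bdd 3)))

/-- The fluxes of `x + J` through the two legs of a characteristic triangle add up to the flux
through the boundary of `E`; as both are nonnegative, each is bounded by the data alone. -/
theorem flux_le (h : IsRegion E C)
    (hv : SpinSol E k (fun p => ![α₀ p.1, β₀ p.1, γ₀ p.2, δ₀ p.2, w₀ p]) v)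
    (hα : Measurable α₀) (hβ : Measurable β₀) (hγ : Measurable γ₀) (hδ : Measurable δ₀)
    (dα : ∀ X, |α₀ X| ≤ D) (dβ : ∀ X, |β₀ X| ≤ D) (dγ : ∀ X, |γ₀ X| ≤ D) (dδ : ∀ X, |δ₀ X| ≤ D)
    (p : ℝ × ℝ) :
    IY E (fun q => v q 2 ^ 2 + v q 3 ^ 2) p ≤ 4 * D ^ 2 * max (p.2 - p.1 + C) 0 ∧
    IX E (fun q => v q 0 ^ 2 + v q 1 ^ 2) p ≤ 4 * D ^ 2 * max (p.2 - p.1 + C) 0 := by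
  have sqb : ∀ {a b : ℝ}, |a| ≤ D → |b| ≤ D → |a ^ 2 + b ^ 2| ≤ 2 * D ^ 2 := by
    intro a b ha hb
    have h1 := sq_le_sq.2 (ha.trans (le_abs_self D))
    have h2 := sq_le_sq.2 (hb.trans (le_abs_self D))
    rw [abs_of_nonneg (by positivity)]; linarith
  have m0 : Measurable fun q : ℝ × ℝ => γ₀ q.2 ^ 2 + δ₀ q.2 ^ 2 := by fun_prop
  have m1 : Measurable fun q : ℝ × ℝ => α₀ q.1 ^ 2 + β₀ q.1 ^ 2 := by fun_prop
  have b0 : ∀ q : ℝ × ℝ, |γ₀ q.2 ^ 2 + δ₀ q.2 ^ 2| ≤ 2 * D ^ 2 := fun q => sqb (dγ _) (dδ _)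
  have b1 : ∀ q : ℝ × ℝ, |α₀ q.1 ^ 2 + β₀ q.1 ^ 2| ≤ 2 * D ^ 2 := fun q => sqb (dα _) (dβ _)
  have mc := hv.meas_cross
  have bc := hv.bdd_cross
  have e1 : IY E (fun q => v q 2 ^ 2 + v q 3 ^ 2) p = IY E (fun q => γ₀ q.2 ^ 2 + δ₀ q.2 ^ 2) p +
      -2 * IY E (IX E (fun q => cross (k q) (v q))) p := by
    rw [show (fun q => v q 2 ^ 2 + v q 3 ^ 2) = fun q => (γ₀ q.2 ^ 2 + δ₀ q.2 ^ 2) +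
      -2 * IX E (fun q => cross (k q) (v q)) q from funext fun q => by
        rw [hv.density_snd h, IX_const_mul],
      h.IY_add m0 ((h.measurable_IX mc).const_mul _) (StripBdd.of_bdd b0)
      ((h.stripBdd_IX bc).const_mul _), IY_const_mul]
  have e2 : IX E (fun q => v q 0 ^ 2 + v q 1 ^ 2) p = IX E (fun q => α₀ q.1 ^ 2 + β₀ q.1 ^ 2) p +
      2 * IX E (IY E (fun q => cross (k q) (v q))) p := by
    rw [show (fun q => v q 0 ^ 2 + v q 1 ^ 2) = fun q => (α₀ q.1 ^ 2 + β₀ q.1 ^ 2) +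
      2 * IY E (fun q => cross (k q) (v q)) q from funext fun q => by
        rw [hv.density_fst h, IY_const_mul],
      h.IX_add m1 ((h.measurable_IY mc).const_mul _) (StripBdd.of_bdd b1)
      ((h.stripBdd_IY bc).const_mul _), IX_const_mul]
  rw [h.IY_IX mc bc] at e1
  have n1 : 0 ≤ IY E (fun q => v q 2 ^ 2 + v q 3 ^ 2) p := IY_nonneg (fun _ _ => by positivity) p
  have n2 : 0 ≤ IX E (fun q => v q 0 ^ 2 + v q 1 ^ 2) p := IX_nonneg (fun _ _ => by positivity) p
  have c1 := (le_abs_self _).trans (h.abs_IY_le (m := p.2 - p.1) (by positivity)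
    (fun q _ _ => b0 q) le_rfl)
  have c2 := (le_abs_self _).trans (h.abs_IX_le (m := p.2 - p.1) (by positivity)
    (fun q _ _ => b1 q) le_rfl)
  constructor <;> linarith

/-- The source of `α² + β²` is linear in `α² + β²`, with a factor whose integral is controlled by
`flux_le`. -/
theorem cross_le {k B : ℝ} (v : Fin 5 → ℝ) (hk : |k| ≤ B) :
    |2 * cross k v| ≤ 2 * B * (v 2 ^ 2 + v 3 ^ 2) * (v 0 ^ 2 + v 1 ^ 2) := by
  have h1 : |(v 2 * v 1 + v 3 * v 0) * (v 0 * v 2 + v 1 * v 3)| ≤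
      (v 2 ^ 2 + v 3 ^ 2) * (v 0 ^ 2 + v 1 ^ 2) := by
    rw [abs_le]
    constructor <;> nlinarith [sq_nonneg (v 2 * v 1 + v 3 * v 0 + (v 0 * v 2 + v 1 * v 3)),
      sq_nonneg (v 2 * v 1 + v 3 * v 0 - (v 0 * v 2 + v 1 * v 3)),
      sq_nonneg (v 2 * v 1 - v 3 * v 0), sq_nonneg (v 0 * v 2 - v 1 * v 3)]
  rw [cross, mul_assoc k, abs_mul, abs_mul, abs_two]
  have := mul_le_mul hk h1 (abs_nonneg _) ((abs_nonneg _).trans hk)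
  linarith

/-- The bound for the unknowns in a strip depends on the data and on the size of `k` there. -/
theorem density_le (h : IsRegion E C)
    (hv : SpinSol E k (fun p => ![α₀ p.1, β₀ p.1, γ₀ p.2, δ₀ p.2, w₀ p]) v)
    (hα : Measurable α₀) (hβ : Measurable β₀) (hγ : Measurable γ₀) (hδ : Measurable δ₀)
    (dα : ∀ X, |α₀ X| ≤ D) (dβ : ∀ X, |β₀ X| ≤ D) (dγ : ∀ X, |γ₀ X| ≤ D) (dδ : ∀ X, |δ₀ X| ≤ D)
    {B m : ℝ} (hB0 : 0 ≤ B) (hB : ∀ p ∈ E, p.2 - p.1 ≤ m → |k p| ≤ B) {p : ℝ × ℝ}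
    (hm : p.2 - p.1 ≤ m) :
    v p 0 ^ 2 + v p 1 ^ 2 ≤ 2 * D ^ 2 * Real.exp (2 * B * (4 * D ^ 2 * max (m + C) 0)) ∧
    v p 2 ^ 2 + v p 3 ^ 2 ≤ 2 * D ^ 2 * Real.exp (2 * B * (4 * D ^ 2 * max (m + C) 0)) := by
  have sqb : ∀ {a b : ℝ}, |a| ≤ D → |b| ≤ D → a ^ 2 + b ^ 2 ≤ 2 * D ^ 2 := by
    intro a b ha hb
    have h1 := sq_le_sq.2 (ha.trans (le_abs_self D))
    have h2 := sq_le_sq.2 (hb.trans (le_abs_self D))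
    linarith
  obtain ⟨f1, f2⟩ := hv.flux_le h hα hβ hγ hδ dα dβ dγ dδ p
  have hmx : 4 * D ^ 2 * max (p.2 - p.1 + C) 0 ≤ 4 * D ^ 2 * max (m + C) 0 := by gcongr
  constructor
  · have := h.le_mul_exp_IY (f := fun p => v p 0 ^ 2 + v p 1 ^ 2) (hv.meas_cross.const_mul 2)
      (hv.bdd_cross.const_mul 2) ((hv.meas_density 2 3).const_mul (2 * B))
      ((hv.bdd_density 2 3).const_mul (2 * B)) (f0 := fun X => α₀ X ^ 2 + β₀ X ^ 2)
      (hv.density_fst h) (p := p) fun η hη hE =>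
        (le_abs_self _).trans (cross_le _ (hB _ hE (by simp only; linarith)))
    refine this.trans ?_
    rw [IY_const_mul]
    gcongr
    · exact sqb (dα _) (dβ _)
    · exact f1.trans hmx
  · have := h.le_mul_exp_IX (f := fun p => v p 2 ^ 2 + v p 3 ^ 2) (hv.meas_cross.const_mul (-2))
      (hv.bdd_cross.const_mul (-2)) ((hv.meas_density 0 1).const_mul (2 * B))
      ((hv.bdd_density 0 1).const_mul (2 * B)) (f0 := fun X => γ₀ X ^ 2 + δ₀ X ^ 2)
      (hv.density_snd h) (p := p) fun ξ hξ hE => by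
        have := cross_le (v (ξ, p.2)) (hB (ξ, p.2) hE (by simp only; linarith))
        have := neg_abs_le (2 * cross (k (ξ, p.2)) (v (ξ, p.2)))
        linarith
    refine this.trans ?_
    rw [IX_const_mul]
    gcongr
    · exact sqb (dγ _) (dδ _)
    · exact f2.trans hmx

/-- The bound for `w` does not involve the coefficient `k`, so that it precedes the bound for `k`
when `k` is a function of `w`. -/
theorem abs_w_le (h : IsRegion E C)
    (hv : SpinSol E k (fun p => ![α₀ p.1, β₀ p.1, γ₀ p.2, δ₀ p.2, w₀ p]) v)
    (hα : Measurable α₀) (hβ : Measurable β₀) (hγ : Measurable γ₀) (hδ : Measurable δ₀)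
    (dα : ∀ X, |α₀ X| ≤ D) (dβ : ∀ X, |β₀ X| ≤ D) (dγ : ∀ X, |γ₀ X| ≤ D) (dδ : ∀ X, |δ₀ X| ≤ D)
    (p : ℝ × ℝ) : |v p 4 - w₀ p| ≤ √2 * (5 * D ^ 2 * max (p.2 - p.1 + C) 0) := by
  obtain ⟨f1, -⟩ := hv.flux_le h hα hβ hγ hδ dα dβ dγ dδ p
  have hD : 0 ≤ D := (abs_nonneg _).trans (dα 0)
  have b0 : ∀ q : ℝ × ℝ, |γ₀ q.2 * δ₀ q.2| ≤ D ^ 2 := fun q => by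
    rw [abs_mul, sq]; exact mul_le_mul (dγ _) (dδ _) (abs_nonneg _) hD
  have m0 : Measurable fun q : ℝ × ℝ => γ₀ q.2 * δ₀ q.2 := by fun_prop
  have e1 : IX E (fun q => spin (k q) (v q) 4) = fun q => γ₀ q.2 * δ₀ q.2 - v q 2 * v q 3 := by
    funext q
    have := hv.prod_snd h q
    rw [IX_const_mul] at this
    linarith
  have e2 : v p 4 - w₀ p =
      -(√2 * (IY E (fun q => γ₀ q.2 * δ₀ q.2) p - IY E (fun q => v q 2 * v q 3) p)) := by
    have h4 : v p 4 = w₀ p + -(√2 * IX E (IY E (fun q => spin (k q) (v q) 4)) p) := hv.eq p 4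
    rw [← h.IY_sub (g := fun q => v q 2 * v q 3) m0 ((hv.meas 2).mul (hv.meas 3)) (StripBdd.of_bdd b0)
      ((hv.bdd 2).mul (hv.bdd 3)), ← e1, h.IY_IX (hv.meas_spin 4) (hv.bdd_spin 4), h4]
    ring
  rw [e2, abs_neg, abs_mul, abs_of_nonneg (Real.sqrt_nonneg _)]
  gcongr
  have c1 := h.abs_IY_le (m := p.2 - p.1) (by positivity) (fun q _ _ => b0 q) (le_refl (p.2 - p.1))
  have c2 := h.abs_IY_le_IY (f := fun q => v q 2 * v q 3) (hv.meas_density 2 3)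
    (hv.bdd_density 2 3) (fun q _ => by
      rw [abs_le]; constructor <;> nlinarith [sq_nonneg (v q 2 + v q 3), sq_nonneg (v q 2 - v q 3)])
    p
  have := abs_sub (IY E (fun q => γ₀ q.2 * δ₀ q.2) p) (IY E (fun q => v q 2 * v q 3) p)
  linarith

/-- Stability of the spinor system with respect to its coefficient. The solutions need only be
comparable in the characteristic triangle with vertex `p₀`; there `spin` is Lipschitz, and the
estimate is obtained by iterating the integral equations in the weighted norm. -/
theorem exists_stability (h : IsRegion E C) (V : ℝ) (hV : 0 ≤ V) : ∃ l L : ℝ, 1 ≤ l ∧ 0 ≤ L ∧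
    (∀ (k k' : ℝ) (u u' : Fin 5 → ℝ) (i : Fin 5), |k| ≤ V → |k'| ≤ V → ‖u‖ ≤ V → ‖u'‖ ≤ V →
      |spin k u i - spin k' u' i| ≤ L * (|k - k'| + ‖u - u'‖)) ∧
    ∀ (k k' : ℝ × ℝ → ℝ) (v0 v v' : ℝ × ℝ → Fin 5 → ℝ) (p₀ : ℝ × ℝ) (ε : ℝ), 0 ≤ ε →
      SpinSol E k v0 v → SpinSol E k' v0 v' →
      (∀ q ∈ E, p₀.1 ≤ q.1 → q.2 ≤ p₀.2 → |k q| ≤ V ∧ |k' q| ≤ V ∧ ‖v q‖ ≤ V ∧ ‖v' q‖ ≤ V ∧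
        |k q - k' q| ≤ ε) →
      ∀ q : ℝ × ℝ, p₀.1 ≤ q.1 → q.2 ≤ p₀.2 →
        ‖v q - v' q‖ ≤ ε * Real.exp (l * C) * Real.exp (l * (q.2 - q.1)) := by
  have hsm : ContDiff ℝ 1 (fun z : ℝ × (Fin 5 → ℝ) => spin z.1 z.2) := by
    rw [contDiff_pi]
    intro i
    fin_cases i <;> simp only [spin] <;> simp <;> fun_prop
  obtain ⟨L, hL⟩ := hsm.contDiffOn.exists_lipschitzOnWith
    (s := Metric.closedBall (0 : ℝ × (Fin 5 → ℝ)) V) (by decide) (convex_closedBall _ _)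
    (isCompact_closedBall _ _)
  have hL0 : (0 : ℝ) ≤ L := L.2
  have hLip : ∀ (k k' : ℝ) (u u' : Fin 5 → ℝ) (i : Fin 5), |k| ≤ V → |k'| ≤ V → ‖u‖ ≤ V →
      ‖u'‖ ≤ V → |spin k u i - spin k' u' i| ≤ L * (|k - k'| + ‖u - u'‖) := by
    intro k k' u u' i hk hk' hu hu'
    have h1 := hL.dist_le_mul (k, u) (by
      rw [mem_closedBall_zero_iff, Prod.norm_def]; exact max_le hk hu) (k', u') (by
      rw [mem_closedBall_zero_iff, Prod.norm_def]; exact max_le hk' hu')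
    rw [dist_eq_norm, dist_eq_norm] at h1
    refine (norm_le_pi_norm (spin k u - spin k' u') i).trans (h1.trans ?_)
    gcongr
    rw [Prod.norm_def]
    exact max_le (le_add_of_nonneg_right (norm_nonneg _)) (le_add_of_nonneg_left (abs_nonneg _))
  set l : ℝ := 4 * L + 1 with hl
  have hl1 : 1 ≤ l := by linarith
  have hl0 : 0 < l := by linarith
  refine ⟨l, L, hl1, hL0, hLip, ?_⟩
  intro k k' v0 v v' p₀ ε hε hv hv' hb
  set e := ε * Real.exp (l * C)
  have he : 0 ≤ e := by positivity
  have hω : ∀ p ∈ E, 1 ≤ Real.exp (l * C) * Real.exp (l * (p.2 - p.1)) := by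
    rintro ⟨X, Y⟩ hp
    rw [← Real.exp_add]
    apply Real.one_le_exp
    have := h.le hp
    have : 0 ≤ l * (C + (Y - X)) := by apply mul_nonneg hl0.le; linarith
    simp only; linarith
  have hdiff : ∀ q i, v q i - v' q i =
      volterra E i (fun q => spin (k q) (v q) i - spin (k' q) (v' q) i) q := by
    intro q i
    rw [h.volterra_sub i (hv.meas_spin i) (hv'.meas_spin i) (hv.bdd_spin i) (hv'.bdd_spin i),
      hv.eq, hv'.eq]
    ring
  have key : ∀ j : ℕ, ∀ q : ℝ × ℝ, p₀.1 ≤ q.1 → q.2 ≤ p₀.2 → ‖v q - v' q‖ ≤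
      (e + 2 * V * Real.exp (l * C) * (1 / 2) ^ j) * Real.exp (l * (q.2 - q.1)) := by
    intro j
    induction j with
    | zero =>
      intro q h1 h2
      by_cases hE : q ∈ E
      · obtain ⟨-, -, a, b, -⟩ := hb q hE h1 h2
        have := norm_sub_le (v q) (v' q)
        have := mul_le_mul_of_nonneg_left (hω q hE) (show 0 ≤ 2 * V by positivity)
        have : 0 ≤ e * Real.exp (l * (q.2 - q.1)) := by positivity
        rw [pow_zero, mul_one, add_mul]
        linarith
      · have : v q - v' q = 0 := by
          funext i
          rw [Pi.sub_apply, hdiff, h.volterra_eq_zero i hE, Pi.zero_apply]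
        rw [this, norm_zero]
        positivity
    | succ j ih =>
      intro q h1 h2
      rw [pi_norm_le_iff_of_nonneg (by positivity)]
      intro i
      rw [Pi.sub_apply, hdiff]
      have := abs_volterra_le_exp (E := E)
        (f := fun q => spin (k q) (v q) i - spin (k' q) (v' q) i)
        (B := L * (2 * e + 2 * V * Real.exp (l * C) * (1 / 2) ^ j)) i hl1 (by positivity) q
        fun r hr h3 h4 => by
          obtain ⟨a, a', b, b', c⟩ := hb r hr (h1.trans h3) (h4.trans h2)
          refine (hLip _ _ _ _ i a a' b b').trans ?_
          rw [mul_assoc]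
          gcongr
          have d1 := ih r (h1.trans h3) (h4.trans h2)
          have d2 := mul_le_mul_of_nonneg_left (hω r hr) hε
          simp only [e] at d1 ⊢
          linarith
      refine this.trans ?_
      have e2 : 2 * (L * (2 * e + 2 * V * Real.exp (l * C) * (1 / 2) ^ j)) / l =
        (4 * L / l) * (e + 2 * V * Real.exp (l * C) * (1 / 2) ^ (j + 1)) := by
        rw [pow_succ]; ring
      rw [e2]
      have : 4 * L / l ≤ 1 := by rw [div_le_one hl0]; linarith
      gcongr
      exact mul_le_of_le_one_left (by positivity) this
  intro q h1 h2
  have ht : Tendsto (fun j : ℕ => (e + 2 * V * Real.exp (l * C) * (1 / 2) ^ j) *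
      Real.exp (l * (q.2 - q.1))) atTop (𝓝 ((e + 2 * V * Real.exp (l * C) * 0) *
      Real.exp (l * (q.2 - q.1)))) :=
    (((tendsto_pow_atTop_nhds_zero_of_lt_one (r := (1 / 2 : ℝ)) (by norm_num)
      (by norm_num)).const_mul _).const_add _).mul_const _
  rw [mul_zero, add_zero] at ht
  exact ge_of_tendsto' ht fun j => key j q h1 h2

end SpinSol

end

/-- Arzelà–Ascoli on the plane, for a pointwise bounded and locally uniformly Lipschitz sequence. -/
theorem exists_subseq_tendstoLocallyUniformly {u : ℕ → ℝ × ℝ → ℝ} {W K : ℝ × ℝ → ℝ}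
    (hW : ∀ n p, |u n p| ≤ W p)
    (hK : ∀ n p q r, q ∈ Metric.ball p 1 → r ∈ Metric.ball p 1 →
      |u n q - u n r| ≤ K p * dist q r) :
    ∃ φ : ℕ → ℕ, StrictMono φ ∧ ∃ u' : ℝ × ℝ → ℝ, Continuous u' ∧
      TendstoLocallyUniformly (fun n => u (φ n)) u' atTop := by
  set T : Set (ℝ × ℝ → ℝ) := {g | (∀ p, |g p| ≤ W p) ∧
    ∀ p q r, q ∈ Metric.ball p 1 → r ∈ Metric.ball p 1 → |g q - g r| ≤ K p * dist q r} with hT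
  have hcont : ∀ g ∈ T, Continuous g := by
    intro g hg
    rw [continuous_iff_continuousAt]
    intro p
    have : LipschitzOnWith (Real.toNNReal (K p)) g (Metric.ball p 1) := by
      apply LipschitzOnWith.of_dist_le_mul
      intro q hq r hr
      refine (hg.2 p q r hq hr).trans ?_
      gcongr
      exact Real.le_coe_toNNReal _
    exact this.continuousOn.continuousAt (Metric.ball_mem_nhds p one_pos)
  have hTc : IsCompact T := by
    have hcl : IsClosed T := by
      rw [hT]
      simp only [ofPred_and, ofPred_forall]
      refine IsClosed.inter (isClosed_iInter fun p => ?_) (isClosed_iInter fun p => isClosed_iInter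
        fun q => isClosed_iInter fun r => isClosed_iInter fun _ => isClosed_iInter fun _ => ?_)
      · exact isClosed_le (continuous_abs.comp (continuous_apply p)) continuous_const
      · exact isClosed_le (continuous_abs.comp ((continuous_apply q).sub (continuous_apply r)))
          continuous_const
    refine (isCompact_univ_pi (fun p => isCompact_Icc (a := -W p) (b := W p))).of_isClosed_subset
      hcl fun g hg p _ => abs_le.1 (hg.1 p)
  set S : Set C(ℝ × ℝ, ℝ) := {g | (g : ℝ × ℝ → ℝ) ∈ T}
  have hST : ContinuousMap.toFun '' S = T := by
    ext g
    constructor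
    · rintro ⟨g', hg', rfl⟩; exact hg'
    · exact fun hg => ⟨⟨g, hcont g hg⟩, hg, rfl⟩
  have hS : IsCompact S := by
    apply ArzelaAscoli.isCompact_of_equicontinuous S (by rw [hST]; exact hTc)
    intro p
    rw [Metric.equicontinuousAt_iff]
    intro ε hε
    refine ⟨min 1 (ε / (|K p| + 1)), by positivity, fun q hq g => ?_⟩
    have h1 := (lt_min_iff.1 hq).1
    have h2 := (lt_min_iff.1 hq).2
    rw [lt_div_iff₀ (by positivity)] at h2
    have h3 := g.2.2 p p q (Metric.mem_ball_self one_pos) (by rwa [Metric.mem_ball])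
    rw [Real.dist_eq]
    refine lt_of_le_of_lt h3 ?_
    rw [dist_comm p q]
    have := le_abs_self (K p)
    have := dist_nonneg (x := q) (y := p)
    nlinarith
  obtain ⟨g, hg, φ, hφ, hlim⟩ := hS.tendsto_subseq
    (x := fun n => (⟨u n, hcont _ ⟨hW n, hK n⟩⟩ : C(ℝ × ℝ, ℝ))) fun n => ⟨hW n, hK n⟩
  exact ⟨φ, hφ, g, g.continuous, ContinuousMap.tendsto_iff_tendstoLocallyUniformly.1 hlim⟩

/-! ### Existence for the spinor system -/

/-- A continuous function is a locally uniform limit of continuously differentiable ones, with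
bounds on bounded intervals that hold along the whole sequence. -/
theorem exists_smooth_approx {b : ℝ → ℝ} (hb : Continuous b) : ∃ bn : ℕ → ℝ → ℝ,
    (∀ n, ContDiff ℝ 1 (bn n)) ∧
    (∀ (n : ℕ) (x : ℝ), |x| ≤ n → |bn n x - b x| ≤ 1 / ((n : ℝ) + 1)) ∧
    ∀ W : ℝ, ∃ B, 0 ≤ B ∧ ∀ n x, |x| ≤ W → |bn n x| ≤ B := by
  have h1 : ∀ n : ℕ, ∃ p : Polynomial ℝ, ∀ x ∈ Icc (-(n : ℝ)) n,
      |p.eval x - b x| < 1 / ((n : ℝ) + 1) := fun n =>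
    exists_polynomial_near_of_continuousOn _ _ b hb.continuousOn _ (by positivity)
  choose p hp using h1
  refine ⟨fun n x => (p n).eval x, fun n => by simpa using (p n).contDiff_aeval (𝕜 := ℝ) 1, fun n x hx =>
    (hp n x (abs_le.1 hx)).le, fun W => ?_⟩
  have hbd : ∀ g : ℝ → ℝ, Continuous g → ∃ B, 0 ≤ B ∧ ∀ x, |x| ≤ W → |g x| ≤ B := by
    intro g hg
    obtain ⟨B, hB⟩ := (isCompact_Icc (a := -W) (b := W)).exists_bound_of_continuousOn hg.continuousOn
    exact ⟨max B 0, le_max_right _ _, fun x hx => (hB x (abs_le.1 hx)).trans (le_max_left _ _)⟩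
  obtain ⟨B0, hB0, hB0'⟩ := hbd b hb
  choose Bn hBn hBn' using fun n => hbd (fun x => (p n).eval x) (p n).continuous
  refine ⟨B0 + 1 + ∑ n ∈ Finset.range ⌈W⌉₊, Bn n,
    by have := Finset.sum_nonneg fun n (_ : n ∈ Finset.range ⌈W⌉₊) => hBn n
       positivity, fun n x hx => ?_⟩
  have hsum := Finset.sum_nonneg fun n (_ : n ∈ Finset.range ⌈W⌉₊) => hBn n
  by_cases hn : n < ⌈W⌉₊
  · have := Finset.single_le_sum (fun n _ => hBn n) (Finset.mem_range.2 hn)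
    have := hBn' n x hx
    linarith
  · have hW : W ≤ n := (Nat.le_ceil W).trans (by exact_mod_cast not_lt.1 hn)
    have h2 := (hp n x (abs_le.1 (hx.trans hW))).le
    have h3 : 1 / ((n : ℝ) + 1) ≤ 1 := by
      rw [div_le_one (by positivity)]; linarith [Nat.cast_nonneg (α := ℝ) n]
    have h4 := hB0' x hx
    have h5 := abs_sub_abs_le_abs_sub ((p n).eval x) (b x)
    linarith

theorem contDiff_spin_comp {κ : (Fin 5 → ℝ) → ℝ} (hκ : ContDiff ℝ 1 κ) :
    ContDiff ℝ 1 fun v => spin (κ v) v := by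
  rw [contDiff_pi]
  intro i
  fin_cases i <;> simp only [spin] <;> simp <;> fun_prop

section

variable {E : Set (ℝ × ℝ)} {C D : ℝ} {α₀ β₀ γ₀ δ₀ : ℝ → ℝ} {w₀ : ℝ × ℝ → ℝ}

/-- The spinor system with a coefficient that is cut off for large values of the unknowns. -/
theorem exists_truncated (h : IsRegion E C) {κ : (Fin 5 → ℝ) → ℝ} (hκ : ContDiff ℝ 1 κ)
    (hκs : HasCompactSupport κ) {v0 : ℝ × ℝ → Fin 5 → ℝ} (hm : ∀ i, Measurable fun p => v0 p i)
    (hb : ∀ i, StripBdd E fun p => v0 p i) : ∃ v, SpinSol E (fun p => κ (v p)) v0 v := by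
  have hG := contDiff_spin_comp hκ
  have hGs : HasCompactSupport fun v => spin (κ v) v := by
    apply hκs.mono
    intro v hv
    contrapose! hv
    rw [Function.notMem_support] at hv ⊢
    funext i
    fin_cases i <;> simp [spin, hv]
  obtain ⟨K, hK⟩ := hGs.exists_bound_of_continuous hG.continuous
  obtain ⟨K', hK'⟩ := hκs.exists_bound_of_continuous hκ.continuous
  have hKi : ∀ v i, |spin (κ v) v i| ≤ K := fun v i => (norm_le_pi_norm _ i).trans (hK v)
  obtain ⟨L, hL⟩ := ContDiff.lipschitzWith_of_hasCompactSupport hGs hG (by decide)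
  obtain ⟨v, hvm, hv⟩ := exists_picard h hL hKi hm
  refine ⟨v, hκ.continuous.measurable.comp (measurable_pi_iff.2 hvm),
    StripBdd.of_bdd fun p => hK' _, hvm, fun i => ?_, hv⟩
  rw [show (fun p => v p i) = fun p => v0 p i + volterra E i (fun q => spin (κ (v q)) (v q) i) p
    from funext fun p => hv p i]
  exact (hb i).add (h.stripBdd_volterra i (StripBdd.of_bdd fun p => hKi _ _))

theorem meas_init (hα : Measurable α₀) (hβ : Measurable β₀) (hγ : Measurable γ₀)
    (hδ : Measurable δ₀) (hw : Continuous w₀) (i : Fin 5) :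
    Measurable fun p : ℝ × ℝ => (![α₀ p.1, β₀ p.1, γ₀ p.2, δ₀ p.2, w₀ p] : Fin 5 → ℝ) i := by
  fin_cases i <;> simp <;> fun_prop

theorem bdd_init (dα : ∀ X, |α₀ X| ≤ D) (dβ : ∀ X, |β₀ X| ≤ D) (dγ : ∀ X, |γ₀ X| ≤ D)
    (dδ : ∀ X, |δ₀ X| ≤ D) (hw : StripBdd E w₀) (i : Fin 5) :
    StripBdd E fun p : ℝ × ℝ => (![α₀ p.1, β₀ p.1, γ₀ p.2, δ₀ p.2, w₀ p] : Fin 5 → ℝ) i := by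
  fin_cases i
  · exact StripBdd.of_bdd fun p => dα p.1
  · exact StripBdd.of_bdd fun p => dβ p.1
  · exact StripBdd.of_bdd fun p => dγ p.2
  · exact StripBdd.of_bdd fun p => dδ p.2
  · exact hw

/-- Existence for the spinor system with a coefficient that depends on `w` and is merely
continuous: solutions with smooth truncated coefficients are bounded in strips uniformly, their
components `w` have a locally uniform limit, and by stability the other components converge. -/
theorem exists_spinSol (h : IsRegion E C) {b : ℝ → ℝ} (hb : Continuous b)
    (hα : Measurable α₀) (hβ : Measurable β₀) (hγ : Measurable γ₀) (hδ : Measurable δ₀)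
    (dα : ∀ X, |α₀ X| ≤ D) (dβ : ∀ X, |β₀ X| ≤ D) (dγ : ∀ X, |γ₀ X| ≤ D) (dδ : ∀ X, |δ₀ X| ≤ D)
    (hw : Continuous w₀) (hwb : StripBdd E w₀) :
    ∃ v, SpinSol E (fun p => b (v p 4))
      (fun p => ![α₀ p.1, β₀ p.1, γ₀ p.2, δ₀ p.2, w₀ p]) v ∧ Continuous fun p => v p 4 := by
  have hD : 0 ≤ D := (abs_nonneg _).trans (dα 0)
  obtain ⟨bn, bnsm, bnlim, bnbd⟩ := exists_smooth_approx hb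
  let χ : ∀ n : ℕ, ContDiffBump (0 : Fin 5 → ℝ) := fun n =>
    ⟨(n : ℝ) + 1, (n : ℝ) + 2, by positivity, by linarith⟩
  let κ : ℕ → (Fin 5 → ℝ) → ℝ := fun n v => χ n v * bn n (v 4)
  have hκ : ∀ n, ContDiff ℝ 1 (κ n) := fun n =>
    (χ n).contDiff.mul ((bnsm n).comp (contDiff_apply ℝ ℝ 4))
  have hκs : ∀ n, HasCompactSupport (κ n) := fun n => (χ n).hasCompactSupport.mul_right
  set v0 : ℝ × ℝ → Fin 5 → ℝ := fun p => ![α₀ p.1, β₀ p.1, γ₀ p.2, δ₀ p.2, w₀ p] with hv0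
  have mv0 := meas_init hα hβ hγ hδ hw
  have bv0 := bdd_init dα dβ dγ dδ hwb
  choose v hv using fun n => exists_truncated h (hκ n) (hκs n) mv0 bv0
  -- Bounds in strips, uniform in `n`.
  have hbound : ∀ m, ∃ V, 0 ≤ V ∧ ∀ n, ∀ p ∈ E, p.2 - p.1 ≤ m →
      |κ n (v n p)| ≤ V ∧ ‖v n p‖ ≤ V ∧ |bn n (v n p 4)| ≤ V := by
    intro m
    obtain ⟨W0, hW00, hW0⟩ := hwb.nonneg m
    set W := W0 + √2 * (5 * D ^ 2 * max (m + C) 0) with hW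
    have hWn : 0 ≤ W := by positivity
    have hwn : ∀ n, ∀ p ∈ E, p.2 - p.1 ≤ m → |v n p 4| ≤ W := by
      intro n p hp hpm
      have h1 := (hv n).abs_w_le h hα hβ hγ hδ dα dβ dγ dδ p
      have h2 := hW0 p hp hpm
      have h3 := abs_sub_abs_le_abs_sub (v n p 4) (w₀ p)
      have h4 : √2 * (5 * D ^ 2 * max (p.2 - p.1 + C) 0) ≤ √2 * (5 * D ^ 2 * max (m + C) 0) := by
        gcongr
      linarith
    obtain ⟨B, hB0, hB⟩ := bnbd W
    have hkn : ∀ n, ∀ p ∈ E, p.2 - p.1 ≤ m → |κ n (v n p)| ≤ B := by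
      intro n p hp hpm
      simp only [κ]
      rw [abs_mul, abs_of_nonneg (χ n).nonneg]
      exact (mul_le_of_le_one_left (abs_nonneg _) (χ n).le_one).trans (hB n _ (hwn n p hp hpm))
    set P := 2 * D ^ 2 * Real.exp (2 * B * (4 * D ^ 2 * max (m + C) 0)) with hP
    have hP0 : 0 ≤ P := by positivity
    refine ⟨B + W + (P + 1), by positivity, fun n p hp hpm => ⟨?_, ?_, ?_⟩⟩
    · have := hkn n p hp hpm; linarith
    · obtain ⟨h1, h2⟩ := (hv n).density_le h hα hβ hγ hδ dα dβ dγ dδ hB0 (hkn n) hpm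
      have habs : ∀ x y : ℝ, x ^ 2 + y ^ 2 ≤ P → |x| ≤ P + 1 ∧ |y| ≤ P + 1 := by
        intro x y hxy
        constructor <;> apply abs_le_of_sq_le_sq _ (by positivity) <;> nlinarith [sq_nonneg x,
          sq_nonneg y]
      rw [pi_norm_le_iff_of_nonneg (by positivity)]
      intro i
      have := hwn n p hp hpm
      have h01 := habs _ _ h1
      have h23 := habs _ _ h2
      rw [Real.norm_eq_abs]
      fin_cases i <;> simp only [Fin.zero_eta, Fin.mk_one, Fin.reduceFinMk] <;> linarith
    · have := hB n _ (hwn n p hp hpm); linarith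
  choose V hV0 hV using hbound
  -- A subsequence along which `w` converges locally uniformly.
  have hwform : ∀ n p, v n p 4 - w₀ p =
      -(√2 * IX E (IY E (fun q => spin (κ n (v n q)) (v n q) 4)) p) := by
    intro n p
    have : v n p 4 = w₀ p + -(√2 * IX E (IY E (fun q => spin (κ n (v n q)) (v n q) 4)) p) :=
      (hv n).eq p 4
    rw [this]; ring
  have hspinbd : ∀ m, ∃ M, 0 ≤ M ∧ ∀ n, ∀ p ∈ E, p.2 - p.1 ≤ m →
      |spin (κ n (v n p)) (v n p) 4| ≤ M := by
    intro m
    refine ⟨V m * (V m * V m + V m * V m) ^ 2, by have := hV0 m; positivity, fun n p hp hpm => ?_⟩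
    obtain ⟨h1, h2, -⟩ := hV m n p hp hpm
    have h3 : ∀ i, |v n p i| ≤ V m := fun i => (norm_le_pi_norm (v n p) i).trans h2
    have h4 : |v n p 2 * v n p 1 + v n p 3 * v n p 0| ≤ V m * V m + V m * V m := by
      refine (abs_add_le _ _).trans ?_
      rw [abs_mul, abs_mul]
      exact add_le_add (mul_le_mul (h3 _) (h3 _) (abs_nonneg _) (hV0 m))
        (mul_le_mul (h3 _) (h3 _) (abs_nonneg _) (hV0 m))
    show |κ n (v n p) * (v n p 2 * v n p 1 + v n p 3 * v n p 0) ^ 2| ≤ _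
    rw [abs_mul, abs_pow]
    exact mul_le_mul h1 (pow_le_pow_left₀ (abs_nonneg _) h4 2) (by positivity) (hV0 m)
  choose M hM0 hM using hspinbd
  obtain ⟨φ, hφ, u', hu'c, hu'⟩ := exists_subseq_tendstoLocallyUniformly
    (u := fun n p => v n p 4 - w₀ p)
    (W := fun p => √2 * (5 * D ^ 2 * max (p.2 - p.1 + C) 0))
    (K := fun p => √2 * (2 * (M (p.2 - p.1 + 2) * max (p.2 - p.1 + 2 + C) 0)))
    (fun n p => (hv n).abs_w_le h hα hβ hγ hδ dα dβ dγ dδ p)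
    (fun n p q r hq hr => by
      have := h.abs_IX_IY_sub_le ((hv n).meas_spin 4) ((hv n).bdd_spin 4) (hM0 (p.2 - p.1 + 2))
        (hM (p.2 - p.1 + 2) n) hq hr
      simp only [hwform]
      rw [show -(√2 * IX E (IY E (fun q => spin (κ n (v n q)) (v n q) 4)) q) -
        -(√2 * IX E (IY E (fun q => spin (κ n (v n q)) (v n q) 4)) r) =
        -(√2 * (IX E (IY E (fun q => spin (κ n (v n q)) (v n q) 4)) q -
        IX E (IY E (fun q => spin (κ n (v n q)) (v n q) 4)) r)) by ring, abs_neg, abs_mul,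
        abs_of_nonneg (Real.sqrt_nonneg 2)]
      calc _ ≤ √2 * _ := mul_le_mul_of_nonneg_left this (Real.sqrt_nonneg _)
        _ = _ := by ring)
  set w : ℝ × ℝ → ℝ := fun p => w₀ p + u' p with hwdef
  have hwc : Continuous w := hw.add hu'c
  have hwlim : ∀ p, Tendsto (fun n => v (φ n) p 4) atTop (𝓝 (w p)) := by
    intro p
    have h1 : Tendsto (fun n => v (φ n) p 4 - w₀ p) atTop (𝓝 (u' p)) :=
      (tendstoLocallyUniformlyOn_univ.2 hu').tendsto_at (mem_univ p)
    simpa [w] using h1.const_add (w₀ p)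
  -- Uniform convergence of the coefficients on characteristic triangles.
  have hklim : ∀ p₀ : ℝ × ℝ, ∀ ε > 0, ∀ᶠ n in atTop, ∀ q ∈ E, p₀.1 ≤ q.1 → q.2 ≤ p₀.2 →
      |κ (φ n) (v (φ n) q) - b (w q)| ≤ ε := by
    intro p₀ ε hε
    set T : Set (ℝ × ℝ) := Icc p₀.1 (p₀.2 + C) ×ˢ Icc (p₀.1 - C) p₀.2 with hT
    have hTc : IsCompact T := isCompact_Icc.prod isCompact_Icc
    have hET : ∀ q ∈ E, p₀.1 ≤ q.1 → q.2 ≤ p₀.2 → q ∈ T := by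
      rintro ⟨X, Y⟩ hq h1 h2
      have := h.le hq
      simp only at h1 h2
      exact ⟨⟨h1, by simp only; linarith⟩, ⟨by simp only; linarith, h2⟩⟩
    obtain ⟨W, hW⟩ := hTc.exists_bound_of_continuousOn hwc.continuousOn
    have hbu : UniformContinuousOn b (Icc (-(W + 1)) (W + 1)) :=
      isCompact_Icc.uniformContinuousOn_of_continuous hb.continuousOn
    obtain ⟨η, hη, hηb⟩ := Metric.uniformContinuousOn_iff.1 hbu (ε / 2) (by positivity)
    have hun := (tendstoLocallyUniformlyOn_iff_tendstoUniformlyOn_of_compact hTc).1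
      (hu'.tendstoLocallyUniformlyOn (s := T))
    have e1 := Metric.tendstoUniformlyOn_iff.1 hun (min 1 η) (by positivity)
    have e2 : ∀ᶠ n : ℕ in atTop, W + 1 + V (p₀.2 - p₀.1) + 2 / ε ≤ n :=
      tendsto_natCast_atTop_atTop.eventually_ge_atTop _
    filter_upwards [e1, e2] with n h1 h2 q hqE hq1 hq2
    have hqT := hET q hqE hq1 hq2
    have hφn : (n : ℝ) ≤ φ n := by exact_mod_cast hφ.id_le n
    have hWn : 0 ≤ W := (norm_nonneg _).trans (hW q hqT)
    have hVn := hV0 (p₀.2 - p₀.1)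
    have hεn : 0 < 2 / ε := by positivity
    have d1 := h1 q hqT
    rw [Real.dist_eq, show u' q - (v (φ n) q 4 - w₀ q) = w q - v (φ n) q 4 by simp only [w]; ring,
      lt_min_iff] at d1
    have hw1 : |w q| ≤ W := hW q hqT
    have hw2 : |v (φ n) q 4| ≤ W + 1 := by
      have := abs_sub_abs_le_abs_sub (v (φ n) q 4) (w q)
      rw [abs_sub_comm] at this
      linarith [d1.1]
    obtain ⟨-, hvV, -⟩ := hV (p₀.2 - p₀.1) (φ n) q hqE (by linarith)
    have hχ : χ (φ n) (v (φ n) q) = 1 := by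
      apply (χ (φ n)).one_of_mem_closedBall
      rw [mem_closedBall_zero_iff]
      show _ ≤ (φ n : ℝ) + 1
      linarith
    have hκe : κ (φ n) (v (φ n) q) = bn (φ n) (v (φ n) q 4) := by simp only [κ, hχ, one_mul]
    rw [hκe]
    have b1 := bnlim (φ n) (v (φ n) q 4) (by linarith)
    have b2 : 1 / ((φ n : ℝ) + 1) ≤ ε / 2 := by
      rw [div_le_div_iff₀ (by positivity) (by positivity)]
      have : 2 ≤ ε * (φ n + 1) := by
        have h3 : 2 / ε ≤ φ n + 1 := by linarith
        rw [div_le_iff₀ hε] at h3; linarith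
      linarith
    have b3 := (hηb _ (abs_le.1 hw2) (w q) (abs_le.1 (hw1.trans (by linarith))) (by
      rw [Real.dist_eq, abs_sub_comm]; exact d1.2)).le
    rw [Real.dist_eq] at b3
    have := abs_sub_le (bn (φ n) (v (φ n) q 4)) (b (v (φ n) q 4)) (b (w q))
    linarith
  have hbw : ∀ m, ∀ q ∈ E, q.2 - q.1 ≤ m → |b (w q)| ≤ V m := by
    intro m q hq hqm
    have hlim : Tendsto (fun n => κ (φ n) (v (φ n) q)) atTop (𝓝 (b (w q))) := by
      rw [Metric.tendsto_nhds]
      intro ε hε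
      filter_upwards [hklim q (ε / 2) (by positivity)] with n hn
      rw [Real.dist_eq]
      have := hn q hq le_rfl le_rfl
      linarith
    exact le_of_tendsto' hlim.abs fun n => (hV m (φ n) q hq hqm).1
  -- The whole vector of unknowns is a Cauchy sequence, uniformly on characteristic triangles.
  have hcauchy : ∀ p₀ : ℝ × ℝ, ∃ A : ℝ, 0 ≤ A ∧ ∀ ε > 0, ∃ N, ∀ n ≥ N, ∀ n' ≥ N, ∀ q : ℝ × ℝ,
      p₀.1 ≤ q.1 → q.2 ≤ p₀.2 → ‖v (φ n) q - v (φ n') q‖ ≤ ε * A := by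
    intro p₀
    obtain ⟨l, L, hl, hL, -, hst⟩ := SpinSol.exists_stability h (V (p₀.2 - p₀.1)) (hV0 _)
    refine ⟨Real.exp (l * C) * Real.exp (l * (p₀.2 - p₀.1)), by positivity, fun ε hε => ?_⟩
    obtain ⟨N, hN⟩ := eventually_atTop.1 (hklim p₀ (ε / 2) (by positivity))
    refine ⟨N, fun n hn n' hn' q hq1 hq2 => ?_⟩
    have := hst _ _ _ _ _ p₀ ε hε.le (hv (φ n)) (hv (φ n')) (fun r hr h1 h2 => by
      have a := hV (p₀.2 - p₀.1) (φ n) r hr (by linarith)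
      have a' := hV (p₀.2 - p₀.1) (φ n') r hr (by linarith)
      refine ⟨a.1, a'.1, a.2.1, a'.2.1, ?_⟩
      have c1 := hN n hn r hr h1 h2
      have c2 := hN n' hn' r hr h1 h2
      rw [abs_sub_comm] at c2
      have := abs_sub_le (κ (φ n) (v (φ n) r)) (b (w r)) (κ (φ n') (v (φ n') r))
      linarith) q hq1 hq2
    refine this.trans ?_
    rw [mul_assoc]
    gcongr
  have hlim : ∀ p, ∃ x, Tendsto (fun n => v (φ n) p) atTop (𝓝 x) := by
    intro p
    obtain ⟨A, hA, hc⟩ := hcauchy p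
    apply cauchySeq_tendsto_of_complete
    rw [Metric.cauchySeq_iff']
    intro ε hε
    obtain ⟨N, hN⟩ := hc (ε / (A + 1)) (by positivity)
    refine ⟨N, fun n hn => ?_⟩
    rw [dist_eq_norm]
    refine lt_of_le_of_lt (hN n hn N le_rfl p le_rfl le_rfl) ?_
    rw [div_mul_eq_mul_div, div_lt_iff₀ (by positivity)]
    nlinarith
  choose u hu using hlim
  have hu4 : ∀ p, u p 4 = w p := fun p =>
    tendsto_nhds_unique (tendsto_pi_nhds.1 (hu p) 4) (hwlim p)
  have hum : ∀ i, Measurable fun p => u p i := fun i =>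
    measurable_of_tendsto_metrizable (fun n => (hv (φ n)).meas i)
      (tendsto_pi_nhds.2 fun p => (tendsto_pi_nhds.1 (hu p)) i)
  have huV : ∀ m, ∀ p ∈ E, p.2 - p.1 ≤ m → ‖u p‖ ≤ V m := fun m p hp hpm =>
    le_of_tendsto' (hu p).norm fun n => (hV m (φ n) p hp hpm).2.1
  have hub : ∀ i, StripBdd E fun p => u p i := fun i m =>
    ⟨V m, fun p hp hpm => (norm_le_pi_norm (u p) i).trans (huV m p hp hpm)⟩
  have hkm : Measurable fun p => b (w p) := (hb.comp hwc).measurable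
  have hkb : StripBdd E fun p => b (w p) := fun m => ⟨V m, hbw m⟩
  have hspin : ∀ i, (Measurable fun p => spin (b (w p)) (u p) i) ∧
      StripBdd E fun p => spin (b (w p)) (u p) i := by
    have m1 := ((hum 2).mul (hum 1)).add ((hum 3).mul (hum 0))
    have b1 := ((hub 2).mul (hub 1)).add ((hub 3).mul (hub 0))
    intro i
    fin_cases i
    · exact ⟨(hkm.mul m1).mul (hum 2), (hkb.mul b1).mul (hub 2)⟩
    · exact ⟨(hkm.mul m1).mul (hum 3), (hkb.mul b1).mul (hub 3)⟩
    · exact ⟨(hkm.mul m1).mul (hum 0), (hkb.mul b1).mul (hub 0)⟩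
    · exact ⟨(hkm.mul m1).mul (hum 1), (hkb.mul b1).mul (hub 1)⟩
    · refine ⟨hkm.mul (m1.pow_const 2), ?_⟩
      have := hkb.mul (b1.mul b1)
      refine (show (fun p => spin (b (w p)) (u p) 4) = _ from ?_) ▸ this
      funext p; simp only [spin, Matrix.cons_val]; ring
  have hfin : SpinSol E (fun p => b (w p)) v0 u := by
    refine ⟨hkm, hkb, hum, hub, fun p i => ?_⟩
    refine tendsto_nhds_unique (tendsto_pi_nhds.1 (hu p) i) ?_
    simp_rw [(hv (φ _)).eq p i]
    apply Tendsto.const_add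
    obtain ⟨l, L, hl, hL, hLip, -⟩ := SpinSol.exists_stability h (V (p.2 - p.1)) (hV0 _)
    obtain ⟨A, hA, hc⟩ := hcauchy p
    have hl0 : 0 < l := by linarith
    set c := 2 * (L * (1 + A) * Real.exp (l * C)) / l * Real.exp (l * (p.2 - p.1)) with hcdef
    have hc0 : 0 ≤ c := by positivity
    rw [Metric.tendsto_nhds]
    intro ε hε
    obtain ⟨N, hN⟩ := hc (ε / (c + 1)) (by positivity)
    filter_upwards [hklim p (ε / (c + 1)) (by positivity), eventually_ge_atTop N] with n hn hnN
    rw [Real.dist_eq, ← h.volterra_sub i ((hv (φ n)).meas_spin i) (hspin i).1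
      ((hv (φ n)).bdd_spin i) (hspin i).2]
    have key := abs_volterra_le_exp (E := E)
      (f := fun q => spin (κ (φ n) (v (φ n) q)) (v (φ n) q) i - spin (b (w q)) (u q) i)
      (B := L * (ε / (c + 1) * (1 + A)) * Real.exp (l * C)) i hl (by positivity) p
      fun q hq h1 h2 => by
        have hqm : q.2 - q.1 ≤ p.2 - p.1 := by linarith
        have a := hV (p.2 - p.1) (φ n) q hq hqm
        have d1 : ‖v (φ n) q - u q‖ ≤ ε / (c + 1) * A :=
          le_of_tendsto ((hu q).const_sub (v (φ n) q)).norm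
            ((eventually_ge_atTop N).mono fun n' hn' => hN n hnN n' hn' q h1 h2)
        refine (hLip _ _ _ _ i a.1 (hbw _ q hq hqm) a.2.1 (huV _ q hq hqm)).trans ?_
        rw [mul_assoc, ← Real.exp_add]
        have hexp : 1 ≤ Real.exp (l * C + l * (q.2 - q.1)) := by
          apply Real.one_le_exp
          have := h.le (X := q.1) (Y := q.2) hq
          have : 0 ≤ l * (C + (q.2 - q.1)) := by apply mul_nonneg hl0.le; linarith
          linarith
        have d2 := hn q hq h1 h2
        calc L * (|κ (φ n) (v (φ n) q) - b (w q)| + ‖v (φ n) q - u q‖)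
            ≤ L * (ε / (c + 1) * (1 + A)) := by gcongr; linarith
          _ ≤ _ := le_mul_of_one_le_right (by positivity) hexp
    refine lt_of_le_of_lt key ?_
    have e : 2 * (L * (ε / (c + 1) * (1 + A)) * Real.exp (l * C)) / l * Real.exp (l * (p.2 - p.1))
      = ε / (c + 1) * c := by rw [hcdef]; ring
    rw [e, div_mul_eq_mul_div, div_lt_iff₀ (by positivity)]
    nlinarith
  refine ⟨u, ?_, ?_⟩
  · simpa only [hu4] using hfin
  · simpa only [hu4] using hwc

end

/-! ### Solutions in the whole plane -/

/-- Boundedness on bounded subsets of the plane. -/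
def LocBdd (f : ℝ × ℝ → ℝ) : Prop :=
  ∀ M, ∃ B, ∀ p : ℝ × ℝ, |p.1| ≤ M → |p.2| ≤ M → |f p| ≤ B

namespace LocBdd

variable {f g : ℝ × ℝ → ℝ}

theorem add (hf : LocBdd f) (hg : LocBdd g) : LocBdd fun p => f p + g p := fun M => by
  obtain ⟨B, hB⟩ := hf M
  obtain ⟨B', hB'⟩ := hg M
  exact ⟨B + B', fun p h1 h2 => (abs_add_le _ _).trans (add_le_add (hB p h1 h2) (hB' p h1 h2))⟩

theorem neg (hf : LocBdd f) : LocBdd fun p => -f p := fun M => by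
  obtain ⟨B, hB⟩ := hf M
  exact ⟨B, fun p h1 h2 => by rw [abs_neg]; exact hB p h1 h2⟩

theorem sub (hf : LocBdd f) (hg : LocBdd g) : LocBdd fun p => f p - g p := by
  simpa only [sub_eq_add_neg] using hf.add hg.neg

theorem mul (hf : LocBdd f) (hg : LocBdd g) : LocBdd fun p => f p * g p := fun M => by
  obtain ⟨B, hB⟩ := hf M
  obtain ⟨B', hB'⟩ := hg M
  refine ⟨B * B', fun p h1 h2 => ?_⟩
  rw [abs_mul]
  exact mul_le_mul (hB p h1 h2) (hB' p h1 h2) (abs_nonneg _) ((abs_nonneg _).trans (hB p h1 h2))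

theorem const_mul (c : ℝ) (hf : LocBdd f) : LocBdd fun p => c * f p :=
  mul (fun _ => ⟨|c|, fun _ _ _ => le_rfl⟩) hf

theorem indicator (E : Set (ℝ × ℝ)) (hf : LocBdd f) : LocBdd (E.indicator f) := fun M => by
  obtain ⟨B, hB⟩ := hf M
  refine ⟨B, fun p h1 h2 => ?_⟩
  by_cases hp : p ∈ E
  · rw [indicator_of_mem hp]; exact hB p h1 h2
  · rw [indicator_of_notMem hp, abs_zero]; exact (abs_nonneg _).trans (hB p h1 h2)

theorem comp_continuous {φ : ℝ → ℝ} (hφ : Continuous φ) (hf : LocBdd f) :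
    LocBdd fun p => φ (f p) := fun M => by
  obtain ⟨B, hB⟩ := hf M
  obtain ⟨B', hB'⟩ :=
    (isCompact_Icc (a := -B) (b := B)).exists_bound_of_continuousOn hφ.continuousOn
  exact ⟨B', fun p h1 h2 => hB' _ (abs_le.1 (hB p h1 h2))⟩

theorem of_continuous (hf : Continuous f) : LocBdd f := fun M => by
  obtain ⟨B, hB⟩ := ((isCompact_Icc (a := -M) (b := M)).prod
    (isCompact_Icc (a := -M) (b := M))).exists_bound_of_continuousOn hf.continuousOn
  exact ⟨B, fun p h1 h2 => hB p ⟨abs_le.1 h1, abs_le.1 h2⟩⟩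

theorem comp_neg (hf : LocBdd f) : LocBdd fun p => f (-p) := fun M => by
  obtain ⟨B, hB⟩ := hf M
  exact ⟨B, fun p h1 h2 => hB _ (by simpa using h1) (by simpa using h2)⟩

theorem comp_swap (hf : LocBdd f) : LocBdd fun p => f p.swap := fun M => by
  obtain ⟨B, hB⟩ := hf M
  exact ⟨B, fun p h1 h2 => hB _ h2 h1⟩

theorem intervalIntegrable_snd (hb : LocBdd f) (hf : Measurable f) (X a b : ℝ) :
    IntervalIntegrable (fun η => f (X, η)) volume a b := by
  obtain ⟨B, hB⟩ := hb (max |X| (max |a| |b|))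
  rw [intervalIntegrable_iff]
  refine Measure.integrableOn_of_bounded (M := B) (by simp)
    (hf.comp measurable_prodMk_left).aestronglyMeasurable ?_
  rw [ae_restrict_iff' measurableSet_uIoc]
  refine ae_of_all _ fun η hη => hB (X, η) (le_max_left _ _) (le_max_of_le_right ?_)
  rw [uIoc, mem_Ioc] at hη
  refine abs_le_max_abs_abs' ?_
  exact ⟨hη.1.le, hη.2⟩
where
  abs_le_max_abs_abs' {η a b : ℝ} (h : min a b ≤ η ∧ η ≤ max a b) : |η| ≤ max |a| |b| := by
    rcases le_total a b with hab | hab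
    · rw [min_eq_left hab, max_eq_right hab] at h; exact abs_le_max_abs_abs h.1 h.2
    · rw [min_eq_right hab, max_eq_left hab] at h; rw [max_comm]; exact abs_le_max_abs_abs h.1 h.2

theorem intervalIntegrable_fst (hb : LocBdd f) (hf : Measurable f) (Y a b : ℝ) :
    IntervalIntegrable (fun ξ => f (ξ, Y)) volume a b :=
  hb.comp_swap.intervalIntegrable_snd (hf.comp measurable_swap) Y a b

end LocBdd

section

variable {E : Set (ℝ × ℝ)} {C : ℝ} {f : ℝ × ℝ → ℝ}

theorem IsRegion.IY_sub_interval (h : IsRegion E C) (hf : Measurable f) (hb : StripBdd E f)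
    (X Y Y' : ℝ) : IY E f (X, Y') - IY E f (X, Y) = ∫ η in Y..Y', E.indicator f (X, η) := by
  set a := min (X - C) (min Y Y')
  have ha : a ≤ X - C := min_le_left _ _
  have h1 : a ≤ Y := (min_le_right _ _).trans (min_le_left _ _)
  have h2 : a ≤ Y' := (min_le_right _ _).trans (min_le_right _ _)
  have hi : ∀ Z, a ≤ Z → IntervalIntegrable (fun η => E.indicator f (X, η)) volume a Z := fun Z hZ => by
    rw [intervalIntegrable_iff_integrableOn_Ico_of_le hZ]
    exact (h.integrableOn hf hb X Z).mono_set Ico_subset_Iio_self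
  rw [h.IY_eq_intervalIntegral X Y ha h1, h.IY_eq_intervalIntegral X Y' ha h2]
  exact intervalIntegral.integral_interval_sub_left (hi _ h2) (hi _ h1)

theorem IsRegion.IX_sub_interval (h : IsRegion E C) (hf : Measurable f) (hb : StripBdd E f)
    (X X' Y : ℝ) : IX E f (X', Y) - IX E f (X, Y) = -∫ ξ in X..X', E.indicator f (ξ, Y) := by
  rw [IX_eq_IY_flip, IX_eq_IY_flip]
  have := h.flip.IY_sub_interval (hf.comp measurable_antidiag) hb.flip (-Y) (-X) (-X')
  show IY _ _ (-Y, -X') - IY _ _ (-Y, -X) = _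
  rw [this, ← intervalIntegral.integral_symm, ← intervalIntegral.integral_comp_neg]
  apply intervalIntegral.integral_congr
  intro ξ _
  by_cases hE : (ξ, Y) ∈ E <;> simp [Set.indicator, antidiag, hE]

end

section spinor

variable {E : Set (ℝ × ℝ)} {C : ℝ} {b α₀ β₀ γ₀ δ₀ : ℝ → ℝ} {w₀ : ℝ × ℝ → ℝ}
  {v : ℝ × ℝ → Fin 5 → ℝ}

/-- A function that equals the data outside `E` and solves the spinor system in `E`. The equation
for `w` is stated in first-order form, `w_X = √2 α β` and `w_Y = √2 γ δ`. -/
structure HalfSol (E : Set (ℝ × ℝ)) (b α₀ β₀ γ₀ δ₀ : ℝ → ℝ) (w₀ : ℝ × ℝ → ℝ)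
    (v : ℝ × ℝ → Fin 5 → ℝ) : Prop where
  meas : ∀ i, Measurable fun p => v p i
  bdd : ∀ i, LocBdd fun p => v p i
  cont : Continuous fun p => v p 4
  off : ∀ p, p ∉ E → v p = ![α₀ p.1, β₀ p.1, γ₀ p.2, δ₀ p.2, w₀ p]
  eq_Y : ∀ X Y Y', ∀ i : Fin 5, i < 2 → v (X, Y') i - v (X, Y) i =
    ∫ η in Y..Y', E.indicator (fun q => spin (b (v q 4)) (v q) i) (X, η)
  eq_X : ∀ X X' Y, ∀ i : Fin 5, i = 2 ∨ i = 3 → v (X', Y) i - v (X, Y) i =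
    ∫ ξ in X..X', E.indicator (fun q => spin (b (v q 4)) (v q) i) (ξ, Y)
  w_Y : ∀ X Y Y', v (X, Y') 4 - v (X, Y) 4 = w₀ (X, Y') - w₀ (X, Y) +
    ∫ η in Y..Y', E.indicator (fun q => √2 * (v q 2 * v q 3 - γ₀ q.2 * δ₀ q.2)) (X, η)
  w_X : ∀ X X' Y, v (X', Y) 4 - v (X, Y) 4 = w₀ (X', Y) - w₀ (X, Y) +
    ∫ ξ in X..X', E.indicator (fun q => √2 * (v q 0 * v q 1 - α₀ q.1 * β₀ q.1)) (ξ, Y)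

/-- The product `α β` is `w_X / √2`; its derivative in `Y` is the last component of `spin`. -/
theorem SpinSol.prod_fst {k : ℝ × ℝ → ℝ} (h : IsRegion E C)
    (hv : SpinSol E k (fun p => ![α₀ p.1, β₀ p.1, γ₀ p.2, δ₀ p.2, w₀ p]) v) (p : ℝ × ℝ) :
    v p 0 * v p 1 = α₀ p.1 * β₀ p.1 + IY E (fun q => spin (k q) (v q) 4) p := by
  have h0 := h.IY_mul (hv.meas_spin 0) (hv.meas_spin 1) (hv.bdd_spin 0) (hv.bdd_spin 1)
    (f0 := α₀) (g0 := β₀) (fun p => hv.eq p 0) (fun p => hv.eq p 1) p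
  rw [h0]
  congr 2
  funext q; simp only [spin, Matrix.cons_val]; ring

theorem exists_halfSol {D : ℝ} (h : IsRegion E C) (hb : Continuous b)
    (hα : Measurable α₀) (hβ : Measurable β₀) (hγ : Measurable γ₀) (hδ : Measurable δ₀)
    (dα : ∀ X, |α₀ X| ≤ D) (dβ : ∀ X, |β₀ X| ≤ D) (dγ : ∀ X, |γ₀ X| ≤ D) (dδ : ∀ X, |δ₀ X| ≤ D)
    (hw : Continuous w₀) (hwb : StripBdd E w₀) : ∃ v, HalfSol E b α₀ β₀ γ₀ δ₀ w₀ v := by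
  obtain ⟨v, hv, hc⟩ := exists_spinSol h hb hα hβ hγ hδ dα dβ dγ dδ hw hwb
  have hoff : ∀ p, p ∉ E → v p = ![α₀ p.1, β₀ p.1, γ₀ p.2, δ₀ p.2, w₀ p] := fun p hp => by
    funext i
    rw [hv.eq p i, h.volterra_eq_zero i hp, add_zero]
  refine ⟨v, hv.meas, fun i M => ?_, hc, hoff, fun X Y Y' i hi => ?_, fun X X' Y i hi => ?_,
    fun X Y Y' => ?_, fun X X' Y => ?_⟩
  · obtain ⟨B, hB⟩ := hv.bdd i (M + M)
    obtain ⟨B', hB'⟩ := LocBdd.of_continuous hw M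
    refine ⟨max B (max D B'), fun p h1 h2 => ?_⟩
    by_cases hp : p ∈ E
    · refine (hB p hp ?_).trans (le_max_left _ _)
      linarith [abs_le.1 h1, abs_le.1 h2]
    · beta_reduce
      rw [hoff p hp]
      refine le_max_of_le_right ?_
      fin_cases i
      · exact (dα _).trans (le_max_left _ _)
      · exact (dβ _).trans (le_max_left _ _)
      · exact (dγ _).trans (le_max_left _ _)
      · exact (dδ _).trans (le_max_left _ _)
      · exact (hB' p h1 h2).trans (le_max_right _ _)
  · rw [← h.IY_sub_interval (hv.meas_spin i) (hv.bdd_spin i), hv.eq, hv.eq]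
    fin_cases i
    · simp [volterra]
    · simp [volterra]
    all_goals exact absurd hi (by decide)
  · have := h.IX_sub_interval (hv.meas_spin i) (hv.bdd_spin i) X X' Y
    rw [← neg_neg (∫ ξ in X..X', _), ← this, hv.eq, hv.eq]
    rcases hi with rfl | rfl <;> simp only [volterra, Matrix.cons_val] <;> ring
  · have hm : Measurable fun p => IX E (fun q => spin (b (v q 4)) (v q) 4) p :=
      h.measurable_IX (hv.meas_spin 4)
    have hb' : StripBdd E fun p => IX E (fun q => spin (b (v q 4)) (v q) 4) p :=
      h.stripBdd_IX (hv.bdd_spin 4)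
    have h1 : ∀ p, v p 4 = w₀ p - √2 * IY E (IX E (fun q => spin (b (v q 4)) (v q) 4)) p :=
      fun p => by
        rw [h.IY_IX (hv.meas_spin 4) (hv.bdd_spin 4), hv.eq p 4]
        simp [volterra, sub_eq_add_neg]
    rw [h1, h1, ← sub_eq_zero]
    have h2 := h.IY_sub_interval hm hb' X Y Y'
    have h3 : ∫ η in Y..Y', E.indicator (fun q => √2 * (v q 2 * v q 3 - γ₀ q.2 * δ₀ q.2)) (X, η) =
        ∫ η in Y..Y', -√2 * E.indicator (fun p => IX E (fun q => spin (b (v q 4)) (v q) 4) p) (X, η) := by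
      apply intervalIntegral.integral_congr
      intro η _
      by_cases hE : (X, η) ∈ E
      · simp only [indicator_of_mem hE]
        rw [hv.prod_snd h, IX_const_mul]; ring
      · simp only [indicator_of_notMem hE, mul_zero]
    rw [h3, intervalIntegral.integral_const_mul, ← h2]
    ring
  · have hm : Measurable fun p => IY E (fun q => spin (b (v q 4)) (v q) 4) p :=
      h.measurable_IY (hv.meas_spin 4)
    have hb' : StripBdd E fun p => IY E (fun q => spin (b (v q 4)) (v q) 4) p :=
      h.stripBdd_IY (hv.bdd_spin 4)
    have h1 : ∀ p, v p 4 = w₀ p - √2 * IX E (IY E (fun q => spin (b (v q 4)) (v q) 4)) p :=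
      fun p => by
        rw [hv.eq p 4]
        simp [volterra, sub_eq_add_neg]
    rw [h1, h1, ← sub_eq_zero]
    have h2 := h.IX_sub_interval hm hb' X X' Y
    have h3 : ∫ ξ in X..X', E.indicator (fun q => √2 * (v q 0 * v q 1 - α₀ q.1 * β₀ q.1)) (ξ, Y) =
        ∫ ξ in X..X', √2 * E.indicator (fun p => IY E (fun q => spin (b (v q 4)) (v q) 4) p) (ξ, Y) := by
      apply intervalIntegral.integral_congr
      intro ξ _
      by_cases hE : (ξ, Y) ∈ E
      · simp only [indicator_of_mem hE]
        rw [hv.prod_fst h]; ring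
      · simp only [indicator_of_notMem hE, mul_zero]
    rw [h3, intervalIntegral.integral_const_mul, ← neg_neg (∫ ξ in X..X', _), ← h2]
    ring

theorem IsRegion.reflect (h : IsRegion E C) : IsRegion {p | -p ∉ E} C where
  meas := (measurable_neg h.meas).compl
  nw := fun {X Y X' Y'} hm hX hY hE =>
    hm (h.nw (X := -X') (Y := -Y') hE (by linarith) (by linarith))
  le := fun {X Y} hm => by have := h.ge (X := -X) (Y := -Y) hm; linarith
  ge := fun {X Y} hm => by have := h.le (X := -X) (Y := -Y) (not_not.1 hm); linarith

/-- Reflection in the origin turns solutions on the reflected complement of `E` into solutions on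
the complement of `E`. The sign of `w` and of the coefficient changes. -/
theorem HalfSol.reflect (hv : HalfSol {p | -p ∉ E} (fun w => -b (-w)) (fun X => α₀ (-X))
    (fun X => β₀ (-X)) (fun Y => γ₀ (-Y)) (fun Y => δ₀ (-Y)) (fun p => -w₀ (-p)) v) :
    HalfSol Eᶜ b α₀ β₀ γ₀ δ₀ w₀
      (fun p => ![v (-p) 0, v (-p) 1, v (-p) 2, v (-p) 3, -v (-p) 4]) where
  meas i := by
    have := fun i => (hv.meas i).comp measurable_neg
    fin_cases i
    · exact this 0
    · exact this 1
    · exact this 2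
    · exact this 3
    · exact (this 4).neg
  bdd i := by
    have := fun i => (hv.bdd i).comp_neg
    fin_cases i
    · exact this 0
    · exact this 1
    · exact this 2
    · exact this 3
    · exact (this 4).neg
  cont := (hv.cont.comp continuous_neg).neg
  off p hp := by
    have hp' : p ∈ E := by simpa using hp
    rw [hv.off (-p) (by simpa using hp')]
    simp
  eq_Y X Y Y' i hi := by
    have h1 := hv.eq_Y (-X) (-Y) (-Y') i hi
    rw [intervalIntegral.integral_symm, ← intervalIntegral.integral_comp_neg,
      ← intervalIntegral.integral_neg] at h1
    have h2 : ∀ p, (![v p 0, v p 1, v p 2, v p 3, -v p 4] : Fin 5 → ℝ) i = v p i := by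
      intro p
      fin_cases i
      · rfl
      · rfl
      all_goals exact absurd hi (by decide)
    rw [h2, h2]
    refine h1.trans (intervalIntegral.integral_congr fun η _ => ?_)
    by_cases hE : (X, η) ∈ E
    · simp [indicator, hE]
    · fin_cases i
      · simp [indicator, hE, spin]
      · simp [indicator, hE, spin]
      all_goals exact absurd hi (by decide)
  eq_X X X' Y i hi := by
    have h1 := hv.eq_X (-X) (-X') (-Y) i hi
    rw [intervalIntegral.integral_symm, ← intervalIntegral.integral_comp_neg,
      ← intervalIntegral.integral_neg] at h1
    have h2 : ∀ p, (![v p 0, v p 1, v p 2, v p 3, -v p 4] : Fin 5 → ℝ) i = v p i := by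
      intro p
      rcases hi with rfl | rfl <;> rfl
    rw [h2, h2]
    refine h1.trans (intervalIntegral.integral_congr fun η _ => ?_)
    by_cases hE : (η, Y) ∈ E
    · simp [indicator, hE]
    · rcases hi with rfl | rfl <;> simp [indicator, hE, spin]
  w_Y X Y Y' := by
    have h1 := hv.w_Y (-X) (-Y) (-Y')
    rw [intervalIntegral.integral_symm, ← intervalIntegral.integral_comp_neg] at h1
    have h2 : ∫ η in Y..Y', {p | -p ∉ E}.indicator (fun q => √2 * (v q 2 * v q 3 -
          γ₀ (-q.2) * δ₀ (-q.2))) (-X, -η) =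
        ∫ η in Y..Y', Eᶜ.indicator (fun q => √2 * (v (-q) 2 * v (-q) 3 -
          γ₀ q.2 * δ₀ q.2)) (X, η) := by
      refine intervalIntegral.integral_congr fun η _ => ?_
      by_cases hE : (X, η) ∈ E <;> simp [indicator, hE]
    rw [h2] at h1
    simp only [Prod.neg_mk, neg_neg, Matrix.cons_val] at h1 ⊢
    linarith
  w_X X X' Y := by
    have h1 := hv.w_X (-X) (-X') (-Y)
    rw [intervalIntegral.integral_symm, ← intervalIntegral.integral_comp_neg] at h1
    have h2 : ∫ ξ in X..X', {p | -p ∉ E}.indicator (fun q => √2 * (v q 0 * v q 1 -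
          α₀ (-q.1) * β₀ (-q.1))) (-ξ, -Y) =
        ∫ ξ in X..X', Eᶜ.indicator (fun q => √2 * (v (-q) 0 * v (-q) 1 -
          α₀ q.1 * β₀ q.1)) (ξ, Y) := by
      refine intervalIntegral.integral_congr fun η _ => ?_
      by_cases hE : (η, Y) ∈ E <;> simp [indicator, hE]
    rw [h2] at h1
    simp only [Prod.neg_mk, neg_neg, Matrix.cons_val] at h1 ⊢
    linarith

/-- Solutions of the spinor system in the whole plane. -/
structure SpinorSol (b : ℝ → ℝ) (v : ℝ × ℝ → Fin 5 → ℝ) : Prop where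
  meas : ∀ i, Measurable fun p => v p i
  bdd : ∀ i, LocBdd fun p => v p i
  cont : Continuous fun p => v p 4
  eq_Y : ∀ X Y Y', ∀ i : Fin 5, i < 2 → v (X, Y') i - v (X, Y) i =
    ∫ η in Y..Y', spin (b (v (X, η) 4)) (v (X, η)) i
  eq_X : ∀ X X' Y, ∀ i : Fin 5, i = 2 ∨ i = 3 → v (X', Y) i - v (X, Y) i =
    ∫ ξ in X..X', spin (b (v (ξ, Y) 4)) (v (ξ, Y)) i
  w_Y : ∀ X Y Y', v (X, Y') 4 - v (X, Y) 4 = ∫ η in Y..Y', √2 * (v (X, η) 2 * v (X, η) 3)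
  w_X : ∀ X X' Y, v (X', Y) 4 - v (X, Y) 4 = ∫ ξ in X..X', √2 * (v (ξ, Y) 0 * v (ξ, Y) 1)

theorem meas_spin_of {k : ℝ × ℝ → ℝ} (hk : Measurable k) (hv : ∀ i, Measurable fun p => v p i)
    (i : Fin 5) : Measurable fun p => spin (k p) (v p) i := by
  have h := hv 0; have := hv 1; have := hv 2; have := hv 3
  fin_cases i
  all_goals
    simp only [spin]
    first
    | exact (by fun_prop : Measurable fun p => k p * (v p 2 * v p 1 + v p 3 * v p 0) * v p 2)
    | exact (by fun_prop : Measurable fun p => k p * (v p 2 * v p 1 + v p 3 * v p 0) * v p 3)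
    | exact (by fun_prop : Measurable fun p => k p * (v p 2 * v p 1 + v p 3 * v p 0) * v p 0)
    | exact (by fun_prop : Measurable fun p => k p * (v p 2 * v p 1 + v p 3 * v p 0) * v p 1)
    | exact (by fun_prop : Measurable fun p => k p * (v p 2 * v p 1 + v p 3 * v p 0) ^ 2)

theorem locBdd_spin {k : ℝ × ℝ → ℝ} (hk : LocBdd k) (hv : ∀ i, LocBdd fun p => v p i)
    (i : Fin 5) : LocBdd fun p => spin (k p) (v p) i := by
  have hs := ((hv 2).mul (hv 1)).add ((hv 3).mul (hv 0))
  fin_cases i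
  · exact (hk.mul hs).mul (hv 2)
  · exact (hk.mul hs).mul (hv 3)
  · exact (hk.mul hs).mul (hv 0)
  · exact (hk.mul hs).mul (hv 1)
  · refine (show (fun p => spin (k p) (v p) 4) = _ from ?_) ▸ hk.mul (hs.mul hs)
    funext p; simp only [spin, Matrix.cons_val]; ring


/-- Solutions on both sides of the boundary of `E` with the same data form a solution in the
plane. -/
theorem HalfSol.glue {v' : ℝ × ℝ → Fin 5 → ℝ} (hE : MeasurableSet E) (hb : Continuous b)
    (hv : HalfSol E b α₀ β₀ γ₀ δ₀ w₀ v) (hv' : HalfSol Eᶜ b α₀ β₀ γ₀ δ₀ w₀ v')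
    (hα : Measurable α₀) (hβ : Measurable β₀) (hγ : Measurable γ₀) (hδ : Measurable δ₀)
    {D : ℝ} (dα : ∀ X, |α₀ X| ≤ D) (dβ : ∀ X, |β₀ X| ≤ D) (dγ : ∀ X, |γ₀ X| ≤ D)
    (dδ : ∀ X, |δ₀ X| ≤ D)
    (hw : Continuous w₀)
    (hwX : ∀ X X' Y, w₀ (X', Y) - w₀ (X, Y) = ∫ ξ in X..X', √2 * (α₀ ξ * β₀ ξ))
    (hwY : ∀ X Y Y', w₀ (X, Y') - w₀ (X, Y) = ∫ η in Y..Y', √2 * (γ₀ η * δ₀ η)) :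
    ∃ u, SpinorSol b u ∧ (∀ p ∈ E, u p = v p) ∧ ∀ p ∉ E, u p = v' p := by
  set v0 : ℝ × ℝ → Fin 5 → ℝ := fun p => ![α₀ p.1, β₀ p.1, γ₀ p.2, δ₀ p.2, w₀ p] with hv0
  set u : ℝ × ℝ → Fin 5 → ℝ := fun p i => v p i + v' p i - v0 p i with hu
  have mv0 : ∀ i, Measurable fun p => v0 p i := meas_init hα hβ hγ hδ hw
  have bv0 : ∀ i, LocBdd fun p => v0 p i := fun i => by
    fin_cases i
    · exact fun _ => ⟨D, fun p _ _ => dα p.1⟩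
    · exact fun _ => ⟨D, fun p _ _ => dβ p.1⟩
    · exact fun _ => ⟨D, fun p _ _ => dγ p.2⟩
    · exact fun _ => ⟨D, fun p _ _ => dδ p.2⟩
    · exact LocBdd.of_continuous hw
  have u1 : ∀ p ∈ E, u p = v p := fun p hp => by
    funext i
    simp only [hu]
    rw [hv'.off p (by simpa using hp)]; ring
  have u2 : ∀ p ∉ E, u p = v' p := fun p hp => by
    funext i
    simp only [hu]
    rw [hv.off p hp]; ring
  have mu : ∀ i, Measurable fun p => u p i := fun i =>
    ((hv.meas i).add (hv'.meas i)).sub (mv0 i)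
  have bu : ∀ i, LocBdd fun p => u p i := fun i =>
    ((hv.bdd i).add (hv'.bdd i)).sub (bv0 i)
  have cu : Continuous fun p => u p 4 := (hv.cont.add hv'.cont).sub hw
  have key : ∀ G : ℝ × ℝ → (Fin 5 → ℝ) → ℝ, ∀ p,
      E.indicator (fun q => G q (v q)) p + Eᶜ.indicator (fun q => G q (v' q)) p = G p (u p) := by
    intro G p
    by_cases hp : p ∈ E
    · simp [indicator, hp, u1 p hp]
    · simp [indicator, hp, u2 p hp]
  have mk : ∀ {v : ℝ × ℝ → Fin 5 → ℝ}, (Continuous fun p => v p 4) →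
    Measurable fun p => b (v p 4) := fun h => (hb.comp h).measurable
  have ms : ∀ i, Measurable fun q => spin (b (v q 4)) (v q) i :=
    meas_spin_of (mk hv.cont) hv.meas
  have ms' : ∀ i, Measurable fun q => spin (b (v' q 4)) (v' q) i :=
    meas_spin_of (mk hv'.cont) hv'.meas
  have bs : ∀ i, LocBdd fun q => spin (b (v q 4)) (v q) i :=
    locBdd_spin ((hv.bdd 4).comp_continuous hb) hv.bdd
  have bs' : ∀ i, LocBdd fun q => spin (b (v' q 4)) (v' q) i :=
    locBdd_spin ((hv'.bdd 4).comp_continuous hb) hv'.bdd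
  refine ⟨u, ⟨mu, bu, cu, fun X Y Y' i hi => ?_, fun X X' Y i hi => ?_, fun X Y Y' => ?_,
    fun X X' Y => ?_⟩, u1, u2⟩
  · have e0 : v0 (X, Y') i = v0 (X, Y) i := by
      fin_cases i
      · rfl
      · rfl
      all_goals exact absurd hi (by decide)
    have h1 := hv.eq_Y X Y Y' i hi
    have h2 := hv'.eq_Y X Y Y' i hi
    have h3 := intervalIntegral.integral_add
      (((bs i).indicator E).intervalIntegrable_snd ((ms i).indicator hE) X Y Y')
      (((bs' i).indicator Eᶜ).intervalIntegrable_snd ((ms' i).indicator hE.compl) X Y Y')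
    rw [← h1, ← h2] at h3
    simp only [key (fun _ w => spin (b (w 4)) w i)] at h3
    rw [h3]; simp only [hu, e0]; ring
  · have e0 : v0 (X', Y) i = v0 (X, Y) i := by
      rcases hi with rfl | rfl <;> rfl
    have h1 := hv.eq_X X X' Y i hi
    have h2 := hv'.eq_X X X' Y i hi
    have h3 := intervalIntegral.integral_add
      (((bs i).indicator E).intervalIntegrable_fst ((ms i).indicator hE) Y X X')
      (((bs' i).indicator Eᶜ).intervalIntegrable_fst ((ms' i).indicator hE.compl) Y X X')
    rw [← h1, ← h2] at h3
    simp only [key (fun _ w => spin (b (w 4)) w i)] at h3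
    rw [h3]; simp only [hu, e0]; ring
  · have h1 := hv.w_Y X Y Y'
    have h2 := hv'.w_Y X Y Y'
    have m : ∀ {v : ℝ × ℝ → Fin 5 → ℝ}, (∀ i, Measurable fun p => v p i) →
        Measurable fun q => √2 * (v q 2 * v q 3 - γ₀ q.2 * δ₀ q.2) := fun hm =>
      (((hm 2).mul (hm 3)).sub ((mv0 2).mul (mv0 3))).const_mul _
    have bm : ∀ {v : ℝ × ℝ → Fin 5 → ℝ}, (∀ i, LocBdd fun p => v p i) →
        LocBdd fun q => √2 * (v q 2 * v q 3 - γ₀ q.2 * δ₀ q.2) := fun hm =>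
      (((hm 2).mul (hm 3)).sub ((bv0 2).mul (bv0 3))).const_mul _
    have h3 := intervalIntegral.integral_add
      (((bm hv.bdd).indicator E).intervalIntegrable_snd ((m hv.meas).indicator hE) X Y Y')
      (((bm hv'.bdd).indicator Eᶜ).intervalIntegrable_snd ((m hv'.meas).indicator hE.compl) X Y Y')
    simp only [key (fun q w => √2 * (w 2 * w 3 - γ₀ q.2 * δ₀ q.2))] at h3
    have h4 := intervalIntegral.integral_add ((bm bu).intervalIntegrable_snd (m mu) X Y Y')
      ((((bv0 2).mul (bv0 3)).const_mul (√2)).intervalIntegrable_snd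
        (((mv0 2).mul (mv0 3)).const_mul _) X Y Y')
    have h5 : ∀ η, √2 * (u (X, η) 2 * u (X, η) 3 - γ₀ η * δ₀ η) + √2 * (γ₀ η * δ₀ η) =
        √2 * (u (X, η) 2 * u (X, η) 3) := fun η => by ring
    simp only [hv0, Matrix.cons_val, h5] at h4
    rw [h4, h3, ← hwY X Y Y']
    simp only [hu, hv0, Matrix.cons_val]
    linarith
  · have h1 := hv.w_X X X' Y
    have h2 := hv'.w_X X X' Y
    have m : ∀ {v : ℝ × ℝ → Fin 5 → ℝ}, (∀ i, Measurable fun p => v p i) →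
        Measurable fun q => √2 * (v q 0 * v q 1 - α₀ q.1 * β₀ q.1) := fun hm =>
      (((hm 0).mul (hm 1)).sub ((mv0 0).mul (mv0 1))).const_mul _
    have bm : ∀ {v : ℝ × ℝ → Fin 5 → ℝ}, (∀ i, LocBdd fun p => v p i) →
        LocBdd fun q => √2 * (v q 0 * v q 1 - α₀ q.1 * β₀ q.1) := fun hm =>
      (((hm 0).mul (hm 1)).sub ((bv0 0).mul (bv0 1))).const_mul _
    have h3 := intervalIntegral.integral_add
      (((bm hv.bdd).indicator E).intervalIntegrable_fst ((m hv.meas).indicator hE) Y X X')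
      (((bm hv'.bdd).indicator Eᶜ).intervalIntegrable_fst ((m hv'.meas).indicator hE.compl) Y X X')
    simp only [key (fun q w => √2 * (w 0 * w 1 - α₀ q.1 * β₀ q.1))] at h3
    have h4 := intervalIntegral.integral_add ((bm bu).intervalIntegrable_fst (m mu) Y X X')
      ((((bv0 0).mul (bv0 1)).const_mul (√2)).intervalIntegrable_fst
        (((mv0 0).mul (mv0 1)).const_mul _) Y X X')
    have h5 : ∀ η, √2 * (u (η, Y) 0 * u (η, Y) 1 - α₀ η * β₀ η) + √2 * (α₀ η * β₀ η) =
        √2 * (u (η, Y) 0 * u (η, Y) 1) := fun η => by ring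
    simp only [hv0, Matrix.cons_val, h5] at h4
    rw [h4, h3, ← hwX X X' Y]
    simp only [hu, hv0, Matrix.cons_val]
    linarith

/-- Existence for the spinor system in the plane with data on the boundary of an open region. The
data are attained at the points of the boundary whose projection to the axis in question has no
other preimage. -/
theorem exists_spinorSol {D : ℝ} (h : IsRegion E C) (ho : IsOpen E) (hb : Continuous b)
    (hα : Measurable α₀) (hβ : Measurable β₀) (hγ : Measurable γ₀) (hδ : Measurable δ₀)
    (dα : ∀ X, |α₀ X| ≤ D) (dβ : ∀ X, |β₀ X| ≤ D) (dγ : ∀ X, |γ₀ X| ≤ D) (dδ : ∀ X, |δ₀ X| ≤ D)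
    (hw : Continuous w₀) (hwb : StripBdd E w₀)
    (hwb' : StripBdd {p | -p ∉ E} (fun p => -w₀ (-p)))
    (hwX : ∀ X X' Y, w₀ (X', Y) - w₀ (X, Y) = ∫ ξ in X..X', √2 * (α₀ ξ * β₀ ξ))
    (hwY : ∀ X Y Y', w₀ (X, Y') - w₀ (X, Y) = ∫ η in Y..Y', √2 * (γ₀ η * δ₀ η)) :
    ∃ v, SpinorSol b v ∧
      (∀ s, (edge E ⁻¹' {edge E s}).Subsingleton →
        v (edge E s, 2 * s - edge E s) 0 = α₀ (edge E s) ∧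
        v (edge E s, 2 * s - edge E s) 1 = β₀ (edge E s)) ∧
      (∀ s, ((fun s => 2 * s - edge E s) ⁻¹' {2 * s - edge E s}).Subsingleton →
        v (edge E s, 2 * s - edge E s) 2 = γ₀ (2 * s - edge E s) ∧
        v (edge E s, 2 * s - edge E s) 3 = δ₀ (2 * s - edge E s)) ∧
      ∀ s, v (edge E s, 2 * s - edge E s) 4 = w₀ (edge E s, 2 * s - edge E s) := by
  obtain ⟨v, hv⟩ := exists_halfSol h hb hα hβ hγ hδ dα dβ dγ dδ hw hwb
  obtain ⟨v', hv'⟩ := exists_halfSol h.reflect (b := fun w => -b (-w)) (by fun_prop)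
    (hα.comp measurable_neg) (hβ.comp measurable_neg) (hγ.comp measurable_neg)
    (hδ.comp measurable_neg) (fun X => dα (-X)) (fun X => dβ (-X)) (fun X => dγ (-X))
    (fun X => dδ (-X)) (w₀ := fun p => -w₀ (-p)) (by fun_prop) hwb'
  have hr := HalfSol.reflect (b := b) (w₀ := w₀) hv'
  set r : ℝ × ℝ → Fin 5 → ℝ := fun p => ![v' (-p) 0, v' (-p) 1, v' (-p) 2, v' (-p) 3, -v' (-p) 4]
  obtain ⟨u, hu, -, hu'⟩ := HalfSol.glue h.meas hb hv hr hα hβ hγ hδ dα dβ dγ dδ hw hwX hwY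
  have hm := h.isCurve
  set 𝒳 := edge E with h𝒳
  set 𝒴 : ℝ → ℝ := fun s => 2 * s - edge E s with h𝒴
  -- Points of the complement of `E` above or to the left of a curve point lie on the curve.
  have up : ∀ s η, 𝒴 s < η → (𝒳 s, η) ∉ E → ¬ (𝒳 ⁻¹' {𝒳 s}).Subsingleton := by
    intro s η h1 h2 h3
    have h4 : 𝒳 ((𝒳 s + η) / 2) ≤ 𝒳 s := by
      by_contra! hlt
      apply h2
      have := h.mem_of_lt_edge hlt
      convert this using 2; ring
    have h5 : s < (𝒳 s + η) / 2 := by have := hm.add_eq s; linarith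
    exact h5.ne (h3 rfl (le_antisymm h4 (hm.mono_X h5.le)))
  have left : ∀ s ξ, ξ < 𝒳 s → (ξ, 𝒴 s) ∉ E → ∃ s' < s, 𝒳 s' = ξ ∧ 𝒴 s' = 𝒴 s := by
    intro s ξ h1 h2
    have h4 : 𝒳 ((ξ + 𝒴 s) / 2) ≤ ξ := by
      by_contra! hlt
      apply h2
      have := h.mem_of_lt_edge hlt
      convert this using 2; ring
    have h5 : (ξ + 𝒴 s) / 2 < s := by have := hm.add_eq s; linarith
    have h6 := hm.add_eq ((ξ + 𝒴 s) / 2)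
    have h7 := hm.mono_Y h5.le
    refine ⟨_, h5, ?_, ?_⟩ <;> linarith
  have off : ∀ s, (𝒳 s, 𝒴 s) ∉ E := h.edge_notMem ho
  have in1 : ∀ s, (𝒳 s, 𝒳 s + |C| + 1) ∈ E := fun s => by
    by_contra hn
    have := h.ge hn
    linarith [le_abs_self C]
  have bX : ∀ s, (𝒳 ⁻¹' {𝒳 s}).Subsingleton → ∀ i : Fin 5, i < 2 →
      u (𝒳 s, 𝒴 s) i = ![α₀ (𝒳 s), β₀ (𝒳 s), γ₀ (𝒴 s), δ₀ (𝒴 s), w₀ (𝒳 s, 𝒴 s)] i := by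
    intro s hs i hi
    rw [hu' _ (off s)]
    set Y' := max (𝒴 s) (𝒳 s + |C| + 1)
    have h1 := hr.eq_Y (𝒳 s) (𝒴 s) Y' i hi
    rw [hr.off (𝒳 s, Y') (by simpa using h.nw (in1 s) le_rfl (le_max_right _ _))] at h1
    have h2 : ∫ η in (𝒴 s)..Y', Eᶜ.indicator (fun q => spin (b (r q 4)) (r q) i) (𝒳 s, η) = 0 := by
      rw [intervalIntegral.integral_of_le (le_max_left _ _)]
      apply setIntegral_eq_zero_of_forall_eq_zero
      intro η hη
      apply indicator_of_notMem
      intro hE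
      exact up s η hη.1 hE hs
    rw [h2] at h1
    have h3 : (![α₀ (𝒳 s), β₀ (𝒳 s), γ₀ Y', δ₀ Y', w₀ (𝒳 s, Y')] : Fin 5 → ℝ) i =
        ![α₀ (𝒳 s), β₀ (𝒳 s), γ₀ (𝒴 s), δ₀ (𝒴 s), w₀ (𝒳 s, 𝒴 s)] i := by
      fin_cases i
      · rfl
      · rfl
      all_goals exact absurd hi (by decide)
    linarith
  have in2 : ∀ s, (𝒴 s - |C| - 1, 𝒴 s) ∈ E := fun s => by
    by_contra hn
    have := h.ge hn
    linarith [le_abs_self C]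
  refine ⟨u, hu, fun s hs => ⟨bX s hs 0 (by decide), bX s hs 1 (by decide)⟩, fun s hs => ?_,
    fun s => ?_⟩
  · have bY : ∀ i : Fin 5, i = 2 ∨ i = 3 →
        u (𝒳 s, 𝒴 s) i = ![α₀ (𝒳 s), β₀ (𝒳 s), γ₀ (𝒴 s), δ₀ (𝒴 s), w₀ (𝒳 s, 𝒴 s)] i := by
      intro i hi
      rw [hu' _ (off s)]
      set X' := min (𝒳 s) (𝒴 s - |C| - 1)
      have h1 := hr.eq_X X' (𝒳 s) (𝒴 s) i hi
      rw [hr.off (X', 𝒴 s) (by simpa using h.nw (in2 s) (min_le_right _ _) le_rfl)] at h1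
      have h2 : ∫ ξ in X'..(𝒳 s), Eᶜ.indicator (fun q => spin (b (r q 4)) (r q) i) (ξ, 𝒴 s) = 0 := by
        rw [intervalIntegral.integral_of_le (min_le_left _ _), integral_Ioc_eq_integral_Ioo]
        apply setIntegral_eq_zero_of_forall_eq_zero
        intro ξ hξ
        apply indicator_of_notMem
        intro hE
        obtain ⟨s', h3, -, h4⟩ := left s ξ hξ.2 hE
        exact h3.ne (hs h4 rfl)
      rw [h2] at h1
      rcases hi with rfl | rfl <;> simp only [Matrix.cons_val] at h1 ⊢ <;> linarith
    exact ⟨bY 2 (by decide), bY 3 (by decide)⟩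
  · show u (𝒳 s, 𝒴 s) 4 = w₀ (𝒳 s, 𝒴 s)
    rw [hu' _ (off s)]
    set X' := min (𝒳 s) (𝒴 s - |C| - 1)
    have h1 := hr.w_X X' (𝒳 s) (𝒴 s)
    rw [hr.off (X', 𝒴 s) (by simpa using h.nw (in2 s) (min_le_right _ _) le_rfl)] at h1
    have h2 : ∫ ξ in X'..(𝒳 s), Eᶜ.indicator
        (fun q => √2 * (r q 0 * r q 1 - α₀ q.1 * β₀ q.1)) (ξ, 𝒴 s) = 0 := by
      rw [intervalIntegral.integral_of_le (min_le_left _ _), integral_Ioc_eq_integral_Ioo]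
      apply setIntegral_eq_zero_of_ae_eq_zero
      filter_upwards [ae_subsingleton_preimage hm.mono_X] with ξ h3 hξ
      by_cases hE : (ξ, 𝒴 s) ∈ E
      · exact indicator_of_notMem (by simpa using hE) _
      · obtain ⟨s', -, h4, h5⟩ := left s ξ hξ.2 hE
        have h6 : (𝒳 ⁻¹' {𝒳 s'}).Subsingleton := fun a ha a' ha' =>
          h3 a a' (ha.trans h4) (ha'.trans h4)
        have h7 := bX s' h6 0 (by decide)
        have h8 := bX s' h6 1 (by decide)
        rw [h4, h5] at h7 h8
        rw [hu' _ hE] at h7 h8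
        rw [indicator_of_mem (by simpa using hE), h7, h8]
        simp
    rw [h2] at h1
    simp only [Matrix.cons_val] at h1
    linarith

end spinor

/-! ### Indefinite integrals of locally bounded functions -/

/-- `f` is an indefinite integral of the measurable and locally bounded function `g`. -/
structure LocPrim (f g : ℝ → ℝ) : Prop where
  meas : Measurable g
  bdd : ∀ M, ∃ B, ∀ x, |x| ≤ M → |g x| ≤ B
  eq : ∀ a b, f b - f a = ∫ x in a..b, g x

namespace LocPrim

variable {f g f₁ g₁ : ℝ → ℝ}

theorem locallyIntegrable (h : LocPrim f g) : LocallyIntegrable g := by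
  rw [locallyIntegrable_iff]
  intro K hK
  obtain ⟨M, hM⟩ := hK.isBounded.exists_norm_le
  obtain ⟨B, hB⟩ := h.bdd M
  refine Measure.integrableOn_of_bounded (M := B) hK.measure_lt_top.ne
    h.meas.aestronglyMeasurable ?_
  rw [ae_restrict_iff' hK.measurableSet]
  exact ae_of_all _ fun x hx => hB x (hM x hx)

theorem intervalIntegrable (h : LocPrim f g) (a b : ℝ) : IntervalIntegrable g volume a b :=
  (h.locallyIntegrable.integrableOn_isCompact isCompact_uIcc).intervalIntegrable

theorem ae_hasDerivAt (h : LocPrim f g) : ∀ᵐ x, HasDerivAt f (g x) x := by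
  filter_upwards [LocallyIntegrable.ae_hasDerivAt_integral h.locallyIntegrable] with x hx
  have := (hx 0).const_add (f 0)
  refine this.congr_of_eventuallyEq (Eventually.of_forall fun y => ?_)
  have := h.eq 0 y
  simp only; linarith

theorem lipschitzOnWith (h : LocPrim f g) (M : ℝ) :
    ∃ L : ℝ≥0, LipschitzOnWith L f (Icc (-M) M) := by
  obtain ⟨B, hB⟩ := h.bdd M
  refine ⟨B.toNNReal, LipschitzOnWith.of_dist_le_mul fun x hx y hy => ?_⟩
  rw [Real.dist_eq, Real.dist_eq, h.eq y x, ← Real.norm_eq_abs]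
  refine (intervalIntegral.norm_integral_le_of_norm_le_const (C := B) fun z hz => ?_).trans ?_
  · have hz' := uIoc_subset_uIcc hz
    exact hB z (abs_le.2 ((uIcc_subset_Icc hy hx) hz'))
  · exact mul_le_mul_of_nonneg_right (Real.le_coe_toNNReal B) (abs_nonneg _)

theorem continuous (h : LocPrim f g) : Continuous f := by
  rw [continuous_iff_continuousAt]
  intro x
  obtain ⟨L, hL⟩ := h.lipschitzOnWith (|x| + 1)
  exact hL.continuousOn.continuousAt (Icc_mem_nhds (by linarith [neg_abs_le x])
    (by linarith [le_abs_self x]))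

theorem of_ae (hg : Measurable g) (hb : ∀ M, ∃ B, ∀ x, |x| ≤ M → |g x| ≤ B)
    (hL : ∀ M, ∃ L : ℝ≥0, LipschitzOnWith L f (Icc (-M) M)) (h : ∀ᵐ x, HasDerivAt f (g x) x) :
    LocPrim f g := by
  refine ⟨hg, hb, fun a b => ?_⟩
  obtain ⟨L, hL⟩ := hL (max |a| |b|)
  refine (integral_eq_sub_of_lipschitzOn (hL.mono ?_) (h.mono fun x hx _ => hx)).symm
  exact uIcc_subset_Icc (abs_le.1 (le_max_left _ _)) (abs_le.1 (le_max_right _ _))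

theorem mul (h : LocPrim f g) (h₁ : LocPrim f₁ g₁) :
    LocPrim (fun x => f x * f₁ x) (fun x => g x * f₁ x + f x * g₁ x) := by
  refine ⟨(h.meas.mul h₁.continuous.measurable).add (h.continuous.measurable.mul h₁.meas),
    fun M => ?_, fun a b => ?_⟩
  · obtain ⟨B, hB⟩ := h.bdd M
    obtain ⟨B₁, hB₁⟩ := h₁.bdd M
    obtain ⟨D, hD⟩ := (isCompact_Icc (a := -M) (b := M)).exists_bound_of_continuousOn
      h.continuous.continuousOn
    obtain ⟨D₁, hD₁⟩ := (isCompact_Icc (a := -M) (b := M)).exists_bound_of_continuousOn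
      h₁.continuous.continuousOn
    refine ⟨B * D₁ + D * B₁, fun x hx => (abs_add_le _ _).trans ?_⟩
    have e1 := hB x hx
    have e2 := hB₁ x hx
    have e3 := hD x (abs_le.1 hx)
    have e4 := hD₁ x (abs_le.1 hx)
    rw [abs_mul, abs_mul]
    exact add_le_add (mul_le_mul e1 e4 (abs_nonneg _) ((abs_nonneg _).trans e1))
      (mul_le_mul e3 e2 (abs_nonneg _) ((abs_nonneg _).trans e3))
  · have key : ∀ a b, a ≤ b → f b * f₁ b - f a * f₁ a = ∫ t in a..b, (g t * f₁ t + f t * g₁ t) :=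
      fun a b hab => mul_sub_mul_eq_integral hab (h.intervalIntegrable a b)
        (h₁.intervalIntegrable a b) (fun x _ => by linarith [h.eq a x])
        (fun x _ => by linarith [h₁.eq a x])
    rcases le_total a b with hab | hab
    · exact key a b hab
    · rw [intervalIntegral.integral_symm, ← key b a hab]; ring

theorem const_mul (c : ℝ) (h : LocPrim f g) : LocPrim (fun x => c * f x) (fun x => c * g x) := by
  refine ⟨h.meas.const_mul c, fun M => ?_, fun a b => ?_⟩
  · obtain ⟨B, hB⟩ := h.bdd M
    exact ⟨|c| * B, fun x hx => by rw [abs_mul]; exact mul_le_mul_of_nonneg_left (hB x hx) (abs_nonneg _)⟩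
  · rw [intervalIntegral.integral_const_mul, ← h.eq]; ring

theorem add (h : LocPrim f g) (h₁ : LocPrim f₁ g₁) :
    LocPrim (fun x => f x + f₁ x) (fun x => g x + g₁ x) := by
  refine ⟨h.meas.add h₁.meas, fun M => ?_, fun a b => ?_⟩
  · obtain ⟨B, hB⟩ := h.bdd M
    obtain ⟨B₁, hB₁⟩ := h₁.bdd M
    exact ⟨B + B₁, fun x hx => (abs_add_le _ _).trans (add_le_add (hB x hx) (hB₁ x hx))⟩
  · rw [intervalIntegral.integral_add (h.intervalIntegrable a b) (h₁.intervalIntegrable a b),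
      ← h.eq, ← h₁.eq]; ring

theorem comp {φ φ' : ℝ → ℝ} (hφ : ∀ y, HasDerivAt φ (φ' y) y) (hφ' : Continuous φ')
    (h : LocPrim f g) : LocPrim (fun x => φ (f x)) (fun x => φ' (f x) * g x) := by
  have hfc := h.continuous
  have hφc : Continuous φ := continuous_iff_continuousAt.2 fun y => (hφ y).continuousAt
  refine of_ae ((hφ'.comp hfc).measurable.mul h.meas) (fun M => ?_) (fun M => ?_) ?_
  · obtain ⟨B, hB⟩ := h.bdd M
    obtain ⟨D, hD⟩ := (isCompact_Icc (a := -M) (b := M)).exists_bound_of_continuousOn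
      (hφ'.comp hfc).continuousOn
    refine ⟨D * B, fun x hx => ?_⟩
    have e3 := hD x (abs_le.1 hx)
    rw [abs_mul]
    exact mul_le_mul e3 (hB x hx) (abs_nonneg _) ((abs_nonneg _).trans e3)
  · obtain ⟨L, hL⟩ := h.lipschitzOnWith M
    obtain ⟨D, hD⟩ := (isCompact_Icc (a := -M) (b := M)).exists_bound_of_continuousOn
      hfc.continuousOn
    obtain ⟨D', hD'⟩ := (isCompact_Icc (a := -D) (b := D)).exists_bound_of_continuousOn
      hφ'.continuousOn
    have hl : LipschitzOnWith D'.toNNReal φ (Icc (-D) D) :=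
      (convex_Icc _ _).lipschitzOnWith_of_nnnorm_hasDerivWithin_le
        (fun y hy => (hφ y).hasDerivWithinAt) fun y hy => by
          rw [← NNReal.coe_le_coe, coe_nnnorm]
          exact (hD' y hy).trans (Real.le_coe_toNNReal D')
    exact ⟨_, hl.comp hL fun x hx => abs_le.1 (hD x hx)⟩
  · filter_upwards [h.ae_hasDerivAt] with x hx
    exact (hφ (f x)).comp x hx

theorem congr {f' g' : ℝ → ℝ} (h : LocPrim f g) (hf : ∀ x, f' x = f x) (hg : ∀ x, g' x = g x) :
    LocPrim f' g' := by
  rwa [show f' = f from funext hf, show g' = g from funext hg]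

/-- An indefinite integral whose density is bounded by a multiple of the function itself vanishes
everywhere if it vanishes at one point. -/
theorem eq_zero (h : LocPrim f g) (h0 : ∀ x, 0 ≤ f x)
    (hg : ∀ M, ∃ K, ∀ x, |x| ≤ M → |g x| ≤ K * f x) {a b : ℝ} (ha : f a = 0) : f b = 0 := by
  have key : ∀ {f g : ℝ → ℝ}, LocPrim f g → (∀ x, 0 ≤ f x) →
      (∀ M, ∃ K, ∀ x, |x| ≤ M → |g x| ≤ K * f x) → ∀ {a b : ℝ}, a ≤ b → f a = 0 → f b = 0 := by
    intro f g h h0 hg a b hab ha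
    obtain ⟨K, hK⟩ := hg (max |a| |b|)
    have := le_mul_exp_of_integral (f := f) (F := g) (k := fun _ => K) hab
      (h.intervalIntegrable a b) (intervalIntegrable_const) (B := |K|) (fun _ => le_rfl)
      (fun x _ => by linarith [h.eq a x])
      (fun x hx => (le_abs_self _).trans (hK x (abs_le_max_abs_abs hx.1 hx.2)))
    rw [ha, zero_mul] at this
    exact le_antisymm this (h0 b)
  rcases le_total a b with hab | hab
  · exact key h h0 hg hab ha
  · have h' : LocPrim (fun x => f (-x)) (fun x => -g (-x)) := by
      refine ⟨(h.meas.comp measurable_neg).neg, fun M => ?_, fun a b => ?_⟩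
      · obtain ⟨B, hB⟩ := h.bdd M
        exact ⟨B, fun x hx => by rw [abs_neg]; exact hB _ (by rwa [abs_neg])⟩
      · rw [intervalIntegral.integral_neg, intervalIntegral.integral_comp_neg, ← h.eq]; ring
    have := key h' (fun x => h0 _) (fun M => by
      obtain ⟨K, hK⟩ := hg M
      exact ⟨K, fun x hx => by rw [abs_neg]; exact hK _ (by rwa [abs_neg])⟩)
      (neg_le_neg hab) (by simpa using ha)
    simpa using this

end LocPrim

/-! ### From the spinor system to the equivalent system -/

/-- The wave speed `c`, with its bounds, and a solution `W` of `W' = 1 / c(W)`, such as the inverse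
of a primitive of `c`. It recovers `U` from the unknown `w` of the spinor system. -/
structure Speed (c W : ℝ → ℝ) (κ : ℝ) : Prop where
  κ_pos : 0 < κ
  smooth : ContDiff ℝ 1 c
  bounds : ∀ v : ℝ, κ⁻¹ ≤ c v ∧ c v ≤ κ
  deriv_inv : ∀ w, HasDerivAt W (c (W w))⁻¹ w

namespace Speed

variable {c W : ℝ → ℝ} {κ : ℝ}

theorem pos (h : Speed c W κ) (v : ℝ) : 0 < c v := (inv_pos.2 h.κ_pos).trans_le (h.bounds v).1

theorem continuous_W (h : Speed c W κ) : Continuous W :=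
  continuous_iff_continuousAt.2 fun w => (h.deriv_inv w).continuousAt

theorem continuous_deriv (h : Speed c W κ) : Continuous (deriv c) :=
  h.smooth.continuous_deriv le_rfl

theorem hasDerivAt (h : Speed c W κ) (v : ℝ) : HasDerivAt c (deriv c v) v :=
  (h.smooth.differentiable one_ne_zero v).hasDerivAt

/-- A primitive of a function bounded from below by a positive constant is invertible. -/
theorem exists_primitive (hκ : 0 < κ) (hc : ContDiff ℝ 1 c) (hcκ : ∀ v : ℝ, κ⁻¹ ≤ c v ∧ c v ≤ κ) :
    ∃ W A : ℝ → ℝ, Speed c W κ ∧ (∀ v, HasDerivAt A (c v) v) ∧ ∀ v, W (A v) = v := by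
  have hpos : ∀ v, 0 < c v := fun v => (inv_pos.2 hκ).trans_le (hcκ v).1
  set A : ℝ → ℝ := fun v => ∫ y in (0 : ℝ)..v, c y with hA
  have hd : ∀ v, HasDerivAt A (c v) v := fun v =>
    intervalIntegral.integral_hasDerivAt_right (hc.continuous.intervalIntegrable _ _)
      (hc.continuous.stronglyMeasurableAtFilter _ _) hc.continuous.continuousAt
  have hAc : Continuous A := continuous_iff_continuousAt.2 fun w => (hd w).continuousAt
  have hm : StrictMono A := strictMono_of_deriv_pos fun v => by rw [(hd v).deriv]; exact hpos v
  have hA0 : A 0 = 0 := by simp [hA]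
  have hgrow : ∀ u v, u ≤ v → κ⁻¹ * (v - u) ≤ A v - A u := fun u v huv => by
    have e : A v - A u = ∫ y in u..v, c y :=
      intervalIntegral.integral_interval_sub_left (hc.continuous.intervalIntegrable _ _)
        (hc.continuous.intervalIntegrable _ _)
    rw [e, mul_comm, ← smul_eq_mul, ← intervalIntegral.integral_const]
    exact intervalIntegral.integral_mono_on huv intervalIntegrable_const
      (hc.continuous.intervalIntegrable _ _) fun y _ => (hcκ y).1
  have hs : Function.Surjective A := by
    refine hAc.surjective ?_ ?_
    · refine tendsto_atTop_mono' atTop ?_ (tendsto_id.const_mul_atTop (inv_pos.2 hκ))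
      filter_upwards [eventually_ge_atTop (0 : ℝ)] with v hv
      have := hgrow 0 v hv
      simpa [hA0] using this
    · refine tendsto_atBot_mono' atBot ?_ (tendsto_id.const_mul_atBot (inv_pos.2 hκ))
      filter_upwards [eventually_le_atBot (0 : ℝ)] with v hv
      have := hgrow v 0 hv
      simp only [hA0, id] at this ⊢; linarith
  set e := hm.orderIsoOfSurjective A hs
  have hl : ∀ w, A (e.symm w) = w := fun w => e.apply_symm_apply w
  refine ⟨e.symm, A, ⟨hκ, hc, hcκ, fun w => ?_⟩, hd, fun v => e.symm_apply_apply v⟩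
  exact HasDerivAt.of_local_left_inverse e.symm.continuous.continuousAt (hd _) (hpos _).ne'
    (Eventually.of_forall hl)

end Speed

/-- The coefficient `c' / (2 √2 c²)` of the spinor system as a function of `w`. -/
noncomputable def coeff (c W : ℝ → ℝ) (w : ℝ) : ℝ := √2 * deriv c (W w) / (4 * c (W w) ^ 2)

/-- The vector `Z_X` in terms of `(α, β, γ, δ, w)`. -/
noncomputable def fieldX (c W : ℝ → ℝ) (v : Fin 5 → ℝ) : Fin 5 → ℝ :=
  ![(c (W (v 4)))⁻¹ * (v 0 * v 0), v 0 * v 0, √2 * ((c (W (v 4)))⁻¹ * (v 0 * v 1)), v 1 * v 1,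
    (c (W (v 4)))⁻¹ * (v 1 * v 1)]

/-- Exchange of the roles of `X` and `Y` in `(α, β, γ, δ, w)`. -/
def swapV (v : Fin 5 → ℝ) : Fin 5 → ℝ := ![v 2, v 3, v 0, v 1, v 4]

/-- Reversal of the sign of the components `t` and `K`. -/
def flipT (z : Fin 5 → ℝ) : Fin 5 → ℝ := ![-z 0, z 1, z 2, z 3, -z 4]

/-- The vector `Z_Y` in terms of `(α, β, γ, δ, w)`. -/
noncomputable def fieldY (c W : ℝ → ℝ) (v : Fin 5 → ℝ) : Fin 5 → ℝ := flipT (fieldX c W (swapV v))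

/-- The mixed derivative `Z_XY` in terms of `(α, β, γ, δ, w)`. -/
noncomputable def fieldXY (c W : ℝ → ℝ) (v : Fin 5 → ℝ) : Fin 5 → ℝ :=
  F c (fun _ => W (v 4)) (fieldX c W v) (fieldY c W v)

theorem F_flip (c : ℝ → ℝ) (z z' P Q : Fin 5 → ℝ) (hz : z' 2 = z 2) :
    F c z' (flipT Q) (flipT P) = flipT (F c z P Q) := by
  funext i
  fin_cases i <;> simp only [F, flipT, hz, Fin.zero_eta, Fin.mk_one, Fin.reduceFinMk, Matrix.cons_val] <;> ring

theorem flipT_flipT (z : Fin 5 → ℝ) : flipT (flipT z) = z := by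
  funext i; fin_cases i <;> simp [flipT]

theorem swapV_swapV (v : Fin 5 → ℝ) : swapV (swapV v) = v := by
  funext i; fin_cases i <;> simp [swapV]

theorem fieldXY_swap (c W : ℝ → ℝ) (v : Fin 5 → ℝ) :
    fieldXY c W (swapV v) = flipT (fieldXY c W v) := by
  have := F_flip c (fun _ => W (v 4)) (fun _ => W (swapV v 4)) (fieldX c W v) (fieldY c W v) rfl
  rw [fieldXY, fieldXY, ← this, fieldY, fieldY, swapV_swapV, flipT_flipT]

namespace SpinorSol

variable {c W : ℝ → ℝ} {κ : ℝ} {b : ℝ → ℝ} {v : ℝ × ℝ → Fin 5 → ℝ}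

theorem swap (h : SpinorSol b v) : SpinorSol b fun p => swapV (v p.swap) where
  meas i := by
    have := fun i => (h.meas i).comp measurable_swap
    fin_cases i
    exacts [this 2, this 3, this 0, this 1, this 4]
  bdd i := by
    have := fun i => (h.bdd i).comp_swap
    fin_cases i
    exacts [this 2, this 3, this 0, this 1, this 4]
  cont := h.cont.comp continuous_swap
  eq_Y X Y Y' i hi := by
    fin_cases i
    · refine (h.eq_X Y Y' X 2 (by decide)).trans (intervalIntegral.integral_congr fun η _ => ?_)
      simp only [spin, swapV, Prod.swap_prod_mk, Fin.zero_eta, Fin.mk_one, Matrix.cons_val]; ring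
    · refine (h.eq_X Y Y' X 3 (by decide)).trans (intervalIntegral.integral_congr fun η _ => ?_)
      simp only [spin, swapV, Prod.swap_prod_mk, Fin.zero_eta, Fin.mk_one, Matrix.cons_val]; ring
    all_goals exact absurd hi (by decide)
  eq_X X X' Y i hi := by
    rcases hi with rfl | rfl
    · refine (h.eq_Y Y X X' 0 (by decide)).trans (intervalIntegral.integral_congr fun η _ => ?_)
      simp only [spin, swapV, Prod.swap_prod_mk, Fin.zero_eta, Fin.mk_one, Matrix.cons_val]; ring
    · refine (h.eq_Y Y X X' 1 (by decide)).trans (intervalIntegral.integral_congr fun η _ => ?_)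
      simp only [spin, swapV, Prod.swap_prod_mk, Fin.zero_eta, Fin.mk_one, Matrix.cons_val]; ring
  w_Y X Y Y' := h.w_X Y Y' X
  w_X X X' Y := h.w_Y Y X X'

theorem locPrim_fst (h : SpinorSol b v) (hb : Continuous b) (X : ℝ) (i : Fin 5) (hi : i < 2) :
    LocPrim (fun Y => v (X, Y) i) (fun Y => spin (b (v (X, Y) 4)) (v (X, Y)) i) := by
  refine ⟨(meas_spin_of (hb.comp h.cont).measurable h.meas i).comp measurable_prodMk_left,
    fun M => ?_, fun Y Y' => h.eq_Y X Y Y' i hi⟩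
  obtain ⟨B, hB⟩ := locBdd_spin ((h.bdd 4).comp_continuous hb) h.bdd i (max |X| M)
  exact ⟨B, fun x hx => hB (X, x) (le_max_left _ _) (hx.trans (le_max_right _ _))⟩

theorem locPrim_w (h : SpinorSol b v) (X : ℝ) :
    LocPrim (fun Y => v (X, Y) 4) (fun Y => √2 * (v (X, Y) 2 * v (X, Y) 3)) := by
  refine ⟨(((h.meas 2).mul (h.meas 3)).const_mul (√2)).comp measurable_prodMk_left,
    fun M => ?_, fun Y Y' => h.w_Y X Y Y'⟩
  obtain ⟨B, hB⟩ := ((h.bdd 2).mul (h.bdd 3)).const_mul (√2) (max |X| M)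
  exact ⟨B, fun x hx => hB (X, x) (le_max_left _ _) (hx.trans (le_max_right _ _))⟩

theorem locPrim_inv (hs : Speed c W κ) (h : SpinorSol b v) (X : ℝ) :
    LocPrim (fun Y => (c (W (v (X, Y) 4)))⁻¹) (fun Y => -deriv c (W (v (X, Y) 4)) /
      c (W (v (X, Y) 4)) ^ 2 * ((c (W (v (X, Y) 4)))⁻¹ * (√2 * (v (X, Y) 2 * v (X, Y) 3)))) := by
  have h1 := (h.locPrim_w X).comp (φ := W) hs.deriv_inv
    ((hs.smooth.continuous.comp hs.continuous_W).inv₀ fun w => (hs.pos _).ne')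
  exact h1.comp (φ := fun u => (c u)⁻¹) (φ' := fun u => -deriv c u / c u ^ 2)
    (fun u => (hs.hasDerivAt u).fun_inv (hs.pos u).ne')
    (hs.continuous_deriv.neg.div (hs.smooth.continuous.pow 2) fun u => (pow_pos (hs.pos u) 2).ne')

theorem locPrim_fieldX (hs : Speed c W κ) (hb : Continuous (coeff c W))
    (h : SpinorSol (coeff c W) v) (X : ℝ) (i : Fin 5) :
    LocPrim (fun Y => fieldX c W (v (X, Y)) i) (fun Y => fieldXY c W (v (X, Y)) i) := by
  have h0 := h.locPrim_fst hb X 0 (by decide)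
  have h1 := h.locPrim_fst hb X 1 (by decide)
  have hi := h.locPrim_inv hs X
  have r2 : √2 ^ 2 = 2 := Real.sq_sqrt (by norm_num)
  fin_cases i
  · refine (hi.mul (h0.mul h0)).congr (fun Y => rfl) fun Y => ?_
    simp [fieldXY, F, fieldX, fieldY, flipT, swapV, spin, coeff]
    ring
  · refine (h0.mul h0).congr (fun Y => rfl) fun Y => ?_
    simp [fieldXY, F, fieldX, fieldY, flipT, swapV, spin, coeff]
    ring
  · refine ((hi.mul (h0.mul h1)).const_mul (√2)).congr (fun Y => rfl) fun Y => ?_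
    simp [fieldXY, F, fieldX, fieldY, flipT, swapV, spin, coeff]
    generalize √2 = r at *
    linear_combination (-(deriv c (W (v (X, Y) 4)) * (c (W (v (X, Y) 4)))⁻¹ ^ 3 *
      ((v (X, Y) 2 * v (X, Y) 1 + v (X, Y) 3 * v (X, Y) 0) ^ 2 / 4 -
        v (X, Y) 0 * v (X, Y) 1 * v (X, Y) 2 * v (X, Y) 3 / 2))) * r2
  · refine (h1.mul h1).congr (fun Y => rfl) fun Y => ?_
    simp [fieldXY, F, fieldX, fieldY, flipT, swapV, spin, coeff]
    ring
  · refine (hi.mul (h1.mul h1)).congr (fun Y => rfl) fun Y => ?_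
    simp [fieldXY, F, fieldX, fieldY, flipT, swapV, spin, coeff]
    ring

end SpinorSol

/-! ### The surface given by a spinor solution -/

theorem LocBdd.comp_vec {φ : (Fin 5 → ℝ) → ℝ} (hφ : Continuous φ) {v : ℝ × ℝ → Fin 5 → ℝ}
    (hv : ∀ i, LocBdd fun p => v p i) : LocBdd fun p => φ (v p) := fun M => by
  choose B hB using fun i => hv i M
  obtain ⟨B', hB'⟩ := (isCompact_univ_pi fun i : Fin 5 =>
    (isCompact_Icc (a := -B i) (b := B i))).exists_bound_of_continuousOn hφ.continuousOn
  exact ⟨B', fun p h1 h2 => hB' _ fun i _ => abs_le.1 (hB i p h1 h2)⟩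

/-- A continuous function of `(X, Y)` with given partial derivatives exists if the mixed
derivatives agree. -/
theorem exists_potential {P Q G : ℝ × ℝ → ℝ} (mP : Measurable P) (bP : LocBdd P)
    (mQ : Measurable Q) (bQ : LocBdd Q) (mG : Measurable G) (bG : LocBdd G)
    (hP : ∀ X Y Y', P (X, Y') - P (X, Y) = ∫ η in Y..Y', G (X, η))
    (hQ : ∀ X X' Y, Q (X', Y) - Q (X, Y) = ∫ ξ in X..X', G (ξ, Y)) (X₀ Y₀ z₀ : ℝ) :
    ∃ z : ℝ → ℝ → ℝ, z X₀ Y₀ = z₀ ∧ (∀ Y, LocPrim (fun X => z X Y) fun X => P (X, Y)) ∧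
      ∀ X, LocPrim (fun Y => z X Y) fun Y => Q (X, Y) := by
  refine ⟨fun X Y => z₀ + (∫ ξ in X₀..X, P (ξ, Y₀)) + ∫ η in Y₀..Y, Q (X, η), by simp,
    fun Y => ⟨mP.comp measurable_prodMk_right, fun M => ?_, fun X X' => ?_⟩,
    fun X => ⟨mQ.comp measurable_prodMk_left, fun M => ?_, fun Y Y' => ?_⟩⟩
  · obtain ⟨B, hB⟩ := bP (max M |Y|)
    exact ⟨B, fun x hx => hB (x, Y) (hx.trans (le_max_left _ _)) (le_max_right _ _)⟩
  · have iP : ∀ Y a b, IntervalIntegrable (fun ξ => P (ξ, Y)) volume a b := fun Y a b =>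
      bP.intervalIntegrable_fst mP Y a b
    have h1 : (∫ ξ in X₀..X', P (ξ, Y₀)) - ∫ ξ in X₀..X, P (ξ, Y₀) = ∫ ξ in X..X', P (ξ, Y₀) :=
      intervalIntegral.integral_interval_sub_left (iP _ _ _) (iP _ _ _)
    have h2 : (∫ η in Y₀..Y, Q (X', η)) - ∫ η in Y₀..Y, Q (X, η) =
        ∫ η in Y₀..Y, ∫ ξ in X..X', G (ξ, η) := by
      rw [← intervalIntegral.integral_sub (bQ.intervalIntegrable_snd mQ _ _ _)
        (bQ.intervalIntegrable_snd mQ _ _ _)]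
      exact intervalIntegral.integral_congr fun η _ => hQ X X' η
    have h3 : (∫ η in Y₀..Y, ∫ ξ in X..X', G (ξ, η)) = ∫ ξ in X..X', ∫ η in Y₀..Y, G (ξ, η) := by
      apply intervalIntegral_intervalIntegral_swap
      obtain ⟨B, hB⟩ := bG (max (max |Y₀| |Y|) (max |X| |X'|))
      refine Measure.integrableOn_of_bounded (M := B) ?_
        (mG.comp measurable_swap).aestronglyMeasurable ?_
      · rw [Measure.volume_eq_prod, Measure.prod_prod]
        exact ENNReal.mul_ne_top (by simp [uIoc]) (by simp [uIoc])
      · rw [ae_restrict_iff' (measurableSet_uIoc.prod measurableSet_uIoc)]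
        refine ae_of_all _ fun p hp => hB p.swap ?_ ?_
        · have := uIoc_subset_uIcc hp.2
          refine le_max_of_le_right ?_
          exact abs_le.2 (uIcc_subset_Icc (abs_le.1 (le_max_left _ _))
            (abs_le.1 (le_max_right _ _)) this)
        · have := uIoc_subset_uIcc hp.1
          refine le_max_of_le_left ?_
          exact abs_le.2 (uIcc_subset_Icc (abs_le.1 (le_max_left _ _))
            (abs_le.1 (le_max_right _ _)) this)
    have h4 : (∫ ξ in X..X', ∫ η in Y₀..Y, G (ξ, η)) =
        (∫ ξ in X..X', P (ξ, Y)) - ∫ ξ in X..X', P (ξ, Y₀) := by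
      rw [← intervalIntegral.integral_sub (iP _ _ _) (iP _ _ _)]
      exact intervalIntegral.integral_congr fun ξ _ => (hP ξ Y₀ Y).symm
    linarith
  · obtain ⟨B, hB⟩ := bQ (max |X| M)
    exact ⟨B, fun x hx => hB (X, x) (le_max_left _ _) (hx.trans (le_max_right _ _))⟩
  · have h1 := intervalIntegral.integral_interval_sub_left
      (bQ.intervalIntegrable_snd mQ X Y₀ Y') (bQ.intervalIntegrable_snd mQ X Y₀ Y)
    linarith

/-- If the density `P` of `z` in `X` is Lipschitz in `Y`, then almost every `X` is a point of
differentiability for all `Y` simultaneously. -/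
theorem ae_forall_hasDerivAt {z P : ℝ → ℝ → ℝ}
    (hz : ∀ Y, LocPrim (fun X => z X Y) fun X => P X Y)
    (hL : ∀ M, ∃ L, ∀ X Y Y', |X| ≤ M → |Y| ≤ M → |Y'| ≤ M → |P X Y - P X Y'| ≤ L * |Y - Y'|) :
    ∀ᵐ X, ∀ Y, HasDerivAt (fun ξ => z ξ Y) (P X Y) X := by
  have h1 : ∀ᵐ X, ∀ q : ℚ, HasDerivAt (fun ξ => z ξ q) (P X q) X :=
    ae_all_iff.2 fun q => (hz q).ae_hasDerivAt
  filter_upwards [h1] with X hX Y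
  rw [hasDerivAt_iff_isLittleO, Asymptotics.isLittleO_iff]
  intro ε hε
  obtain ⟨L, hL⟩ := hL (max (|X| + 1) (|Y| + 1))
  obtain ⟨q, hq1, hq2⟩ := exists_rat_btwn (show Y < Y + min 1 (ε / (4 * (|L| + 1))) by
    have : 0 < ε / (4 * (|L| + 1)) := by positivity
    simpa using this)
  have hqY : |Y - q| ≤ min 1 (ε / (4 * (|L| + 1))) := by
    rw [abs_sub_comm, abs_of_pos (by linarith)]; linarith
  have hqL : |L| * |Y - q| ≤ ε / 4 := by
    have h2 := hqY.trans (min_le_right _ _)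
    rw [le_div_iff₀ (by positivity)] at h2
    nlinarith [abs_nonneg (Y - q), abs_nonneg L]
  have hq1' : |Y - q| ≤ 1 := hqY.trans (min_le_left _ _)
  have hqa : |(q : ℝ)| ≤ |Y| + 1 := by
    have := abs_sub_abs_le_abs_sub (q : ℝ) Y
    rw [abs_sub_comm] at this; linarith
  have hPd : ∀ ξ, |ξ| ≤ |X| + 1 → |P ξ Y - P ξ q| ≤ ε / 4 := fun ξ hξ =>
    (hL ξ Y q (le_max_of_le_left hξ) (le_max_of_le_right (by linarith [abs_nonneg Y]))
      (le_max_of_le_right hqa)).trans ((mul_le_mul_of_nonneg_right (le_abs_self L)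
        (abs_nonneg _)).trans hqL)
  have hd := hX q
  rw [hasDerivAt_iff_isLittleO, Asymptotics.isLittleO_iff] at hd
  filter_upwards [hd (half_pos hε), Metric.ball_mem_nhds X one_pos] with x hx hxb
  rw [Metric.mem_ball, Real.dist_eq] at hxb
  have hxa : ∀ ξ ∈ uIcc X x, |ξ| ≤ |X| + 1 := by
    intro ξ hξ
    have h3 := abs_sub_left_of_mem_uIcc hξ
    have := abs_sub_abs_le_abs_sub ξ X
    linarith
  have e : z x Y - z X Y - (z x q - z X q) = ∫ ξ in X..x, (P ξ Y - P ξ q) := by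
    rw [intervalIntegral.integral_sub ((hz Y).intervalIntegrable _ _)
      ((hz q).intervalIntegrable _ _), ← (hz Y).eq, ← (hz q).eq]
  have hb : |z x Y - z X Y - (z x q - z X q)| ≤ ε / 4 * |x - X| := by
    rw [e, ← Real.norm_eq_abs]
    exact intervalIntegral.norm_integral_le_of_norm_le_const fun ξ hξ =>
      hPd ξ (hxa ξ (uIoc_subset_uIcc hξ))
  have hpx := hPd X (by linarith)
  rw [Real.norm_eq_abs, Real.norm_eq_abs, smul_eq_mul] at hx ⊢
  have e2 : z x Y - z X Y - (x - X) * P X Y = (z x Y - z X Y - (z x q - z X q)) +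
      (z x q - z X q - (x - X) * P X q) - (x - X) * (P X Y - P X q) := by ring
  rw [e2]
  refine (abs_sub _ _).trans ?_
  refine (add_le_add_left (abs_add_le _ _) _).trans ?_
  rw [abs_mul (x - X)]
  nlinarith [abs_nonneg (x - X)]

section fields

variable {c W : ℝ → ℝ} {κ : ℝ} {v : ℝ × ℝ → Fin 5 → ℝ}

theorem Speed.continuous_coeff (hs : Speed c W κ) : Continuous (coeff c W) := by
  have h1 := hs.continuous_W
  have h2 := hs.smooth.continuous
  have h3 := hs.continuous_deriv
  unfold coeff
  exact (continuous_const.mul (h3.comp h1)).div (continuous_const.mul ((h2.comp h1).pow 2))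
    fun w => (mul_pos (by norm_num) (pow_pos (hs.pos _) 2)).ne'

theorem Speed.continuous_fieldX (hs : Speed c W κ) (i : Fin 5) :
    Continuous fun v => fieldX c W v i := by
  have h2 := (hs.smooth.continuous.comp hs.continuous_W).inv₀ fun w => (hs.pos _).ne'
  have h4 : Continuous fun v : Fin 5 → ℝ => (c (W (v 4)))⁻¹ := h2.comp (continuous_apply 4)
  have e : ∀ i : Fin 5, Continuous fun v : Fin 5 → ℝ => v i := continuous_apply
  fin_cases i
  · exact h4.mul ((e 0).mul (e 0))
  · exact (e 0).mul (e 0)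
  · exact continuous_const.mul (h4.mul ((e 0).mul (e 1)))
  · exact (e 1).mul (e 1)
  · exact h4.mul ((e 1).mul (e 1))

theorem continuous_swapV : Continuous swapV := by
  refine continuous_pi fun i => ?_
  fin_cases i
  exacts [continuous_apply 2, continuous_apply 3, continuous_apply 0, continuous_apply 1,
    continuous_apply 4]

theorem continuous_flipT : Continuous flipT := by
  refine continuous_pi fun i => ?_
  fin_cases i
  exacts [(continuous_apply 0).neg, continuous_apply 1, continuous_apply 2, continuous_apply 3,
    (continuous_apply 4).neg]

theorem Speed.continuous_fieldY (hs : Speed c W κ) (i : Fin 5) :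
    Continuous fun v => fieldY c W v i :=
  (continuous_apply i).comp (continuous_flipT.comp
    ((continuous_pi hs.continuous_fieldX).comp continuous_swapV))

theorem Speed.continuous_fieldXY (hs : Speed c W κ) (i : Fin 5) :
    Continuous fun v => fieldXY c W v i := by
  have h1 := hs.continuous_fieldX
  have h2 := hs.continuous_fieldY
  have hw : Continuous fun v : Fin 5 → ℝ => W (v 4) := hs.continuous_W.comp (continuous_apply 4)
  have hcw : Continuous fun v : Fin 5 → ℝ => c (W (v 4)) := hs.smooth.continuous.comp hw
  have ha : Continuous fun v : Fin 5 → ℝ => deriv c (W (v 4)) / (2 * c (W (v 4))) :=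
    (hs.continuous_deriv.comp hw).div (continuous_const.mul hcw)
      fun v => (mul_pos two_pos (hs.pos _)).ne'
  have ha3 : Continuous fun v : Fin 5 → ℝ => deriv c (W (v 4)) / (2 * c (W (v 4)) ^ 3) :=
    (hs.continuous_deriv.comp hw).div (continuous_const.mul (hcw.pow 3))
      fun v => (mul_pos two_pos (pow_pos (hs.pos _) 3)).ne'
  fin_cases i
  · exact ha.neg.mul (((h1 2).mul (h2 0)).add ((h2 2).mul (h1 0)))
  · exact ha.mul (((h2 2).mul (h1 1)).add ((h1 2).mul (h2 1)))
  · exact (ha3.mul (((h2 1).mul (h1 3)).add ((h2 3).mul (h1 1)))).sub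
      (ha.mul ((h2 2).mul (h1 2)))
  · exact ha.mul (((h1 3).mul (h2 2)).add ((h2 3).mul (h1 2)))
  · exact ha.neg.mul (((h1 4).mul (h2 2)).add ((h2 4).mul (h1 2)))

namespace SpinorSol

theorem measurable_comp (h : SpinorSol (coeff c W) v) {φ : (Fin 5 → ℝ) → ℝ} (hφ : Continuous φ) :
    Measurable fun p => φ (v p) :=
  hφ.measurable.comp (measurable_pi_iff.2 h.meas)

theorem locPrim_fieldY (hs : Speed c W κ) (h : SpinorSol (coeff c W) v) (Y : ℝ) (i : Fin 5) :
    LocPrim (fun X => fieldY c W (v (X, Y)) i) (fun X => fieldXY c W (v (X, Y)) i) := by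
  have h1 := h.swap.locPrim_fieldX hs hs.continuous_coeff Y
  have key : ∀ {f g : Fin 5 → ℝ → ℝ}, (∀ i, LocPrim (f i) (g i)) → ∀ i,
      LocPrim (fun x => flipT (fun j => f j x) i) (fun x => flipT (fun j => g j x) i) := by
    intro f g h i
    fin_cases i
    · exact ((h 0).const_mul (-1)).congr (fun x => by simp [flipT]) (fun x => by simp [flipT])
    · exact h 1
    · exact h 2
    · exact h 3
    · exact ((h 4).const_mul (-1)).congr (fun x => by simp [flipT]) (fun x => by simp [flipT])
  refine (key h1 i).congr (fun X => rfl) fun X => ?_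
  simp only [Prod.swap_prod_mk, fieldXY_swap]
  exact (congrFun (flipT_flipT _) i).symm

/-- The potential of the fields given by a solution of the spinor system. -/
theorem exists_surface (hs : Speed c W κ) (h : SpinorSol (coeff c W) v) (X₀ Y₀ : ℝ)
    (z₀ : Fin 5 → ℝ) (hz : z₀ 2 = W (v (X₀, Y₀) 4)) : ∃ Z : ℝ → ℝ → Fin 5 → ℝ, Z X₀ Y₀ = z₀ ∧
      (∀ Y i, LocPrim (fun X => Z X Y i) fun X => fieldX c W (v (X, Y)) i) ∧
      (∀ X i, LocPrim (fun Y => Z X Y i) fun Y => fieldY c W (v (X, Y)) i) ∧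
      ∀ X Y, Z X Y 2 = W (v (X, Y) 4) := by
  choose z h0 hX hY using fun i => exists_potential (h.measurable_comp (hs.continuous_fieldX i))
    (LocBdd.comp_vec (hs.continuous_fieldX i) h.bdd) (h.measurable_comp (hs.continuous_fieldY i))
    (LocBdd.comp_vec (hs.continuous_fieldY i) h.bdd) (h.measurable_comp (hs.continuous_fieldXY i))
    (LocBdd.comp_vec (hs.continuous_fieldXY i) h.bdd)
    (fun X => (h.locPrim_fieldX hs hs.continuous_coeff X i).eq)
    (fun X X' Y => (h.locPrim_fieldY hs Y i).eq X X') X₀ Y₀ (z₀ i)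
  refine ⟨fun X Y i => z i X Y, funext h0, fun Y i => hX i Y, fun X i => hY i X, fun X Y => ?_⟩
  have hci : Continuous fun w => (c (W w))⁻¹ :=
    (hs.smooth.continuous.comp hs.continuous_W).inv₀ fun w => (hs.pos _).ne'
  have e1 := ((h.swap.locPrim_w Y₀).comp hs.deriv_inv hci).eq X₀ X
  have e2 := ((h.locPrim_w X).comp hs.deriv_inv hci).eq Y₀ Y
  have e3 := (hX 2 Y₀).eq X₀ X
  have e4 := (hY 2 X).eq Y₀ Y
  have e5 := h0 2
  have e6 : (∫ x in X₀..X, fieldX c W (v (x, Y₀)) 2) = ∫ x in X₀..X,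
      (c (W (swapV (v (Prod.swap (Y₀, x))) 4)))⁻¹ *
        (√2 * (swapV (v (Prod.swap (Y₀, x))) 2 * swapV (v (Prod.swap (Y₀, x))) 3)) :=
    intervalIntegral.integral_congr fun x _ => by
      simp only [fieldX, swapV, Prod.swap_prod_mk, Matrix.cons_val]; ring
  have e7 : (∫ x in Y₀..Y, fieldY c W (v (X, x)) 2) = ∫ x in Y₀..Y,
      (c (W (v (X, x) 4)))⁻¹ * (√2 * (v (X, x) 2 * v (X, x) 3)) :=
    intervalIntegral.integral_congr fun x _ => by
      simp only [fieldY, fieldX, flipT, swapV, Matrix.cons_val]; ring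
  simp only [swapV, Prod.swap_prod_mk, Matrix.cons_val] at e1 e6
  linarith

/-- The density `α² + β²` vanishes on a vertical line everywhere or nowhere. -/
theorem density_pos (hs : Speed c W κ) (h : SpinorSol (coeff c W) v) {X Y₀ : ℝ}
    (h0 : v (X, Y₀) 0 ^ 2 + v (X, Y₀) 1 ^ 2 ≠ 0) (Y : ℝ) :
    0 < v (X, Y) 0 ^ 2 + v (X, Y) 1 ^ 2 := by
  have hb := hs.continuous_coeff
  have hp := ((h.locPrim_fst hb X 0 (by decide)).mul (h.locPrim_fst hb X 0 (by decide))).add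
    ((h.locPrim_fst hb X 1 (by decide)).mul (h.locPrim_fst hb X 1 (by decide)))
  refine lt_of_le_of_ne (by positivity) fun he => h0 ?_
  rw [sq, sq]
  refine hp.eq_zero (a := Y) (b := Y₀)
    (fun x => add_nonneg (mul_self_nonneg _) (mul_self_nonneg _)) (fun M => ?_) (by
    rw [sq, sq] at he; exact he.symm)
  obtain ⟨B, hB⟩ := ((h.bdd 4).comp_continuous hb) (max |X| M)
  obtain ⟨D, hD⟩ := ((h.bdd 2).mul (h.bdd 2)).add ((h.bdd 3).mul (h.bdd 3)) (max |X| M)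
  refine ⟨2 * B * D, fun x hx => ?_⟩
  have h1 := hB (X, x) (le_max_left _ _) (hx.trans (le_max_right _ _))
  have h2 := (le_abs_self _).trans (hD (X, x) (le_max_left _ _) (hx.trans (le_max_right _ _)))
  simp only [spin, Matrix.cons_val] at h1 h2 ⊢
  set β := coeff c W (v (X, x) 4)
  set p := v (X, x)
  have e : β * (p 2 * p 1 + p 3 * p 0) * p 2 * p 0 + p 0 * (β * (p 2 * p 1 + p 3 * p 0) * p 2) +
      (β * (p 2 * p 1 + p 3 * p 0) * p 3 * p 1 + p 1 * (β * (p 2 * p 1 + p 3 * p 0) * p 3)) =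
      2 * β * ((p 2 * p 1 + p 3 * p 0) * (p 2 * p 0 + p 3 * p 1)) := by ring
  have h3 : |(p 2 * p 1 + p 3 * p 0) * (p 2 * p 0 + p 3 * p 1)| ≤
      (p 2 * p 2 + p 3 * p 3) * (p 0 * p 0 + p 1 * p 1) := by
    rw [abs_le]
    constructor
    · nlinarith [sq_nonneg (p 2 * p 1 + p 3 * p 0 + (p 2 * p 0 + p 3 * p 1)),
        sq_nonneg (p 2 * p 1 - p 3 * p 0), sq_nonneg (p 2 * p 0 - p 3 * p 1)]
    · nlinarith [sq_nonneg (p 2 * p 1 + p 3 * p 0 - (p 2 * p 0 + p 3 * p 1)),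
        sq_nonneg (p 2 * p 1 - p 3 * p 0), sq_nonneg (p 2 * p 0 - p 3 * p 1)]
  have hB0 : 0 ≤ B := (abs_nonneg _).trans h1
  have hp0 : 0 ≤ p 0 * p 0 + p 1 * p 1 := add_nonneg (mul_self_nonneg _) (mul_self_nonneg _)
  rw [e, abs_mul, abs_mul, abs_two]
  calc 2 * |β| * |(p 2 * p 1 + p 3 * p 0) * (p 2 * p 0 + p 3 * p 1)|
      ≤ 2 * B * ((p 2 * p 2 + p 3 * p 3) * (p 0 * p 0 + p 1 * p 1)) :=
        mul_le_mul (by linarith) h3 (abs_nonneg _) (by linarith)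
    _ ≤ 2 * B * (D * (p 0 * p 0 + p 1 * p 1)) :=
        mul_le_mul_of_nonneg_left (mul_le_mul_of_nonneg_right h2 hp0) (by linarith)
    _ = _ := by ring


theorem lipschitz_fieldX (hs : Speed c W κ) (h : SpinorSol (coeff c W) v) (M : ℝ) :
    ∃ L, 0 ≤ L ∧ ∀ i X Y Y', |X| ≤ M → |Y| ≤ M → |Y'| ≤ M →
      |fieldX c W (v (X, Y)) i - fieldX c W (v (X, Y')) i| ≤ L * |Y - Y'| := by
  choose B hB using fun i => LocBdd.comp_vec (hs.continuous_fieldXY i) h.bdd M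
  have hB' : ∀ i, B i ≤ ∑ j, |B j| := fun i =>
    (le_abs_self _).trans (Finset.single_le_sum (f := fun j => |B j|) (fun j _ => abs_nonneg _)
      (Finset.mem_univ i))
  refine ⟨∑ j, |B j|, Finset.sum_nonneg fun j _ => abs_nonneg _, fun i X Y Y' h1 h2 h3 => ?_⟩
  rw [(h.locPrim_fieldX hs hs.continuous_coeff X i).eq Y' Y, ← Real.norm_eq_abs]
  refine intervalIntegral.norm_integral_le_of_norm_le_const fun η hη => ?_
  have := uIcc_subset_Icc (abs_le.1 h3) (abs_le.1 h2) (uIoc_subset_uIcc hη)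
  exact (hB i (X, η) h1 (abs_le.2 this)).trans (hB' i)

theorem lipschitz_fieldY (hs : Speed c W κ) (h : SpinorSol (coeff c W) v) (M : ℝ) :
    ∃ L, 0 ≤ L ∧ ∀ i Y X X', |Y| ≤ M → |X| ≤ M → |X'| ≤ M →
      |fieldY c W (v (X, Y)) i - fieldY c W (v (X', Y)) i| ≤ L * |X - X'| := by
  obtain ⟨L, hL, hL'⟩ := h.swap.lipschitz_fieldX hs M
  refine ⟨L, hL, fun i Y X X' h1 h2 h3 => ?_⟩
  have := hL' i Y X X' h1 h2 h3
  fin_cases i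
  · simp only [Fin.zero_eta, fieldY, flipT, Matrix.cons_val]
    rw [← neg_sub', abs_neg]; exact this
  · exact this
  · exact this
  · exact this
  · simp only [Fin.reduceFinMk, fieldY, flipT, Matrix.cons_val]
    rw [← neg_sub', abs_neg]; exact this

/-- Where the density is positive, the components of `Z_X` satisfy the algebraic relations. -/
theorem fieldX_rel (hs : Speed c W κ) {p : Fin 5 → ℝ} (hp : 0 < p 0 ^ 2 + p 1 ^ 2) :
    fieldX c W p 1 = c (W (p 4)) * fieldX c W p 0 ∧
    fieldX c W p 3 = c (W (p 4)) * fieldX c W p 4 ∧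
    2 * fieldX c W p 3 * fieldX c W p 1 = (c (W (p 4)) * fieldX c W p 2) ^ 2 ∧
    0 ≤ fieldX c W p 1 ∧ 0 ≤ fieldX c W p 3 ∧ 0 < fieldX c W p 1 + fieldX c W p 3 := by
  have h0 := (hs.pos (W (p 4))).ne'
  simp only [fieldX, Matrix.cons_val]
  refine ⟨by field_simp, by field_simp, ?_, mul_self_nonneg _, mul_self_nonneg _,
    by rwa [sq, sq] at hp⟩
  have r2 : √2 ^ 2 = 2 := Real.sq_sqrt (by norm_num)
  field_simp
  rw [r2]; ring

theorem fieldY_rel (hs : Speed c W κ) {p : Fin 5 → ℝ} (hp : 0 < p 2 ^ 2 + p 3 ^ 2) :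
    fieldY c W p 1 = -(c (W (p 4)) * fieldY c W p 0) ∧
    fieldY c W p 3 = -(c (W (p 4)) * fieldY c W p 4) ∧
    2 * fieldY c W p 3 * fieldY c W p 1 = (c (W (p 4)) * fieldY c W p 2) ^ 2 ∧
    0 ≤ fieldY c W p 1 ∧ 0 ≤ fieldY c W p 3 ∧ 0 < fieldY c W p 1 + fieldY c W p 3 := by
  obtain ⟨h1, h2, h3⟩ := fieldX_rel hs (p := swapV p) hp
  refine ⟨?_, ?_, h3⟩
  · simp only [fieldY, flipT, Matrix.cons_val, mul_neg, neg_neg]; exact h1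
  · simp only [fieldY, flipT, Matrix.cons_val, mul_neg, neg_neg]; exact h2

variable {Z : ℝ → ℝ → Fin 5 → ℝ}

theorem ae_hasDerivAt_X (hs : Speed c W κ) (h : SpinorSol (coeff c W) v)
    (hX : ∀ Y i, LocPrim (fun X => Z X Y i) fun X => fieldX c W (v (X, Y)) i) :
    ∀ᵐ X, ∀ Y, HasDerivAt (fun ξ => Z ξ Y) (fieldX c W (v (X, Y))) X := by
  have h1 : ∀ i : Fin 5, ∀ᵐ X, ∀ Y, HasDerivAt (fun ξ => Z ξ Y i) (fieldX c W (v (X, Y)) i) X :=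
    fun i => ae_forall_hasDerivAt (fun Y => hX Y i) fun M => by
      obtain ⟨L, -, hL⟩ := h.lipschitz_fieldX hs M
      exact ⟨L, hL i⟩
  filter_upwards [ae_all_iff.2 h1] with X hX Y
  exact hasDerivAt_pi.2 fun i => hX i Y

theorem ae_hasDerivAt_Y (hs : Speed c W κ) (h : SpinorSol (coeff c W) v)
    (hY : ∀ X i, LocPrim (fun Y => Z X Y i) fun Y => fieldY c W (v (X, Y)) i) :
    ∀ᵐ Y, ∀ X, HasDerivAt (fun η => Z X η) (fieldY c W (v (X, Y))) Y := by
  have h1 : ∀ i : Fin 5, ∀ᵐ Y, ∀ X, HasDerivAt (fun η => Z X η i) (fieldY c W (v (X, Y)) i) Y :=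
    fun i => ae_forall_hasDerivAt (z := fun Y X => Z X Y i) (fun X => hY X i) fun M => by
      obtain ⟨L, -, hL⟩ := h.lipschitz_fieldY hs M
      exact ⟨L, hL i⟩
  filter_upwards [ae_all_iff.2 h1] with Y hY X
  exact hasDerivAt_pi.2 fun i => hY i X

/-- The potential of the fields of a spinor solution belongs to `ℋ(Ω)`. The densities of `x + J` are
assumed to be nonzero somewhere on almost every characteristic, which by `density_pos` is enough. -/
theorem memHOn (hs : Speed c W κ) (h : SpinorSol (coeff c W) v)
    (hX : ∀ Y i, LocPrim (fun X => Z X Y i) fun X => fieldX c W (v (X, Y)) i)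
    (hY : ∀ X i, LocPrim (fun Y => Z X Y i) fun Y => fieldY c W (v (X, Y)) i)
    (hU : ∀ X Y, Z X Y 2 = W (v (X, Y) 4))
    (pX : ∀ᵐ X, ∃ Y, v (X, Y) 0 ^ 2 + v (X, Y) 1 ^ 2 ≠ 0)
    (pY : ∀ᵐ Y, ∃ X, v (X, Y) 2 ^ 2 + v (X, Y) 3 ^ 2 ≠ 0) (Xl Xr Yl Yr : ℝ) :
    MemHOn c Z Xl Xr Yl Yr := by
  have dX' := h.ae_hasDerivAt_X hs hX
  have dY' := h.ae_hasDerivAt_Y hs hY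
  have eX : ∀ᵐ X, ∀ Y, dX Z X Y = fieldX c W (v (X, Y)) :=
    dX'.mono fun X hX Y => (hX Y).deriv
  have eY : ∀ᵐ Y, ∀ X, dY Z X Y = fieldY c W (v (X, Y)) :=
    dY'.mono fun X hX Y => (hX Y).deriv
  set M := max (max |Xl| |Xr|) (max |Yl| |Yr|) with hM
  have mX : ∀ X ∈ Icc Xl Xr, |X| ≤ M := fun X hX =>
    (abs_le_max_abs_abs hX.1 hX.2).trans (le_max_left _ _)
  have mY : ∀ Y ∈ Icc Yl Yr, |Y| ≤ M := fun X hX =>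
    (abs_le_max_abs_abs hX.1 hX.2).trans (le_max_right _ _)
  obtain ⟨L₁, hL₁, lX⟩ := h.lipschitz_fieldX hs M
  obtain ⟨L₂, hL₂, lY⟩ := h.lipschitz_fieldY hs M
  have bound : ∀ φ : (Fin 5 → ℝ) → Fin 5 → ℝ, (∀ i, Continuous fun v => φ v i) →
      ∃ B, 0 ≤ B ∧ ∀ p : ℝ × ℝ, |p.1| ≤ M → |p.2| ≤ M → ‖φ (v p)‖ ≤ B := by
    intro φ hφ
    choose B hB using fun i => LocBdd.comp_vec (hφ i) h.bdd M
    refine ⟨∑ j, |B j|, Finset.sum_nonneg fun j _ => abs_nonneg _, fun p h1 h2 => ?_⟩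
    rw [pi_norm_le_iff_of_nonneg (Finset.sum_nonneg fun j _ => abs_nonneg _)]
    intro i
    exact (hB i p h1 h2).trans ((le_abs_self _).trans (Finset.single_le_sum
      (f := fun j => |B j|) (fun j _ => abs_nonneg _) (Finset.mem_univ i)))
  obtain ⟨B₁, hB₁, bX⟩ := bound _ hs.continuous_fieldX
  obtain ⟨B₂, hB₂, bY⟩ := bound _ hs.continuous_fieldY
  refine ⟨⟨⟨(B₁ + B₂).toNNReal, LipschitzOnWith.of_dist_le_mul ?_⟩,
    ⟨(B₁ + L₁).toNNReal, ?_⟩, ⟨(B₂ + L₂).toNNReal, ?_⟩, ?_, ?_⟩, ?_, ?_⟩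
  · rintro ⟨X, Y⟩ ⟨h1, h2⟩ ⟨X', Y'⟩ ⟨h3, h4⟩
    rw [Real.coe_toNNReal _ (by positivity), dist_pi_le_iff (by positivity)]
    intro i
    have e1 : |Z X Y i - Z X' Y i| ≤ B₁ * |X - X'| := by
      rw [(hX Y i).eq X' X, ← Real.norm_eq_abs]
      refine intervalIntegral.norm_integral_le_of_norm_le_const fun ξ hξ => ?_
      have := uIcc_subset_Icc h3 h1 (uIoc_subset_uIcc hξ)
      exact (norm_le_pi_norm _ i).trans (bX (ξ, Y) (mX ξ this) (mY Y h2))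
    have e2 : |Z X' Y i - Z X' Y' i| ≤ B₂ * |Y - Y'| := by
      rw [(hY X' i).eq Y' Y, ← Real.norm_eq_abs]
      refine intervalIntegral.norm_integral_le_of_norm_le_const fun ξ hξ => ?_
      have := uIcc_subset_Icc h4 h2 (uIoc_subset_uIcc hξ)
      exact (norm_le_pi_norm _ i).trans (bY (X', ξ) (mX X' h3) (mY ξ this))
    have d1 : |X - X'| ≤ dist (X, Y) (X', Y') := by
      rw [Prod.dist_eq]; exact le_max_left _ _
    have d2 : |Y - Y'| ≤ dist (X, Y) (X', Y') := by
      rw [Prod.dist_eq]; exact le_max_right _ _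
    rw [Real.dist_eq]
    have := abs_sub_le (Z X Y i) (Z X' Y i) (Z X' Y' i)
    nlinarith
  · rw [ae_restrict_iff' measurableSet_Icc]
    filter_upwards [dX', eX] with X h1 h2 hXm
    refine ⟨fun Y hY => ⟨(h1 Y).differentiableAt, ?_⟩, LipschitzOnWith.of_dist_le_mul ?_⟩
    · rw [h2 Y, Real.coe_toNNReal _ (by positivity)]
      linarith [bX (X, Y) (mX X hXm) (mY Y hY)]
    · intro Y hY Y' hY'
      rw [h2, h2, Real.coe_toNNReal _ (by positivity), dist_pi_le_iff (by positivity)]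
      intro i
      have := lX i X Y Y' (mX X hXm) (mY Y hY) (mY Y' hY')
      rw [Real.dist_eq, Real.dist_eq]
      nlinarith [abs_nonneg (Y - Y')]
  · rw [ae_restrict_iff' measurableSet_Icc]
    filter_upwards [dY', eY] with Y h1 h2 hYm
    refine ⟨fun X hX => ⟨(h1 X).differentiableAt, ?_⟩, LipschitzOnWith.of_dist_le_mul ?_⟩
    · rw [h2 X, Real.coe_toNNReal _ (by positivity)]
      linarith [bY (X, Y) (mX X hX) (mY Y hYm)]
    · intro X hX X' hX'
      rw [h2, h2, Real.coe_toNNReal _ (by positivity), dist_pi_le_iff (by positivity)]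
      intro i
      have := lY i Y X X' (mY Y hYm) (mX X hX) (mX X' hX')
      rw [Real.dist_eq, Real.dist_eq]
      nlinarith [abs_nonneg (X - X')]
  · apply ae_restrict_of_ae
    filter_upwards [eX] with X h1
    apply ae_restrict_of_ae
    have h2 := fun i => (h.locPrim_fieldX hs hs.continuous_coeff X i).ae_hasDerivAt
    filter_upwards [ae_all_iff.2 h2, eY] with Y h3 h4
    have e : F c (Z X Y) (dX Z X Y) (dY Z X Y) = fieldXY c W (v (X, Y)) := by
      rw [h1, h4, fieldXY]
      simp only [F, hU]
    rw [e, show (fun η => dX Z X η) = fun η => fieldX c W (v (X, η)) from funext h1]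
    exact hasDerivAt_pi.2 h3
  · apply ae_restrict_of_ae
    filter_upwards [eY] with Y h1
    apply ae_restrict_of_ae
    have h2 := fun i => (h.locPrim_fieldY hs Y i).ae_hasDerivAt
    filter_upwards [ae_all_iff.2 h2, eX] with X h3 h4
    have e : F c (Z X Y) (dX Z X Y) (dY Z X Y) = fieldXY c W (v (X, Y)) := by
      rw [h1, h4, fieldXY]
      simp only [F, hU]
    rw [e, show (fun ξ => dY Z ξ Y) = fun ξ => fieldY c W (v (ξ, Y)) from funext h1]
    exact hasDerivAt_pi.2 h3
  · apply ae_restrict_of_ae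
    filter_upwards [eX, pX] with X h1 ⟨Y₀, h2⟩ Y _
    rw [h1, hU]
    exact fieldX_rel hs (h.density_pos hs h2 Y)
  · apply ae_restrict_of_ae
    filter_upwards [eY, pY] with Y h1 ⟨X₀, h2⟩ X _
    rw [h1, hU]
    exact fieldY_rel hs (h.swap.density_pos hs h2 X)

end SpinorSol

end fields

/-! ### Properties of global solutions -/

theorem hasDerivAt_flipT {f : ℝ → Fin 5 → ℝ} {f' : Fin 5 → ℝ} {x : ℝ} (h : HasDerivAt f f' x) :
    HasDerivAt (fun y => flipT (f y)) (flipT f') x := by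
  have h' := hasDerivAt_pi.1 h
  refine hasDerivAt_pi.2 fun i => ?_
  fin_cases i
  exacts [(h' 0).neg, h' 1, h' 2, h' 3, (h' 4).neg]

theorem dX_flipT (Z : ℝ → ℝ → Fin 5 → ℝ) (X Y : ℝ) :
    dX (fun X Y => flipT (Z Y X)) X Y = flipT (dY Z Y X) := by
  unfold dX dY
  by_cases hd : DifferentiableAt ℝ (fun η => Z Y η) X
  · exact (hasDerivAt_flipT hd.hasDerivAt).deriv
  · rw [deriv_zero_of_not_differentiableAt hd, deriv_zero_of_not_differentiableAt]
    · funext i; fin_cases i <;> simp [flipT]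
    · intro h
      apply hd
      have := (hasDerivAt_flipT h.hasDerivAt).differentiableAt
      simpa only [flipT_flipT] using this

theorem dY_flipT (Z : ℝ → ℝ → Fin 5 → ℝ) (X Y : ℝ) :
    dY (fun X Y => flipT (Z Y X)) X Y = flipT (dX Z Y X) := by
  have := dX_flipT (fun X Y => flipT (Z Y X)) Y X
  simp only [flipT_flipT] at this
  rw [show (fun X Y => Z X Y) = Z from rfl] at this
  rw [this, flipT_flipT]

theorem norm_flipT (z : Fin 5 → ℝ) : ‖flipT z‖ = ‖z‖ := by
  have key : ∀ z : Fin 5 → ℝ, ‖flipT z‖ ≤ ‖z‖ := fun z => by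
    rw [pi_norm_le_iff_of_nonneg (norm_nonneg _)]
    intro i
    fin_cases i
    · simpa [flipT] using norm_le_pi_norm z 0
    · exact norm_le_pi_norm z 1
    · exact norm_le_pi_norm z 2
    · exact norm_le_pi_norm z 3
    · simpa [flipT] using norm_le_pi_norm z 4
  exact le_antisymm (key z) (by simpa [flipT_flipT] using key (flipT z))

theorem lipschitzWith_flipT : LipschitzWith 1 flipT := by
  refine LipschitzWith.of_dist_le_mul fun z z' => ?_
  rw [dist_eq_norm, dist_eq_norm, NNReal.coe_one, one_mul, ← norm_flipT (z - z')]
  apply le_of_eq; congr 1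
  funext i; fin_cases i <;> simp [flipT] <;> ring

/-- `Z` belongs to `ℋ(Ω)` for every rectangle `Ω`. -/
def MemHLoc (c : ℝ → ℝ) (Z : ℝ → ℝ → Fin 5 → ℝ) : Prop :=
  ∀ Xl Xr Yl Yr : ℝ, Xl < Xr → Yl < Yr → MemHOn c Z Xl Xr Yl Yr

namespace MemHLoc

variable {c : ℝ → ℝ} {Z : ℝ → ℝ → Fin 5 → ℝ}

/-- The system is invariant under the exchange of `X` and `Y` combined with the reversal of
time. -/
theorem swap (h : MemHLoc c Z) : MemHLoc c fun X Y => flipT (Z Y X) := by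
  intro Xl Xr Yl Yr hXlr hYlr
  obtain ⟨⟨⟨L, lip⟩, ⟨L₁, rX⟩, ⟨L₂, rY⟩, eX, eY⟩, relX, relY⟩ := h Yl Yr Xl Xr hYlr hXlr
  have hF : ∀ X Y, F c (flipT (Z Y X)) (flipT (dY Z Y X)) (flipT (dX Z Y X)) =
      flipT (F c (Z Y X) (dX Z Y X) (dY Z Y X)) := fun X Y => F_flip c _ _ _ _ rfl
  refine ⟨⟨⟨L, ?_⟩, ⟨L₂, ?_⟩, ⟨L₁, ?_⟩, ?_, ?_⟩, ?_, ?_⟩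
  · refine LipschitzOnWith.of_dist_le_mul fun p hp q hq => ?_
    refine (lipschitzWith_flipT.dist_le_mul _ _).trans ?_
    rw [NNReal.coe_one, one_mul]
    have := lip.dist_le_mul p.swap ⟨hp.2, hp.1⟩ q.swap ⟨hq.2, hq.1⟩
    rwa [Prod.dist_eq, max_comm] at this
  · filter_upwards [rY] with X hX
    simp only [dX_flipT, norm_flipT]
    refine ⟨fun Y hY => ⟨(hasDerivAt_flipT (hX.1 Y hY).1.hasDerivAt).differentiableAt, (hX.1 Y hY).2⟩, ?_⟩
    have := lipschitzWith_flipT.comp_lipschitzOnWith hX.2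
    rwa [one_mul] at this
  · filter_upwards [rX] with X hX
    simp only [dY_flipT, norm_flipT]
    refine ⟨fun Y hY => ⟨(hasDerivAt_flipT (hX.1 Y hY).1.hasDerivAt).differentiableAt, (hX.1 Y hY).2⟩, ?_⟩
    have := lipschitzWith_flipT.comp_lipschitzOnWith hX.2
    rwa [one_mul] at this
  · filter_upwards [eY] with X hX
    filter_upwards [hX] with Y hY
    simp only [dX_flipT, dY_flipT, hF]
    exact hasDerivAt_flipT hY
  · filter_upwards [eX] with X hX
    filter_upwards [hX] with Y hY
    simp only [dX_flipT, dY_flipT, hF]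
    exact hasDerivAt_flipT hY
  · filter_upwards [relY] with X hX Y hY
    obtain ⟨h1, h2, h3⟩ := hX Y hY
    simp only [dX_flipT]
    refine ⟨?_, ?_, h3⟩
    · simp only [flipT, Matrix.cons_val, mul_neg]; exact h1
    · simp only [flipT, Matrix.cons_val, mul_neg]; exact h2
  · filter_upwards [relX] with X hX Y hY
    obtain ⟨h1, h2, h3⟩ := hX Y hY
    simp only [dY_flipT]
    refine ⟨?_, ?_, h3⟩
    · simp only [flipT, Matrix.cons_val, mul_neg, neg_neg]; exact h1
    · simp only [flipT, Matrix.cons_val, mul_neg, neg_neg]; exact h2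

theorem lipschitzOnWith (h : MemHLoc c Z) (M : ℝ) :
    ∃ L : ℝ≥0, LipschitzOnWith L (fun p : ℝ × ℝ => Z p.1 p.2) (Icc (-M) M ×ˢ Icc (-M) M) := by
  obtain ⟨L, hL⟩ := (h (-(|M| + 1)) (|M| + 1) (-(|M| + 1)) (|M| + 1)
    (by linarith [abs_nonneg M]) (by linarith [abs_nonneg M])).solution.lipschitz
  refine ⟨L, hL.mono (prod_mono ?_ ?_)⟩ <;>
    exact Icc_subset_Icc (by linarith [le_abs_self M]) (by linarith [le_abs_self M])

theorem continuous (h : MemHLoc c Z) : Continuous fun p : ℝ × ℝ => Z p.1 p.2 := by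
  rw [continuous_iff_continuousAt]
  rintro ⟨X, Y⟩
  obtain ⟨L, hL⟩ := h.lipschitzOnWith (|X| + |Y| + 1)
  refine hL.continuousOn.continuousAt (prod_mem_nhds (Icc_mem_nhds ?_ ?_) (Icc_mem_nhds ?_ ?_)) <;>
    linarith [neg_abs_le X, le_abs_self X, neg_abs_le Y, le_abs_self Y, abs_nonneg X, abs_nonneg Y]

theorem lipschitzOnWith_fst (h : MemHLoc c Z) (M : ℝ) : ∃ L : ℝ≥0, ∀ Y, |Y| ≤ M →
    LipschitzOnWith L (fun X => Z X Y) (Icc (-M) M) := by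
  obtain ⟨L, hL⟩ := h.lipschitzOnWith M
  refine ⟨L, fun Y hY => LipschitzOnWith.of_dist_le_mul fun X hX X' hX' => ?_⟩
  have := hL.dist_le_mul (X, Y) ⟨hX, abs_le.1 hY⟩ (X', Y) ⟨hX', abs_le.1 hY⟩
  simpa [Prod.dist_eq] using this

theorem ae_of_forall_nat {p : ℕ → ℝ → Prop} 
    (hp : ∀ n, ∀ᵐ X ∂volume.restrict (Icc (-(n + 1 : ℝ)) (n + 1)),
    p n X) :
    ∀ᵐ X : ℝ, ∀ n : ℕ, |X| ≤ n + 1 → p n X := by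
  refine ae_all_iff.2 fun n => ?_
  have := hp n
  rw [ae_restrict_iff' measurableSet_Icc] at this
  exact this.mono fun X hX hn => hX (abs_le.1 hn)

theorem exists_nat (X Y : ℝ) : ∃ n : ℕ, |X| ≤ n + 1 ∧ |Y| ≤ n + 1 := by
  obtain ⟨n, hn⟩ := exists_nat_ge (max |X| |Y|)
  exact ⟨n, by linarith [le_max_left |X| |Y|], by linarith [le_max_right |X| |Y|]⟩

theorem nat_lt (n : ℕ) : -(n + 1 : ℝ) < n + 1 := by
  have : (0 : ℝ) ≤ n := n.cast_nonneg
  linarith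

theorem ae_hasDerivAt (h : MemHLoc c Z) :
    ∀ᵐ X, ∀ Y, HasDerivAt (fun ξ => Z ξ Y) (dX Z X Y) X := by
  have h1 := fun n : ℕ => (h _ _ _ _ (nat_lt n) (nat_lt n)).solution.reg_X
  choose L hL using h1
  filter_upwards [ae_of_forall_nat hL] with X hX Y
  obtain ⟨n, h1, h2⟩ := exists_nat X Y
  exact (((hX n h1).1 Y (abs_le.1 h2)).1).hasDerivAt

theorem ae_rel (h : MemHLoc c Z) : ∀ᵐ X, ∀ Y,
    dX Z X Y 1 = c (Z X Y 2) * dX Z X Y 0 ∧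
    dX Z X Y 3 = c (Z X Y 2) * dX Z X Y 4 ∧
    2 * dX Z X Y 3 * dX Z X Y 1 = (c (Z X Y 2) * dX Z X Y 2) ^ 2 ∧
    0 ≤ dX Z X Y 1 ∧ 0 ≤ dX Z X Y 3 ∧ 0 < dX Z X Y 1 + dX Z X Y 3 := by
  filter_upwards [ae_of_forall_nat fun n : ℕ => (h _ _ _ _ (nat_lt n) (nat_lt n)).rel_X] with X hX Y
  obtain ⟨n, h1, h2⟩ := exists_nat X Y
  exact hX n h1 Y (abs_le.1 h2)

theorem ae_eq (h : MemHLoc c Z) : ∀ᵐ X, ∀ᵐ Y,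
    HasDerivAt (fun η => dX Z X η) (F c (Z X Y) (dX Z X Y) (dY Z X Y)) Y := by
  filter_upwards [ae_of_forall_nat fun n : ℕ =>
    (h _ _ _ _ (nat_lt n) (nat_lt n)).solution.eq_X] with X hX
  have h1 : ∀ᵐ Y : ℝ, ∀ n : ℕ, |Y| ≤ n + 1 → |X| ≤ n + 1 →
      HasDerivAt (fun η => dX Z X η) (F c (Z X Y) (dX Z X Y) (dY Z X Y)) Y := by
    refine ae_all_iff.2 fun n => ?_
    by_cases hn : |X| ≤ n + 1
    · have := hX n hn
      rw [ae_restrict_iff' measurableSet_Icc] at this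
      exact this.mono fun Y hY h1 _ => hY (abs_le.1 h1)
    · exact ae_of_all _ fun Y _ h2 => absurd h2 hn
  filter_upwards [h1] with Y hY
  obtain ⟨n, h1, h2⟩ := exists_nat X Y
  exact hY n h2 h1

/-- Almost every `Z_X(X, ·)` is bounded and Lipschitz on bounded intervals, uniformly for bounded
`X`. -/
theorem ae_lipschitz (h : MemHLoc c Z) (M : ℝ) : ∃ L : ℝ≥0, ∀ᵐ X, |X| ≤ M →
    LipschitzOnWith L (fun Y => dX Z X Y) (Icc (-M) M) := by
  obtain ⟨n, h1, -⟩ := exists_nat M 0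
  obtain ⟨L, hL⟩ := (h _ _ _ _ (nat_lt n) (nat_lt n)).solution.reg_X
  rw [ae_restrict_iff' measurableSet_Icc] at hL
  refine ⟨L, hL.mono fun X hX hXM => ?_⟩
  have h2 := abs_le.1 h1
  exact (hX (abs_le.1 (hXM.trans ((le_abs_self M).trans h1)))).2.mono
    (Icc_subset_Icc (by linarith) (by linarith))

theorem locPrim (h : MemHLoc c Z) (Y : ℝ) (i : Fin 5) :
    LocPrim (fun X => Z X Y i) fun X => dX Z X Y i := by
  have hl : ∀ M, ∃ L : ℝ≥0, LipschitzOnWith L (fun X => Z X Y) (Icc (-M) M) := fun M => by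
    obtain ⟨L, hL⟩ := h.lipschitzOnWith_fst (max M |Y|)
    exact ⟨L, (hL Y (le_max_right _ _)).mono (Icc_subset_Icc (neg_le_neg (le_max_left _ _))
      (le_max_left _ _))⟩
  refine LocPrim.of_ae ((measurable_pi_apply i).comp (measurable_deriv _)) (fun M => ?_)
    (fun M => ?_) ?_
  · obtain ⟨L, hL⟩ := hl (M + 1)
    refine ⟨L, fun X hX => (norm_le_pi_norm (dX Z X Y) i).trans ?_⟩
    refine norm_deriv_le_of_lipschitzOn (Icc_mem_nhds ?_ ?_) hL <;> linarith [abs_le.1 hX]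
  · obtain ⟨L, hL⟩ := hl M
    refine ⟨L, LipschitzOnWith.of_dist_le_mul fun X hX X' hX' => ?_⟩
    exact (dist_le_pi_dist (Z X Y) (Z X' Y) i).trans (hL.dist_le_mul X hX X' hX')
  · exact h.ae_hasDerivAt.mono fun X hX => hasDerivAt_pi.1 (hX Y) i

/-- Mixed differences are quadratically small. This replaces joint differentiability of `Z` in the
chain rule along curves. -/
theorem mixed_le (h : MemHLoc c Z) (M : ℝ) : ∃ L : ℝ≥0, ∀ X X' Y Y', |X| ≤ M → |X'| ≤ M →
    |Y| ≤ M → |Y'| ≤ M → ‖Z X' Y' - Z X Y' - (Z X' Y - Z X Y)‖ ≤ L * |X' - X| * |Y' - Y| := by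
  obtain ⟨L, hL⟩ := h.ae_lipschitz M
  refine ⟨L, fun X X' Y Y' hX hX' hY hY' => ?_⟩
  rw [pi_norm_le_iff_of_nonneg (by positivity)]
  intro i
  have e : (Z X' Y' - Z X Y' - (Z X' Y - Z X Y)) i =
      ∫ ξ in X..X', (dX Z ξ Y' i - dX Z ξ Y i) := by
    rw [intervalIntegral.integral_sub ((h.locPrim Y' i).intervalIntegrable _ _)
      ((h.locPrim Y i).intervalIntegrable _ _), ← (h.locPrim Y' i).eq, ← (h.locPrim Y i).eq]
    simp
  rw [e, mul_right_comm]
  refine intervalIntegral.norm_integral_le_of_norm_le_const_ae ?_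
  filter_upwards [hL] with ξ hξ hm
  have h1 := abs_le.2 (uIcc_subset_Icc (abs_le.1 hX) (abs_le.1 hX') (uIoc_subset_uIcc hm))
  have h2 := (hξ h1).dist_le_mul Y' (abs_le.1 hY') Y (abs_le.1 hY)
  rw [dist_eq_norm, Real.dist_eq] at h2
  exact (norm_le_pi_norm (dX Z ξ Y' - dX Z ξ Y) i).trans h2

end MemHLoc

theorem hasDerivAt_zero_of_bound {f : ℝ → Fin 5 → ℝ} {g : ℝ → ℝ} {s K : ℝ} (hg : HasDerivAt g 0 s)
    (hfg : ∀ᶠ s' in 𝓝 s, ‖f s' - f s‖ ≤ K * |g s' - g s|) : HasDerivAt f 0 s := by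
  rw [hasDerivAt_iff_isLittleO] at hg ⊢
  simp only [smul_zero, sub_zero] at hg ⊢
  exact (Asymptotics.IsBigO.of_bound K hfg).trans_isLittleO hg

namespace MemHLoc

variable {c : ℝ → ℝ} {Z : ℝ → ℝ → Fin 5 → ℝ} {𝒳 𝒴 : ℝ → ℝ}

/-- Where `𝒳` has zero derivative, differentiability of `Z` in `X` is not needed, as `Z` is
locally Lipschitz. -/
theorem hasDerivAt_fst (h : MemHLoc c Z) {s Y : ℝ} (hd : DifferentiableAt ℝ 𝒳 s)
    (h0 : deriv 𝒳 s = 0 ∨ HasDerivAt (fun ξ => Z ξ Y) (dX Z (𝒳 s) Y) (𝒳 s)) :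
    HasDerivAt (fun s' => Z (𝒳 s') Y) (deriv 𝒳 s • dX Z (𝒳 s) Y) s := by
  rcases h0 with h0 | h0
  · have h1 := hd.hasDerivAt
    rw [h0] at h1
    rw [h0, zero_smul]
    set M := max (|𝒳 s| + 1) |Y|
    obtain ⟨L, hL⟩ := h.lipschitzOnWith_fst M
    refine hasDerivAt_zero_of_bound (K := L) h1 ?_
    have h2 : ∀ᶠ s' in 𝓝 s, |𝒳 s' - 𝒳 s| < 1 := by
      have := (h1.continuousAt.sub (continuousAt_const (y := 𝒳 s))).abs
      refine this.eventually_lt continuousAt_const ?_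
      simp
    filter_upwards [h2] with s' hs'
    have h3 : |𝒳 s'| ≤ |𝒳 s| + 1 := by
      have := abs_sub_abs_le_abs_sub (𝒳 s') (𝒳 s); linarith
    have := (hL Y (le_max_right _ _)).dist_le_mul (𝒳 s') (abs_le.1 (le_max_of_le_left h3)) (𝒳 s)
      (abs_le.1 (le_max_of_le_left (by linarith)))
    rwa [dist_eq_norm, Real.dist_eq] at this
  · exact h0.scomp s hd.hasDerivAt

theorem hasDerivAt_snd (h : MemHLoc c Z) {s X : ℝ} (hd : DifferentiableAt ℝ 𝒴 s)
    (h0 : deriv 𝒴 s = 0 ∨ HasDerivAt (fun η => Z X η) (dY Z X (𝒴 s)) (𝒴 s)) :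
    HasDerivAt (fun s' => Z X (𝒴 s')) (deriv 𝒴 s • dY Z X (𝒴 s)) s := by
  have h1 := h.swap.hasDerivAt_fst (𝒳 := 𝒴) (s := s) (Y := X) hd
    (h0.imp_right fun h2 => by rw [dX_flipT]; exact hasDerivAt_flipT h2)
  have h2 := hasDerivAt_flipT h1
  simp only [flipT_flipT] at h2
  convert h2 using 1
  rw [dX_flipT]
  funext i; fin_cases i <;> simp [flipT]

/-- The chain rule along curves. -/
theorem ae_hasDerivAt_curve (h : MemHLoc c Z) (hC : IsCurve 𝒳 𝒴) :
    ∀ᵐ s, HasDerivAt (fun s => Z (𝒳 s) (𝒴 s))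
      (deriv 𝒳 s • dX Z (𝒳 s) (𝒴 s) + deriv 𝒴 s • dY Z (𝒳 s) (𝒴 s)) s := by
  have hX := ae_deriv_eq_zero_of_preimage_null hC.mono_X
    (ae_iff.1 h.ae_hasDerivAt)
  have hY := ae_deriv_eq_zero_of_preimage_null hC.mono_Y
    (ae_iff.1 h.swap.ae_hasDerivAt)
  filter_upwards [hX, hY, hC.lipschitz_fst.ae_differentiableAt,
    hC.lipschitz_snd.ae_differentiableAt] with s h1 h2 h3 h4
  have A := h.hasDerivAt_fst (Y := 𝒴 s) h3 (by
    by_cases h5 : ∀ Y, HasDerivAt (fun ξ => Z ξ Y) (dX Z (𝒳 s) Y) (𝒳 s)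
    · exact Or.inr (h5 _)
    · exact Or.inl (h1 h5))
  have B := h.hasDerivAt_snd (X := 𝒳 s) h4 (by
    by_cases h5 : ∀ Y, HasDerivAt (fun ξ => flipT (Z Y ξ))
        (dX (fun X Y => flipT (Z Y X)) (𝒴 s) Y) (𝒴 s)
    · refine Or.inr ?_
      have := hasDerivAt_flipT (h5 (𝒳 s))
      rw [dX_flipT] at this
      simpa only [flipT_flipT] using this
    · exact Or.inl (h2 h5))
  set M := |𝒳 s| + |𝒴 s| + 2
  obtain ⟨L, hL⟩ := h.mixed_le M
  have R : HasDerivAt (fun s' => Z (𝒳 s') (𝒴 s') - Z (𝒳 s) (𝒴 s') -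
      (Z (𝒳 s') (𝒴 s) - Z (𝒳 s) (𝒴 s))) 0 s := by
    have hg : HasDerivAt (fun s' : ℝ => (s' - s) ^ 2) 0 s := by
      have := ((hasDerivAt_id s).sub_const s).fun_pow 2
      simpa using this
    refine hasDerivAt_zero_of_bound (K := L * 4) hg ?_
    filter_upwards [Metric.ball_mem_nhds s (one_pos)] with s' hs'
    rw [Metric.mem_ball] at hs'
    have h5 := hC.lipschitz_fst.dist_le_mul s' s
    have h6 := hC.lipschitz_snd.dist_le_mul s' s
    rw [Real.dist_eq] at h5 h6 hs'
    rw [Real.dist_eq, NNReal.coe_ofNat] at h5 h6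
    have b1 : |𝒳 s'| ≤ M := by
      have := abs_sub_abs_le_abs_sub (𝒳 s') (𝒳 s)
      linarith [abs_nonneg (𝒴 s)]
    have b2 : |𝒴 s'| ≤ M := by
      have := abs_sub_abs_le_abs_sub (𝒴 s') (𝒴 s)
      linarith [abs_nonneg (𝒳 s)]
    have := hL (𝒳 s) (𝒳 s') (𝒴 s) (𝒴 s') (by linarith [abs_nonneg (𝒴 s)]) b1
      (by linarith [abs_nonneg (𝒳 s)]) b2
    simp only [sub_self, sub_zero, ne_eq, OfNat.ofNat_ne_zero, not_false_eq_true, zero_pow]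
    rw [abs_pow]
    refine this.trans ?_
    have e : (L : ℝ) * 4 * |s' - s| ^ 2 = L * (2 * |s' - s|) * (2 * |s' - s|) := by ring
    rw [e]
    gcongr
  have := ((R.add A).add B).sub_const (Z (𝒳 s) (𝒴 s))
  rw [zero_add] at this
  refine this.congr_of_eventuallyEq (Eventually.of_forall fun s' => ?_)
  simp only [Pi.add_apply]
  abel

end MemHLoc

/-! ### The initial change of variables -/

section initPos

variable (μ : Measure ℝ) [IsFiniteMeasure μ]

theorem tendsto_real_Iio_right (x : ℝ) :
    Tendsto (fun y => μ.real (Iio y)) (𝓝[>] x) (𝓝 (μ.real (Iic x))) := by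
  have h := tendsto_measure_biInter_gt (μ := μ) (s := fun r : ℝ => Iio r) (a := x)
    (fun r _ => measurableSet_Iio.nullMeasurableSet) (fun i j _ hij => Iio_subset_Iio hij)
    ⟨x + 1, by simp, measure_ne_top _ _⟩
  have e : (⋂ r > x, Iio r) = Iic x := by
    ext y
    simp only [mem_iInter, mem_Iio, mem_Iic]
    exact forall_gt_iff_le
  rw [e] at h
  exact (ENNReal.tendsto_toReal (measure_ne_top _ _)).comp h

theorem tendsto_real_Iio_left (x : ℝ) :
    Tendsto (fun n : ℕ => μ.real (Iio (x - 1 / ((n : ℝ) + 1)))) atTop (𝓝 (μ.real (Iio x))) := by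
  have hm : Monotone fun n : ℕ => Iio (x - 1 / ((n : ℝ) + 1)) := fun n m hnm =>
    Iio_subset_Iio (by
      have : 1 / ((m : ℝ) + 1) ≤ 1 / ((n : ℝ) + 1) := Nat.one_div_le_one_div hnm
      linarith)
  have h := tendsto_measure_iUnion_atTop (μ := μ) hm
  have e : (⋃ n : ℕ, Iio (x - 1 / ((n : ℝ) + 1))) = Iio x := by
    ext y
    simp only [mem_iUnion, mem_Iio]
    constructor
    · rintro ⟨n, hn⟩
      have : 0 < 1 / ((n : ℝ) + 1) := Nat.one_div_pos_of_nat
      linarith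
    · intro hy
      obtain ⟨n, hn⟩ := exists_nat_one_div_lt (sub_pos.2 hy)
      exact ⟨n, by linarith⟩
  rw [e] at h
  exact (ENNReal.tendsto_toReal (measure_ne_top _ _)).comp h

theorem real_Iio_mono : Monotone fun x => μ.real (Iio x) := fun _ _ h =>
  measureReal_mono (Iio_subset_Iio h)

theorem initPos_aux (X : ℝ) : {x | ∀ x' < x, x' + μ.real (Iio x') < X}.Nonempty ∧
    BddAbove {x | ∀ x' < x, x' + μ.real (Iio x') < X} := by
  constructor
  · refine ⟨X - μ.real univ, fun x' hx' => ?_⟩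
    have : μ.real (Iio x') ≤ μ.real univ := measureReal_mono (subset_univ _)
    linarith
  · refine ⟨X + 1, fun x hx => ?_⟩
    by_contra! hlt
    have := hx (X + 1) hlt
    have := measureReal_nonneg (μ := μ) (s := Iio (X + 1))
    linarith

theorem lt_of_lt_initPos {x X : ℝ} (h : x < initPos μ X) : x + μ.real (Iio x) < X := by
  obtain ⟨y, hy, hxy⟩ := exists_lt_of_lt_csSup (initPos_aux μ X).1 h
  exact hy x hxy

theorem le_of_initPos_lt {x X : ℝ} (h : initPos μ X < x) : X ≤ x + μ.real (Iio x) := by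
  by_contra! hlt
  refine absurd (le_csSup (initPos_aux μ X).2 (a := x) fun x' hx' => ?_) (not_le.2 h)
  have := real_Iio_mono μ hx'.le
  simp only at this
  linarith

/-- Together with `initPos_upper`: the graph of `initPos μ` is the inverse of the graph of
`x + μ((-∞, x))`, with its jumps filled in. -/
theorem initPos_lower (X : ℝ) : initPos μ X + μ.real (Iio (initPos μ X)) ≤ X := by
  have h1 : Tendsto (fun n : ℕ => initPos μ X - 1 / ((n : ℝ) + 1)) atTop (𝓝 (initPos μ X - 0)) :=
    tendsto_const_nhds.sub tendsto_one_div_add_atTop_nhds_zero_nat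
  rw [sub_zero] at h1
  refine le_of_tendsto' (h1.add (tendsto_real_Iio_left μ _)) fun n => ?_
  have : 0 < 1 / ((n : ℝ) + 1) := Nat.one_div_pos_of_nat
  exact (lt_of_lt_initPos μ (by linarith)).le

theorem initPos_upper (X : ℝ) : X ≤ initPos μ X + μ.real (Iic (initPos μ X)) := by
  have h1 : Tendsto (fun x : ℝ => x) (𝓝[>] (initPos μ X)) (𝓝 (initPos μ X)) :=
    tendsto_id.mono_left nhdsWithin_le_nhds
  refine ge_of_tendsto (h1.add (tendsto_real_Iio_right μ _)) ?_
  filter_upwards [self_mem_nhdsWithin] with x hx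
  exact le_of_initPos_lt μ hx

theorem initPos_lt_iff (b X : ℝ) : initPos μ X < b ↔ X < b + μ.real (Iio b) := by
  constructor
  · intro h
    have h1 := initPos_upper μ X
    have h2 : μ.real (Iic (initPos μ X)) ≤ μ.real (Iio b) :=
      measureReal_mono (Iic_subset_Iio.2 h)
    linarith
  · intro h
    by_contra! hb
    have h1 := initPos_lower μ X
    have := real_Iio_mono μ hb
    simp only at this
    linarith

theorem initPos_apply (x : ℝ) : initPos μ (x + μ.real (Iio x)) = x := by
  apply le_antisymm
  · refine le_of_forall_gt fun b hb => (initPos_lt_iff μ b _).2 ?_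
    have := real_Iio_mono μ hb.le
    simp only at this
    linarith
  · by_contra! h
    rw [initPos_lt_iff] at h
    exact lt_irrefl _ h

theorem initPos_mono : Monotone (initPos μ) := fun X X' h => by
  refine le_of_forall_gt fun b hb => ?_
  rw [initPos_lt_iff] at hb ⊢
  linarith

theorem initPos_sub_le {X X' : ℝ} (h : X ≤ X') : initPos μ X' - initPos μ X ≤ X' - X := by
  rcases (initPos_mono μ h).eq_or_lt with he | hlt
  · linarith
  · have h1 := initPos_lower μ X'
    have h2 := initPos_upper μ X
    have h3 : μ.real (Iic (initPos μ X)) ≤ μ.real (Iio (initPos μ X')) :=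
      measureReal_mono (Iic_subset_Iio.2 hlt)
    linarith

theorem initPos_lipschitz : LipschitzWith 1 (initPos μ) := by
  refine LipschitzWith.of_dist_le_mul fun X X' => ?_
  rw [NNReal.coe_one, one_mul, Real.dist_eq, Real.dist_eq]
  rcases le_total X X' with h | h
  · rw [abs_sub_comm, abs_sub_comm X, abs_of_nonneg (sub_nonneg.2 (initPos_mono μ h)),
      abs_of_nonneg (sub_nonneg.2 h)]
    exact initPos_sub_le μ h
  · rw [abs_of_nonneg (sub_nonneg.2 (initPos_mono μ h)), abs_of_nonneg (sub_nonneg.2 h)]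
    exact initPos_sub_le μ h

theorem initPos_le (X : ℝ) : initPos μ X ≤ X := by
  have := initPos_lower μ X
  have := measureReal_nonneg (μ := μ) (s := Iio (initPos μ X))
  linarith

theorem sub_initPos_le (X : ℝ) : X - initPos μ X ≤ μ.real univ := by
  have := initPos_upper μ X
  have : μ.real (Iic (initPos μ X)) ≤ μ.real univ := measureReal_mono (subset_univ _)
  linarith

theorem initPos_surjective : Function.Surjective (initPos μ) :=
  fun x => ⟨_, initPos_apply μ x⟩

theorem tendsto_sub_initPos_atBot : Tendsto (fun X => X - initPos μ X) atBot (𝓝 0) := by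
  have h1 : Tendsto (fun x => μ.real (Ici x)) atBot (𝓝 (μ.real univ)) :=
    (ENNReal.tendsto_toReal (measure_ne_top _ _)).comp (tendsto_measure_Ici_atBot μ)
  have h2 : Tendsto (fun X : ℝ => μ.real univ - μ.real (Ici (X + 1))) atBot (𝓝 0) := by
    have := (h1.comp (tendsto_atBot_add_const_right atBot (1 : ℝ) tendsto_id)).const_sub
      (μ.real univ)
    simpa using this
  refine squeeze_zero (fun X => sub_nonneg.2 (initPos_le μ X)) (fun X => ?_) h2
  have h3 := initPos_upper μ X
  have h4 : μ.real (Iic (initPos μ X)) ≤ μ.real (Iio (X + 1)) :=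
    measureReal_mono (Iic_subset_Iio.2 (by linarith [initPos_le μ X]))
  have h5 : μ.real (Iio (X + 1)) = μ.real univ - μ.real (Ici (X + 1)) := by
    rw [← measureReal_compl measurableSet_Ici, compl_Ici]
  linarith

theorem tendsto_sub_initPos_atTop : Tendsto (fun X => X - initPos μ X) atTop (𝓝 (μ.real univ)) := by
  have h1 : Tendsto (fun x => μ.real (Iic x)) atTop (𝓝 (μ.real univ)) :=
    (ENNReal.tendsto_toReal (measure_ne_top _ _)).comp (tendsto_measure_Iic_atTop μ)
  have h2 : Tendsto (fun X : ℝ => μ.real (Iic (X - μ.real univ - 1))) atTop (𝓝 (μ.real univ)) :=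
    h1.comp (tendsto_atTop_add_const_right atTop (-1 : ℝ)
      (tendsto_atTop_add_const_right atTop (-μ.real univ) tendsto_id))
  refine tendsto_of_tendsto_of_tendsto_of_le_of_le h2 tendsto_const_nhds (fun X => ?_)
    (sub_initPos_le μ)
  have h3 := initPos_lower μ X
  have h4 : μ.real (Iic (X - μ.real univ - 1)) ≤ μ.real (Iio (initPos μ X)) :=
    measureReal_mono (Iic_subset_Iio.2 (by linarith [sub_initPos_le μ X]))
  linarith

theorem stieltjes_Iio : (real_Iio_mono μ).stieltjesFunction.measure = μ := by
  refine Measure.ext_of_Ioc _ _ fun a b hab => ?_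
  have e : ∀ x, (real_Iio_mono μ).stieltjesFunction x = μ.real (Iic x) := fun x => by
    rw [Monotone.stieltjesFunction_eq]
    exact rightLim_eq_of_tendsto (tendsto_real_Iio_right μ x)
  rw [StieltjesFunction.measure_Ioc, e, e, ← ofReal_measureReal (μ := μ) (s := Ioc a b),
    ← Iic_sdiff_Iic]
  congr 1
  exact (measureReal_sdiff (Iic_subset_Iic.2 hab.le) measurableSet_Iic).symm

/-- The inverse function theorem for `x₁`: where the measure has the finite density `ρ`, the
derivative of `x₁` is `1 / (1 + ρ)`, and on the preimage of the exceptional set it vanishes. -/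
theorem ae_deriv_initPos {ρ : ℝ → ℝ}
    (hρ : ∀ᵐ x, (μ.rnDeriv volume x).toReal = ρ x) :
    ∀ᵐ X, deriv (initPos μ) X = 0 ∨ deriv (initPos μ) X * (1 + ρ (initPos μ X)) = 1 := by
  have h1 := (real_Iio_mono μ).ae_hasDerivAt
  rw [stieltjes_Iio] at h1
  have h2 : ∀ᵐ x, HasDerivAt (fun x => μ.real (Iio x)) (ρ x) x := by
    filter_upwards [h1, hρ] with x hx1 hx2
    rwa [hx2] at hx1
  have h3 := ae_deriv_eq_zero_of_preimage_null (initPos_mono μ) (ae_iff.1 h2)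
  filter_upwards [h3, (initPos_lipschitz μ).ae_differentiableAt] with X h4 h5
  by_cases h6 : HasDerivAt (fun x => μ.real (Iio x)) (ρ (initPos μ X)) (initPos μ X)
  · right
    set x := initPos μ X
    have h7 : HasDerivAt (fun x => x + μ.real (Iio x)) (1 + ρ x) x := (hasDerivAt_id x).add h6
    have h8 : x + μ.real (Iio x) = X := by
      refine le_antisymm (initPos_lower μ X) ((initPos_upper μ X).trans ?_)
      have := tendsto_nhds_unique (tendsto_real_Iio_right μ x)
        (h6.continuousAt.tendsto.mono_left nhdsWithin_le_nhds)
      exact add_le_add le_rfl this.le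
    have h9 : HasDerivAt (initPos μ) (deriv (initPos μ) X) (x + μ.real (Iio x)) := by
      rw [h8]; exact h5.hasDerivAt
    have h10 := h9.comp x h7
    have h11 : (initPos μ ∘ fun x => x + μ.real (Iio x)) = id := funext fun x => initPos_apply μ x
    rw [h11] at h10
    exact h10.unique (hasDerivAt_id x)
  · exact Or.inl (h4 h6)

/-- The relation between the position, the energy and the derivative along the new coordinate. -/
theorem ae_initPos_rel {R : ℝ → ℝ} (hR : AEStronglyMeasurable R volume)
    (hμ : volume.withDensity (μ.rnDeriv volume) =
      volume.withDensity (fun x => ENNReal.ofReal (R x ^ 2 / 4))) :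
    ∀ᵐ X, (1 - deriv (initPos μ) X) * deriv (initPos μ) X =
      (R (initPos μ X) * deriv (initPos μ) X / 2) ^ 2 := by
  have hm : AEMeasurable (fun x => ENNReal.ofReal (R x ^ 2 / 4)) volume :=
    ((hR.aemeasurable.pow_const 2).div_const 4).ennreal_ofReal
  rw [withDensity_eq_iff_of_sigmaFinite (Measure.measurable_rnDeriv _ _).aemeasurable hm] at hμ
  have h1 : ∀ᵐ x, (μ.rnDeriv volume x).toReal = R x ^ 2 / 4 := by
    filter_upwards [hμ] with x hx
    rw [hx, ENNReal.toReal_ofReal (by positivity)]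
  filter_upwards [ae_deriv_initPos μ h1] with X hX
  rcases hX with h | h
  · simp [h]
  · linear_combination (-deriv (initPos μ) X) * h

theorem deriv_initPos_mem (X : ℝ) : 0 ≤ deriv (initPos μ) X ∧ deriv (initPos μ) X ≤ 1 := by
  refine ⟨(initPos_mono μ).deriv_nonneg, ?_⟩
  have := norm_deriv_le_of_lipschitz (initPos_lipschitz μ) (x₀ := X)
  exact (le_abs_self _).trans (by simpa using this)

end initPos

/-! ### Bounds for data in the original variables -/

section initial

variable {c W A : ℝ → ℝ} {κ : ℝ} {ζ : EulerData}

theorem LipschitzWith.comp_absolutelyContinuous {φ f : ℝ → ℝ} {K : ℝ≥0} {a b : ℝ}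
    (hφ : LipschitzWith K φ) (hf : AbsolutelyContinuousOnInterval f a b) :
    AbsolutelyContinuousOnInterval (fun x => φ (f x)) a b := by
  rw [absolutelyContinuousOnInterval_iff] at hf ⊢
  intro ε hε
  obtain ⟨δ, hδ, h⟩ := hf (ε / (K + 1)) (by positivity)
  refine ⟨δ, hδ, fun E hE hE' => ?_⟩
  have h1 := h E hE hE'
  rw [lt_div_iff₀ (by positivity)] at h1
  refine lt_of_le_of_lt ?_ h1
  rw [Finset.sum_mul]
  refine Finset.sum_le_sum fun i _ => ?_
  refine (hφ.dist_le_mul _ _).trans ?_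
  rw [mul_comm]
  exact mul_le_mul_of_nonneg_left (by linarith) dist_nonneg

theorem Speed.inv_le (hs : Speed c W κ) (v : ℝ) : (c v)⁻¹ ≤ κ :=
  inv_le_of_inv_le₀ hs.κ_pos (hs.bounds v).1

/-- The right-hand side `(R - S) / (2 c(u))` is square integrable. -/
theorem MemD.memLp_ux (hs : Speed c W κ) (h : MemD c ζ) :
    MemLp (fun x => (ζ.R x - ζ.S x) / (2 * c (ζ.u x))) 2 volume := by
  have h1 : MemLp (fun x => κ * (ζ.R x - ζ.S x)) 2 volume := (h.memLp_R.sub h.memLp_S).const_mul κ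
  refine h1.mono ?_ (ae_of_all _ fun x => ?_)
  · have h2 : AEStronglyMeasurable (fun x => c (ζ.u x)) volume :=
      hs.smooth.continuous.comp_aestronglyMeasurable h.memLp_u.1
    exact ((h.memLp_R.1.sub h.memLp_S.1).aemeasurable.div
      (h2.aemeasurable.const_mul 2)).aestronglyMeasurable
  · have hp := hs.pos (ζ.u x)
    rw [norm_div, norm_mul, div_eq_mul_inv, mul_comm, norm_mul, Real.norm_of_nonneg hp.le,
      Real.norm_of_nonneg hs.κ_pos.le]
    refine mul_le_mul_of_nonneg_right ?_ (norm_nonneg _)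
    rw [mul_inv]
    have := hs.inv_le (ζ.u x)
    have : 0 < (c (ζ.u x))⁻¹ := inv_pos.2 hp
    norm_num
    linarith

theorem MemLp.intervalIntegrable_two {f : ℝ → ℝ} (hf : MemLp f 2 volume) (a b : ℝ) :
    IntervalIntegrable f volume a b :=
  ((hf.locallyIntegrable (by norm_num)).integrableOn_isCompact isCompact_uIcc).intervalIntegrable

theorem MemD.continuous_u (hs : Speed c W κ) (h : MemD c ζ) : Continuous ζ.u := by
  have h1 := intervalIntegral.continuous_primitive
    (fun a b => MemLp.intervalIntegrable_two (h.memLp_ux hs) a b) 0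
  have : ζ.u = fun x => ζ.u 0 + ∫ y in (0 : ℝ)..x, (ζ.R y - ζ.S y) / (2 * c (ζ.u y)) := by
    funext x
    have := h.u_x 0 x
    linarith
  rw [this]
  exact continuous_const.add h1

/-- A square integrable function with square integrable derivative is bounded. -/
theorem MemD.bdd_u (hs : Speed c W κ) (h : MemD c ζ) : ∃ B, ∀ x, |ζ.u x| ≤ B := by
  set g : ℝ → ℝ := fun x => (ζ.R x - ζ.S x) / (2 * c (ζ.u x)) with hg
  have hg2 := h.memLp_ux hs
  have hgi := MemLp.intervalIntegrable_two hg2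
  have hI : Integrable (fun x => ζ.u x ^ 2 + g x ^ 2) volume :=
    h.memLp_u.integrable_sq.add hg2.integrable_sq
  set I := ∫ x, (ζ.u x ^ 2 + g x ^ 2)
  have key : ∀ a b, a ≤ b → |ζ.u b * ζ.u b - ζ.u a * ζ.u a| ≤ I := by
    intro a b hab
    have h1 := mul_sub_mul_eq_integral hab (hgi a b) (hgi a b)
      (f := ζ.u) (g := ζ.u) (fun x _ => by have := h.u_x a x; linarith)
      (fun x _ => by have := h.u_x a x; linarith)
    rw [h1, ← Real.norm_eq_abs]
    refine (intervalIntegral.norm_integral_le_integral_norm hab).trans ?_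
    rw [intervalIntegral.integral_of_le hab]
    have h2 : ∀ x, ‖g x * ζ.u x + ζ.u x * g x‖ ≤ ζ.u x ^ 2 + g x ^ 2 := fun x => by
      rw [Real.norm_eq_abs, abs_le]
      constructor <;> nlinarith [sq_nonneg (ζ.u x + g x), sq_nonneg (ζ.u x - g x)]
    refine (integral_mono_of_nonneg (ae_of_all _ fun x => norm_nonneg _) hI.integrableOn
      (ae_of_all _ h2)).trans ?_
    exact setIntegral_le_integral hI (ae_of_all _ fun x => by positivity)
  have hex : ∃ a, |ζ.u a| ≤ 1 := by
    by_contra! hn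
    have h3 : Integrable (fun _ : ℝ => (1 : ℝ)) volume :=
      h.memLp_u.integrable_sq.mono' aestronglyMeasurable_const (ae_of_all _ fun x => by
        have := hn x
        rw [norm_one, ← sq_abs]; nlinarith)
    rw [integrable_const_iff] at h3
    simp [isFiniteMeasure_iff] at h3
  obtain ⟨a, ha⟩ := hex
  refine ⟨1 + I, fun x => ?_⟩
  have h4 : |ζ.u x * ζ.u x - ζ.u a * ζ.u a| ≤ I := by
    rcases le_total a x with hax | hax
    · exact key a x hax
    · rw [abs_sub_comm]; exact key x a hax
  have hI0 : 0 ≤ I := (abs_nonneg _).trans h4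
  have h5 := (abs_le.1 h4).2
  have h6 : ζ.u a * ζ.u a ≤ 1 := by nlinarith [abs_le.1 ha]
  refine abs_le_of_sq_le_sq (by nlinarith) (by linarith)

/-- The primitive `A` of `c` turns the equation for `u_x` into `A(u)_x = (R - S) / 2`. -/
theorem MemD.primitive_u (hs : Speed c W κ) (h : MemD c ζ) (hA : ∀ v, HasDerivAt A (c v) v)
    (a b : ℝ) : A (ζ.u b) - A (ζ.u a) = ∫ x in a..b, (ζ.R x - ζ.S x) / 2 := by
  set g : ℝ → ℝ := fun x => (ζ.R x - ζ.S x) / (2 * c (ζ.u x)) with hg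
  have hgi := MemLp.intervalIntegrable_two (h.memLp_ux hs)
  have hAl : LipschitzWith κ.toNNReal A := by
    refine lipschitzWith_of_nnnorm_deriv_le (fun v => (hA v).differentiableAt) fun v => ?_
    rw [(hA v).deriv, ← NNReal.coe_le_coe, coe_nnnorm, Real.norm_of_nonneg (hs.pos v).le]
    exact (hs.bounds v).2.trans (Real.le_coe_toNNReal κ)
  have hu : ∀ x, ζ.u x = ζ.u a + ∫ y in a..x, g y := fun x => by have := h.u_x a x; linarith
  have hac : AbsolutelyContinuousOnInterval ζ.u a b := by
    have h1 := ((LipschitzWith.const (α := ℝ) (ζ.u a)).lipschitzOnWith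
      (s := uIcc a b)).absolutelyContinuousOnInterval.add
      ((hgi a b).absolutelyContinuousOnInterval_intervalIntegral left_mem_uIcc)
    rwa [show ζ.u = (fun _ => ζ.u a) + fun x => ∫ y in a..x, g y from funext hu]
  rw [← (LipschitzWith.comp_absolutelyContinuous hAl hac).integral_deriv_eq_sub]
  apply intervalIntegral.integral_congr_ae
  filter_upwards [(hgi a b).ae_hasDerivAt_integral] with x hx hxm
  have h2 : HasDerivAt ζ.u (g x) x := by
    have := (hx (uIoc_subset_uIcc hxm) a left_mem_uIcc).const_add (ζ.u a)
    exact this.congr_of_eventuallyEq (Eventually.of_forall hu)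
  have := ((hA (ζ.u x)).comp x h2).deriv
  simp only [Function.comp_def] at this
  rw [this, hg]
  have := (hs.pos (ζ.u x)).ne'
  field_simp

end initial

/-! ### The data in the characteristic variables at time zero -/

section side

variable {c W : ℝ → ℝ} {κ : ℝ} {μ : Measure ℝ} [IsFiniteMeasure μ] {r u : ℝ → ℝ}

/-- The energy `J(X) = X - x(X)` carried by one family of characteristics. -/
noncomputable def energy (μ : Measure ℝ) (X : ℝ) : ℝ := X - initPos μ X

/-- The potential `K` that belongs to `energy`. -/
noncomputable def energyK (c u : ℝ → ℝ) (μ : Measure ℝ) (X : ℝ) : ℝ :=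
  ∫ ξ in Iic X, deriv (energy μ) ξ / c (u (initPos μ ξ))

/-- The initial values of `Z_X`. -/
noncomputable def sideV (c u r : ℝ → ℝ) (μ : Measure ℝ) (X : ℝ) : Fin 5 → ℝ :=
  ![deriv (initPos μ) X / (2 * c (u (initPos μ X))), deriv (initPos μ) X / 2,
    r (initPos μ X) / (2 * c (u (initPos μ X))) * deriv (initPos μ) X,
    deriv (energy μ) X, deriv (energyK c u μ) X]

theorem energy_mono : Monotone (energy μ) := fun X X' h => by
  have := initPos_sub_le μ h
  simp only [energy]; linarith

theorem lipschitz_energy : LipschitzWith 1 (energy μ) := by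
  refine LipschitzWith.of_dist_le_mul fun X X' => ?_
  have key : ∀ X X' : ℝ, X ≤ X' → |energy μ X' - energy μ X| ≤ |X' - X| := fun X X' h => by
    rw [abs_of_nonneg (sub_nonneg.2 (energy_mono h)), abs_of_nonneg (sub_nonneg.2 h)]
    have := initPos_mono μ h
    simp only [energy]; linarith
  rw [NNReal.coe_one, one_mul, Real.dist_eq, Real.dist_eq]
  rcases le_total X X' with h | h
  · rw [abs_sub_comm, abs_sub_comm X]; exact key X X' h
  · exact key X' X h

theorem ae_deriv_energy : ∀ᵐ X, deriv (energy μ) X = 1 - deriv (initPos μ) X := by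
  filter_upwards [(initPos_lipschitz μ).ae_differentiableAt] with X hX
  exact ((hasDerivAt_id X).sub hX.hasDerivAt).deriv

theorem deriv_energy_mem (X : ℝ) : 0 ≤ deriv (energy μ) X ∧ deriv (energy μ) X ≤ 1 := by
  refine ⟨energy_mono.deriv_nonneg, ?_⟩
  have := norm_deriv_le_of_lipschitz (lipschitz_energy (μ := μ)) (x₀ := X)
  exact (le_abs_self _).trans (by simpa using this)

theorem energy_sub (a b : ℝ) : energy μ b - energy μ a = ∫ X in a..b, deriv (energy μ) X :=
  (integral_eq_sub_of_lipschitzOn (lipschitz_energy (μ := μ)).lipschitzOnWith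
    ((lipschitz_energy (μ := μ)).ae_differentiableAt.mono fun _ hx _ => hx.hasDerivAt)).symm

theorem energy_mem (X : ℝ) : 0 ≤ energy μ X ∧ energy μ X ≤ μ.real univ :=
  ⟨sub_nonneg.2 (initPos_le μ X), sub_initPos_le μ X⟩

theorem intervalIntegrable_deriv_energy (a b : ℝ) :
    IntervalIntegrable (deriv (energy μ)) volume a b := by
  refine (intervalIntegrable_const (c := (1 : ℝ))).mono_fun
    (measurable_deriv _).aestronglyMeasurable (ae_of_all _ fun X => ?_)
  beta_reduce
  rw [norm_one, Real.norm_of_nonneg (deriv_energy_mem X).1]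
  exact (deriv_energy_mem X).2

theorem integrable_deriv_energy : Integrable (deriv (energy μ)) volume := by
  refine integrable_of_intervalIntegral_norm_bounded (l := atTop) (a := fun n : ℝ => -n)
    (b := fun n : ℝ => n) (μ.real univ) (fun n => ?_) tendsto_neg_atTop_atBot tendsto_id
    (Eventually.of_forall fun n => ?_)
  · exact (intervalIntegrable_deriv_energy (-n) n).1
  · simp only [Real.norm_of_nonneg (deriv_energy_mem (μ := μ) _).1]
    rw [← energy_sub]
    linarith [energy_mem (μ := μ) n, energy_mem (μ := μ) (-n)]

theorem bound_densityK (hs : Speed c W κ) (X : ℝ) :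
    0 ≤ deriv (energy μ) X / c (u (initPos μ X)) ∧
    deriv (energy μ) X / c (u (initPos μ X)) ≤ κ * deriv (energy μ) X := by
  have h1 := deriv_energy_mem (μ := μ) X
  refine ⟨div_nonneg h1.1 (hs.pos _).le, ?_⟩
  rw [div_eq_mul_inv, mul_comm]
  exact mul_le_mul_of_nonneg_right (hs.inv_le _) h1.1

theorem measurable_densityK (hs : Speed c W κ) (hu : Continuous u) :
    Measurable fun X => deriv (energy μ) X / c (u (initPos μ X)) :=
  (measurable_deriv _).div (hs.smooth.continuous.comp
    (hu.comp (initPos_lipschitz μ).continuous)).measurable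

theorem integrable_densityK (hs : Speed c W κ) (hu : Continuous u) :
    Integrable (fun X => deriv (energy μ) X / c (u (initPos μ X))) := by
  refine ((integrable_deriv_energy (μ := μ)).const_mul κ).mono'
    (measurable_densityK hs hu).aestronglyMeasurable (ae_of_all _ fun X => ?_)
  rw [Real.norm_of_nonneg (bound_densityK hs X).1]
  exact (bound_densityK hs X).2

theorem energyK_sub (hs : Speed c W κ) (hu : Continuous u) (a b : ℝ) :
    energyK c u μ b - energyK c u μ a =
    ∫ X in a..b, deriv (energy μ) X / c (u (initPos μ X)) :=
  intervalIntegral.integral_Iic_sub_Iic (integrable_densityK hs hu).integrableOn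
    (integrable_densityK hs hu).integrableOn

theorem energyK_mem (hs : Speed c W κ) (hu : Continuous u) (X : ℝ) :
    0 ≤ energyK c u μ X ∧ energyK c u μ X ≤
    ∫ X, deriv (energy μ) X / c (u (initPos μ X)) :=
  ⟨setIntegral_nonneg measurableSet_Iic fun X _ => (bound_densityK hs X).1,
    setIntegral_le_integral (integrable_densityK hs hu)
      (ae_of_all _ fun X => (bound_densityK hs X).1)⟩

theorem ae_deriv_energyK (hs : Speed c W κ) (hu : Continuous u) :
    ∀ᵐ X, deriv (energyK c u μ) X =
    deriv (energy μ) X / c (u (initPos μ X)) := by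
  filter_upwards [LocallyIntegrable.ae_hasDerivAt_integral
    (integrable_densityK (μ := μ) hs hu).locallyIntegrable] with X hX
  refine (((hX 0).const_add (energyK c u μ 0)).congr_of_eventuallyEq
    (Eventually.of_forall fun y => ?_)).deriv
  have := energyK_sub (μ := μ) hs hu 0 y
  simp only; linarith

/-- Spinor components of the initial data: they exist because of the algebraic relation, the sign
of `β` being that of `r`. -/
theorem exists_spinor_side (hr : AEStronglyMeasurable r volume)
    (hμ : volume.withDensity (μ.rnDeriv volume) =
      volume.withDensity (fun x => ENNReal.ofReal (r x ^ 2 / 4))) :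
    ∃ α β : ℝ → ℝ, Measurable α ∧ Measurable β ∧ (∀ X, |α X| ≤ 1) ∧ (∀ X, |β X| ≤ 1) ∧
      ∀ᵐ X, α X * α X = deriv (initPos μ) X / 2 ∧ β X * β X = deriv (energy μ) X ∧
        √2 * (α X * β X) = r (initPos μ X) * deriv (initPos μ) X / 2 := by
  set r' := hr.mk r
  have hr' : Measurable r' := hr.stronglyMeasurable_mk.measurable
  have hx : Measurable (initPos μ) := (initPos_lipschitz μ).continuous.measurable
  have hpos : MeasurableSet {X | 0 ≤ r' (initPos μ X)} := measurableSet_le measurable_const (hr'.comp hx)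
  have mβ : Measurable fun X => √(deriv (energy μ) X) := (measurable_deriv _).sqrt
  refine ⟨fun X => √(deriv (initPos μ) X / 2), fun X => {X | 0 ≤ r' (initPos μ X)}.indicator
      (fun X => √(deriv (energy μ) X)) X - {X | 0 ≤ r' (initPos μ X)}ᶜ.indicator
      (fun X => √(deriv (energy μ) X)) X, ((measurable_deriv _).div_const 2).sqrt,
    (mβ.indicator hpos).sub (mβ.indicator hpos.compl), fun X => ?_, fun X => ?_, ?_⟩
  · rw [abs_of_nonneg (Real.sqrt_nonneg _)]
    exact Real.sqrt_le_one.2 (by linarith [(deriv_initPos_mem μ X).2])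
  · have h1 : √(deriv (energy μ) X) ≤ 1 := Real.sqrt_le_one.2 (deriv_energy_mem X).2
    by_cases h : 0 ≤ r' (initPos μ X)
    · simpa [indicator, h, abs_of_nonneg (Real.sqrt_nonneg _)] using h1
    · simpa [indicator, h, abs_of_nonneg (Real.sqrt_nonneg _)] using h1
  · have hN := ae_deriv_eq_zero_of_preimage_null (initPos_mono μ) (ae_iff.1 hr.ae_eq_mk)
    filter_upwards [ae_initPos_rel μ hr hμ, ae_deriv_energy (μ := μ), hN] with X h1 h2 h3
    have h4 := deriv_initPos_mem μ X
    have h5 := deriv_energy_mem (μ := μ) X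
    have e1 : r (initPos μ X) * deriv (initPos μ) X = r' (initPos μ X) * deriv (initPos μ) X := by
      by_cases h : r (initPos μ X) = r' (initPos μ X)
      · rw [h]
      · rw [h3 h]; simp
    have e2 : √2 * (√(deriv (initPos μ) X / 2) * √(deriv (energy μ) X)) =
        |r' (initPos μ X) * deriv (initPos μ) X / 2| := by
      rw [← Real.sqrt_mul (by linarith), ← Real.sqrt_mul (by norm_num), ← Real.sqrt_sq_eq_abs]
      congr 1
      rw [← e1, ← h1, h2]; ring
    refine ⟨Real.mul_self_sqrt (by linarith), ?_, ?_⟩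
    · by_cases h : 0 ≤ r' (initPos μ X)
      · simp [indicator, h, Real.mul_self_sqrt h5.1]
      · simp [indicator, h, Real.mul_self_sqrt h5.1]
    · by_cases h : 0 ≤ r' (initPos μ X)
      · simp only [indicator, mem_ofPred_eq, h, if_true, mem_compl_iff, not_true, if_false, sub_zero]
        rw [e2, e1, abs_of_nonneg (div_nonneg (mul_nonneg h h4.1) two_pos.le)]
      · simp only [indicator, mem_ofPred_eq, h, if_true, mem_compl_iff, not_false_iff, if_false,
          zero_sub, mul_neg]
        rw [e2, e1, abs_of_nonpos (div_nonpos_of_nonpos_of_nonneg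
          (mul_nonpos_of_nonpos_of_nonneg (not_le.1 h).le h4.1) two_pos.le), neg_neg]

/-- The initial values of `Z_X` in terms of the spinor components. -/
theorem sideV_eq_fieldX (hs : Speed c W κ) (hu : Continuous u) {α β : ℝ → ℝ}
    (h : ∀ᵐ X, α X * α X = deriv (initPos μ) X / 2 ∧ β X * β X = deriv (energy μ) X ∧
        √2 * (α X * β X) = r (initPos μ X) * deriv (initPos μ) X / 2) :
    ∀ᵐ X, ∀ v : Fin 5 → ℝ, v 0 = α X → v 1 = β X → W (v 4) = u (initPos μ X) →
      fieldX c W v = sideV c u r μ X := by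
  filter_upwards [h, ae_deriv_energyK (μ := μ) hs hu] with X ⟨h1, h2, h3⟩ h4 v e0 e1 e4
  have h0 := (hs.pos (u (initPos μ X))).ne'
  funext i
  fin_cases i
  · simp only [fieldX, sideV, Fin.zero_eta, Matrix.cons_val, e0, e4, h1]; field_simp
  · simp only [fieldX, sideV, Fin.mk_one, Matrix.cons_val, e0, h1]
  · simp only [fieldX, sideV, Fin.reduceFinMk, Matrix.cons_val, e0, e1, e4]
    rw [mul_left_comm, h3]; field_simp
  · simp only [fieldX, sideV, Fin.reduceFinMk, Matrix.cons_val, e1, h2]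
  · simp only [fieldX, sideV, Fin.reduceFinMk, Matrix.cons_val, e1, e4, h2, h4]
    field_simp

end side

/-! ### The initial curve -/

section initialCurve

variable {c W A u r : ℝ → ℝ} {κ : ℝ} {μ ν : Measure ℝ} [IsFiniteMeasure μ] [IsFiniteMeasure ν]

/-- The region above the initial curve. -/
def initRegion (μ ν : Measure ℝ) : Set (ℝ × ℝ) := {p | initPos μ p.1 < initPos ν p.2}

theorem isOpen_initRegion : IsOpen (initRegion μ ν) :=
  isOpen_lt ((initPos_lipschitz μ).continuous.comp continuous_fst)
    ((initPos_lipschitz ν).continuous.comp continuous_snd)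

theorem isRegion_initRegion :
    IsRegion (initRegion μ ν) (max (μ.real univ) (ν.real univ)) where
  meas := isOpen_initRegion.measurableSet
  nw h hX hY := ((initPos_mono μ hX).trans_lt h).trans_le (initPos_mono ν hY)
  le {X Y} h := by
    have h : initPos μ X < initPos ν Y := h
    linarith [sub_initPos_le μ X, initPos_le ν Y, le_max_left (μ.real univ) (ν.real univ)]
  ge {X Y} h := by
    have h : initPos ν Y ≤ initPos μ X := not_lt.1 h
    linarith [sub_initPos_le ν Y, initPos_le μ X, le_max_right (μ.real univ) (ν.real univ)]

/-- On the initial curve the two families of characteristics are at the same position. -/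
theorem initPos_edge (s : ℝ) : initPos μ (edge (initRegion μ ν) s) =
    initPos ν (2 * s - edge (initRegion μ ν) s) := by
  have h := isRegion_initRegion (μ := μ) (ν := ν)
  apply le_antisymm
  · have h1 : ∀ᶠ X in 𝓝[<] (edge (initRegion μ ν) s), initPos μ X ≤ initPos ν (2 * s - X) := by
      filter_upwards [self_mem_nhdsWithin] with X hX
      exact le_of_lt (h.mem_of_lt_edge hX)
    exact le_of_tendsto_of_tendsto
      (((initPos_lipschitz μ).continuous.tendsto _).mono_left nhdsWithin_le_nhds)
      ((((initPos_lipschitz ν).continuous.comp (continuous_const.sub continuous_id)).tendsto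
        _).mono_left nhdsWithin_le_nhds) h1
  · exact not_lt.1 (h.edge_notMem isOpen_initRegion s)

theorem integral_sideV (hs : Speed c W κ) (hu : Continuous u) (a b : ℝ) (i : Fin 5) :
    ∫ X in a..b, sideV c u r μ X i = ![∫ x in (initPos μ a)..(initPos μ b), 1 / (2 * c (u x)),
      (initPos μ b - initPos μ a) / 2,
      ∫ x in (initPos μ a)..(initPos μ b), r x / (2 * c (u x)),
      energy μ b - energy μ a, energyK c u μ b - energyK c u μ a] i := by
  have hcv := intervalIntegral_comp_of_monotone (initPos_mono μ) (initPos_lipschitz μ) a b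
  fin_cases i
  · simp only [Fin.zero_eta, sideV, Matrix.cons_val]
    rw [hcv]
    exact intervalIntegral.integral_congr fun X _ => by ring
  · simp only [Fin.mk_one, sideV, Matrix.cons_val]
    rw [intervalIntegral.integral_div]
    congr 1
    have := hcv fun _ => 1
    simp only [mul_one, intervalIntegral.integral_const, smul_eq_mul] at this
    exact this.symm
  · simp only [Fin.reduceFinMk, sideV, Matrix.cons_val]
    rw [hcv]
    exact intervalIntegral.integral_congr fun X _ => by ring
  · simp only [Fin.reduceFinMk, sideV, Matrix.cons_val]
    exact (energy_sub a b).symm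
  · simp only [Fin.reduceFinMk, sideV, Matrix.cons_val]
    rw [energyK_sub hs hu]
    apply intervalIntegral.integral_congr_ae
    filter_upwards [ae_deriv_energyK (μ := μ) hs hu] with X hX _
    exact hX

/-- Integration along a curve, split into the two families of characteristics. -/
theorem curve_integral {𝒳 𝒴 f p q : ℝ → ℝ} (hC : IsCurve 𝒳 𝒴) (hp : Measurable p)
    (hq : Measurable q) {B : ℝ} (bp : ∀ X, |p X| ≤ B) (bq : ∀ Y, |q Y| ≤ B)
    (hf : ∀ M, ∃ L : ℝ≥0, LipschitzOnWith L f (Icc (-M) M))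
    (hd : ∀ᵐ s, HasDerivAt f (deriv 𝒳 s * p (𝒳 s) + deriv 𝒴 s * q (𝒴 s)) s) (a b : ℝ) :
    f b - f a = (∫ X in (𝒳 a)..(𝒳 b), p X) + ∫ Y in (𝒴 a)..(𝒴 b), q Y := by
  have hi : ∀ {𝒳 p : ℝ → ℝ}, LipschitzWith 2 𝒳 → Measurable p → (∀ X, |p X| ≤ B) →
      IntervalIntegrable (fun s => deriv 𝒳 s * p (𝒳 s)) volume a b := by
    intro 𝒳 p hL hp bp
    refine (intervalIntegrable_const (c := 2 * B)).mono_fun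
      ((measurable_deriv _).mul (hp.comp hL.continuous.measurable)).aestronglyMeasurable
      (ae_of_all _ fun s => ?_)
    have h1 := norm_deriv_le_of_lipschitz hL (x₀ := s)
    have hB := (abs_nonneg _).trans (bp 0)
    simp only [norm_mul, Real.norm_eq_abs, NNReal.coe_ofNat, abs_of_nonneg hB, abs_two] at h1 ⊢
    exact mul_le_mul h1 (bp _) (abs_nonneg _) two_pos.le
  rw [intervalIntegral_comp_of_monotone hC.mono_X hC.lipschitz_fst,
    intervalIntegral_comp_of_monotone hC.mono_Y hC.lipschitz_snd,
    ← intervalIntegral.integral_add (hi hC.lipschitz_fst hp bp) (hi hC.lipschitz_snd hq bq)]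
  obtain ⟨L, hL⟩ := hf (max |a| |b|)
  refine (integral_eq_sub_of_lipschitzOn (hL.mono ?_) (hd.mono fun s hs _ => hs)).symm
  exact uIcc_subset_Icc (abs_le.1 (le_max_left _ _)) (abs_le.1 (le_max_right _ _))

theorem abs_fieldX_le (hs : Speed c W κ) {v : Fin 5 → ℝ} (h0 : |v 0| ≤ 1) (h1 : |v 1| ≤ 1)
    (i : Fin 5) : |fieldX c W v i| ≤ 2 * (κ + 1) := by
  have hk := hs.κ_pos
  have hc0 : 0 < (c (W (v 4)))⁻¹ := inv_pos.2 (hs.pos _)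
  have hc1 := hs.inv_le (W (v 4))
  have e0 : |v 0 * v 0| ≤ 1 := by rw [abs_mul]; nlinarith [abs_nonneg (v 0)]
  have e1 : |v 1 * v 1| ≤ 1 := by rw [abs_mul]; nlinarith [abs_nonneg (v 1)]
  have e2 : |v 0 * v 1| ≤ 1 := by rw [abs_mul]; nlinarith [abs_nonneg (v 0), abs_nonneg (v 1)]
  have hr : √2 ≤ 2 := by rw [Real.sqrt_le_left (by norm_num)]; norm_num
  have key : ∀ y, |y| ≤ 1 → |(c (W (v 4)))⁻¹ * y| ≤ κ := fun y hy => by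
    rw [abs_mul, abs_of_pos hc0]
    nlinarith [abs_nonneg y]
  fin_cases i
  · exact (key _ e0).trans (by linarith)
  · exact e0.trans (by linarith)
  · show |√2 * ((c (W (v 4)))⁻¹ * (v 0 * v 1))| ≤ _
    rw [abs_mul, abs_of_nonneg (Real.sqrt_nonneg 2)]
    nlinarith [key _ e2, abs_nonneg ((c (W (v 4)))⁻¹ * (v 0 * v 1)), Real.sqrt_nonneg 2]
  · exact e1.trans (by linarith)
  · exact (key _ e1).trans (by linarith)

theorem abs_flipT_le {z : Fin 5 → ℝ} {B : ℝ} (h : ∀ i, |z i| ≤ B) (i : Fin 5) :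
    |flipT z i| ≤ B := by
  fin_cases i
  · simpa [flipT] using h 0
  · exact h 1
  · exact h 2
  · exact h 3
  · simpa [flipT] using h 4

variable {ζ : EulerData}

/-- The values of `Z` on the initial curve. -/
noncomputable def initZ (c : ℝ → ℝ) (ζ : EulerData) (s : ℝ) : Fin 5 → ℝ :=
  ![0, initPos ζ.μ (edge (initRegion ζ.μ ζ.ν) s), ζ.u (initPos ζ.μ (edge (initRegion ζ.μ ζ.ν) s)),
    energy ζ.μ (edge (initRegion ζ.μ ζ.ν) s) + energy ζ.ν (2 * s - edge (initRegion ζ.μ ζ.ν) s),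
    energyK c ζ.u ζ.μ (edge (initRegion ζ.μ ζ.ν) s) -
      energyK c ζ.u ζ.ν (2 * s - edge (initRegion ζ.μ ζ.ν) s)]

/-- The initial data satisfy the compatibility condition `Ż = V(𝒳) 𝒳' + W(𝒴) 𝒴'` in integrated
form. For the component `U` it is the equation `u_x = (R - S) / (2 c(u))`, for the component `t` the
two integrals cancel. -/
theorem initZ_sub (hs : Speed c W κ) (h : MemD c ζ) (a b : ℝ) (i : Fin 5) :
    initZ c ζ b i - initZ c ζ a i =
      (∫ X in (edge (initRegion ζ.μ ζ.ν) a)..(edge (initRegion ζ.μ ζ.ν) b),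
        sideV c ζ.u ζ.R ζ.μ X i) +
      ∫ Y in (2 * a - edge (initRegion ζ.μ ζ.ν) a)..(2 * b - edge (initRegion ζ.μ ζ.ν) b),
        flipT (sideV c ζ.u (fun x => -ζ.S x) ζ.ν Y) i := by
  have := h.finite_μ
  have := h.finite_ν
  have hu := h.continuous_u hs
  set 𝒳 := edge (initRegion ζ.μ ζ.ν)
  have hx : ∀ s, initPos ζ.μ (𝒳 s) = initPos ζ.ν (2 * s - 𝒳 s) := initPos_edge
  have I1 := integral_sideV (μ := ζ.μ) (r := ζ.R) hs hu (𝒳 a) (𝒳 b)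
  have I2 := integral_sideV (μ := ζ.ν) (r := fun x => -ζ.S x) hs hu (2 * a - 𝒳 a) (2 * b - 𝒳 b)
  have J1 := I1 i
  rw [J1]
  fin_cases i
  · have := I2 0
    simp only [Fin.zero_eta, flipT, Matrix.cons_val, intervalIntegral.integral_neg, initZ] at this ⊢
    rw [this, hx, hx]; ring
  · have := I2 1
    simp only [Fin.mk_one, flipT, Matrix.cons_val, initZ] at this ⊢
    rw [this, ← hx, ← hx]; ring
  · have := I2 2
    simp only [Fin.reduceFinMk, flipT, Matrix.cons_val, initZ] at this ⊢
    rw [this, ← hx, ← hx, h.u_x]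
    have hi : ∀ r : ℝ → ℝ, MemLp r 2 volume →
        IntervalIntegrable (fun x => r x / (2 * c (ζ.u x))) volume (initPos ζ.μ (𝒳 a))
          (initPos ζ.μ (𝒳 b)) := fun r hr => by
      have h1 := (MemLp.intervalIntegrable_two hr (initPos ζ.μ (𝒳 a)) (initPos ζ.μ (𝒳 b)))
      simp only [div_eq_mul_inv]
      refine h1.mul_continuousOn (Continuous.continuousOn ?_)
      exact (continuous_const.mul (hs.smooth.continuous.comp hu)).inv₀
        fun x => (mul_pos two_pos (hs.pos _)).ne'
    rw [← intervalIntegral.integral_add (hi _ h.memLp_R) (hi (fun x => -ζ.S x) h.memLp_S.neg)]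
    exact intervalIntegral.integral_congr fun x _ => by ring
  · have := I2 3
    simp only [Fin.reduceFinMk, flipT, Matrix.cons_val, initZ] at this ⊢
    rw [this]; ring
  · have := I2 4
    simp only [Fin.reduceFinMk, flipT, Matrix.cons_val, initZ, intervalIntegral.integral_neg] at this ⊢
    rw [this]; ring

end initialCurve

/-! ### Existence of the global solution -/

section existence

variable {c W A : ℝ → ℝ} {κ : ℝ} {ζ : EulerData} {Z : ℝ → ℝ → Fin 5 → ℝ}

/-- A function on the plane with prescribed partial derivatives `P(X)` and `Q(Y)` is determined by
its values on a curve, and grows at most linearly away from the curve. -/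
theorem IsCurve.exists_sum_primitive {𝒳 𝒴 P Q g : ℝ → ℝ} {B C : ℝ} (hC : IsCurve 𝒳 𝒴)
    (mP : Measurable P) (mQ : Measurable Q) (bP : ∀ X, |P X| ≤ 2) (bQ : ∀ Y, |Q Y| ≤ 2)
    (hg : ∀ a b, g b - g a = (∫ ξ in (𝒳 a)..(𝒳 b), P ξ) + ∫ η in (𝒴 a)..(𝒴 b), Q η)
    (hB : ∀ s, |g s| ≤ B) (hXC : ∀ s, |𝒳 s - s| ≤ C / 2) :
    ∃ w : ℝ × ℝ → ℝ, Continuous w ∧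
      (∀ X X' Y, w (X', Y) - w (X, Y) = ∫ ξ in X..X', P ξ) ∧
      (∀ X Y Y', w (X, Y') - w (X, Y) = ∫ η in Y..Y', Q η) ∧
      (∀ s, w (𝒳 s, 𝒴 s) = g s) ∧ ∀ p, |w p| ≤ B + 2 * (|p.2 - p.1| + C) := by
  have iI : ∀ {P : ℝ → ℝ}, Measurable P → (∀ X, |P X| ≤ 2) → ∀ a b, IntervalIntegrable P volume a b :=
    fun mP bP a b => (intervalIntegrable_const (c := (2 : ℝ))).mono_fun mP.aestronglyMeasurable
      (ae_of_all _ fun X => by simpa using bP X)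
  have iP := iI mP bP
  have iQ := iI mQ bQ
  set w : ℝ × ℝ → ℝ := fun p =>
    g 0 + (∫ ξ in (𝒳 0)..p.1, P ξ) + ∫ η in (𝒴 0)..p.2, Q η with hw
  have hwY : ∀ X Y Y', w (X, Y') - w (X, Y) = ∫ η in Y..Y', Q η := fun X Y Y' => by
    rw [← intervalIntegral.integral_interval_sub_left (iQ (𝒴 0) Y') (iQ (𝒴 0) Y)]
    simp only [hw]; ring
  have hwc : ∀ s, w (𝒳 s, 𝒴 s) = g s := fun s => by
    simp only [hw]
    linarith [hg 0 s]
  refine ⟨w, ?_, fun X X' Y => ?_, hwY, hwc, ?_⟩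
  · have h1 := intervalIntegral.continuous_primitive iP (𝒳 0)
    have h2 := intervalIntegral.continuous_primitive iQ (𝒴 0)
    exact (continuous_const.add (h1.comp continuous_fst)).add (h2.comp continuous_snd)
  · rw [← intervalIntegral.integral_interval_sub_left (iP (𝒳 0) X') (iP (𝒳 0) X)]
    simp only [hw]; ring
  · rintro ⟨X, Y⟩
    obtain ⟨s, rfl⟩ := hC.surjective_fst X
    have h1 := hwY (𝒳 s) (𝒴 s) Y
    have h2 := intervalIntegral.norm_integral_le_of_norm_le_const (f := Q) (C := 2) (a := 𝒴 s) (b := Y)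
      fun x _ => bQ x
    rw [← h1, hwc, Real.norm_eq_abs] at h2
    have h3 := hXC s
    have h4 : |Y - 𝒴 s| ≤ |Y - 𝒳 s| + C := by
      have e : Y - 𝒴 s = (Y - 𝒳 s) + 2 * (𝒳 s - s) := by linarith [hC.add_eq s]
      rw [e]
      refine (abs_add_le _ _).trans ?_
      rw [abs_mul, abs_two]
      linarith
    have h5 : |w (𝒳 s, Y)| ≤ |g s| + |w (𝒳 s, Y) - g s| := by
      have := abs_add_le (g s) (w (𝒳 s, Y) - g s)
      simpa using this
    linarith [hB s]

theorem MemHLoc.lipschitzOnWith_curve (h : MemHLoc c Z) {𝒳 𝒴 : ℝ → ℝ} (hC : IsCurve 𝒳 𝒴) (M : ℝ) :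
    ∃ L : ℝ≥0, LipschitzOnWith L (fun s => Z (𝒳 s) (𝒴 s)) (Icc (-M) M) := by
  obtain ⟨B, hB⟩ := hC.reg_X.1
  obtain ⟨B', hB'⟩ := hC.reg_Y.1
  obtain ⟨L, hL⟩ := h.lipschitzOnWith (M + max B B')
  have hm : ∀ s ∈ Icc (-M) M, (𝒳 s, 𝒴 s) ∈ Icc (-(M + max B B')) (M + max B B') ×ˢ
      Icc (-(M + max B B')) (M + max B B') := fun s hs => by
    have h1 := abs_le.1 (hB s)
    have h2 := abs_le.1 (hB' s)
    have := le_max_left B B'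
    have := le_max_right B B'
    exact ⟨⟨by linarith [hs.1, h1.1], by linarith [hs.2, h1.2]⟩,
      ⟨by linarith [hs.1, h2.1], by linarith [hs.2, h2.2]⟩⟩
  have h2 : LipschitzWith 2 fun s => (𝒳 s, 𝒴 s) := by
    simpa using hC.lipschitz_fst.prodMk hC.lipschitz_snd
  exact ⟨L * 2, hL.comp (h2.lipschitzOnWith (s := Icc (-M) M)) hm⟩

/-- There is a solution in `ℋ` taking the prescribed data on the initial curve. -/
theorem exists_solution (hs : Speed c W κ) (hA : ∀ v, HasDerivAt A (c v) v)
    (hWA : ∀ v, W (A v) = v) (hζ : MemD c ζ) :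
    ∃ Z, MemHLoc c Z ∧
      (∀ s, Z (edge (initRegion ζ.μ ζ.ν) s) (2 * s - edge (initRegion ζ.μ ζ.ν) s) =
        initZ c ζ s) ∧
      (∀ᵐ X, ∀ s, edge (initRegion ζ.μ ζ.ν) s = X →
        dX Z X (2 * s - edge (initRegion ζ.μ ζ.ν) s) = sideV c ζ.u ζ.R ζ.μ X) ∧
      ∀ᵐ Y, ∀ s, 2 * s - edge (initRegion ζ.μ ζ.ν) s = Y →
        dY Z (edge (initRegion ζ.μ ζ.ν) s) Y =
          flipT (sideV c ζ.u (fun x => -ζ.S x) ζ.ν Y) := by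
  have := hζ.finite_μ
  have := hζ.finite_ν
  have hu := hζ.continuous_u hs
  obtain ⟨B, hB⟩ := hζ.bdd_u hs
  obtain ⟨α, β, mα, mβ, bα, bβ, hαβ⟩ := exists_spinor_side hζ.memLp_R.1 hζ.μ_ac
  obtain ⟨γ, δ, mγ, mδ, bγ, bδ, hγδ⟩ := exists_spinor_side (r := fun x => -ζ.S x) (μ := ζ.ν)
    hζ.memLp_S.1.neg (by simpa using hζ.ν_ac)
  have hE := isRegion_initRegion (μ := ζ.μ) (ν := ζ.ν)
  have ho := isOpen_initRegion (μ := ζ.μ) (ν := ζ.ν)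
  have hC := hE.isCurve
  have hx : ∀ s, initPos ζ.μ (edge (initRegion ζ.μ ζ.ν) s) =
    initPos ζ.ν (2 * s - edge (initRegion ζ.μ ζ.ν) s) := initPos_edge
  have hXC := hE.abs_edge_sub_le
  set E := initRegion ζ.μ ζ.ν
  set C := max (ζ.μ.real univ) (ζ.ν.real univ)
  set 𝒳 := edge E
  set 𝒴 : ℝ → ℝ := fun s => 2 * s - 𝒳 s with h𝒴
  -- the spinor components and `w = A(u)` on the initial curve
  have hsq : √2 ≤ 2 := by rw [Real.sqrt_le_left (by norm_num)]; norm_num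
  have bP : ∀ {α β : ℝ → ℝ}, (∀ X, |α X| ≤ 1) → (∀ X, |β X| ≤ 1) → ∀ X, |√2 * (α X * β X)| ≤ 2 := by
    intro α β bα bβ X
    rw [abs_mul, abs_mul, abs_of_nonneg (Real.sqrt_nonneg 2)]
    have := mul_le_one₀ (bα X) (abs_nonneg _) (bβ X)
    nlinarith [Real.sqrt_nonneg 2, mul_nonneg (abs_nonneg (α X)) (abs_nonneg (β X))]
  have hAc : Continuous A := continuous_iff_continuousAt.2 fun v => (hA v).continuousAt
  obtain ⟨B', hB'⟩ : ∃ B', ∀ s, |A (ζ.u (initPos ζ.μ (𝒳 s)))| ≤ B' := by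
    obtain ⟨B', hB'⟩ := isCompact_Icc.exists_bound_of_continuousOn (s := Icc (-B) B) hAc.continuousOn
    exact ⟨B', fun s => hB' _ (abs_le.1 (hB _))⟩
  have hint : ∀ {μ : Measure ℝ} [IsFiniteMeasure μ] {r α β : ℝ → ℝ},
      (∀ᵐ X, α X * α X = deriv (initPos μ) X / 2 ∧ β X * β X = deriv (energy μ) X ∧
        √2 * (α X * β X) = r (initPos μ X) * deriv (initPos μ) X / 2) → ∀ a b,
      ∫ ξ in a..b, √2 * (α ξ * β ξ) = ∫ x in (initPos μ a)..(initPos μ b), r x / 2 := by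
    intro μ _ r α β h a b
    rw [intervalIntegral_comp_of_monotone (initPos_mono μ) (initPos_lipschitz μ)]
    apply intervalIntegral.integral_congr_ae
    filter_upwards [h] with X hX _
    rw [hX.2.2]; ring
  have hg : ∀ a b, A (ζ.u (initPos ζ.μ (𝒳 b))) - A (ζ.u (initPos ζ.μ (𝒳 a))) =
      (∫ ξ in (𝒳 a)..(𝒳 b), √2 * (α ξ * β ξ)) + ∫ η in (𝒴 a)..(𝒴 b), √2 * (γ η * δ η) := by
    intro a b
    rw [hζ.primitive_u hs hA, hint hαβ, hint (r := fun x => -ζ.S x) hγδ, ← hx, ← hx,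
      ← intervalIntegral.integral_add
      ((MemLp.intervalIntegrable_two hζ.memLp_R _ _).div_const 2)
      ((MemLp.intervalIntegrable_two (f := fun x => -ζ.S x) hζ.memLp_S.neg _ _).div_const 2)]
    exact intervalIntegral.integral_congr fun x _ => by ring
  obtain ⟨w, cw, wX, wY, hwc, wb⟩ := hC.exists_sum_primitive (measurable_const.mul (mα.mul mβ))
    (measurable_const.mul (mγ.mul mδ)) (bP bα bβ) (bP bγ bδ) hg hB' hXC
  have hC0 : 0 ≤ C := measureReal_nonneg.trans (le_max_left _ _)
  obtain ⟨v, hv, v1, v2, v4⟩ := exists_spinorSol hE ho hs.continuous_coeff mα mβ mγ mδ bα bβ bγ bδ cw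
    (fun m => ⟨B' + 2 * (max m C + C), fun p hp hm => (wb p).trans (by
      have : |p.2 - p.1| ≤ max m C := abs_le.2 ⟨by
        linarith [hE.le (X := p.1) (Y := p.2) hp, le_max_right m C], hm.trans (le_max_left _ _)⟩
      linarith)⟩)
    (fun m => ⟨B' + 2 * (max m C + C), fun p hp hm => by
      rw [abs_neg]
      refine (wb _).trans ?_
      have h1 := hE.ge (X := -p.1) (Y := -p.2) hp
      have : |(-p).2 - (-p).1| ≤ max m C := by
        rw [Prod.fst_neg, Prod.snd_neg]
        exact abs_le.2 ⟨by linarith [le_max_left m C], h1.trans (le_max_right _ _)⟩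
      linarith⟩) wX wY
  -- the values of the spinor on the curve
  have sX := ae_subsingleton_preimage hC.mono_X
  have sY := ae_subsingleton_preimage hC.mono_Y
  have vX : ∀ᵐ X, ∀ s, 𝒳 s = X → v (X, 𝒴 s) 0 = α X ∧ v (X, 𝒴 s) 1 = β X := by
    filter_upwards [sX] with X hX s rfl
    exact v1 s fun a ha b hb => hX a b ha hb
  have vY : ∀ᵐ Y, ∀ s, 𝒴 s = Y → v (𝒳 s, Y) 2 = γ Y ∧ v (𝒳 s, Y) 3 = δ Y := by
    filter_upwards [sY] with Y hY s hsY
    subst hsY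
    exact v2 s fun a ha b hb => hY a b ha hb
  have vw : ∀ s, v (𝒳 s, 𝒴 s) 4 = A (ζ.u (initPos ζ.μ (𝒳 s))) := fun s => (v4 s).trans (hwc s)
  obtain ⟨Z, hZ0, hZX, hZY, hZU⟩ := hv.exists_surface hs (𝒳 0) (𝒴 0) (initZ c ζ 0) (by
    rw [vw, hWA]; rfl)
  have pos : ∀ {μ : Measure ℝ} [IsFiniteMeasure μ] {r α β : ℝ → ℝ},
      (∀ᵐ X, α X * α X = deriv (initPos μ) X / 2 ∧ β X * β X = deriv (energy μ) X ∧
        √2 * (α X * β X) = r (initPos μ X) * deriv (initPos μ) X / 2) →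
      ∀ᵐ X, α X ^ 2 + β X ^ 2 ≠ 0 := by
    intro μ _ r α β h
    filter_upwards [h, ae_deriv_energy (μ := μ)] with X h1 h2
    rw [sq, sq, h1.1, h1.2.1, h2]
    have := (deriv_initPos_mem μ X).2
    have := (deriv_initPos_mem μ X).1
    intro h0
    linarith
  have hZ : MemHLoc c Z := fun Xl Xr Yl Yr _ _ => hv.memHOn hs hZX hZY hZU (by
      filter_upwards [vX, pos hαβ] with X h1 h2
      refine ⟨𝒴 (genInv 𝒳 X), ?_⟩
      rwa [(h1 _ (hC.fst_genInv X)).1, (h1 _ (hC.fst_genInv X)).2]) (by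
      filter_upwards [vY, pos (r := fun x => -ζ.S x) hγδ] with Y h1 h2
      refine ⟨𝒳 (genInv 𝒴 Y), ?_⟩
      rwa [(h1 _ (hC.snd_genInv Y)).1, (h1 _ (hC.snd_genInv Y)).2]) _ _ _ _
  have dXc : ∀ᵐ X, ∀ s, 𝒳 s = X → dX Z X (𝒴 s) = sideV c ζ.u ζ.R ζ.μ X := by
    filter_upwards [vX, hv.ae_hasDerivAt_X hs hZX, sideV_eq_fieldX hs hu hαβ] with X h1 h2 h3 s hX
    rw [dX, (h2 _).deriv]
    exact h3 _ (h1 s hX).1 (h1 s hX).2 (by rw [← hX, vw, hWA])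
  have dYc : ∀ᵐ Y, ∀ s, 𝒴 s = Y →
      dY Z (𝒳 s) Y = flipT (sideV c ζ.u (fun x => -ζ.S x) ζ.ν Y) := by
    filter_upwards [vY, hv.ae_hasDerivAt_Y hs hZY, 
      sideV_eq_fieldX (r := fun x => -ζ.S x) hs hu hγδ] with Y h1 h2 h3 s hY
    rw [dY, (h2 _).deriv, fieldY]
    congr 1
    refine h3 _ (h1 s hY).1 (h1 s hY).2 ?_
    show W (v (𝒳 s, Y) 4) = _
    rw [← hY, vw, hWA, hx]
  refine ⟨Z, hZ, fun s => ?_, dXc, dYc⟩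
  -- along the curve both `Z` and the prescribed values have the same derivative
  set p : ℝ → Fin 5 → ℝ := fun X => fieldX c W ![α X, β X, 0, 0, A (ζ.u (initPos ζ.μ X))] with hp
  set q : ℝ → Fin 5 → ℝ := fun Y =>
    flipT (fieldX c W ![γ Y, δ Y, 0, 0, A (ζ.u (initPos ζ.ν Y))]) with hq
  have ep : ∀ᵐ X, p X = sideV c ζ.u ζ.R ζ.μ X := by
    filter_upwards [sideV_eq_fieldX hs hu hαβ] with X h
    exact h _ rfl rfl (hWA _)
  have eq : ∀ᵐ Y, q Y = flipT (sideV c ζ.u (fun x => -ζ.S x) ζ.ν Y) := by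
    filter_upwards [sideV_eq_fieldX (r := fun x => -ζ.S x) hs hu hγδ] with Y h
    exact congrArg flipT (h _ rfl rfl (hWA _))
  have mvec : ∀ {μ : Measure ℝ} [IsFiniteMeasure μ] {α β : ℝ → ℝ}, Measurable α → Measurable β →
      Measurable fun X => (![α X, β X, 0, 0, A (ζ.u (initPos μ X))] : Fin 5 → ℝ) := by
    intro μ _ α β hα hβ
    refine measurable_pi_iff.2 fun i => ?_
    fin_cases i
    exacts [hα, hβ, measurable_const, measurable_const,
      (hAc.comp (hu.comp (initPos_lipschitz μ).continuous)).measurable]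
  have dc := hZ.ae_hasDerivAt_curve hC
  have hd : ∀ i : Fin 5, ∀ᵐ s, HasDerivAt (fun s => Z (𝒳 s) (𝒴 s) i)
      (deriv 𝒳 s * p (𝒳 s) i + deriv 𝒴 s * q (𝒴 s) i) s := by
    intro i
    filter_upwards [dc, ae_deriv_eq_zero_of_preimage_null hC.mono_X
        (ae_iff.1 (dXc.and ep)),
      ae_deriv_eq_zero_of_preimage_null hC.mono_Y (ae_iff.1 (dYc.and eq))] with s h1 h2 h3
    have h4 := hasDerivAt_pi.1 h1 i
    suffices e : deriv 𝒳 s * p (𝒳 s) i + deriv 𝒴 s * q (𝒴 s) i =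
        deriv 𝒳 s * dX Z (𝒳 s) (𝒴 s) i + deriv 𝒴 s * dY Z (𝒳 s) (𝒴 s) i by rw [e]; exact h4
    congr 1
    · by_cases h : (∀ s', 𝒳 s' = 𝒳 s → dX Z (𝒳 s) (𝒴 s') = sideV c ζ.u ζ.R ζ.μ (𝒳 s)) ∧
        p (𝒳 s) = sideV c ζ.u ζ.R ζ.μ (𝒳 s)
      · rw [h.2, h.1 s rfl]
      · rw [h2 h, zero_mul, zero_mul]
    · by_cases h : (∀ s', 𝒴 s' = 𝒴 s → dY Z (𝒳 s') (𝒴 s) =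
          flipT (sideV c ζ.u (fun x => -ζ.S x) ζ.ν (𝒴 s))) ∧
        q (𝒴 s) = flipT (sideV c ζ.u (fun x => -ζ.S x) ζ.ν (𝒴 s))
      · rw [h.2, h.1 s rfl]
      · rw [h3 h, zero_mul, zero_mul]
  funext i
  have h1 := curve_integral (f := fun s => Z (𝒳 s) (𝒴 s) i) (p := fun X => p X i)
    (q := fun Y => q Y i)
    hC ((hs.continuous_fieldX i).measurable.comp (mvec mα mβ))
    ((measurable_pi_apply i).comp (lipschitzWith_flipT.continuous.measurable.comp
      (measurable_pi_iff.2 fun i => (hs.continuous_fieldX i).measurable.comp (mvec mγ mδ))))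
    (B := 2 * (κ + 1)) (fun X => abs_fieldX_le hs (bα X) (bβ X) i)
    (fun Y => abs_flipT_le (fun i => abs_fieldX_le hs (bγ Y) (bδ Y) i) i)
    (fun M => by
      obtain ⟨L, hL⟩ := hZ.lipschitzOnWith_curve hC M
      refine ⟨L, LipschitzOnWith.of_dist_le_mul fun a ha b hb => ?_⟩
      exact (dist_le_pi_dist _ _ i).trans (hL.dist_le_mul a ha b hb)) (hd i) 0 s
  have h2 := initZ_sub hs hζ 0 s i
  have h3 : ∫ X in (𝒳 0)..(𝒳 s), p X i = ∫ X in (𝒳 0)..(𝒳 s), sideV c ζ.u ζ.R ζ.μ X i :=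
    intervalIntegral.integral_congr_ae (ep.mono fun X h _ => congrFun h i)
  have h4 : ∫ Y in (𝒴 0)..(𝒴 s), q Y i =
      ∫ Y in (𝒴 0)..(𝒴 s), flipT (sideV c ζ.u (fun x => -ζ.S x) ζ.ν Y) i :=
    intervalIntegral.integral_congr_ae (eq.mono fun Y h _ => congrFun h i)
  rw [h3, h4] at h1
  have h5 := congrFun hZ0 i
  simp only [h𝒴] at h1 h5 ⊢
  linarith

end existence

/-! ### Membership of the initial data in the class `𝒢` -/

section initialData

variable {c W A u r : ℝ → ℝ} {κ : ℝ} {μ : Measure ℝ} [IsFiniteMeasure μ] {ζ : EulerData}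
  {Z : ℝ → ℝ → Fin 5 → ℝ}

/-- The algebraic relations for the initial data of one family of characteristics. -/
theorem ae_sideV_rel (hs : Speed c W κ) (hu : Continuous u) (hWA : ∀ v, W (A v) = v)
    (hr : AEStronglyMeasurable r volume)
    (hμ : volume.withDensity (μ.rnDeriv volume) =
      volume.withDensity (fun x => ENNReal.ofReal (r x ^ 2 / 4))) :
    (∀ i, AEStronglyMeasurable (fun X => sideV c u r μ X i)) ∧
    (∀ᵐ X, ∀ i, |sideV c u r μ X i| ≤ 2 * (κ + 1)) ∧
    ∀ᵐ X, sideV c u r μ X 1 = c (u (initPos μ X)) * sideV c u r μ X 0 ∧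
      sideV c u r μ X 3 = c (u (initPos μ X)) * sideV c u r μ X 4 ∧
      2 * sideV c u r μ X 3 * sideV c u r μ X 1 =
        (c (u (initPos μ X)) * sideV c u r μ X 2) ^ 2 ∧
      sideV c u r μ X 1 = 1 / 2 - deriv (energy μ) X / 2 := by
  obtain ⟨α, β, mα, mβ, bα, bβ, h⟩ := exists_spinor_side hr hμ
  -- the fourth entry is chosen so that `W` of it is `u`
  obtain ⟨w, hw⟩ : ∃ w : ℝ → ℝ, ∀ X, w X = A (u (initPos μ X)) := ⟨_, fun _ => rfl⟩
  have e : ∀ᵐ X, fieldX c W ![α X, β X, 0, 0, w X] = sideV c u r μ X := by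
    filter_upwards [sideV_eq_fieldX hs hu h] with X hX
    exact hX _ rfl rfl (by rw [show (![α X, β X, 0, 0, w X] : Fin 5 → ℝ) 4 = w X from rfl, hw, hWA])
  have hpos : ∀ᵐ X, 0 < α X ^ 2 + β X ^ 2 := by
    filter_upwards [h, ae_deriv_energy (μ := μ)] with X h1 h2
    rw [sq, sq, h1.1, h1.2.1, h2]
    linarith [(deriv_initPos_mem μ X).2, (deriv_initPos_mem μ X).1]
  refine ⟨fun i => ?_, ?_, ?_⟩
  · have hc : Measurable fun X => c (u (initPos μ X)) :=
      (hs.smooth.continuous.comp (hu.comp (initPos_lipschitz μ).continuous)).measurable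
    have hx : AEStronglyMeasurable (fun X => r (initPos μ X) * deriv (initPos μ) X) volume := by
      refine ((measurable_const.mul (mα.mul mβ)).const_mul 2).aestronglyMeasurable.congr
        (h.mono fun X hX => ?_) (f := fun X => 2 * (√2 * (α X * β X)))
      show 2 * (√2 * (α X * β X)) = _
      rw [hX.2.2]; ring
    fin_cases i
    · exact ((measurable_deriv _).div (hc.const_mul 2)).aestronglyMeasurable
    · exact ((measurable_deriv _).div_const 2).aestronglyMeasurable
    · refine (hx.mul (hc.const_mul 2).inv.aestronglyMeasurable).congr (ae_of_all _ fun X => ?_)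
      show r (initPos μ X) * deriv (initPos μ) X * (2 * c (u (initPos μ X)))⁻¹ =
        r (initPos μ X) / (2 * c (u (initPos μ X))) * deriv (initPos μ) X
      ring
    · exact (measurable_deriv _).aestronglyMeasurable
    · exact (measurable_deriv _).aestronglyMeasurable
  · filter_upwards [e] with X hX i
    rw [← hX]
    exact abs_fieldX_le hs (bα X) (bβ X) i
  · filter_upwards [e, hpos, ae_deriv_energy (μ := μ)] with X hX hp he
    have h1 := SpinorSol.fieldX_rel hs (p := ![α X, β X, 0, 0, w X]) hp
    rw [hX, show (![α X, β X, 0, 0, w X] : Fin 5 → ℝ) 4 = w X from rfl, hw, hWA] at h1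
    refine ⟨h1.1, h1.2.1, h1.2.2.1, ?_⟩
    simp only [sideV, Matrix.cons_val, he]; ring

theorem memLp_two_of_sq_le {f g : ℝ → ℝ} (hf : AEStronglyMeasurable f volume)
    (hg : Integrable g volume) (h : ∀ᵐ X, f X ^ 2 ≤ g X) : MemLp f 2 volume := by
  rw [memLp_two_iff_integrable_sq hf]
  refine hg.mono' (hf.pow 2) (h.mono fun X hX => ?_)
  rwa [Real.norm_of_nonneg (sq_nonneg _)]

/-- By the algebraic relations each of the squares is bounded by a multiple of the density of the
energy, which is integrable. -/
theorem memLp_sideV (hs : Speed c W κ) (hu : Continuous u) (hWA : ∀ v, W (A v) = v)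
    (hr : AEStronglyMeasurable r volume)
    (hμ : volume.withDensity (μ.rnDeriv volume) =
      volume.withDensity (fun x => ENNReal.ofReal (r x ^ 2 / 4))) :
    MemLp (fun X => sideV c u r μ X 1 - 1 / 2) 2 volume ∧
      ∀ i : Fin 5, 2 ≤ i → MemLp (fun X => sideV c u r μ X i) 2 volume := by
  obtain ⟨m, -, h⟩ := ae_sideV_rel hs hu hWA hr hμ
  have hE := integrable_deriv_energy (μ := μ)
  have hk := hs.κ_pos
  refine ⟨?_, fun i hi => ?_⟩
  · refine memLp_two_of_sq_le ((m 1).sub aestronglyMeasurable_const) hE (h.mono fun X hX => ?_)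
    rw [hX.2.2.2]
    have := deriv_energy_mem (μ := μ) X
    nlinarith
  · refine memLp_two_of_sq_le (m i) (hE.const_mul (κ ^ 2 + 1)) (h.mono fun X ⟨h1, h2, h3, h4⟩ => ?_)
    have hd := deriv_energy_mem (μ := μ) X
    have e3 : sideV c u r μ X 3 = deriv (energy μ) X := rfl
    have hc0 := hs.pos (u (initPos μ X))
    have key : ∀ y : ℝ, (c (u (initPos μ X)) * y) ^ 2 ≤ deriv (energy μ) X →
        y ^ 2 ≤ (κ ^ 2 + 1) * deriv (energy μ) X := fun y hy => by
      have h1 := hs.inv_le (u (initPos μ X))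
      have h2 : y ^ 2 = (c (u (initPos μ X)))⁻¹ ^ 2 * (c (u (initPos μ X)) * y) ^ 2 := by
        field_simp
      have h3 : (c (u (initPos μ X)))⁻¹ ^ 2 ≤ κ ^ 2 := pow_le_pow_left₀ (inv_pos.2 hc0).le h1 2
      rw [h2]
      exact mul_le_mul (h3.trans (by linarith)) hy (sq_nonneg _) (by positivity)
    have : i = 2 ∨ i = 3 ∨ i = 4 := by revert hi; revert i; decide
    rcases this with rfl | rfl | rfl
    · apply key
      rw [← h3, e3, h4]
      nlinarith
    · rw [e3]
      have := mul_nonneg (sq_nonneg κ) hd.1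
      nlinarith
    · apply key
      rw [← h2, e3]
      nlinarith

/-- Square integrability of `u` along the initial curve: as `2 ds` is `2 dx` plus the increment of
the energy, the integral of `u²` is bounded by that over the line plus a multiple of the total
energy. -/
theorem memLp_u_curve (hs : Speed c W κ) (hζ : MemD c ζ) :
    MemLp (fun s => ζ.u (initPos ζ.μ (edge (initRegion ζ.μ ζ.ν) s))) 2 volume := by
  have := hζ.finite_μ
  have := hζ.finite_ν
  obtain ⟨B, hB⟩ := hζ.bdd_u hs
  have hu := hζ.continuous_u hs
  have hC := (isRegion_initRegion (μ := ζ.μ) (ν := ζ.ν)).isCurve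
  have hxy : ∀ s, initPos ζ.μ (edge (initRegion ζ.μ ζ.ν) s) =
    initPos ζ.ν (2 * s - edge (initRegion ζ.μ ζ.ν) s) := initPos_edge
  set 𝒳 := edge (initRegion ζ.μ ζ.ν)
  set x : ℝ → ℝ := fun s => initPos ζ.μ (𝒳 s) with hx
  -- `s` is the sum of the position and of half the energy to the left of it
  set e : ℝ → ℝ := fun s => energy ζ.μ (𝒳 s) + energy ζ.ν (2 * s - 𝒳 s) with he
  have hxe : ∀ s, 2 * x s + e s = 2 * s := fun s => by
    simp only [he, hx, energy]; linarith [hxy s]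
  have x_mono : Monotone x := (initPos_mono ζ.μ).comp hC.mono_X
  have x_lip : LipschitzWith (1 * 2) x := (initPos_lipschitz ζ.μ).comp hC.lipschitz_fst
  have x_surj : Function.Surjective x := (initPos_surjective ζ.μ).comp hC.surjective_fst
  have e_mono : Monotone e := fun a b h => add_le_add (energy_mono (hC.mono_X h))
    (energy_mono (hC.mono_Y h))
  have e_lip : LipschitzWith (1 * 2 + 1 * 2) e :=
    (lipschitz_energy.comp hC.lipschitz_fst).add (lipschitz_energy.comp hC.lipschitz_snd)
  have e_int : ∫⁻ s, ENNReal.ofReal (deriv e s) < ∞ := by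
    have h1 := lintegral_image_of_monotone e_mono e_lip MeasurableSet.univ fun _ => 1
    simp only [lintegral_const, one_mul, Measure.restrict_apply_univ, mul_one,
      Measure.restrict_univ, image_univ] at h1
    rw [← h1]
    refine lt_of_le_of_lt (measure_mono ?_ : _ ≤ volume (Icc 0 (ζ.μ.real univ + ζ.ν.real univ))) ?_
    · rintro _ ⟨s, rfl⟩
      have h1 := energy_mem (μ := ζ.μ) (𝒳 s)
      have h2 := energy_mem (μ := ζ.ν) (2 * s - 𝒳 s)
      exact ⟨add_nonneg h1.1 h2.1, add_le_add h1.2 h2.2⟩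
    · simp
  have u_int : ∫⁻ s, ENNReal.ofReal (deriv x s) * ENNReal.ofReal (ζ.u (x s) ^ 2) < ∞ := by
    rw [← lintegral_eq_lintegral_deriv_mul_comp x_mono x_lip x_surj fun y =>
      ENNReal.ofReal (ζ.u y ^ 2)]
    have := hζ.memLp_u.integrable_sq
    rw [← ofReal_integral_eq_lintegral_ofReal this (ae_of_all _ fun _ => sq_nonneg _)]
    exact ENNReal.ofReal_lt_top
  have hm : AEStronglyMeasurable (fun s => ζ.u (x s)) volume :=
    (hu.comp x_lip.continuous).aestronglyMeasurable
  rw [memLp_two_iff_integrable_sq hm]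
  refine ⟨hm.pow 2, ?_⟩
  have key : ∀ᵐ s, ‖ζ.u (x s) ^ 2‖ₑ ≤ ENNReal.ofReal (deriv x s) * ENNReal.ofReal (ζ.u (x s) ^ 2) +
      ENNReal.ofReal (B ^ 2) * ENNReal.ofReal (deriv e s) := by
    filter_upwards [x_lip.ae_differentiableAt, e_lip.ae_differentiableAt] with s h1 h2
    have h3 := (h1.hasDerivAt.const_mul 2).add h2.hasDerivAt
    have h4 : HasDerivAt (fun s : ℝ => 2 * s) (2 * deriv x s + deriv e s) s := by
      have e1 : (fun s : ℝ => 2 * s) = fun s => 2 * x s + e s := funext fun s => (hxe s).symm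
      rw [e1]; exact h3
    have h5 := h4.unique ((hasDerivAt_id s).const_mul 2)
    have h6 : 0 ≤ deriv x s := x_mono.deriv_nonneg
    have h7 : 0 ≤ deriv e s := e_mono.deriv_nonneg
    have h8 : ζ.u (x s) ^ 2 ≤ B ^ 2 := sq_le_sq' (abs_le.1 (hB _)).1 (abs_le.1 (hB _)).2
    rw [Real.enorm_of_nonneg (sq_nonneg _), ← ENNReal.ofReal_mul h6,
      ← ENNReal.ofReal_mul (sq_nonneg _), ← ENNReal.ofReal_add (by positivity) (by positivity)]
    apply ENNReal.ofReal_le_ofReal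
    nlinarith [mul_nonneg h7 (sq_nonneg (ζ.u (x s))), mul_le_mul_of_nonneg_right h8 h7]
  refine lt_of_le_of_lt (lintegral_mono_ae key) ?_
  rw [lintegral_add_right _ (by fun_prop), lintegral_const_mul _ (by fun_prop)]
  exact ENNReal.add_lt_top.2 ⟨u_int, ENNReal.mul_lt_top ENNReal.ofReal_lt_top e_int⟩

theorem lipschitz_initZ (hs : Speed c W κ) (hWA : ∀ v, W (A v) = v) (hζ : MemD c ζ) :
    ∃ L : ℝ≥0, LipschitzWith L (initZ c ζ) := by
  have := hζ.finite_μ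
  have := hζ.finite_ν
  have hu := hζ.continuous_u hs
  have hC := (isRegion_initRegion (μ := ζ.μ) (ν := ζ.ν)).isCurve
  obtain ⟨-, b1, -⟩ := ae_sideV_rel hs hu hWA hζ.memLp_R.1 hζ.μ_ac
  obtain ⟨-, b2, -⟩ := ae_sideV_rel (r := fun x => -ζ.S x) hs hu hWA hζ.memLp_S.1.neg
    (by simpa using hζ.ν_ac)
  have hk := hs.κ_pos
  have key : ∀ {f : ℝ → ℝ}, (∀ᵐ X, |f X| ≤ 2 * (κ + 1)) → ∀ a b,
      |∫ X in a..b, f X| ≤ 2 * (κ + 1) * |b - a| := fun hf a b => by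
    exact intervalIntegral.norm_integral_le_of_norm_le_const_ae (E := ℝ)
      (hf.mono fun X hX _ => hX)
  refine ⟨(8 * (κ + 1)).toNNReal, LipschitzWith.of_dist_le_mul fun a b => ?_⟩
  rw [Real.coe_toNNReal _ (by positivity), dist_pi_le_iff (by positivity)]
  intro i
  rw [Real.dist_eq, initZ_sub hs hζ b a i]
  have h1 := key (b1.mono fun X h => h i) (edge (initRegion ζ.μ ζ.ν) b) (edge (initRegion ζ.μ ζ.ν) a)
  have h2 := key (b2.mono fun X h => abs_flipT_le h i) (2 * b - edge (initRegion ζ.μ ζ.ν) b)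
    (2 * a - edge (initRegion ζ.μ ζ.ν) a)
  have h3 := hC.lipschitz_fst.dist_le_mul a b
  have h4 := hC.lipschitz_snd.dist_le_mul a b
  simp only [Real.dist_eq, NNReal.coe_ofNat] at h3 h4 ⊢
  refine (abs_add_le _ _).trans ((add_le_add h1 h2).trans ?_)
  nlinarith

/-- The data on the initial curve belong to `𝒢`, and the solution carrying them belongs to `ℋ`. -/
theorem exists_isSolutionThrough (hs : Speed c W κ) (hA : ∀ v, HasDerivAt A (c v) v)
    (hWA : ∀ v, W (A v) = v) (hζ : MemD c ζ) :
    ∃ Z, IsSolutionThrough c (mapC c (mapL c ζ)) Z := by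
  have := hζ.finite_μ
  have := hζ.finite_ν
  have hu := hζ.continuous_u hs
  obtain ⟨B, hB⟩ := hζ.bdd_u hs
  obtain ⟨Z, hZ, hZc, hX, hY⟩ := exists_solution hs hA hWA hζ
  have hE := isRegion_initRegion (μ := ζ.μ) (ν := ζ.ν)
  have hC := hE.isCurve
  have hν : volume.withDensity (ζ.ν.rnDeriv volume) =
    volume.withDensity (fun x => ENNReal.ofReal ((-ζ.S x) ^ 2 / 4)) := by simpa using hζ.ν_ac
  obtain ⟨m1, b1, r1⟩ := ae_sideV_rel hs hu hWA hζ.memLp_R.1 hζ.μ_ac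
  obtain ⟨m2, b2, r2⟩ := ae_sideV_rel (r := fun x => -ζ.S x) hs hu hWA hζ.memLp_S.1.neg hν
  obtain ⟨p1, q1⟩ := memLp_sideV hs hu hWA hζ.memLp_R.1 hζ.μ_ac
  obtain ⟨p2, q2⟩ := memLp_sideV (r := fun x => -ζ.S x) hs hu hWA hζ.memLp_S.1.neg hν
  have hx : ∀ s, initPos ζ.μ (edge (initRegion ζ.μ ζ.ν) s) =
    initPos ζ.ν (2 * s - edge (initRegion ζ.μ ζ.ν) s) := initPos_edge
  have mu := memLp_u_curve hs hζ
  obtain ⟨L, hL⟩ := lipschitz_initZ hs hWA hζ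
  set 𝒳 := edge (initRegion ζ.μ ζ.ν) with h𝒳
  set C := max (ζ.μ.real univ) (ζ.ν.real univ)
  have eV : ∀ᵐ X, dX Z X (2 * genInv 𝒳 X - 𝒳 (genInv 𝒳 X)) = sideV c ζ.u ζ.R ζ.μ X :=
    hX.mono fun X h => h _ (hC.fst_genInv X)
  have eW : ∀ᵐ Y, dY Z (𝒳 (genInv (fun s => 2 * s - 𝒳 s) Y)) Y =
      flipT (sideV c ζ.u (fun x => -ζ.S x) ζ.ν Y) := hY.mono fun Y h => h _ (hC.snd_genInv Y)
  have hk := hs.κ_pos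
  have nonneg : ∀ {μ : Measure ℝ} [IsFiniteMeasure μ] {r : ℝ → ℝ} {X : ℝ},
      0 ≤ sideV c ζ.u r μ X 1 ∧ 0 ≤ sideV c ζ.u r μ X 3 := fun {μ} _ r X =>
    ⟨div_nonneg (deriv_initPos_mem μ X).1 two_pos.le, (deriv_energy_mem X).1⟩
  have hinv : ∀ {μ : Measure ℝ} [IsFiniteMeasure μ] {r : ℝ → ℝ} {X : ℝ},
      sideV c ζ.u r μ X 1 = 1 / 2 - deriv (energy μ) X / 2 →
      1 / 2 ≤ sideV c ζ.u r μ X 1 + sideV c ζ.u r μ X 3 := fun {μ} _ r X h => by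
    have e3 : sideV c ζ.u r μ X 3 = deriv (energy μ) X := rfl
    rw [h, e3]; linarith [(deriv_energy_mem (μ := μ) X).1]
  have mem : MemG c (extract Z 𝒳 fun s => 2 * s - 𝒳 s) :=
    { curve := hC
      memLp_U := by simp only [extract, hZc]; exact mu
      memLp_V1 := p1.ae_eq (eV.mono fun X h => congrArg (· - (1 : ℝ) / 2) (congrFun h 1).symm)
      memLp_W1 := p2.ae_eq (eW.mono fun X h => congrArg (· - (1 : ℝ) / 2) (congrFun h 1).symm)
      memLp_V := fun i hi => (q1 i hi).ae_eq (eV.mono fun X h => (congrFun h i).symm)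
      memLp_W := fun i hi => by
        have : MemLp (fun X => flipT (sideV c ζ.u (fun x => -ζ.S x) ζ.ν X) i) 2 volume := by
          have : i = 2 ∨ i = 3 ∨ i = 4 := by revert hi; revert i; decide
          rcases this with rfl | rfl | rfl
          exacts [q2 2 hi, q2 3 hi, (q2 4 hi).neg]
        exact this.ae_eq (eW.mono fun X h => (congrFun h i).symm)
      bdd_x := by
        refine ⟨C / 2 + ζ.μ.real univ, fun s => ?_⟩
        simp only [extract, hZc]
        have h1 := hE.abs_edge_sub_le s
        have h2 := energy_mem (μ := ζ.μ) (𝒳 s)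
        have e : initZ c ζ s 1 - s = (𝒳 s - s) - energy ζ.μ (𝒳 s) := by
          simp only [initZ, energy, Matrix.cons_val]; ring
        rw [e]
        refine (abs_sub _ _).trans (add_le_add h1 ?_)
        rw [abs_of_nonneg h2.1]; exact h2.2
      bdd_Z := by
        obtain ⟨k1, hk1⟩ : ∃ k, ∀ X, |energyK c ζ.u ζ.μ X| ≤ k := ⟨_, fun X => by
          rw [abs_of_nonneg (energyK_mem hs hu X).1]; exact (energyK_mem hs hu X).2⟩
        obtain ⟨k2, hk2⟩ : ∃ k, ∀ X, |energyK c ζ.u ζ.ν X| ≤ k := ⟨_, fun X => by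
          rw [abs_of_nonneg (energyK_mem hs hu X).1]; exact (energyK_mem hs hu X).2⟩
        refine ⟨B + (ζ.μ.real univ + ζ.ν.real univ) + (k1 + k2), fun s i hi => ?_⟩
        simp only [extract, hZc]
        have h0 : 0 ≤ B := (abs_nonneg _).trans (hB 0)
        have h1 := energy_mem (μ := ζ.μ) (𝒳 s)
        have h2 := energy_mem (μ := ζ.ν) (2 * s - 𝒳 s)
        have h3 := (abs_nonneg _).trans (hk1 0)
        have h4 := (abs_nonneg _).trans (hk2 0)
        have h5 : 0 ≤ ζ.μ.real univ := measureReal_nonneg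
        have h6 : 0 ≤ ζ.ν.real univ := measureReal_nonneg
        fin_cases i
        · show |(0 : ℝ)| ≤ _
          rw [abs_zero]; positivity
        · exact absurd rfl hi
        · exact (hB _).trans (by linarith)
        · show |energy ζ.μ (𝒳 s) + energy ζ.ν (2 * s - 𝒳 s)| ≤ _
          rw [abs_of_nonneg (add_nonneg h1.1 h2.1)]; linarith
        · exact (abs_sub _ _).trans ((add_le_add (hk1 _) (hk2 _)).trans (by linarith))
      bdd_V := memLp_top_of_bound
        (((aemeasurable_pi_lambda _ fun i =>
          (m1 i).aemeasurable).aestronglyMeasurable).congr (eV.mono fun X h => h.symm))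
        (2 * (κ + 1)) (by
          filter_upwards [eV, b1] with X h1 h2
          refine (pi_norm_le_iff_of_nonneg (by positivity)).2 fun i => ?_
          exact (congrArg (fun z : Fin 5 → ℝ => ‖z i‖) h1).trans_le (h2 i))
      bdd_W := memLp_top_of_bound ((lipschitzWith_flipT.continuous.comp_aestronglyMeasurable
          ((aemeasurable_pi_lambda _ fun i =>
            (m2 i).aemeasurable).aestronglyMeasurable)).congr (eW.mono fun X h => h.symm))
        (2 * (κ + 1)) (by
          filter_upwards [eW, b2] with X h1 h2
          refine (pi_norm_le_iff_of_nonneg (by positivity)).2 fun i => ?_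
          exact (congrArg (fun z : Fin 5 → ℝ => ‖z i‖) h1).trans_le (abs_flipT_le h2 i))
      inv_bdd_V := ⟨1 / 2, by norm_num, by
        filter_upwards [eV, r1] with X h1 h2
        simp only [extract, h1]
        exact hinv h2.2.2.2⟩
      inv_bdd_W := ⟨1 / 2, by norm_num, by
        filter_upwards [eW, r2] with X h1 h2
        simp only [extract, h1]
        exact hinv h2.2.2.2⟩
      nonneg_V := eV.mono fun X h => by simp only [extract, h]; exact nonneg
      nonneg_W := eW.mono fun X h => by
        simp only [extract, h]
        exact nonneg (r := fun x => -ζ.S x)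
      lipschitz_Z := ⟨L, by simp only [extract, hZc]; exact hL⟩
      deriv_Z := by
        filter_upwards [hZ.ae_hasDerivAt_curve hC] with s h
        have e1 : deriv 𝒳 s • dX Z (𝒳 s) (2 * genInv 𝒳 (𝒳 s) - 𝒳 (genInv 𝒳 (𝒳 s))) =
            deriv 𝒳 s • dX Z (𝒳 s) (2 * s - 𝒳 s) := by
          rcases hC.deriv_fst s with h1 | h1
          · rw [h1, zero_smul, zero_smul]
          · rw [h1]
        have e2 : deriv (fun s => 2 * s - 𝒳 s) s •
            dY Z (𝒳 (genInv (fun s => 2 * s - 𝒳 s) (2 * s - 𝒳 s))) (2 * s - 𝒳 s) =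
            deriv (fun s => 2 * s - 𝒳 s) s • dY Z (𝒳 s) (2 * s - 𝒳 s) := by
          rcases hC.deriv_snd s with h1 | h1
          · rw [h1, zero_smul, zero_smul]
          · rw [h1]
        rw [← e1, ← e2] at h
        exact h
      rel_V := by
        filter_upwards [eV, r1] with X h1 h2
        simp only [extract, h1, hZc]
        rw [show initZ c ζ (genInv 𝒳 X) 2 = ζ.u (initPos ζ.μ (𝒳 (genInv 𝒳 X))) from rfl,
          hC.fst_genInv]
        exact ⟨h2.2.2.1, h2.1, h2.2.1⟩
      rel_W := by
        filter_upwards [eW, r2] with Y h1 h2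
        simp only [extract, h1, hZc]
        rw [show initZ c ζ (genInv (fun s => 2 * s - 𝒳 s) Y) 2 =
          ζ.u (initPos ζ.μ (𝒳 (genInv (fun s => 2 * s - 𝒳 s) Y))) from rfl, hx, hC.snd_genInv]
        refine ⟨h2.2.2.1, h2.1.trans ?_, h2.2.1.trans ?_⟩
        · simp [flipT]
        · simp [flipT]
      normalized_J := by
        simp only [extract, hZc]
        have h1 := (tendsto_sub_initPos_atBot ζ.μ).comp (hC.mono_X.tendsto_atBot_atBot
          fun b => (hC.surjective_fst b).imp fun a h => h.le)
        have h2 := (tendsto_sub_initPos_atBot ζ.ν).comp (hC.mono_Y.tendsto_atBot_atBot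
          fun b => (hC.surjective_snd b).imp fun a h => h.le)
        have h3 := h1.add h2
        rw [add_zero] at h3
        exact h3 }
  refine ⟨Z, ⟨hZ, 𝒳, _, hC, mem⟩, ?_, ?_, ?_⟩
  · funext s
    refine (hZc s).trans ?_
    funext i
    fin_cases i
    exacts [rfl, rfl, rfl, rfl, sub_eq_add_neg _ _]
  · exact eV
  · refine eW.mono fun Y h => h.trans ?_
    funext i
    fin_cases i
    · rfl
    · rfl
    · show -ζ.S (initPos ζ.ν Y) / (2 * c (ζ.u (initPos ζ.ν Y))) * deriv (initPos ζ.ν) Y =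
        -(ζ.S (initPos ζ.ν Y) / (2 * c (ζ.u (initPos ζ.ν Y)))) * deriv (initPos ζ.ν) Y
      rw [neg_div]
    · rfl
    · exact (deriv.fun_neg (f := energyK c ζ.u ζ.ν) (x := Y)).symm

end initialData

/-! ### Level sets of time -/

theorem LocPrim.monotone {f g : ℝ → ℝ} (h : LocPrim f g) (hg : ∀ᵐ x, 0 ≤ g x) : Monotone f :=
  fun a b hab => by
    have h1 := h.eq a b
    have h2 : 0 ≤ ∫ x in a..b, g x := intervalIntegral.integral_nonneg_of_ae hab hg
    linarith

/-- A curve of `𝒞` on which `t` vanishes, the position stays within distance `m` of both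
parameters, and the energy increases from `0` to `j`. -/
structure Anchored (Z : ℝ → ℝ → Fin 5 → ℝ) (m j : ℝ) (𝒳 𝒴 : ℝ → ℝ) : Prop where
  curve : IsCurve 𝒳 𝒴
  time : ∀ s, Z (𝒳 s) (𝒴 s) 0 = 0
  le_fst : ∀ s, Z (𝒳 s) (𝒴 s) 1 ≤ 𝒳 s
  fst_le : ∀ s, 𝒳 s ≤ Z (𝒳 s) (𝒴 s) 1 + m
  le_snd : ∀ s, Z (𝒳 s) (𝒴 s) 1 ≤ 𝒴 s
  snd_le : ∀ s, 𝒴 s ≤ Z (𝒳 s) (𝒴 s) 1 + m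
  energy_bot : Tendsto (fun s => Z (𝒳 s) (𝒴 s) 3) atBot (𝓝 0)
  energy_top : Tendsto (fun s => Z (𝒳 s) (𝒴 s) 3) atTop (𝓝 j)

section

variable {c W : ℝ → ℝ} {κ : ℝ} {Z : ℝ → ℝ → Fin 5 → ℝ} {𝒳 𝒴 𝒳₀ 𝒴₀ : ℝ → ℝ} {m j τ : ℝ}

theorem IsCurve.tendsto_fst_atTop (h : IsCurve 𝒳 𝒴) : Tendsto 𝒳 atTop atTop :=
  h.mono_X.tendsto_atTop_atTop fun b => (h.surjective_fst b).imp fun _ h => h.ge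

theorem IsCurve.tendsto_fst_atBot (h : IsCurve 𝒳 𝒴) : Tendsto 𝒳 atBot atBot :=
  h.mono_X.tendsto_atBot_atBot fun b => (h.surjective_fst b).imp fun _ h => h.le

theorem Anchored.swap (a : Anchored Z m j 𝒳 𝒴) :
    Anchored (fun X Y => flipT (Z Y X)) m j 𝒴 𝒳 :=
  ⟨a.curve.symm, fun s => neg_eq_zero.2 (a.time s), a.le_snd, a.snd_le, a.le_fst, a.fst_le,
    a.energy_bot, a.energy_top⟩

namespace MemHLoc

theorem mono_x_fst (h : MemHLoc c Z) (Y : ℝ) : Monotone fun X => Z X Y 1 :=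
  (h.locPrim Y 1).monotone (h.ae_rel.mono fun _ hX => (hX Y).2.2.2.1)

theorem mono_J_fst (h : MemHLoc c Z) (Y : ℝ) : Monotone fun X => Z X Y 3 :=
  (h.locPrim Y 3).monotone (h.ae_rel.mono fun _ hX => (hX Y).2.2.2.2.1)

theorem mono_x_snd (h : MemHLoc c Z) (X : ℝ) : Monotone fun Y => Z X Y 1 := h.swap.mono_x_fst X

theorem mono_J_snd (h : MemHLoc c Z) (X : ℝ) : Monotone fun Y => Z X Y 3 := h.swap.mono_J_fst X

theorem mono_t_fst (h : MemHLoc c Z) (hs : Speed c W κ) (Y : ℝ) : Monotone fun X => Z X Y 0 :=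
  (h.locPrim Y 0).monotone (h.ae_rel.mono fun X hX => by
    have h1 := (hX Y).1 ▸ (hX Y).2.2.2.1
    exact nonneg_of_mul_nonneg_right h1 (hs.pos _))

theorem anti_t_snd (h : MemHLoc c Z) (hs : Speed c W κ) (X : ℝ) : Antitone fun Y => Z X Y 0 :=
  fun _ _ hY => neg_le_neg_iff.1 (h.swap.mono_t_fst hs X hY)

/-- Along a forward characteristic the position advances with speed at most `κ`. -/
theorem x_sub_le (h : MemHLoc c Z) (hs : Speed c W κ) {X X' : ℝ} (hX : X ≤ X') (Y : ℝ) :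
    Z X' Y 1 - Z X Y 1 ≤ κ * (Z X' Y 0 - Z X Y 0) := by
  have h1 := (((h.locPrim Y 0).const_mul κ).add ((h.locPrim Y 1).const_mul (-1))).monotone
    (h.ae_rel.mono fun X hX => by
      have h1 := (hX Y).1
      have h2 : 0 ≤ dX Z X Y 0 := nonneg_of_mul_nonneg_right (h1 ▸ (hX Y).2.2.2.1) (hs.pos _)
      have h3 := mul_le_mul_of_nonneg_right (hs.bounds (Z X Y 2)).2 h2
      linarith)
  have := h1 hX
  simp only at this
  linarith

end MemHLoc

namespace Anchored

theorem abs_fst_sub_le (a : Anchored Z m j 𝒳 𝒴) (s : ℝ) : |𝒳 s - s| ≤ m / 2 := by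
  have := a.curve.add_eq s
  rw [abs_le]
  constructor <;> linarith [a.le_fst s, a.le_snd s, a.fst_le s, a.snd_le s]

/-- Far below the curve `t` is large: going back to the curve along either characteristic takes
time proportional to the distance covered. -/
theorem sub_le (a : Anchored Z m j 𝒳 𝒴) (h : MemHLoc c Z) (hs : Speed c W κ) {X Y : ℝ}
    (hXY : m < X - Y) : X - Y - m ≤ 2 * κ * Z X Y 0 := by
  obtain ⟨s, rfl⟩ := a.curve.surjective_snd Y
  obtain ⟨s', rfl⟩ := a.curve.surjective_fst X
  have hss : s ≤ s' := by
    by_contra! hlt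
    have := a.curve.mono_X hlt.le
    linarith [a.fst_le s, a.le_snd s]
  have h1 := h.x_sub_le hs (a.curve.mono_X hss) (𝒴 s)
  have h2 := h.swap.x_sub_le hs (a.curve.mono_Y hss) (𝒳 s')
  simp only [flipT, Matrix.cons_val, a.time] at h1 h2
  linarith [a.fst_le s', a.le_snd s]

end Anchored

/-- The region where `t < τ`. -/
def timeRegion (Z : ℝ → ℝ → Fin 5 → ℝ) (τ : ℝ) : Set (ℝ × ℝ) := {p | Z p.1 p.2 0 < τ}

theorem MemHLoc.isOpen_timeRegion (h : MemHLoc c Z) : IsOpen (timeRegion Z τ) :=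
  isOpen_lt ((continuous_apply 0).comp h.continuous) continuous_const

theorem Anchored.isRegion (a : Anchored Z m j 𝒳 𝒴) (h : MemHLoc c Z) (hs : Speed c W κ) :
    IsRegion (timeRegion Z τ) (m + 2 * κ * |τ|) where
  meas := h.isOpen_timeRegion.measurableSet
  nw {X Y X' Y'} hE hX hY :=
    ((h.mono_t_fst hs Y' hX).trans (h.anti_t_snd hs X hY)).trans_lt hE
  le {X Y} hE := by
    have hE : Z X Y 0 < τ := hE
    have hk := hs.κ_pos
    by_contra! hlt
    have h0 : 0 ≤ 2 * κ * |τ| := by positivity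
    have h1 := a.sub_le h hs (by linarith : m < X - Y)
    have h2 : 2 * κ * Z X Y 0 ≤ 2 * κ * |τ| := by
      gcongr
      exact hE.le.trans (le_abs_self τ)
    linarith
  ge {X Y} hE := by
    have hE : τ ≤ Z X Y 0 := not_lt.1 hE
    have hk := hs.κ_pos
    by_contra! hlt
    have h0 : 0 ≤ 2 * κ * |τ| := by positivity
    have h1 := a.swap.sub_le h.swap hs (by linarith : m < Y - X)
    have h2 : 2 * κ * (-Z X Y 0) ≤ 2 * κ * |τ| := by
      gcongr
      exact (neg_le_neg hE).trans (neg_le_abs τ)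
    have h3 : flipT (Z X Y) 0 = -Z X Y 0 := rfl
    rw [h3] at h1
    linarith

theorem Anchored.time_edge (a : Anchored Z m j 𝒳 𝒴) (h : MemHLoc c Z) (hs : Speed c W κ) (s : ℝ) :
    Z (edge (timeRegion Z τ) s) (2 * s - edge (timeRegion Z τ) s) 0 = τ := by
  have hE := a.isRegion h hs (τ := τ)
  apply le_antisymm
  · have h1 : ∀ᶠ X in 𝓝[<] (edge (timeRegion Z τ) s), Z X (2 * s - X) 0 ≤ τ := by
      filter_upwards [self_mem_nhdsWithin] with X hX
      exact le_of_lt (hE.mem_of_lt_edge hX)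
    have h2 : Continuous fun X => Z X (2 * s - X) 0 :=
      (continuous_apply 0).comp (h.continuous.comp (by fun_prop : Continuous fun X => (X, 2 * s - X)))
    exact le_of_tendsto ((h2.tendsto _).mono_left nhdsWithin_le_nhds) h1
  · exact not_lt.1 (hE.edge_notMem h.isOpen_timeRegion s)

namespace Anchored

theorem x_ge (a : Anchored Z m j 𝒳 𝒴) (h : MemHLoc c Z) (X Y : ℝ) : min X Y - 2 * m ≤ Z X Y 1 := by
  obtain ⟨s, hs⟩ : ∃ s, s = min X Y - m / 2 := ⟨_, rfl⟩
  have h1 := abs_le.1 (a.abs_fst_sub_le s)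
  have h2 := abs_le.1 (a.swap.abs_fst_sub_le s)
  have h3 := h.mono_x_fst (𝒴 s) (show 𝒳 s ≤ X by linarith [min_le_left X Y])
  have h4 := h.mono_x_snd X (show 𝒴 s ≤ Y by linarith [min_le_right X Y])
  simp only at h3 h4
  linarith [a.fst_le s]

theorem x_le (a : Anchored Z m j 𝒳 𝒴) (h : MemHLoc c Z) (X Y : ℝ) : Z X Y 1 ≤ max X Y + m := by
  obtain ⟨s, hs⟩ : ∃ s, s = max X Y + m / 2 := ⟨_, rfl⟩
  have h1 := abs_le.1 (a.abs_fst_sub_le s)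
  have h2 := abs_le.1 (a.swap.abs_fst_sub_le s)
  have h3 := h.mono_x_fst Y (show X ≤ 𝒳 s by linarith [le_max_left X Y])
  have h4 := h.mono_x_snd (𝒳 s) (show Y ≤ 𝒴 s by linarith [le_max_right X Y])
  simp only at h3 h4
  linarith [a.le_fst s]

theorem J_ge (a : Anchored Z m j 𝒳 𝒴) (h : MemHLoc c Z) (X Y : ℝ) :
    Z (𝒳 (min X Y - m / 2)) (𝒴 (min X Y - m / 2)) 3 ≤ Z X Y 3 := by
  obtain ⟨s, hs⟩ : ∃ s, s = min X Y - m / 2 := ⟨_, rfl⟩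
  rw [← hs]
  have h1 := abs_le.1 (a.abs_fst_sub_le s)
  have h2 := abs_le.1 (a.swap.abs_fst_sub_le s)
  have h3 := h.mono_J_fst (𝒴 s) (show 𝒳 s ≤ X by linarith [min_le_left X Y])
  have h4 := h.mono_J_snd X (show 𝒴 s ≤ Y by linarith [min_le_right X Y])
  exact h3.trans h4

theorem J_le (a : Anchored Z m j 𝒳 𝒴) (h : MemHLoc c Z) (X Y : ℝ) :
    Z X Y 3 ≤ Z (𝒳 (max X Y + m / 2)) (𝒴 (max X Y + m / 2)) 3 := by
  obtain ⟨s, hs⟩ : ∃ s, s = max X Y + m / 2 := ⟨_, rfl⟩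
  rw [← hs]
  have h1 := abs_le.1 (a.abs_fst_sub_le s)
  have h2 := abs_le.1 (a.swap.abs_fst_sub_le s)
  have h3 := h.mono_J_fst Y (show X ≤ 𝒳 s by linarith [le_max_left X Y])
  have h4 := h.mono_J_snd (𝒳 s) (show Y ≤ 𝒴 s by linarith [le_max_right X Y])
  exact h3.trans h4

/-- The energy on any curve increases from `0` to the same value `j`. -/
theorem tendsto_J (a : Anchored Z m j 𝒳₀ 𝒴₀) (h : MemHLoc c Z) (hC : IsCurve 𝒳 𝒴) :
    Tendsto (fun s => Z (𝒳 s) (𝒴 s) 3) atBot (𝓝 0) ∧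
      Tendsto (fun s => Z (𝒳 s) (𝒴 s) 3) atTop (𝓝 j) := by
  have t1 : Tendsto (fun s => min (𝒳 s) (𝒴 s) - m / 2) atBot atBot := by
    refine tendsto_atBot_mono (fun s => ?_) (tendsto_atBot_add_const_right _ (-(m / 2))
      hC.tendsto_fst_atBot)
    linarith [min_le_left (𝒳 s) (𝒴 s)]
  have t2 : Tendsto (fun s => max (𝒳 s) (𝒴 s) + m / 2) atTop atTop := by
    refine tendsto_atTop_mono (fun s => ?_) (tendsto_atTop_add_const_right _ (m / 2)
      hC.tendsto_fst_atTop)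
    linarith [le_max_left (𝒳 s) (𝒴 s)]
  have t3 : Tendsto (fun s => max (𝒳 s) (𝒴 s) + m / 2) atBot atBot := by
    refine tendsto_atBot_add_const_right _ _ (tendsto_atBot.2 fun b => ?_)
    filter_upwards [tendsto_atBot.1 hC.tendsto_fst_atBot b,
      tendsto_atBot.1 hC.symm.tendsto_fst_atBot b] with s h1 h2
    exact max_le h1 h2
  have t4 : Tendsto (fun s => min (𝒳 s) (𝒴 s) - m / 2) atTop atTop := by
    refine tendsto_atTop_add_const_right _ (-(m / 2)) (tendsto_atTop.2 fun b => ?_)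
    filter_upwards [tendsto_atTop.1 hC.tendsto_fst_atTop b,
      tendsto_atTop.1 hC.symm.tendsto_fst_atTop b] with s h1 h2
    exact le_min h1 h2
  exact ⟨tendsto_of_tendsto_of_tendsto_of_le_of_le (a.energy_bot.comp t1) (a.energy_bot.comp t3)
      (fun s => a.J_ge h _ _) fun s => a.J_le h _ _,
    tendsto_of_tendsto_of_tendsto_of_le_of_le (a.energy_top.comp t4) (a.energy_top.comp t2)
      (fun s => a.J_ge h _ _) fun s => a.J_le h _ _⟩

theorem surjective_x (a : Anchored Z m j 𝒳₀ 𝒴₀) (h : MemHLoc c Z) (hC : IsCurve 𝒳 𝒴) :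
    Function.Surjective fun s => Z (𝒳 s) (𝒴 s) 1 := by
  obtain ⟨B, hB⟩ := hC.reg_X.1
  obtain ⟨B', hB'⟩ := hC.reg_Y.1
  have hc : Continuous fun s => Z (𝒳 s) (𝒴 s) 1 := (continuous_apply 1).comp
    (h.continuous.comp (hC.lipschitz_fst.continuous.prodMk hC.lipschitz_snd.continuous))
  refine surjective_of_sub_id_bdd hc (B := |B| + |B'| + 2 * |m|) fun s => ?_
  have h1 := a.x_ge h (𝒳 s) (𝒴 s)
  have h2 := a.x_le h (𝒳 s) (𝒴 s)
  have h3 := abs_le.1 ((hB s).trans (le_abs_self B))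
  have h4 := abs_le.1 ((hB' s).trans (le_abs_self B'))
  have h5 := abs_nonneg B
  have h6 := abs_nonneg B'
  have h7 := le_abs_self m
  have h8 := abs_nonneg m
  rw [abs_le]
  constructor
  · rcases min_choice (𝒳 s) (𝒴 s) with e | e <;> rw [e] at h1 <;> linarith
  · rcases max_choice (𝒳 s) (𝒴 s) with e | e <;> rw [e] at h2 <;> linarith

end Anchored

end

/-! ### Data on a level set of time -/

/-- The values of `Z` along a curve, as a function of the first parameter. -/
noncomputable def sideAt (Z : ℝ → ℝ → Fin 5 → ℝ) (𝒳 𝒴 : ℝ → ℝ) (X : ℝ) : Fin 5 → ℝ :=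
  Z (𝒳 (genInv 𝒳 X)) (𝒴 (genInv 𝒳 X))

/-- The values of `Z_X` along a curve. -/
noncomputable def sideD (Z : ℝ → ℝ → Fin 5 → ℝ) (𝒳 𝒴 : ℝ → ℝ) (X : ℝ) : Fin 5 → ℝ :=
  dX Z X (𝒴 (genInv 𝒳 X))

/-- The part of the energy along a curve that is carried by the first family of
characteristics. -/
noncomputable def sideJ (Z : ℝ → ℝ → Fin 5 → ℝ) (𝒳 𝒴 : ℝ → ℝ) (X : ℝ) : ℝ :=
  ∫ s in Iic (genInv 𝒳 X), sideD Z 𝒳 𝒴 (𝒳 s) 3 * deriv 𝒳 s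

theorem intervalIntegrable_of_locBdd {g : ℝ → ℝ} (hm : Measurable g)
    (hb : ∀ M, ∃ B, ∀ x, |x| ≤ M → |g x| ≤ B) (a b : ℝ) : IntervalIntegrable g volume a b := by
  obtain ⟨B, hB⟩ := hb (max |a| |b|)
  refine IntegrableOn.intervalIntegrable (Measure.integrableOn_of_bounded (M := B)
    isCompact_uIcc.measure_lt_top.ne hm.aestronglyMeasurable ?_)
  refine (ae_restrict_iff' measurableSet_uIcc).2 (ae_of_all _ fun x hx => hB x ?_)
  exact abs_le_max_abs_abs hx.1 hx.2 |>.trans (by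
    rcases le_total a b with h | h <;> simp [h, max_comm])

section

variable {c W : ℝ → ℝ} {κ : ℝ} {Z : ℝ → ℝ → Fin 5 → ℝ} {𝒳 𝒴 𝒳₀ 𝒴₀ : ℝ → ℝ} {m j τ : ℝ}

theorem IsCurve.measurable_genInv (hC : IsCurve 𝒳 𝒴) : Measurable (genInv 𝒳) :=
  hC.genInv_fst_mono.measurable

theorem IsCurve.bdd_snd_genInv (hC : IsCurve 𝒳 𝒴) (M : ℝ) :
    ∃ B, ∀ X, |X| ≤ M → |𝒴 (genInv 𝒳 X)| ≤ B := by
  obtain ⟨B, hB⟩ := hC.reg_X.1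
  refine ⟨M + 2 * B, fun X hX => ?_⟩
  have h1 := abs_le.1 (hB (genInv 𝒳 X))
  have h2 := hC.add_eq (genInv 𝒳 X)
  have h3 := abs_le.1 hX
  simp only [hC.fst_genInv] at h1 h2
  rw [abs_le]
  constructor <;> linarith

namespace MemHLoc

theorem measurable_dX (h : MemHLoc c Z) : Measurable fun p : ℝ × ℝ => dX Z p.1 p.2 := by
  have h1 : Continuous (Function.uncurry fun Y X => Z X Y) := h.continuous.comp continuous_swap
  exact (measurable_deriv_with_param h1).comp measurable_swap

theorem exists_bound_dX (h : MemHLoc c Z) (M : ℝ) :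
    ∃ B, ∀ X Y, |X| ≤ M → |Y| ≤ M → ‖dX Z X Y‖ ≤ B := by
  obtain ⟨L, hL⟩ := h.lipschitzOnWith_fst (M + 1)
  refine ⟨L, fun X Y hX hY => ?_⟩
  have hX := abs_le.1 hX
  exact norm_deriv_le_of_lipschitzOn (Icc_mem_nhds (by linarith) (by linarith))
    (hL Y (hY.trans (by linarith)))

theorem measurable_sideD (h : MemHLoc c Z) (hC : IsCurve 𝒳 𝒴) : Measurable (sideD Z 𝒳 𝒴) :=
  h.measurable_dX.comp (measurable_id.prodMk
    (hC.lipschitz_snd.continuous.measurable.comp hC.measurable_genInv))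

theorem measurable_sideAt (h : MemHLoc c Z) (hC : IsCurve 𝒳 𝒴) : Measurable (sideAt Z 𝒳 𝒴) :=
  h.continuous.measurable.comp
    ((hC.lipschitz_fst.continuous.measurable.comp hC.measurable_genInv).prodMk
      (hC.lipschitz_snd.continuous.measurable.comp hC.measurable_genInv))

theorem locBdd_sideD (h : MemHLoc c Z) (hC : IsCurve 𝒳 𝒴) (i : Fin 5) (M : ℝ) :
    ∃ B, ∀ X, |X| ≤ M → |sideD Z 𝒳 𝒴 X i| ≤ B := by
  obtain ⟨B, hB⟩ := hC.bdd_snd_genInv M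
  obtain ⟨B', hB'⟩ := h.exists_bound_dX (max M B)
  exact ⟨B', fun X hX => (norm_le_pi_norm _ i).trans
    (hB' X _ (hX.trans (le_max_left _ _)) ((hB X hX).trans (le_max_right _ _)))⟩

theorem intervalIntegrable_sideD (h : MemHLoc c Z) (hC : IsCurve 𝒳 𝒴) (i : Fin 5) (a b : ℝ) :
    IntervalIntegrable (fun X => sideD Z 𝒳 𝒴 X i) volume a b :=
  intervalIntegrable_of_locBdd ((measurable_pi_apply i).comp (h.measurable_sideD hC))
    (h.locBdd_sideD hC i) a b

theorem intervalIntegrable_deriv_mul (h : MemHLoc c Z) (hC : IsCurve 𝒳 𝒴) (i : Fin 5) (a b : ℝ) :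
    IntervalIntegrable (fun s => deriv 𝒳 s * sideD Z 𝒳 𝒴 (𝒳 s) i) volume a b := by
  refine intervalIntegrable_of_locBdd ((measurable_deriv _).mul ((measurable_pi_apply i).comp
    ((h.measurable_sideD hC).comp hC.lipschitz_fst.continuous.measurable))) (fun M => ?_) a b
  obtain ⟨B, hB⟩ := hC.reg_X.1
  obtain ⟨B', hB'⟩ := h.locBdd_sideD hC i (M + B)
  refine ⟨2 * B', fun s hs => ?_⟩
  have h1 := norm_deriv_le_of_lipschitz hC.lipschitz_fst (x₀ := s)
  have h2 : |𝒳 s| ≤ M + B := by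
    have := abs_add_le s (𝒳 s - s)
    rw [add_sub_cancel] at this
    linarith [hB s]
  show |deriv 𝒳 s * sideD Z 𝒳 𝒴 (𝒳 s) i| ≤ _
  rw [abs_mul]
  exact mul_le_mul h1 (hB' _ h2) (abs_nonneg _) zero_le_two

/-- The chain rule along a curve, with the derivatives replaced by their values as functions of
one parameter. -/
theorem ae_hasDerivAt_sideD (h : MemHLoc c Z) (hC : IsCurve 𝒳 𝒴) :
    ∀ᵐ s, HasDerivAt (fun s => Z (𝒳 s) (𝒴 s)) (deriv 𝒳 s • sideD Z 𝒳 𝒴 (𝒳 s) +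
      deriv 𝒴 s • flipT (sideD (fun X Y => flipT (Z Y X)) 𝒴 𝒳 (𝒴 s))) s := by
  filter_upwards [h.ae_hasDerivAt_curve hC] with s h1
  have e1 : deriv 𝒳 s • sideD Z 𝒳 𝒴 (𝒳 s) = deriv 𝒳 s • dX Z (𝒳 s) (𝒴 s) := by
    rcases hC.deriv_fst s with h2 | h2
    · rw [h2, zero_smul, zero_smul]
    · rw [sideD, h2]
  have e2 : deriv 𝒴 s • flipT (sideD (fun X Y => flipT (Z Y X)) 𝒴 𝒳 (𝒴 s)) =
      deriv 𝒴 s • dY Z (𝒳 s) (𝒴 s) := by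
    rcases hC.deriv_snd s with h2 | h2
    · rw [h2, zero_smul, zero_smul]
    · rw [sideD, h2, dX_flipT, flipT_flipT]
  rwa [e1, e2]

/-- The increments of `Z` along a curve as integrals of `sideD` and of its reflection. -/
theorem curve_sub (h : MemHLoc c Z) (hC : IsCurve 𝒳 𝒴) (i : Fin 5) (a b : ℝ) :
    Z (𝒳 b) (𝒴 b) i - Z (𝒳 a) (𝒴 a) i = ∫ s in a..b, (deriv 𝒳 s * sideD Z 𝒳 𝒴 (𝒳 s) i +
      deriv 𝒴 s * flipT (sideD (fun X Y => flipT (Z Y X)) 𝒴 𝒳 (𝒴 s)) i) := by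
  obtain ⟨L, hL⟩ := h.lipschitzOnWith_curve hC (max |a| |b|)
  have hsub : uIcc a b ⊆ Icc (-(max |a| |b|)) (max |a| |b|) :=
    uIcc_subset_Icc (abs_le.1 (le_max_left _ _)) (abs_le.1 (le_max_right _ _))
  refine (integral_eq_sub_of_lipschitzOn (f := fun s => Z (𝒳 s) (𝒴 s) i) (K := L)
    (LipschitzOnWith.of_dist_le_mul fun x hx y hy => (dist_le_pi_dist _ _ i).trans
      (hL.dist_le_mul x (hsub hx) y (hsub hy))) ?_).symm
  exact (h.ae_hasDerivAt_sideD hC).mono fun s hs _ => hasDerivAt_pi.1 hs i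

theorem ae_rel_sideD (h : MemHLoc c Z) (hC : IsCurve 𝒳 𝒴) : ∀ᵐ X,
    sideD Z 𝒳 𝒴 X 1 = c (sideAt Z 𝒳 𝒴 X 2) * sideD Z 𝒳 𝒴 X 0 ∧
    2 * sideD Z 𝒳 𝒴 X 3 * sideD Z 𝒳 𝒴 X 1 = (c (sideAt Z 𝒳 𝒴 X 2) * sideD Z 𝒳 𝒴 X 2) ^ 2 ∧
    0 ≤ sideD Z 𝒳 𝒴 X 1 ∧ 0 ≤ sideD Z 𝒳 𝒴 X 3 := by
  filter_upwards [h.ae_rel] with X hX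
  obtain ⟨h1, -, h3, h4, h5, -⟩ := hX (𝒴 (genInv 𝒳 X))
  simp only [sideAt, hC.fst_genInv]
  exact ⟨h1, h3, h4, h5⟩

theorem ae_rel_curve (h : MemHLoc c Z) (hC : IsCurve 𝒳 𝒴) : ∀ᵐ s, deriv 𝒳 s = 0 ∨
    (sideD Z 𝒳 𝒴 (𝒳 s) 1 = c (Z (𝒳 s) (𝒴 s) 2) * sideD Z 𝒳 𝒴 (𝒳 s) 0 ∧
    2 * sideD Z 𝒳 𝒴 (𝒳 s) 3 * sideD Z 𝒳 𝒴 (𝒳 s) 1 =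
      (c (Z (𝒳 s) (𝒴 s) 2) * sideD Z 𝒳 𝒴 (𝒳 s) 2) ^ 2 ∧
    0 ≤ sideD Z 𝒳 𝒴 (𝒳 s) 1 ∧ 0 ≤ sideD Z 𝒳 𝒴 (𝒳 s) 3) := by
  filter_upwards [ae_deriv_eq_zero_of_preimage_null hC.mono_X
    (ae_iff.1 (h.ae_rel_sideD hC))] with s h1
  rcases hC.deriv_fst s with h2 | h2
  · exact Or.inl h2
  · by_cases h3 : deriv 𝒳 s = 0
    · exact Or.inl h3
    · right
      have := not_not.1 fun h4 => h3 (h1 h4)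
      simpa only [sideAt, h2] using this

/-- On a level set of time the two families of characteristics contribute equally to the
displacement. -/
theorem ae_displacement (h : MemHLoc c Z) (hC : IsCurve 𝒳 𝒴)
    (hτ : ∀ s, Z (𝒳 s) (𝒴 s) 0 = τ) : ∀ᵐ s, deriv 𝒳 s * sideD Z 𝒳 𝒴 (𝒳 s) 1 =
      deriv 𝒴 s * sideD (fun X Y => flipT (Z Y X)) 𝒴 𝒳 (𝒴 s) 1 := by
  filter_upwards [h.ae_hasDerivAt_sideD hC, h.ae_rel_curve hC, h.swap.ae_rel_curve hC.symm]
    with s h1 h2 h3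
  have h4 := hasDerivAt_pi.1 h1 0
  simp only [hτ] at h4
  have h5 := h4.unique (hasDerivAt_const s τ)
  have h6 : deriv 𝒳 s * sideD Z 𝒳 𝒴 (𝒳 s) 0 +
    deriv 𝒴 s * -sideD (fun X Y => flipT (Z Y X)) 𝒴 𝒳 (𝒴 s) 0 = 0 := h5
  have h7 : deriv 𝒳 s * sideD Z 𝒳 𝒴 (𝒳 s) 1 =
      c (Z (𝒳 s) (𝒴 s) 2) * (deriv 𝒳 s * sideD Z 𝒳 𝒴 (𝒳 s) 0) := by
    rcases h2 with h2 | h2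
    · rw [h2]; ring
    · rw [h2.1]; ring
  have h8 : deriv 𝒴 s * sideD (fun X Y => flipT (Z Y X)) 𝒴 𝒳 (𝒴 s) 1 =
      c (Z (𝒳 s) (𝒴 s) 2) * (deriv 𝒴 s * sideD (fun X Y => flipT (Z Y X)) 𝒴 𝒳 (𝒴 s) 0) := by
    rcases h3 with h3 | h3
    · rw [h3]; ring
    · rw [h3.1, show flipT (Z (𝒳 s) (𝒴 s)) 2 = Z (𝒳 s) (𝒴 s) 2 from rfl]; ring
  rw [h7, h8]
  congr 1
  linarith

theorem x_curve_sub (h : MemHLoc c Z) (hC : IsCurve 𝒳 𝒴) (hτ : ∀ s, Z (𝒳 s) (𝒴 s) 0 = τ)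
    (a b : ℝ) : Z (𝒳 b) (𝒴 b) 1 - Z (𝒳 a) (𝒴 a) 1 =
      ∫ X in (𝒳 a)..(𝒳 b), 2 * sideD Z 𝒳 𝒴 X 1 := by
  rw [h.curve_sub hC, intervalIntegral_comp_of_monotone hC.mono_X hC.lipschitz_fst]
  apply intervalIntegral.integral_congr_ae
  filter_upwards [h.ae_displacement hC hτ] with s h1 _
  have h2 : flipT (sideD (fun X Y => flipT (Z Y X)) 𝒴 𝒳 (𝒴 s)) 1 =
    sideD (fun X Y => flipT (Z Y X)) 𝒴 𝒳 (𝒴 s) 1 := rfl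
  rw [h2, ← h1]; ring

/-- The position on a level set of time, as a function of the first parameter. -/
theorem locPrim_sideAt (h : MemHLoc c Z) (hC : IsCurve 𝒳 𝒴) (hτ : ∀ s, Z (𝒳 s) (𝒴 s) 0 = τ) :
    LocPrim (fun X => sideAt Z 𝒳 𝒴 X 1) fun X => 2 * sideD Z 𝒳 𝒴 X 1 where
  meas := ((measurable_pi_apply 1).comp (h.measurable_sideD hC)).const_mul 2
  bdd M := by
    obtain ⟨B, hB⟩ := h.locBdd_sideD hC 1 M
    refine ⟨2 * B, fun X hX => ?_⟩
    rw [abs_mul, abs_two]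
    linarith [hB X hX]
  eq a b := by
    have := h.x_curve_sub hC hτ (genInv 𝒳 a) (genInv 𝒳 b)
    simpa only [sideAt, hC.fst_genInv] using this

theorem mono_x_curve (h : MemHLoc c Z) (hC : IsCurve 𝒳 𝒴) : Monotone fun s => Z (𝒳 s) (𝒴 s) 1 :=
  fun a b hab => (h.mono_x_fst (𝒴 a) (hC.mono_X hab)).trans (h.mono_x_snd (𝒳 b) (hC.mono_Y hab))

theorem mono_J_curve (h : MemHLoc c Z) (hC : IsCurve 𝒳 𝒴) : Monotone fun s => Z (𝒳 s) (𝒴 s) 3 :=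
  fun a b hab => (h.mono_J_fst (𝒴 a) (hC.mono_X hab)).trans (h.mono_J_snd (𝒳 b) (hC.mono_Y hab))

theorem mono_sideAt (h : MemHLoc c Z) (hC : IsCurve 𝒳 𝒴) : Monotone fun X => sideAt Z 𝒳 𝒴 X 1 :=
  (h.mono_x_curve hC).comp hC.genInv_fst_mono

theorem surjective_sideAt (h : MemHLoc c Z) (hC : IsCurve 𝒳 𝒴) (hτ : ∀ s, Z (𝒳 s) (𝒴 s) 0 = τ)
    (a : Anchored Z m j 𝒳₀ 𝒴₀) : Function.Surjective fun X => sideAt Z 𝒳 𝒴 X 1 := by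
  intro y
  obtain ⟨s, rfl⟩ := a.surjective_x h hC y
  refine ⟨𝒳 s, ?_⟩
  have := h.x_curve_sub hC hτ (genInv 𝒳 (𝒳 s)) s
  simp only [hC.fst_genInv, intervalIntegral.integral_same] at this
  simp only [sideAt, hC.fst_genInv]
  exact (sub_eq_zero.1 this).symm

/-- On a level set of time `U` is a function of the position. -/
theorem U_eq_of_x_eq (h : MemHLoc c Z) (hs : Speed c W κ) (hC : IsCurve 𝒳 𝒴)
    (hτ : ∀ s, Z (𝒳 s) (𝒴 s) 0 = τ) {a b : ℝ} (hx : Z (𝒳 a) (𝒴 a) 1 = Z (𝒳 b) (𝒴 b) 1) :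
    Z (𝒳 a) (𝒴 a) 2 = Z (𝒳 b) (𝒴 b) 2 := by
  wlog hab : a ≤ b generalizing a b
  · exact (this hx.symm (le_of_not_ge hab)).symm
  have h0 : ∀ᵐ s, s ∈ uIoc a b → deriv 𝒳 s * sideD Z 𝒳 𝒴 (𝒳 s) 2 +
      deriv 𝒴 s * flipT (sideD (fun X Y => flipT (Z Y X)) 𝒴 𝒳 (𝒴 s)) 2 = 0 := by
    have hb : ∀ᵐ s : ℝ, s ≠ b := by simp [ae_iff]
    filter_upwards [h.ae_displacement hC hτ, h.ae_hasDerivAt_sideD hC, h.ae_rel_curve hC,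
      h.swap.ae_rel_curve hC.symm, hb] with s h1 h2 h3 h4 hsb hs'
    rw [uIoc_of_le hab] at hs'
    -- the position is constant near `s`
    have h5 : HasDerivAt (fun s => Z (𝒳 s) (𝒴 s) 1) 0 s := by
      refine (hasDerivAt_const s (Z (𝒳 a) (𝒴 a) 1)).congr_of_eventuallyEq ?_
      filter_upwards [Ioo_mem_nhds hs'.1 (lt_of_le_of_ne hs'.2 hsb)] with r hr
      exact le_antisymm ((h.mono_x_curve hC hr.2.le).trans hx.ge) (h.mono_x_curve hC hr.1.le)
    have h6 : deriv 𝒳 s * sideD Z 𝒳 𝒴 (𝒳 s) 1 +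
      deriv 𝒴 s * sideD (fun X Y => flipT (Z Y X)) 𝒴 𝒳 (𝒴 s) 1 = 0 :=
      (hasDerivAt_pi.1 h2 1).unique h5
    have key : ∀ {d k p1 p2 p3 : ℝ}, 0 < k → (d = 0 ∨ (2 * p3 * p1 = (k * p2) ^ 2)) →
        d * p1 = 0 → d * p2 = 0 := by
      intro d k p1 p2 p3 hk hd h0
      rcases hd with hd | hd
      · rw [hd, zero_mul]
      · rcases mul_eq_zero.1 h0 with h0 | h0
        · rw [h0, zero_mul]
        · rw [h0, mul_zero, eq_comm, sq_eq_zero_iff, mul_eq_zero] at hd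
          rw [hd.resolve_left hk.ne', mul_zero]
    have e1 : deriv 𝒳 s * sideD Z 𝒳 𝒴 (𝒳 s) 2 = 0 :=
      key (hs.pos _) (h3.imp_right fun h => h.2.1) (by linarith)
    have e2 : deriv 𝒴 s * sideD (fun X Y => flipT (Z Y X)) 𝒴 𝒳 (𝒴 s) 2 = 0 :=
      key (hs.pos _) (h4.imp_right fun h => h.2.1) (by linarith)
    have e3 : flipT (sideD (fun X Y => flipT (Z Y X)) 𝒴 𝒳 (𝒴 s)) 2 =
      sideD (fun X Y => flipT (Z Y X)) 𝒴 𝒳 (𝒴 s) 2 := rfl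
    rw [e3, e1, e2, add_zero]
  have h1 := h.curve_sub hC 2 a b
  rw [intervalIntegral.integral_zero_ae h0] at h1
  exact (sub_eq_zero.1 h1).symm

/-- The energies carried by the two families along any curve are finite, and their sum is `j`. -/
theorem integrable_sideD (h : MemHLoc c Z) (hC : IsCurve 𝒳 𝒴) (a : Anchored Z m j 𝒳₀ 𝒴₀) :
    Integrable (fun X => sideD Z 𝒳 𝒴 X 3) ∧
    Integrable (fun Y => sideD (fun X Y => flipT (Z Y X)) 𝒴 𝒳 Y 3) ∧
    (∫ X, sideD Z 𝒳 𝒴 X 3) + ∫ Y, sideD (fun X Y => flipT (Z Y X)) 𝒴 𝒳 Y 3 = j := by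
  obtain ⟨t0, t1⟩ := a.tendsto_J h hC
  have hm := h.mono_J_curve hC
  have nP : ∀ᵐ X, 0 ≤ sideD Z 𝒳 𝒴 X 3 := (h.ae_rel_sideD hC).mono fun X hX => hX.2.2.2
  have nQ : ∀ᵐ Y, 0 ≤ sideD (fun X Y => flipT (Z Y X)) 𝒴 𝒳 Y 3 :=
    (h.swap.ae_rel_sideD hC.symm).mono fun X hX => hX.2.2.2
  have eq : ∀ a b, Z (𝒳 b) (𝒴 b) 3 - Z (𝒳 a) (𝒴 a) 3 = (∫ X in (𝒳 a)..(𝒳 b), sideD Z 𝒳 𝒴 X 3) +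
      ∫ Y in (𝒴 a)..(𝒴 b), sideD (fun X Y => flipT (Z Y X)) 𝒴 𝒳 Y 3 := fun a b => by
    rw [h.curve_sub hC, intervalIntegral_comp_of_monotone hC.mono_X hC.lipschitz_fst,
      intervalIntegral_comp_of_monotone hC.mono_Y hC.lipschitz_snd,
      ← intervalIntegral.integral_add (h.intervalIntegrable_deriv_mul hC 3 a b)
      (h.swap.intervalIntegrable_deriv_mul hC.symm 3 a b)]
    rfl
  have ePQ : ∀ a b, a ≤ b → (0 ≤ ∫ X in (𝒳 a)..(𝒳 b), sideD Z 𝒳 𝒴 X 3) ∧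
      (0 ≤ ∫ Y in (𝒴 a)..(𝒴 b), sideD (fun X Y => flipT (Z Y X)) 𝒴 𝒳 Y 3) ∧
      (∫ X in (𝒳 a)..(𝒳 b), sideD Z 𝒳 𝒴 X 3) ≤ j ∧
      (∫ Y in (𝒴 a)..(𝒴 b), sideD (fun X Y => flipT (Z Y X)) 𝒴 𝒳 Y 3) ≤ j := fun a b hab => by
    have h1 := intervalIntegral.integral_nonneg_of_ae (hC.mono_X hab) nP
    have h2 := intervalIntegral.integral_nonneg_of_ae (hC.mono_Y hab) nQ
    have h3 := hm.ge_of_tendsto t1 b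
    have h4 := hm.le_of_tendsto t0 a
    have h5 := eq a b
    exact ⟨h1, h2, by linarith, by linarith⟩
  have tX := hC.tendsto_fst_atTop
  have tX' := hC.tendsto_fst_atBot.comp tendsto_neg_atTop_atBot
  have tY := hC.symm.tendsto_fst_atTop
  have tY' := hC.symm.tendsto_fst_atBot.comp tendsto_neg_atTop_atBot
  have norm_eq : ∀ {f : ℝ → ℝ}, (∀ᵐ x, 0 ≤ f x) → ∀ a b, ∫ x in a..b, ‖f x‖ = ∫ x in a..b, f x :=
    fun hf a b => intervalIntegral.integral_congr_ae
      (hf.mono fun x hx _ => Real.norm_of_nonneg hx)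
  have iP : Integrable (fun X => sideD Z 𝒳 𝒴 X 3) := by
    refine integrable_of_intervalIntegral_norm_bounded j (fun n : ℝ =>
      (h.intervalIntegrable_sideD hC 3 ((𝒳 ∘ Neg.neg) n) (𝒳 n)).1) tX' tX ?_
    filter_upwards [eventually_ge_atTop 0] with n hn
    rw [norm_eq nP]
    exact (ePQ (-n) n (by linarith)).2.2.1
  have iQ : Integrable (fun Y => sideD (fun X Y => flipT (Z Y X)) 𝒴 𝒳 Y 3) := by
    refine integrable_of_intervalIntegral_norm_bounded j (fun n : ℝ =>
      (h.swap.intervalIntegrable_sideD hC.symm 3 ((𝒴 ∘ Neg.neg) n) (𝒴 n)).1) tY' tY ?_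
    filter_upwards [eventually_ge_atTop 0] with n hn
    rw [norm_eq nQ]
    exact (ePQ (-n) n (by linarith)).2.2.2
  refine ⟨iP, iQ, ?_⟩
  have l1 := (intervalIntegral_tendsto_integral iP tX' tX).add
    (intervalIntegral_tendsto_integral iQ tY' tY)
  have l2 := t1.sub (t0.comp tendsto_neg_atTop_atBot)
  rw [sub_zero] at l2
  refine tendsto_nhds_unique (l1.congr fun n => ?_) l2
  exact (eq (-n) n).symm

theorem sideJ_eq (hC : IsCurve 𝒳 𝒴) (X : ℝ) :
    sideJ Z 𝒳 𝒴 X = ∫ ξ in Iic X, sideD Z 𝒳 𝒴 ξ 3 := by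
  have himg : 𝒳 '' Iic (genInv 𝒳 X) = Iic X := by
    apply Subset.antisymm
    · rintro _ ⟨s, hs, rfl⟩
      exact (hC.mono_X hs).trans (hC.fst_genInv X).le
    · intro ξ hξ
      exact ⟨genInv 𝒳 ξ, hC.genInv_fst_mono hξ, hC.fst_genInv ξ⟩
  rw [← himg, integral_image_of_monotone hC.mono_X hC.lipschitz_fst measurableSet_Iic]
  simp only [sideJ, mul_comm]

theorem ae_deriv_sideJ (h : MemHLoc c Z) (hC : IsCurve 𝒳 𝒴) (a : Anchored Z m j 𝒳₀ 𝒴₀) :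
    ∀ᵐ X, deriv (sideJ Z 𝒳 𝒴) X = sideD Z 𝒳 𝒴 X 3 := by
  have hi := (h.integrable_sideD hC a).1
  filter_upwards [LocallyIntegrable.ae_hasDerivAt_integral hi.locallyIntegrable] with X hX
  refine (((hX 0).const_add (sideJ Z 𝒳 𝒴 0)).congr_of_eventuallyEq
    (Eventually.of_forall fun X' => ?_)).deriv
  have := intervalIntegral.integral_Iic_sub_Iic (hi.integrableOn (s := Iic 0))
    (hi.integrableOn (s := Iic X'))
  simp only [sideJ_eq hC]
  linarith

end MemHLoc

end

/-! ### Return to the original variables -/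

/-- The part of the relation `ζ = 𝐌(ψ)` that concerns one family of characteristics. -/
structure IsSideM (c : ℝ → ℝ) (Z : ℝ → ℝ → Fin 5 → ℝ) (𝒳 𝒴 u R : ℝ → ℝ) (μ : Measure ℝ) :
    Prop where
  u_eq : ∀ X, u (sideAt Z 𝒳 𝒴 X 1) = sideAt Z 𝒳 𝒴 X 2
  μ_eq : μ = (volume.withDensity (fun X => ENNReal.ofReal (deriv (sideJ Z 𝒳 𝒴) X))).map
    fun X => sideAt Z 𝒳 𝒴 X 1
  measurable_R : AEStronglyMeasurable R volume
  R_eq : ∀ᵐ X, R (sideAt Z 𝒳 𝒴 X 1) * deriv (fun X => sideAt Z 𝒳 𝒴 X 1) X =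
    2 * c (sideAt Z 𝒳 𝒴 X 2) * sideD Z 𝒳 𝒴 X 2

section

variable {c W A : ℝ → ℝ} {κ : ℝ} {Z : ℝ → ℝ → Fin 5 → ℝ} {𝒳 𝒴 𝒳₀ 𝒴₀ u R : ℝ → ℝ} {m j τ : ℝ}
  {μ : Measure ℝ} {ζ : EulerData}

theorem shift_eq (T : ℝ) (Z : ℝ → ℝ → Fin 5 → ℝ) (X Y : ℝ) :
    shift T Z X Y = Z X Y - ![T, 0, 0, 0, 0] := by
  funext i
  fin_cases i <;> simp [shift]

theorem dX_shift (T : ℝ) (Z : ℝ → ℝ → Fin 5 → ℝ) : dX (shift T Z) = dX Z := by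
  funext X Y
  simp only [dX, shift_eq, deriv_sub_const_fun]

theorem dY_shift (T : ℝ) (Z : ℝ → ℝ → Fin 5 → ℝ) : dY (shift T Z) = dY Z := by
  funext X Y
  simp only [dY, shift_eq, deriv_sub_const_fun]

theorem mapE_shift (T : ℝ) (Z : ℝ → ℝ → Fin 5 → ℝ) : mapE (shift T Z) =
    extract (shift T Z) (edge (timeRegion Z T)) fun s => 2 * s - edge (timeRegion Z T) s := by
  have : (fun s => sSup {X | ∀ X' < X, shift T Z X' (2 * s - X') 0 < 0}) =
      edge (timeRegion Z T) := by
    funext s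
    simp only [edge, timeRegion, shift, Matrix.cons_val, sub_neg]
    rfl
  rw [mapE, this]

theorem isMapM_iff (ζ : EulerData) : IsMapM c (mapD (mapE (shift τ Z))) ζ ↔
    IsSideM c Z (edge (timeRegion Z τ)) (fun s => 2 * s - edge (timeRegion Z τ) s) ζ.u ζ.R ζ.μ ∧
    IsSideM c (fun X Y => flipT (Z Y X)) (fun s => 2 * s - edge (timeRegion Z τ) s)
      (edge (timeRegion Z τ)) ζ.u (fun x => -ζ.S x) ζ.ν := by
  rw [mapE_shift]
  set 𝒳 := edge (timeRegion Z τ)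
  set 𝒴 : ℝ → ℝ := fun s => 2 * s - 𝒳 s
  set ψ := mapD (extract (shift τ Z) 𝒳 𝒴) with hψ
  have x1 : ψ.fst.x = fun X => sideAt Z 𝒳 𝒴 X 1 := rfl
  have U1 : ψ.fst.U = fun X => sideAt Z 𝒳 𝒴 X 2 := rfl
  have V1 : ψ.fst.V = fun X => sideD Z 𝒳 𝒴 X 2 := by
    simp only [hψ, mapD, extract, dX_shift, sideD]
  have J1 : ψ.fst.J = sideJ Z 𝒳 𝒴 := by
    funext X
    simp only [hψ, mapD, extract, dX_shift, sideJ, sideD]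
  have x2 : ψ.snd.x = fun Y => sideAt (fun X Y => flipT (Z Y X)) 𝒴 𝒳 Y 1 := rfl
  have U2 : ψ.snd.U = fun Y => sideAt (fun X Y => flipT (Z Y X)) 𝒴 𝒳 Y 2 := rfl
  have V2 : ψ.snd.V = fun Y => sideD (fun X Y => flipT (Z Y X)) 𝒴 𝒳 Y 2 := by
    simp only [hψ, mapD, extract, dY_shift, sideD, dX_flipT]
    rfl
  have J2 : ψ.snd.J = sideJ (fun X Y => flipT (Z Y X)) 𝒴 𝒳 := by
    funext Y
    simp only [hψ, mapD, extract, dY_shift, sideJ, sideD, dX_flipT]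
    rfl
  constructor
  · intro h
    refine ⟨⟨?_, ?_, h.measurable_R, ?_⟩, ⟨?_, ?_, h.measurable_S.neg, ?_⟩⟩
    · exact fun X => h.u_fst X
    · rw [h.μ_eq, J1, x1]
    · have := h.R_eq
      rwa [x1, U1, V1] at this
    · exact fun X => h.u_snd X
    · rw [h.ν_eq, J2, x2]
    · have := h.S_eq
      rw [x2, U2, V2] at this
      filter_upwards [this] with Y hY
      rw [neg_mul, hY, neg_neg]
  · rintro ⟨h1, h2⟩
    refine ⟨h1.u_eq, h2.u_eq, ?_, ?_, h1.measurable_R, ?_, ?_, ?_⟩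
    · rw [h1.μ_eq, J1, x1]
    · rw [h2.μ_eq, J2, x2]
    · exact h2.measurable_R.neg.congr (ae_of_all _ fun x => neg_neg (ζ.S x))
    · rw [x1, U1, V1]
      exact h1.R_eq
    · rw [x2, U2, V2]
      filter_upwards [h2.R_eq] with Y hY
      rw [← hY]; ring

theorem MemHLoc.measurable_sideX (h : MemHLoc c Z) (hC : IsCurve 𝒳 𝒴) :
    Measurable fun X => sideAt Z 𝒳 𝒴 X 1 :=
  (measurable_pi_apply 1).comp (h.measurable_sideAt hC)

/-- The total mass is the energy carried by the corresponding family of characteristics. -/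
theorem IsSideM.measure_univ (hM : IsSideM c Z 𝒳 𝒴 u R μ) (h : MemHLoc c Z) (hC : IsCurve 𝒳 𝒴)
    (a : Anchored Z m j 𝒳₀ 𝒴₀) : μ univ = ENNReal.ofReal (∫ X, sideD Z 𝒳 𝒴 X 3) := by
  rw [hM.μ_eq, Measure.map_apply (h.measurable_sideX hC) MeasurableSet.univ, preimage_univ,
    withDensity_apply _ MeasurableSet.univ, Measure.restrict_univ,
    ofReal_integral_eq_lintegral_ofReal (h.integrable_sideD hC a).1
      ((h.ae_rel_sideD hC).mono fun X hX => hX.2.2.2)]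
  exact lintegral_congr_ae ((h.ae_deriv_sideJ hC a).mono fun X hX => congrArg ENNReal.ofReal hX)

/-- The function `R` is the quotient of `2 c(U) U_X` by `x'`, transported by the generalized inverse
of the position. Where `x' = 0`, the algebraic relations give `U_X = 0` as well. -/
theorem MemHLoc.exists_velocity (h : MemHLoc c Z) (hs : Speed c W κ) (hC : IsCurve 𝒳 𝒴)
    (hτ : ∀ s, Z (𝒳 s) (𝒴 s) 0 = τ) (a : Anchored Z m j 𝒳₀ 𝒴₀) :
    ∃ R : ℝ → ℝ, AEStronglyMeasurable R volume ∧
      ∀ᵐ X, R (sideAt Z 𝒳 𝒴 X 1) * deriv (fun X => sideAt Z 𝒳 𝒴 X 1) X =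
        2 * c (sideAt Z 𝒳 𝒴 X 2) * sideD Z 𝒳 𝒴 X 2 := by
  have hx := h.locPrim_sideAt hC hτ
  have hmono := h.mono_sideAt hC
  have hsurj := h.surjective_sideAt hC hτ a
  set x : ℝ → ℝ := fun X => sideAt Z 𝒳 𝒴 X 1
  set φ : ℝ → ℝ := fun X => 2 * c (sideAt Z 𝒳 𝒴 X 2) * sideD Z 𝒳 𝒴 X 2 / deriv x X with hφ
  have mφ : Measurable φ := by
    have h1 : Measurable fun X => c (sideAt Z 𝒳 𝒴 X 2) :=
      hs.smooth.continuous.measurable.comp ((measurable_pi_apply 2).comp (h.measurable_sideAt hC))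
    have h2 : Measurable fun X => sideD Z 𝒳 𝒴 X 2 :=
      (measurable_pi_apply 2).comp (h.measurable_sideD hC)
    exact ((h1.const_mul 2).mul h2).div (measurable_deriv x)
  refine ⟨fun y => φ (genInv x y),
    (mφ.comp (genInv_mono hmono hx.continuous hsurj).measurable).aestronglyMeasurable, ?_⟩
  filter_upwards [hx.ae_hasDerivAt, h.ae_rel_sideD hC] with X h1 h2
  rcases deriv_eq_zero_or_genInv hmono hx.continuous hsurj X with h3 | h3
  · -- where `x' = 0` the relation `2 J_X x_X = (c U_X)²` forces `U_X = 0`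
    have h4 : sideD Z 𝒳 𝒴 X 1 = 0 := by
      have := h1.deriv
      rw [h3] at this
      linarith
    have h5 := h2.2.1
    rw [h4, mul_zero, eq_comm, sq_eq_zero_iff, mul_eq_zero] at h5
    rw [h3, h5.resolve_left (hs.pos _).ne', mul_zero, mul_zero]
  · show φ (genInv x (x X)) * deriv x X = _
    rw [h3]
    by_cases h4 : deriv x X = 0
    · have h5 : sideD Z 𝒳 𝒴 X 1 = 0 := by
        have := h1.deriv
        rw [h4] at this
        linarith
      have h6 := h2.2.1
      rw [h5, mul_zero, eq_comm, sq_eq_zero_iff, mul_eq_zero] at h6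
      rw [h4, h6.resolve_left (hs.pos _).ne', mul_zero, mul_zero]
    · exact div_mul_cancel₀ _ h4

/-- At every time the data of `Z` come from data in the original variables. -/
theorem MemHLoc.exists_isMapM (h : MemHLoc c Z) (hs : Speed c W κ) (a : Anchored Z m j 𝒳₀ 𝒴₀)
    (τ : ℝ) : ∃ ζ : EulerData, IsMapM c (mapD (mapE (shift τ Z))) ζ := by
  have hC := (a.isRegion h hs (τ := τ)).isCurve
  have hτ := a.time_edge h hs (τ := τ)
  simp only [isMapM_iff]
  set 𝒳 := edge (timeRegion Z τ)
  set 𝒴 : ℝ → ℝ := fun s => 2 * s - 𝒳 s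
  obtain ⟨u, hu⟩ : ∃ u : ℝ → ℝ, ∀ s, u (Z (𝒳 s) (𝒴 s) 1) = Z (𝒳 s) (𝒴 s) 2 := by
    choose r hr using a.surjective_x h hC
    exact ⟨fun y => Z (𝒳 (r y)) (𝒴 (r y)) 2, fun s => h.U_eq_of_x_eq hs hC hτ (hr _)⟩
  obtain ⟨R, mR, eR⟩ := h.exists_velocity hs hC hτ a
  obtain ⟨S, mS, eS⟩ := h.swap.exists_velocity hs hC.symm (τ := -τ)
    (fun s => congrArg Neg.neg (hτ s)) a.swap
  refine ⟨⟨u, R, fun x => -S x, _, _⟩, ⟨fun X => hu _, rfl, mR, eR⟩,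
    ⟨fun Y => hu _, rfl, ?_, ?_⟩⟩
  · simpa using mS
  · simpa using eS

theorem IsSolutionThrough.anchored (hζ : MemD c ζ)
    (hZ : IsSolutionThrough c (mapC c (mapL c ζ)) Z) :
    Anchored Z (max (ζ.μ.real univ) (ζ.ν.real univ)) (ζ.μ.real univ + ζ.ν.real univ)
      (edge (initRegion ζ.μ ζ.ν)) fun s => 2 * s - edge (initRegion ζ.μ ζ.ν) s := by
  have := hζ.finite_μ
  have := hζ.finite_ν
  have hC := (isRegion_initRegion (μ := ζ.μ) (ν := ζ.ν)).isCurve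
  have hx : ∀ s, initPos ζ.μ (edge (initRegion ζ.μ ζ.ν) s) =
    initPos ζ.ν (2 * s - edge (initRegion ζ.μ ζ.ν) s) := initPos_edge
  have e : ∀ s, Z (edge (initRegion ζ.μ ζ.ν) s) (2 * s - edge (initRegion ζ.μ ζ.ν) s) =
    (mapC c (mapL c ζ)).𝒵 s := fun s => congrFun hZ.eq_Z s
  set 𝒳 := edge (initRegion ζ.μ ζ.ν)
  have e0 : ∀ s, Z (𝒳 s) (2 * s - 𝒳 s) 0 = 0 := fun s => by rw [e]; rfl
  have e1 : ∀ s, Z (𝒳 s) (2 * s - 𝒳 s) 1 = initPos ζ.μ (𝒳 s) := fun s => by rw [e]; rfl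
  have e3 : ∀ s, Z (𝒳 s) (2 * s - 𝒳 s) 3 =
      (𝒳 s - initPos ζ.μ (𝒳 s)) + ((2 * s - 𝒳 s) - initPos ζ.ν (2 * s - 𝒳 s)) :=
    fun s => by rw [e]; rfl
  have hm := le_max_left (ζ.μ.real univ) (ζ.ν.real univ)
  have hm' := le_max_right (ζ.μ.real univ) (ζ.ν.real univ)
  refine ⟨hC, e0, fun s => ?_, fun s => ?_, fun s => ?_, fun s => ?_, ?_, ?_⟩
  · rw [e1]; exact initPos_le ζ.μ _
  · rw [e1]; linarith [sub_initPos_le ζ.μ (𝒳 s)]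
  · rw [e1, hx]; exact initPos_le ζ.ν _
  · rw [e1, hx]; linarith [sub_initPos_le ζ.ν (2 * s - 𝒳 s)]
  · simp only [e3]
    have := ((tendsto_sub_initPos_atBot ζ.μ).comp hC.tendsto_fst_atBot).add
      ((tendsto_sub_initPos_atBot ζ.ν).comp hC.symm.tendsto_fst_atBot)
    rwa [add_zero] at this
  · simp only [e3]
    exact ((tendsto_sub_initPos_atTop ζ.μ).comp hC.tendsto_fst_atTop).add
      ((tendsto_sub_initPos_atTop ζ.ν).comp hC.symm.tendsto_fst_atTop)

end

/-! ### Concentration of the singular parts -/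

section

variable {c W : ℝ → ℝ} {κ : ℝ} {Z : ℝ → ℝ → Fin 5 → ℝ} {𝒳 𝒴 𝒳₀ 𝒴₀ u R : ℝ → ℝ} {m j τ : ℝ}
  {μ : Measure ℝ}

/-- The zeros of a function at which its derivative is nonzero are isolated, hence countable. -/
theorem countable_zeros_of_deriv_ne_zero {f f' : ℝ → ℝ} :
    {y | f y = 0 ∧ HasDerivAt f (f' y) y ∧ f' y ≠ 0}.Countable := by
  set S := {y | f y = 0 ∧ HasDerivAt f (f' y) y ∧ f' y ≠ 0}
  have hd : IsDiscrete S := by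
    rw [isDiscrete_iff_nhdsNE]
    rintro y ⟨h1, h2, h3⟩
    rw [inf_principal_eq_bot]
    exact (h2.eventually_ne (c := 0) h3).mono fun z hz hzS => hz hzS.1
  have := isDiscrete_iff_discreteTopology.1 hd
  exact TopologicalSpace.separableSpace_iff_countable.1 inferInstance

theorem volume_image_eq_zero_of_hasDerivAt_zero {f : ℝ → ℝ} {s : Set ℝ}
    (h : ∀ y ∈ s, HasDerivAt f 0 y) : volume (f '' s) = 0 :=
  addHaar_image_eq_zero_of_det_fderivWithin_eq_zero volume (f' := fun _ => 0)
    (fun y hy => by simpa using (h y hy).hasDerivWithinAt.hasFDerivWithinAt) fun y _ => by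
      simp [ContinuousLinearMap.det]

namespace MemHLoc

theorem volume_image_of_null (h : MemHLoc c Z) (X : ℝ) (i : Fin 5) {s : Set ℝ}
    (hs : volume s = 0) : volume ((fun Y => Z X Y i) '' s) = 0 := by
  have hl := h.swap.locPrim X i
  have key : ∀ n : ℕ, volume ((fun Y => flipT (Z X Y) i) '' (s ∩ Icc (-n : ℝ) n)) = 0 := fun n => by
    obtain ⟨L, hL⟩ := hl.lipschitzOnWith n
    exact volume_image_eq_zero_of_lipschitzOn (hL.mono inter_subset_right)
      (measure_mono_null inter_subset_left hs)
  have h1 : volume ((fun Y => flipT (Z X Y) i) '' s) = 0 := by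
    refine measure_mono_null ?_ (measure_iUnion_null key)
    rintro _ ⟨Y, hY, rfl⟩
    obtain ⟨n, hn⟩ := exists_nat_ge |Y|
    exact mem_iUnion.2 ⟨n, Y, ⟨hY, abs_le.1 hn⟩, rfl⟩
  have h2 : (fun Y => Z X Y i) '' s = (fun Y => flipT (Z X Y) i) '' s ∨
      (fun Y => Z X Y i) '' s = Neg.neg '' ((fun Y => flipT (Z X Y) i) '' s) := by
    rw [image_image]
    fin_cases i
    · right; simp [flipT]
    · left; rfl
    · left; rfl
    · left; rfl
    · right; simp [flipT]
  rcases h2 with h2 | h2 <;> rw [h2]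
  · exact h1
  · rw [image_neg_eq_neg, Measure.measure_neg, h1]

/-- Along almost every characteristic, the times at which `x_X = 0` and `c'(U) ≠ 0` form a null
set. Where `x_X` vanishes so does `U_X`, while `U_XY = c'(U) x_Y J_X / (2 c(U)³)`: either `x_Y ≠ 0`
and the zero of `U_X` is isolated, or `t_Y = 0`. -/
theorem volume_image_time (h : MemHLoc c Z) (hs : Speed c W κ) : ∀ᵐ X,
    volume ((fun Y => Z X Y 0) '' {Y | dX Z X Y 1 = 0 ∧ deriv c (Z X Y 2) ≠ 0}) = 0 := by
  filter_upwards [h.ae_rel, h.ae_eq] with X hX hF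
  have hN := ae_iff.1 (hF.and (h.swap.ae_rel.and h.swap.ae_hasDerivAt))
  set N := {Y | ¬_}
  set S₁ := {Y | dX Z X Y 2 = 0 ∧ HasDerivAt (fun Y => dX Z X Y 2)
    (F c (Z X Y) (dX Z X Y) (dY Z X Y) 2) Y ∧ F c (Z X Y) (dX Z X Y) (dY Z X Y) 2 ≠ 0}
  set S₂ := {Y | HasDerivAt (fun Y => Z X Y 0) 0 Y}
  have hsub : {Y | dX Z X Y 1 = 0 ∧ deriv c (Z X Y 2) ≠ 0} ⊆ N ∪ S₁ ∪ S₂ := by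
    rintro Y ⟨hY, hcY⟩
    by_cases hYN : Y ∈ N
    · exact Or.inl (Or.inl hYN)
    obtain ⟨g1, g2, g3⟩ := not_not.1 hYN
    have r := hX Y
    have hc0 := hs.pos (Z X Y 2)
    have hU : dX Z X Y 2 = 0 := by
      have := r.2.2.1
      rw [hY, mul_zero, eq_comm, sq_eq_zero_iff, mul_eq_zero] at this
      exact this.resolve_left hc0.ne'
    have hJ : 0 < dX Z X Y 3 := by
      have := r.2.2.2.2.2
      rwa [hY, zero_add] at this
    by_cases hx : dY Z X Y 1 = 0
    · right
      have e1 := (g2 X).1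
      have e2 := hasDerivAt_flipT (g3 X)
      rw [dX_flipT, flipT_flipT] at e2
      simp only [dX_flipT, flipT_flipT] at e1 e2
      have e3 : dY Z X Y 0 = 0 := by
        have e1 : dY Z X Y 1 = c (Z X Y 2) * -dY Z X Y 0 := e1
        rw [hx, eq_comm, mul_eq_zero] at e1
        exact neg_eq_zero.1 (e1.resolve_left hc0.ne')
      have e4 := hasDerivAt_pi.1 e2 0
      rwa [e3] at e4
    · left; right
      refine ⟨hU, hasDerivAt_pi.1 g1 2, ?_⟩
      simp only [F, Matrix.cons_val, hU, hY]
      have : deriv c (Z X Y 2) / (2 * c (Z X Y 2) ^ 3) * (dY Z X Y 1 * dX Z X Y 3) ≠ 0 :=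
        mul_ne_zero (div_ne_zero hcY (by positivity)) (mul_ne_zero hx hJ.ne')
      convert this using 1
      ring
  refine measure_mono_null (image_mono hsub) ?_
  rw [image_union, image_union]
  refine measure_union_null (measure_union_null (h.volume_image_of_null X 0 hN)
    (h.volume_image_of_null X 0 ?_)) (volume_image_eq_zero_of_hasDerivAt_zero fun Y hY => hY)
  exact countable_zeros_of_deriv_ne_zero.measure_zero volume

/-- Along every characteristic all times are reached. -/
theorem tendsto_time (h : MemHLoc c Z) (hs : Speed c W κ) (a : Anchored Z m j 𝒳₀ 𝒴₀) (X : ℝ) :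
    Tendsto (fun Y => Z X Y 0) atTop atBot ∧ Tendsto (fun Y => Z X Y 0) atBot atTop := by
  have hk := hs.κ_pos
  constructor
  · refine tendsto_atBot.2 fun b => ?_
    filter_upwards [eventually_gt_atTop (X + m + 2 * κ * |b|)] with Y hY
    by_contra! hlt
    have := (a.isRegion h hs (τ := b)).ge (X := X) (Y := Y) (not_lt.2 hlt.le)
    linarith
  · refine tendsto_atTop.2 fun b => ?_
    filter_upwards [eventually_lt_atBot (X - m - 2 * κ * |b|)] with Y hY
    by_contra! hlt
    have := (a.isRegion h hs (τ := b)).le (X := X) (Y := Y) hlt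
    linarith

/-- At almost every time, `c'(U) = 0` wherever `x_X = 0`, up to a null set of characteristics. -/
theorem ae_time (h : MemHLoc c Z) (hs : Speed c W κ) (a : Anchored Z m j 𝒳₀ 𝒴₀) :
    ∀ᵐ τ, ∀ᵐ X, ∀ Y, Z X Y 0 = τ → dX Z X Y 1 = 0 → deriv c (Z X Y 2) = 0 := by
  have ct : ∀ q : ℝ, Continuous fun p : ℝ × ℝ => Z p.1 q 0 := fun q =>
    (continuous_apply 0).comp (h.continuous.comp (continuous_fst.prodMk continuous_const))
  have ctY : ∀ X, Continuous fun Y => Z X Y 0 := fun X =>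
    (continuous_apply 0).comp (h.continuous.comp (continuous_const.prodMk continuous_id))
  -- the last point of the characteristic `X` at which the time is `τ`
  set e : ℝ × ℝ → ℝ := fun p => sSup {Y | p.2 ≤ Z p.1 Y 0} with he
  have bdd : ∀ X τ, BddAbove {Y | τ ≤ Z X Y 0} := fun X τ => by
    obtain ⟨b, hb⟩ := eventually_atTop.1 ((tendsto_atBot.1 (h.tendsto_time hs a X).1) (τ - 1))
    refine ⟨b, fun Y hY => le_of_not_gt fun hlt => ?_⟩
    have hY : τ ≤ Z X Y 0 := hY
    linarith [hb Y hlt.le]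
  have ne : ∀ X τ, {Y | τ ≤ Z X Y 0}.Nonempty := fun X τ => by
    obtain ⟨b, hb⟩ := eventually_atBot.1 ((tendsto_atTop.1 (h.tendsto_time hs a X).2) τ)
    exact ⟨b, hb b le_rfl⟩
  have le_e : ∀ q p, q ≤ e p ↔ p.2 ≤ Z p.1 q 0 := by
    rintro q ⟨X, τ⟩
    refine ⟨fun hq => ?_, fun hq => le_csSup (bdd X τ) hq⟩
    have h1 : e (X, τ) ∈ {Y | τ ≤ Z X Y 0} :=
      (isClosed_le continuous_const (ctY X)).csSup_mem (ne X τ) (bdd X τ)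
    exact le_trans h1 (h.anti_t_snd hs X hq)
  have me : Measurable e := measurable_of_Ici fun q => by
    have : e ⁻¹' Ici q = {p | p.2 ≤ Z p.1 q 0} := by ext p; exact le_e q p
    rw [this]
    exact (isClosed_le continuous_snd (ct q)).measurableSet
  have time_e : ∀ X τ, Z X (e (X, τ)) 0 = τ := fun X τ => by
    refine le_antisymm ?_ ((le_e _ (X, τ)).1 le_rfl)
    by_contra! hlt
    have h1 : ∀ᶠ Y in 𝓝[>] (e (X, τ)), τ < Z X Y 0 :=
      ((ctY X).continuousAt.eventually (lt_mem_nhds hlt)).filter_mono nhdsWithin_le_nhds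
    obtain ⟨Y, hY1, hY2⟩ := (h1.and self_mem_nhdsWithin).exists
    exact absurd ((le_e Y (X, τ)).2 hY1.le) (not_le.2 hY2)
  have mpair : Measurable fun p : ℝ × ℝ => (p.1, e p) := measurable_fst.prodMk me
  have mU : Measurable fun p : ℝ × ℝ => deriv c (Z p.1 (e p) 2) :=
    hs.continuous_deriv.measurable.comp
      ((measurable_pi_apply 2).comp (h.continuous.measurable.comp mpair))
  have mD : Measurable fun p : ℝ × ℝ => dX Z p.1 (e p) 1 :=
    (measurable_pi_apply 1).comp (h.measurable_dX.comp mpair)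
  -- both exceptional sets are null on almost every characteristic, hence at almost every time
  have f1 : ∀ᵐ τ, ∀ᵐ X, ¬(dX Z X (e (X, τ)) 1 = 0 ∧ deriv c (Z X (e (X, τ)) 2) ≠ 0) := by
    refine (Measure.ae_ae_comm (p := fun X τ =>
      ¬(dX Z X (e (X, τ)) 1 = 0 ∧ deriv c (Z X (e (X, τ)) 2) ≠ 0)) ?_).1 ?_
    · exact ((mD (measurableSet_singleton 0)).inter (mU (measurableSet_singleton 0).compl)).compl
    · filter_upwards [h.volume_image_time hs] with X hX
      refine measure_mono_null (fun τ hτ => ?_) hX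
      exact ⟨e (X, τ), not_not.1 hτ, time_e X τ⟩
  have f2 : ∀ᵐ τ, ∀ᵐ X, ∀ p q : ℚ, p < q → ¬(Z X p 0 = τ ∧ Z X q 0 = τ) := by
    refine (Measure.ae_ae_comm (p := fun X τ =>
      ∀ p q : ℚ, p < q → ¬(Z X p 0 = τ ∧ Z X q 0 = τ)) ?_).1 (ae_of_all _ fun X => ?_)
    · simp only [ofPred_forall]
      refine .iInter fun p => .iInter fun q => .iInter fun _ => MeasurableSet.compl ?_
      exact ((isClosed_eq (ct p) continuous_snd).inter
        (isClosed_eq (ct q) continuous_snd)).measurableSet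
    · have h1 := ae_subsingleton_preimage (f := fun Y => -Z X Y 0) fun _ _ hY =>
        neg_le_neg (h.anti_t_snd hs X hY)
      have h2 : ∀ᵐ τ : ℝ, ∀ Y Y', -Z X Y 0 = -τ → -Z X Y' 0 = -τ → Y = Y' :=
        (Measure.measurePreserving_neg volume).quasiMeasurePreserving.ae h1
      filter_upwards [h2] with τ hτ p q hpq hpq'
      exact hpq.ne (by exact_mod_cast hτ p q (by rw [hpq'.1]) (by rw [hpq'.2]))
  filter_upwards [f1, f2] with τ h1 h2
  filter_upwards [h1, h2] with X h3 h4 Y hY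
  have hYe : Y = e (X, τ) := by
    refine ((le_e Y (X, τ)).2 hY.ge).eq_of_not_lt fun hlt => ?_
    obtain ⟨q, hq1, hq2⟩ := exists_rat_btwn hlt
    obtain ⟨p, hp1, hp2⟩ := exists_rat_btwn hq1
    have key : ∀ r, Y ≤ r → r ≤ e (X, τ) → Z X r 0 = τ := fun r hr1 hr2 =>
      le_antisymm ((h.anti_t_snd hs X hr1).trans hY.le)
        ((time_e X τ).ge.trans (h.anti_t_snd hs X hr2))
    exact h4 p q (by exact_mod_cast hp2) ⟨key p hp1.le (hp2.trans hq2).le, key q hq1.le hq2.le⟩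
  rw [hYe]
  exact fun h5 => by_contra fun h6 => h3 ⟨h5, h6⟩

end MemHLoc

/-- The singular part lives on a Lebesgue null set of positions. On its preimage the position has
zero derivative, so `x_X = 0` there, and hence `c'(u) = 0` at a good time. -/
theorem IsSideM.singularPart_eq_zero (hM : IsSideM c Z 𝒳 𝒴 u R μ) (h : MemHLoc c Z)
    (hs : Speed c W κ) (hC : IsCurve 𝒳 𝒴) (hτ : ∀ s, Z (𝒳 s) (𝒴 s) 0 = τ)
    (a : Anchored Z m j 𝒳₀ 𝒴₀)
    (hgood : ∀ᵐ X, ∀ Y, Z X Y 0 = τ → dX Z X Y 1 = 0 → deriv c (Z X Y 2) = 0) :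
    μ.singularPart volume {x | deriv c (u x) ≠ 0} = 0 := by
  have hx := h.locPrim_sideAt hC hτ
  have hmono := h.mono_sideAt hC
  have hsurj := h.surjective_sideAt hC hτ a
  have hmx := h.measurable_sideX hC
  have hu := hM.u_eq
  have hμ := hM.μ_eq
  set x : ℝ → ℝ := fun X => sideAt Z 𝒳 𝒴 X 1
  have mu : Measurable u := by
    have e : u = fun y => sideAt Z 𝒳 𝒴 (genInv x y) 2 := by
      funext y
      have h1 : x (genInv x y) = y := genInv_spec hmono hx.continuous hsurj y
      have h2 := hu (genInv x y)
      have h3 : sideAt Z 𝒳 𝒴 (genInv x y) 1 = y := h1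
      rwa [h3] at h2
    rw [e]
    exact (measurable_pi_apply 2).comp ((h.measurable_sideAt hC).comp
      (genInv_mono hmono hx.continuous hsurj).measurable)
  have mA : MeasurableSet {y | deriv c (u y) ≠ 0} :=
    (hs.continuous_deriv.measurable.comp mu) (measurableSet_singleton 0).compl
  obtain ⟨N, mN, hN0, hN1⟩ := Measure.mutuallySingular_singularPart μ volume
  have h1 : μ ({y | deriv c (u y) ≠ 0} ∩ Nᶜ) = 0 := by
    rw [hμ, Measure.map_apply hmx (mA.inter mN.compl)]
    refine withDensity_absolutelyContinuous _ _ ?_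
    -- the position has zero derivative on the preimage of a null set, which forces `c'(u) = 0`
    have h2 := ae_deriv_eq_zero_of_preimage_null hmono hN1
    have h3 : ∀ᵐ X, X ∉ x ⁻¹' ({y | deriv c (u y) ≠ 0} ∩ Nᶜ) := by
      filter_upwards [h2, hx.ae_hasDerivAt, hgood] with X h4 h5 h6 h7
      have h8 := h4 h7.2
      rw [h5.deriv] at h8
      have h9 := h6 (𝒴 (genInv 𝒳 X)) (by have := hτ (genInv 𝒳 X); rwa [hC.fst_genInv] at this)
        (by simp only [sideD] at h8; linarith)
      refine h7.1 ?_
      have h10 : u (x X) = Z X (𝒴 (genInv 𝒳 X)) 2 := by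
        rw [hu X, sideAt, hC.fst_genInv]
      rw [h10, h9]
    have h4 := ae_iff.1 h3
    simp only [not_not] at h4
    exact h4
  refine measure_mono_null (t := N ∪ ({y | deriv c (u y) ≠ 0} ∩ Nᶜ)) (fun y hy => ?_)
    (measure_union_null hN0 (le_antisymm ((Measure.singularPart_le μ volume _).trans h1.le) bot_le))
  by_cases hyN : y ∈ N
  · exact Or.inl hyN
  · exact Or.inr ⟨hy, hyN⟩

end

end NVW

theorem mainTheorem2 (c : ℝ → ℝ) (κ : ℝ) (hκ : 0 < κ) (hc : ContDiff ℝ 1 c)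
    (hcκ : ∀ v : ℝ, κ⁻¹ ≤ c v ∧ c v ≤ κ)
    (ζ₀ : NVW.EulerData) (hζ₀ : NVW.MemD c ζ₀) :
    (∃ ζ : ℝ → NVW.EulerData, NVW.IsConservativeSolution c ζ₀ ζ) ∧
    ∀ ζ : ℝ → NVW.EulerData, NVW.IsConservativeSolution c ζ₀ ζ →
      (∀ t : ℝ, (ζ t).μ Set.univ + (ζ t).ν Set.univ = ζ₀.μ Set.univ + ζ₀.ν Set.univ) ∧
      (∀ᵐ t : ℝ,
        (ζ t).μ.singularPart MeasureTheory.volume {x : ℝ | deriv c ((ζ t).u x) ≠ 0} = 0 ∧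
        (ζ t).ν.singularPart MeasureTheory.volume {x : ℝ | deriv c ((ζ t).u x) ≠ 0} = 0) := by
  obtain ⟨W, A, hs, hA, hWA⟩ := NVW.Speed.exists_primitive hκ hc hcκ
  have := hζ₀.finite_μ
  have := hζ₀.finite_ν
  constructor
  · obtain ⟨Z, hZ⟩ := NVW.exists_isSolutionThrough hs hA hWA hζ₀
    have h : NVW.MemHLoc c Z := hZ.memH.memHOn
    choose ζ hζ using h.exists_isMapM hs (hZ.anchored hζ₀)
    exact ⟨ζ, Z, hZ, hζ⟩
  · rintro ζ ⟨Z, hZ, hζ⟩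
    have h : NVW.MemHLoc c Z := hZ.memH.memHOn
    have a := hZ.anchored hζ₀
    have hM := fun t => (NVW.isMapM_iff (ζ t)).1 (hζ t)
    have hC := fun t => (a.isRegion h hs (τ := t)).isCurve
    have ht := fun t => a.time_edge h hs (τ := t)
    refine ⟨fun t => ?_, ?_⟩
    · have hj := h.integrable_sideD (hC t) a
      rw [(hM t).1.measure_univ h (hC t) a, (hM t).2.measure_univ h.swap (hC t).symm a.swap,
        ← ENNReal.ofReal_add
          (integral_nonneg_of_ae ((h.ae_rel_sideD (hC t)).mono fun X hX => hX.2.2.2))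
          (integral_nonneg_of_ae
            ((h.swap.ae_rel_sideD (hC t).symm).mono fun Y hY => hY.2.2.2)), hj.2.2,
        ENNReal.ofReal_add measureReal_nonneg measureReal_nonneg, ofReal_measureReal,
        ofReal_measureReal]
    · -- the times of the reflected solution are those of `Z` with the opposite sign
      have hneg := (Measure.measurePreserving_neg (volume : Measure ℝ)).quasiMeasurePreserving.ae
        (h.swap.ae_time hs a.swap)
      filter_upwards [h.ae_time hs a, hneg] with t h1 h2
      exact ⟨(hM t).1.singularPart_eq_zero h hs (hC t) (ht t) a h1,
        (hM t).2.singularPart_eq_zero h.swap hs (hC t).symm (τ := -t)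
          (fun s => congrArg Neg.neg (ht t s)) a.swap h2⟩
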